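/- Let $n\ge 2$, let $R$ be an integral domain, let $q\in R$ be a unit with a chosen unit $q^{1/n}\in R$ such that $(q^{1/n})^n=q$, and suppose that $q-q^{-1}$ and the quantum integers $[k]=q^{k-1}+q^{k-3}+\dots+q^{1-k}$, $1\le k\le n$, are units of $R$. Quantum binomials are $\begin{bmatrix}m\\t\end{bmatrix}=\frac{[m][m-1]\cdots[m-t+1]}{[t]!}$ for $m\in\mathbb Z$, $t\ge 0$, with $[-k]=-[k]$. A spider category over $R$ is given by a set of colors of oriented edges, a set of vertices, and relations: its objects are the finite sequences of oriented colors, its morphisms are the $R$-linear combinations of diagrams built from edges, crossings, cups, caps and vertices, up to isotopy (the axioms of an $R$-linear strict monoidal, braided, pivotal category) and modulo the tensor ideal generated by the relations. $\mathcal{HMF}(SL_n)$ is the spider category with one color (objects: sequences in $\{+,-\}$), no vertices, and the HOMFLYPT relations $$a^{-1}X_+-aX_-=(s-s^{-1})\,\mathrm{id}_{++},\qquad \text{positive kink}=a v^{-1}\,\mathrm{id}_{+},\qquad \text{unknot}=\frac{v^{-1}-v}{s-s^{-1}},$$ specialized at $a=q^{-1/n}$, $s=q$, $v=q^{-n}$;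 here $X_\pm$ are the crossings of two upward strands, and the kink may turn to either side. $\mathcal{MOY}(SL_n)$ is the spider category with colors $1,\dots,n$ (objects: sequences in $\{1^\pm,\dots,n^\pm\}$), with vertices the trivalent merges $k\otimes l\to k+l$ and splits $k+l\to k\otimes l$ for $k+l\le n$, and with the following relations. Edges labelled $0$ are erased, and a relation is imposed for all values of the labels for which every label occurring in it lies in $\{0,\dots,n\}$. * Bubbles: splitting $k+l$ into $k,l$ and merging again is $\begin{bmatrix}k+l\\k\end{bmatrix}\mathrm{id}_{k+l}$; merging $k$ with $l$, splitting into $k$ and $l$ again, and closing up the strand $l$ (on the right or, in the mirror image, on the left) is $\begin{bmatrix}n-k\\l\end{bmatrix}\mathrm{id}_k$. * $6j$: merging is associative and splitting is coassociative. * Boxes: let $F^{(s)}\colon k\otimes l\to(k-s)\otimes(l+s)$ be the ladder with one rung labelled $s$ from the left to the right upright, and $E^{(r)}\colon k\otimes l\to(k+r)\otimes(l-r)$ the one with a rung labelled $r$ from the right to the left. On $k\otimes l$, $$E^{(r)}F^{(s)}=\sum_{t\ge0}\begin{bmatrix}k-l+r-s\\t\end{bmatrix}F^{(s-t)}E^{(r-t)},$$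 and the mirror image of this relation holds. * Braiding: the positive crossing $k\otimes l\to l\otimes k$ of upward strands is $(-1)^{k+kl}q^{k-kl/n}\sum_{a,b\ge0,\ b-a=k-l}(-q)^{-b}E^{(a)}F^{(b)}$, and the negative crossing is obtained by replacing $q^{1/n}$ by $q^{-1/n}$. Let $\mathcal{MOY}^n(SL_n)$ be the full subcategory of $\mathcal{MOY}(SL_n)$ on the sequences in $\{1^+,1^-\}$ (the inner edges may have any label $1,\dots,n$). **Theorem.** The categories $\mathcal{MOY}^n(SL_n)$ and $\mathcal{HMF}(SL_n)$ are equivalent as $R$-linear spherical braided categories: both are spherical, and there is an $R$-linear braided monoidal functor $\mathcal{MOY}^n(SL_n)\to\mathcal{HMF}(SL_n)$ that preserves the pivotal structure and is an equivalence of categories. -/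

import Mathlib

open CategoryTheory MonoidalCategory

universe u v w v₁ u₁ v₂ u₂

noncomputable section

/-! ### Pivotal and spherical categories -/

/-- A pivotal structure on a monoidal category: every object has a chosen two-sided dual, and the
two contravariant monoidal functors `X ↦ X*` given by the left and by the right duality coincide.
Equivalently, the category is rigid and `X ⟶ X**`, built from `coev` at `X*` and from `ev'` at `X`,
is a monoidal natural isomorphism. The morphisms `g` below are unique, because the pairings are
nondegenerate. -/
class PivotalCategory (C : Type u) [Category.{v} C] [MonoidalCategory C] where
  /-- the dual object -/
  dual : C → C
  ev : ∀ X : C, dual X ⊗ X ⟶ 𝟙_ C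
  coev : ∀ X : C, 𝟙_ C ⟶ X ⊗ dual X
  ev' : ∀ X : C, X ⊗ dual X ⟶ 𝟙_ C
  coev' : ∀ X : C, 𝟙_ C ⟶ dual X ⊗ X
  zigzag₁ : ∀ X : C, coev X ▷ X ≫ (α_ _ _ _).hom ≫ X ◁ ev X = (λ_ X).hom ≫ (ρ_ X).inv
  zigzag₂ : ∀ X : C, dual X ◁ coev X ≫ (α_ _ _ _).inv ≫ ev X ▷ dual X =
    (ρ_ (dual X)).hom ≫ (λ_ (dual X)).inv
  zigzag₃ : ∀ X : C, coev' X ▷ dual X ≫ (α_ _ _ _).hom ≫ dual X ◁ ev' X =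
    (λ_ (dual X)).hom ≫ (ρ_ (dual X)).inv
  zigzag₄ : ∀ X : C, X ◁ coev' X ≫ (α_ _ _ _).inv ≫ ev' X ▷ X = (ρ_ X).hom ≫ (λ_ X).inv
  /-- the left and the right transpose of a morphism agree -/
  exists_transpose : ∀ {X Y : C} (f : X ⟶ Y), ∃ g : dual Y ⟶ dual X,
    g ▷ X ≫ ev X = dual Y ◁ f ≫ ev Y ∧ X ◁ g ≫ ev' X = f ▷ dual Y ≫ ev' Y
  /-- the left and the right comparison `Y* ⊗ X* ⟶ (X ⊗ Y)*` agree -/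
  exists_dual_tensor : ∀ X Y : C, ∃ g : dual Y ⊗ dual X ⟶ dual (X ⊗ Y),
    g ▷ (X ⊗ Y) ≫ ev (X ⊗ Y) =
      (α_ _ _ _).hom ≫ dual Y ◁ ((α_ _ _ _).inv ≫ ev X ▷ Y ≫ (λ_ Y).hom) ≫ ev Y ∧
    (X ⊗ Y) ◁ g ≫ ev' (X ⊗ Y) =
      (α_ _ _ _).hom ≫ X ◁ ((α_ _ _ _).inv ≫ ev' Y ▷ dual X ≫ (λ_ (dual X)).hom) ≫ ev' X
  /-- the left and the right comparison `𝟙 ⟶ 𝟙*` agree -/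
  exists_dual_unit : ∃ g : 𝟙_ C ⟶ dual (𝟙_ C),
    g ▷ 𝟙_ C ≫ ev (𝟙_ C) = (λ_ (𝟙_ C)).hom ∧ 𝟙_ C ◁ g ≫ ev' (𝟙_ C) = (λ_ (𝟙_ C)).hom

namespace PivotalCategory

variable {C : Type u} [Category.{v} C] [MonoidalCategory C] [PivotalCategory C]

/-- The left quantum trace. -/
def leftTrace {X : C} (f : X ⟶ X) : 𝟙_ C ⟶ 𝟙_ C := coev' X ≫ dual X ◁ f ≫ ev X

/-- The right quantum trace. -/
def rightTrace {X : C} (f : X ⟶ X) : 𝟙_ C ⟶ 𝟙_ C := coev X ≫ f ▷ dual X ≫ ev' X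

end PivotalCategory

/-- A pivotal category is spherical if its left and right quantum traces agree. -/
def IsSpherical (C : Type u) [Category.{v} C] [MonoidalCategory C] [PivotalCategory C] : Prop :=
  ∀ (X : C) (f : X ⟶ X), PivotalCategory.leftTrace f = PivotalCategory.rightTrace f

/-- A monoidal functor is pivotal if it takes the dual of `X` to a dual of the image of `X`,
compatibly with both evaluations (hence with both coevaluations). -/
def IsPivotalFunctor {C : Type u₁} [Category.{v₁} C] [MonoidalCategory C] [PivotalCategory C]
    {D : Type u₂} [Category.{v₂} D] [MonoidalCategory D] [PivotalCategory D]
    (F : C ⥤ D) [F.Monoidal] : Prop :=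
  ∀ X : C, ∃ φ : F.obj (PivotalCategory.dual X) ≅ PivotalCategory.dual (F.obj X),
    Functor.LaxMonoidal.μ F (PivotalCategory.dual X) X ≫ F.map (PivotalCategory.ev X) =
      φ.hom ▷ F.obj X ≫ PivotalCategory.ev (F.obj X) ≫ Functor.LaxMonoidal.ε F ∧
    Functor.LaxMonoidal.μ F X (PivotalCategory.dual X) ≫ F.map (PivotalCategory.ev' X) =
      F.obj X ◁ φ.hom ≫ PivotalCategory.ev' (F.obj X) ≫ Functor.LaxMonoidal.ε F

/-- Two `R`-linear spherical braided categories are equivalent as such: both are spherical, and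
there is an `R`-linear braided monoidal pivotal functor between them that is an equivalence. -/
def SphericalBraidedEquivalent (R : Type w) [CommRing R]
    (C : Type u₁) [Category.{v₁} C] [Preadditive C] [Linear R C] [MonoidalCategory C]
    [BraidedCategory C] [PivotalCategory C]
    (D : Type u₂) [Category.{v₂} D] [Preadditive D] [Linear R D] [MonoidalCategory D]
    [BraidedCategory D] [PivotalCategory D] : Prop :=
  IsSpherical C ∧ IsSpherical D ∧
    ∃ (F : C ⥤ D) (_ : F.Additive) (_ : F.Braided),
      F.Linear R ∧ F.IsEquivalence ∧ IsPivotalFunctor F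

/-- The pivotal structure of a full monoidal subcategory that is closed under duals. -/
abbrev fullSubcategoryPivotal {C : Type u} [Category.{v} C] [MonoidalCategory C] [PivotalCategory C]
    (P : ObjectProperty C) [P.IsMonoidal] (hP : ∀ X, P X → P (PivotalCategory.dual X)) :
    PivotalCategory P.FullSubcategory where
  dual X := ⟨PivotalCategory.dual X.obj, hP _ X.property⟩
  ev X := ObjectProperty.homMk (PivotalCategory.ev X.obj)
  coev X := ObjectProperty.homMk (PivotalCategory.coev X.obj)
  ev' X := ObjectProperty.homMk (PivotalCategory.ev' X.obj)
  coev' X := ObjectProperty.homMk (PivotalCategory.coev' X.obj)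
  zigzag₁ X := ObjectProperty.hom_ext _ (PivotalCategory.zigzag₁ X.obj)
  zigzag₂ X := ObjectProperty.hom_ext _ (PivotalCategory.zigzag₂ X.obj)
  zigzag₃ X := ObjectProperty.hom_ext _ (PivotalCategory.zigzag₃ X.obj)
  zigzag₄ X := ObjectProperty.hom_ext _ (PivotalCategory.zigzag₄ X.obj)
  exists_transpose f := by
    obtain ⟨g, h₁, h₂⟩ := PivotalCategory.exists_transpose f.hom
    exact ⟨ObjectProperty.homMk g, ObjectProperty.hom_ext _ h₁, ObjectProperty.hom_ext _ h₂⟩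
  exists_dual_tensor X Y := by
    obtain ⟨g, h₁, h₂⟩ := PivotalCategory.exists_dual_tensor X.obj Y.obj
    exact ⟨ObjectProperty.homMk g, ObjectProperty.hom_ext _ h₁, ObjectProperty.hom_ext _ h₂⟩
  exists_dual_unit := by
    obtain ⟨g, h₁, h₂⟩ := PivotalCategory.exists_dual_unit (C := C)
    exact ⟨ObjectProperty.homMk g, ObjectProperty.hom_ext _ h₁, ObjectProperty.hom_ext _ h₂⟩

/-! ### Spider categories by generators and relations -/

/-- The data generating a free spider category: the colors of oriented edges, with the reversal of
orientation, and the vertices. A vertex in `Vertex a b` has the word `a` as its bottom boundary and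
the word `b` as its top boundary. -/
structure SpiderSignature where
  Letter : Type
  bar : Letter → Letter
  bar_bar : ∀ x, bar (bar x) = x
  Vertex : List Letter → List Letter → Type

namespace SpiderSignature

variable (S : SpiderSignature)

/-- The dual of a word: reverse the word and all the orientations. -/
def dual (a : List S.Letter) : List S.Letter := (a.map S.bar).reverse

theorem dual_dual (a : List S.Letter) : S.dual (S.dual a) = a := by
  simp [dual, List.map_reverse, Function.comp_def, S.bar_bar]

theorem dual_append (a b : List S.Letter) : S.dual (a ++ b) = S.dual b ++ S.dual a := by
  simp [dual]

variable {S} in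
theorem eq_dual_symm {a b : List S.Letter} (h : b = S.dual a) : a = S.dual b := by
  rw [h, dual_dual]

variable {S} in
theorem eq_dual_append {a b a' b' : List S.Letter} (ha : a' = S.dual a) (hb : b' = S.dual b) :
    b' ++ a' = S.dual (a ++ b) := by
  rw [dual_append, ha, hb]

/-- Formal `R`-linear combinations of diagrams, read from bottom to top: composition is stacking,
`tensor` is the join, `rot` is the rotation by half a turn. The identity diagram is `eqTo rfl`. -/
inductive Diagram (R : Type u) : List S.Letter → List S.Letter → Type u
  | eqTo {a b : List S.Letter} (h : a = b) : Diagram R a b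
  | comp {a b c : List S.Letter} (f : Diagram R a b) (g : Diagram R b c) : Diagram R a c
  | tensor {a b c d : List S.Letter} (f : Diagram R a b) (g : Diagram R c d) :
      Diagram R (a ++ c) (b ++ d)
  | zero {a b : List S.Letter} : Diagram R a b
  | add {a b : List S.Letter} (f g : Diagram R a b) : Diagram R a b
  | smul {a b : List S.Letter} (r : R) (f : Diagram R a b) : Diagram R a b
  | vertex {a b : List S.Letter} (x : S.Vertex a b) : Diagram R a b
  | cup (a b : List S.Letter) (h : b = S.dual a) : Diagram R [] (a ++ b)
  | cap (a b : List S.Letter) (h : b = S.dual a) : Diagram R (b ++ a) []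
  | braid (a b : List S.Letter) : Diagram R (a ++ b) (b ++ a)
  | braidInv (a b : List S.Letter) : Diagram R (b ++ a) (a ++ b)
  | rot {a b : List S.Letter} (f : Diagram R a b) : Diagram R (S.dual b) (S.dual a)

/-- A set of relators: pairs of parallel formal combinations of diagrams. -/
abbrev Relators (R : Type u) : Type u :=
  ∀ a b : List S.Letter, S.Diagram R a b → S.Diagram R a b → Prop

namespace Diagram

variable {S} {R : Type u}

/-- The identity diagram. -/
abbrev idd (a : List S.Letter) : S.Diagram R a a := eqTo rfl

/-- The sum of a list of diagrams. -/
def sum {a b : List S.Letter} (l : List (S.Diagram R a b)) : S.Diagram R a b := l.foldr add zero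

/-- Closing up the strands `x` of `f` to the right of `a`. -/
def closeRight (a x : List S.Letter) (f : S.Diagram R (a ++ x) (a ++ x)) : S.Diagram R a a :=
  (((((eqTo (a.append_nil).symm).comp ((idd a).tensor (cup x (S.dual x) rfl))).comp
    (eqTo (List.append_assoc _ _ _).symm)).comp (f.tensor (idd (S.dual x)))).comp
    (eqTo (List.append_assoc _ _ _))).comp
    (((idd a).tensor (cap (S.dual x) x (eq_dual_symm rfl))).comp (eqTo a.append_nil))

/-- Closing up the strands `x` of `f` to the left of `a`. -/
def closeLeft (x a : List S.Letter) (f : S.Diagram R (x ++ a) (x ++ a)) : S.Diagram R a a :=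
  (((((cup (S.dual x) x (eq_dual_symm rfl)).tensor (idd a)).comp
    (eqTo (List.append_assoc _ _ _))).comp ((idd (S.dual x)).tensor f)).comp
    (eqTo (List.append_assoc _ _ _).symm)).comp
    ((cap x (S.dual x) rfl).tensor (idd a))

end Diagram

open Diagram

variable {S} in
/-- The congruence on diagrams generated by the relators `rel` and by isotopy: the axioms of an
`R`-linear strict monoidal category that is braided and pivotal. -/
inductive SkeinEq {R : Type u} [CommRing R] (rel : S.Relators R) :
    ∀ {a b : List S.Letter}, S.Diagram R a b → S.Diagram R a b → Prop
  | rel {a b} {f g : S.Diagram R a b} : rel a b f g → SkeinEq rel f g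
  -- equivalence relation and compatibility with the operations
  | refl {a b} (f : S.Diagram R a b) : SkeinEq rel f f
  | symm {a b} {f g : S.Diagram R a b} : SkeinEq rel f g → SkeinEq rel g f
  | trans {a b} {f g h : S.Diagram R a b} : SkeinEq rel f g → SkeinEq rel g h → SkeinEq rel f h
  | comp_congr {a b c} {f f' : S.Diagram R a b} {g g' : S.Diagram R b c} :
      SkeinEq rel f f' → SkeinEq rel g g' → SkeinEq rel (f.comp g) (f'.comp g')
  | tensor_congr {a b c d} {f f' : S.Diagram R a b} {g g' : S.Diagram R c d} :
      SkeinEq rel f f' → SkeinEq rel g g' → SkeinEq rel (f.tensor g) (f'.tensor g')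
  | add_congr {a b} {f f' g g' : S.Diagram R a b} :
      SkeinEq rel f f' → SkeinEq rel g g' → SkeinEq rel (f.add g) (f'.add g')
  | smul_congr {a b} (r : R) {f f' : S.Diagram R a b} :
      SkeinEq rel f f' → SkeinEq rel (f.smul r) (f'.smul r)
  -- modules of morphisms
  | add_assoc {a b} (f g h : S.Diagram R a b) : SkeinEq rel ((f.add g).add h) (f.add (g.add h))
  | add_comm {a b} (f g : S.Diagram R a b) : SkeinEq rel (f.add g) (g.add f)
  | zero_add {a b} (f : S.Diagram R a b) : SkeinEq rel (zero.add f) f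
  | one_smul {a b} (f : S.Diagram R a b) : SkeinEq rel (f.smul 1) f
  | mul_smul {a b} (r s : R) (f : S.Diagram R a b) :
      SkeinEq rel (f.smul (r * s)) ((f.smul s).smul r)
  | smul_add {a b} (r : R) (f g : S.Diagram R a b) :
      SkeinEq rel ((f.add g).smul r) ((f.smul r).add (g.smul r))
  | add_smul {a b} (r s : R) (f : S.Diagram R a b) :
      SkeinEq rel (f.smul (r + s)) ((f.smul r).add (f.smul s))
  | zero_smul {a b} (f : S.Diagram R a b) : SkeinEq rel (f.smul 0) zero
  -- bilinearity of composition and of the tensor product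
  | add_comp {a b c} (f f' : S.Diagram R a b) (g : S.Diagram R b c) :
      SkeinEq rel ((f.add f').comp g) ((f.comp g).add (f'.comp g))
  | comp_add {a b c} (f : S.Diagram R a b) (g g' : S.Diagram R b c) :
      SkeinEq rel (f.comp (g.add g')) ((f.comp g).add (f.comp g'))
  | smul_comp {a b c} (r : R) (f : S.Diagram R a b) (g : S.Diagram R b c) :
      SkeinEq rel ((f.smul r).comp g) ((f.comp g).smul r)
  | comp_smul {a b c} (r : R) (f : S.Diagram R a b) (g : S.Diagram R b c) :
      SkeinEq rel (f.comp (g.smul r)) ((f.comp g).smul r)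
  | add_tensor {a b c d} (f f' : S.Diagram R a b) (g : S.Diagram R c d) :
      SkeinEq rel ((f.add f').tensor g) ((f.tensor g).add (f'.tensor g))
  | tensor_add {a b c d} (f : S.Diagram R a b) (g g' : S.Diagram R c d) :
      SkeinEq rel (f.tensor (g.add g')) ((f.tensor g).add (f.tensor g'))
  | smul_tensor {a b c d} (r : R) (f : S.Diagram R a b) (g : S.Diagram R c d) :
      SkeinEq rel ((f.smul r).tensor g) ((f.tensor g).smul r)
  | tensor_smul {a b c d} (r : R) (f : S.Diagram R a b) (g : S.Diagram R c d) :
      SkeinEq rel (f.tensor (g.smul r)) ((f.tensor g).smul r)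
  -- strict monoidal category
  | id_comp {a b} (f : S.Diagram R a b) : SkeinEq rel ((idd a).comp f) f
  | comp_id {a b} (f : S.Diagram R a b) : SkeinEq rel (f.comp (idd b)) f
  | comp_assoc {a b c d} (f : S.Diagram R a b) (g : S.Diagram R b c) (h : S.Diagram R c d) :
      SkeinEq rel ((f.comp g).comp h) (f.comp (g.comp h))
  | tensor_id (a b) : SkeinEq rel ((idd a).tensor (idd b)) (idd (a ++ b))
  | interchange {a b c a' b' c'} (f : S.Diagram R a b) (g : S.Diagram R b c)
      (f' : S.Diagram R a' b') (g' : S.Diagram R b' c') :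
      SkeinEq rel ((f.tensor f').comp (g.tensor g')) ((f.comp g).tensor (f'.comp g'))
  | tensor_assoc {a b c a' b' c'} (f : S.Diagram R a a') (g : S.Diagram R b b')
      (h : S.Diagram R c c') :
      SkeinEq rel (((f.tensor g).tensor h).comp (eqTo (List.append_assoc _ _ _)))
        ((eqTo (List.append_assoc _ _ _)).comp (f.tensor (g.tensor h)))
  | nil_tensor {a b} (f : S.Diagram R a b) : SkeinEq rel ((idd []).tensor f) f
  | tensor_nil {a b} (f : S.Diagram R a b) :
      SkeinEq rel ((f.tensor (idd [])).comp (eqTo b.append_nil)) ((eqTo a.append_nil).comp f)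
  -- cups and caps
  | zigzag_left (a b h) :
      SkeinEq rel ((((cup a b h).tensor (idd a)).comp (eqTo (List.append_assoc _ _ _))).comp
        ((idd a).tensor (cap a b h))) (eqTo a.append_nil.symm)
  | zigzag_right (a b h) :
      SkeinEq rel ((((idd b).tensor (cup a b h)).comp (eqTo (List.append_assoc _ _ _).symm)).comp
        ((cap a b h).tensor (idd b))) (eqTo b.append_nil)
  | cap_nil : SkeinEq rel (cap [] [] rfl) (idd [])
  | cap_append (a b a' b') (ha : a' = S.dual a) (hb : b' = S.dual b) :
      SkeinEq rel (cap (a ++ b) (b' ++ a') (eq_dual_append ha hb))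
        (((eqTo (by simp only [List.append_assoc])).comp
          ((idd b').tensor ((cap a a' ha).tensor (idd b)))).comp (cap b b' hb))
  -- rotations; the two equations say that the rotations in the two directions agree
  | rot_cap {a b} (f : S.Diagram R a b) :
      SkeinEq rel ((f.rot.tensor (idd a)).comp (cap a (S.dual a) rfl))
        (((idd (S.dual b)).tensor f).comp (cap b (S.dual b) rfl))
  | rot_cap' {a b} (f : S.Diagram R a b) :
      SkeinEq rel (((idd a).tensor f.rot).comp (cap (S.dual a) a (eq_dual_symm rfl)))
        ((f.tensor (idd (S.dual b))).comp (cap (S.dual b) b (eq_dual_symm rfl)))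
  -- crossings: both Reidemeister II moves, and naturality (which contains Reidemeister III)
  | braid_braidInv (a b) : SkeinEq rel ((braid a b).comp (braidInv a b)) (idd _)
  | braidInv_braid (a b) : SkeinEq rel ((braidInv a b).comp (braid a b)) (idd _)
  | braid_natural {a b a' b'} (f : S.Diagram R a a') (g : S.Diagram R b b') :
      SkeinEq rel ((f.tensor g).comp (braid a' b')) ((braid a b).comp (g.tensor f))
  | braid_append_right (a b c) :
      SkeinEq rel (((eqTo (List.append_assoc a b c)).comp (braid a (b ++ c))).comp
          (eqTo (List.append_assoc b c a)))
        ((((braid a b).tensor (idd c)).comp (eqTo (List.append_assoc b a c))).comp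
          ((idd b).tensor (braid a c)))
  | braid_append_left (a b c) :
      SkeinEq rel (((eqTo (List.append_assoc a b c).symm).comp (braid (a ++ b) c)).comp
          (eqTo (List.append_assoc c a b).symm))
        ((((idd a).tensor (braid b c)).comp (eqTo (List.append_assoc a c b).symm)).comp
          ((braid a c).tensor (idd b)))

end SpiderSignature

open SpiderSignature SpiderSignature.Diagram

/-- The spider category with the given generators and relators. Its objects are the words in the
oriented colors. -/
structure Spider (S : SpiderSignature) (R : Type u) [CommRing R] (rel : S.Relators R) where
  word : List S.Letter

namespace Spider

variable {S : SpiderSignature} {R : Type u} [CommRing R] {rel : S.Relators R}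

/-- Skein equivalence of diagrams as a setoid. -/
abbrev homSetoid (rel : S.Relators R) (a b : List S.Letter) : Setoid (S.Diagram R a b) :=
  ⟨SkeinEq rel, ⟨SkeinEq.refl, SkeinEq.symm, SkeinEq.trans⟩⟩

/-- Morphisms: formal combinations of diagrams modulo skein equivalence. -/
def SHom (rel : S.Relators R) (a b : List S.Letter) : Type u := Quotient (homSetoid rel a b)

/-- The morphism represented by a diagram. -/
def ofDiagram (rel : S.Relators R) {a b : List S.Letter} (f : S.Diagram R a b) : SHom rel a b :=
  Quotient.mk (homSetoid rel a b) f

theorem sound {a b : List S.Letter} {f g : S.Diagram R a b} (h : SkeinEq rel f g) :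
    ofDiagram rel f = ofDiagram rel g := Quotient.sound (s := homSetoid rel a b) h

theorem ind {a b : List S.Letter} {p : SHom rel a b → Prop} (h : ∀ f, p (ofDiagram rel f)) (x) : p x :=
  Quotient.ind (s := homSetoid rel a b) h x

/-- Stacking of morphisms. -/
def hcomp {a b c : List S.Letter} (x : SHom rel a b) (y : SHom rel b c) : SHom rel a c :=
  Quotient.map₂ (sa := homSetoid rel a b) (sb := homSetoid rel b c) (sc := homSetoid rel a c)
    Diagram.comp (fun _ _ h _ _ h' => SkeinEq.comp_congr h h') x y

/-- Join of morphisms. -/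
def htensor {a b c d : List S.Letter} (x : SHom rel a b) (y : SHom rel c d) :
    SHom rel (a ++ c) (b ++ d) :=
  Quotient.map₂ (sa := homSetoid rel a b) (sb := homSetoid rel c d)
    (sc := homSetoid rel (a ++ c) (b ++ d))
    Diagram.tensor (fun _ _ h _ _ h' => SkeinEq.tensor_congr h h') x y

instance (a b : List S.Letter) : Add (SHom rel a b) where
  add x y := Quotient.map₂ (sa := homSetoid rel a b) (sb := homSetoid rel a b)
    (sc := homSetoid rel a b) Diagram.add (fun _ _ h _ _ h' => SkeinEq.add_congr h h') x y

instance (a b : List S.Letter) : Zero (SHom rel a b) where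
  zero := ofDiagram rel Diagram.zero

instance (a b : List S.Letter) : Neg (SHom rel a b) where
  neg x := Quotient.map (sa := homSetoid rel a b) (sb := homSetoid rel a b)
    (Diagram.smul (-1)) (fun _ _ h => SkeinEq.smul_congr _ h) x

instance (a b : List S.Letter) : AddCommGroup (SHom rel a b) where
  add_assoc x y z := by
    induction x using ind; induction y using ind; induction z using ind
    exact sound (.add_assoc _ _ _)
  add_comm x y := by
    induction x using ind; induction y using ind
    exact sound (.add_comm _ _)
  zero_add x := by
    induction x using ind
    exact sound (.zero_add _)
  add_zero x := by
    induction x using ind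
    exact sound (.trans (.add_comm _ _) (.zero_add _))
  neg_add_cancel x := by
    induction x using ind with | _ f
    have h : SkeinEq rel ((f.smul (-1)).add (f.smul 1)) Diagram.zero := by
      refine .trans (.symm (.add_smul _ _ _)) ?_
      rw [neg_add_cancel]
      exact .zero_smul f
    exact sound (.trans (.add_congr (.refl _) (.symm (.one_smul f))) h)
  nsmul := nsmulRec
  zsmul := zsmulRec

instance (a b : List S.Letter) : Module R (SHom rel a b) where
  smul r x := Quotient.map (sa := homSetoid rel a b) (sb := homSetoid rel a b)
    (Diagram.smul r) (fun _ _ h => SkeinEq.smul_congr _ h) x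
  one_smul x := by
    induction x using ind
    exact sound (.one_smul _)
  mul_smul r s x := by
    induction x using ind
    exact sound (.mul_smul _ _ _)
  smul_zero r := by
    refine sound (f := Diagram.zero.smul r) ?_
    refine .trans (.smul_congr r (.symm (.zero_smul .zero))) ?_
    refine .trans (.symm (.mul_smul _ _ _)) ?_
    rw [mul_zero]
    exact .zero_smul _
  smul_add r x y := by
    induction x using ind; induction y using ind
    exact sound (.smul_add _ _ _)
  add_smul r s x := by
    induction x using ind
    exact sound (.add_smul _ _ _)
  zero_smul x := by
    induction x using ind
    exact sound (.zero_smul _)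

theorem tensor_eqTo {a b c d : List S.Letter} (h : a = b) (h' : c = d) :
    SkeinEq rel ((eqTo h).tensor (eqTo h')) (eqTo (by rw [h, h'])) := by
  subst h; subst h'; exact .tensor_id _ _

theorem eqTo_comp_eqTo {a b c : List S.Letter} (h : a = b) (h' : b = c) :
    SkeinEq rel ((eqTo h).comp (eqTo h')) (eqTo (h.trans h')) := by
  subst h; exact .id_comp _

instance : Category (Spider S R rel) where
  Hom X Y := SHom rel X.word Y.word
  id X := ofDiagram rel (idd X.word)
  comp x y := hcomp x y
  id_comp x := by
    induction x using ind
    exact sound (.id_comp _)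
  comp_id x := by
    induction x using ind
    exact sound (.comp_id _)
  assoc x y z := by
    induction x using ind; induction y using ind; induction z using ind
    exact sound (.comp_assoc _ _ _)

/-- The morphism of the spider category represented by a diagram. -/
abbrev hom {X Y : Spider S R rel} (f : S.Diagram R X.word Y.word) : X ⟶ Y := ofDiagram rel f

theorem hom_ind {X Y : Spider S R rel} {p : (X ⟶ Y) → Prop} (h : ∀ f, p (hom f)) (x) : p x :=
  ind h x

instance : Preadditive (Spider S R rel) where
  homGroup X Y := inferInstanceAs (AddCommGroup (SHom rel X.word Y.word))
  add_comp X Y Z x x' y := by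
    induction x using hom_ind; induction x' using hom_ind; induction y using hom_ind
    exact sound (.add_comp _ _ _)
  comp_add X Y Z x y y' := by
    induction x using hom_ind; induction y using hom_ind; induction y' using hom_ind
    exact sound (.comp_add _ _ _)

instance : Linear R (Spider S R rel) where
  homModule X Y := inferInstanceAs (Module R (SHom rel X.word Y.word))
  smul_comp X Y Z r x y := by
    induction x using hom_ind; induction y using hom_ind
    exact sound (.smul_comp _ _ _)
  comp_smul X Y Z x r y := by
    induction x using hom_ind; induction y using hom_ind
    exact sound (.comp_smul _ _ _)

/-- The structural isomorphism between two objects with equal words. -/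
def eqIso {X Y : Spider S R rel} (h : X.word = Y.word) : X ≅ Y where
  hom := hom (eqTo h)
  inv := hom (eqTo h.symm)
  hom_inv_id := sound (eqTo_comp_eqTo _ _)
  inv_hom_id := sound (eqTo_comp_eqTo _ _)

instance : MonoidalCategoryStruct (Spider S R rel) where
  tensorObj X Y := ⟨X.word ++ Y.word⟩
  tensorHom x y := htensor x y
  whiskerLeft X _ _ y := htensor (ofDiagram rel (idd X.word)) y
  whiskerRight x Y := htensor x (ofDiagram rel (idd Y.word))
  tensorUnit := ⟨[]⟩
  associator _ _ _ := eqIso (List.append_assoc _ _ _)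
  leftUnitor _ := eqIso rfl
  rightUnitor _ := eqIso (List.append_nil _)

instance : MonoidalCategory (Spider S R rel) :=
  MonoidalCategory.ofTensorHom
    (id_tensorHom_id := fun _ _ => sound (.tensor_id _ _))
    (id_tensorHom := fun _ _ _ _ => rfl)
    (tensorHom_id := fun _ _ => rfl)
    (tensorHom_comp_tensorHom := fun x y x' y' => by
      induction x using hom_ind; induction y using hom_ind
      induction x' using hom_ind; induction y' using hom_ind
      exact sound (.interchange _ _ _ _))
    (associator_naturality := fun x y z => by
      induction x using hom_ind; induction y using hom_ind; induction z using hom_ind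
      exact sound (.tensor_assoc _ _ _))
    (leftUnitor_naturality := fun x => by
      induction x using hom_ind
      exact sound (.trans (.comp_id _) (.trans (.nil_tensor _) (.symm (.id_comp _)))))
    (rightUnitor_naturality := fun x => by
      induction x using hom_ind
      exact sound (.tensor_nil _))
    (pentagon := fun W X Y Z => sound <|
      .trans (.comp_congr (tensor_eqTo _ _) (.comp_congr (.refl _) (tensor_eqTo _ _)))
        (.trans (.comp_congr (.refl _) (eqTo_comp_eqTo _ _))
          (.trans (eqTo_comp_eqTo _ _) (.symm (eqTo_comp_eqTo _ _)))))
    (triangle := fun X Y => sound <|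
      .trans (.comp_congr (.refl _) (tensor_eqTo _ _))
        (.trans (eqTo_comp_eqTo _ _) (.symm (tensor_eqTo _ _))))

theorem tensor_zero_eq {a b c d : List S.Letter} (f : S.Diagram R a b) :
    SkeinEq rel (f.tensor (Diagram.zero : S.Diagram R c d)) Diagram.zero :=
  .trans (.tensor_congr (.refl _) (.symm (.zero_smul .zero)))
    (.trans (.tensor_smul _ _ _) (.zero_smul _))

theorem zero_tensor_eq {a b c d : List S.Letter} (f : S.Diagram R c d) :
    SkeinEq rel ((Diagram.zero : S.Diagram R a b).tensor f) Diagram.zero :=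
  .trans (.tensor_congr (.symm (.zero_smul .zero)) (.refl _))
    (.trans (.smul_tensor _ _ _) (.zero_smul _))

instance : MonoidalPreadditive (Spider S R rel) where
  whiskerLeft_zero := sound (tensor_zero_eq _)
  zero_whiskerRight := sound (zero_tensor_eq _)
  whiskerLeft_add x y := by
    induction x using hom_ind; induction y using hom_ind
    exact sound (.tensor_add _ _ _)
  add_whiskerRight x y := by
    induction x using hom_ind; induction y using hom_ind
    exact sound (.add_tensor _ _ _)

instance : MonoidalLinear R (Spider S R rel) where
  whiskerLeft_smul X _ _ r x := by
    induction x using hom_ind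
    exact sound (.tensor_smul _ _ _)
  smul_whiskerRight r _ _ x X := by
    induction x using hom_ind
    exact sound (.smul_tensor _ _ _)

instance : BraidedCategory (Spider S R rel) where
  braiding X Y :=
    { hom := hom (braid X.word Y.word)
      inv := hom (braidInv X.word Y.word)
      hom_inv_id := sound (.braid_braidInv _ _)
      inv_hom_id := sound (.braidInv_braid _ _) }
  braiding_naturality_right X _ _ x := by
    induction x using hom_ind
    exact sound (.braid_natural _ _)
  braiding_naturality_left x Z := by
    induction x using hom_ind
    exact sound (.braid_natural _ _)
  hexagon_forward X Y Z := sound <|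
    .trans (.symm (.comp_assoc _ _ _))
      (.trans (.braid_append_right X.word Y.word Z.word) (.comp_assoc _ _ _))
  hexagon_reverse X Y Z := sound <|
    .trans (.symm (.comp_assoc _ _ _))
      (.trans (.braid_append_left X.word Y.word Z.word) (.comp_assoc _ _ _))

theorem zigzag_left_eq (a b : List S.Letter) (h : b = S.dual a) :
    SkeinEq rel (((cup a b h).tensor (idd a)).comp
        ((eqTo (List.append_assoc _ _ _)).comp ((idd a).tensor (cap a b h))))
      ((eqTo (List.nil_append a)).comp (eqTo a.append_nil.symm)) :=
  .trans (.symm (.comp_assoc _ _ _)) (.trans (.zigzag_left a b h) (.symm (.id_comp _)))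

theorem zigzag_right_eq (a b : List S.Letter) (h : b = S.dual a) :
    SkeinEq rel (((idd b).tensor (cup a b h)).comp
        ((eqTo (List.append_assoc _ _ _).symm).comp ((cap a b h).tensor (idd b))))
      ((eqTo b.append_nil).comp (eqTo (List.nil_append b).symm)) :=
  .trans (.symm (.comp_assoc _ _ _)) (.trans (.zigzag_right a b h) (.symm (.comp_id _)))

theorem cap_append_eq (a b a' b' : List S.Letter) (ha : a' = S.dual a) (hb : b' = S.dual b) :
    SkeinEq rel (cap (a ++ b) (b' ++ a') (eq_dual_append ha hb))
      ((eqTo (List.append_assoc b' a' (a ++ b))).comp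
        (((idd b').tensor ((eqTo (List.append_assoc a' a b).symm).comp
          (((cap a a' ha).tensor (idd b)).comp (eqTo (List.nil_append b))))).comp
          (cap b b' hb))) := by
  have e : SkeinEq rel ((idd b').tensor ((eqTo (List.append_assoc a' a b).symm).comp
      (((cap a a' ha).tensor (idd b)).comp (eqTo (List.nil_append b)))))
      ((eqTo (by simp only [List.append_assoc])).comp
        ((idd b').tensor ((cap a a' ha).tensor (idd b)))) :=
    .trans (.tensor_congr (.symm (.id_comp _)) (.comp_congr (.refl _) (.comp_id _)))
      (.trans (.symm (.interchange _ _ _ _)) (.comp_congr (tensor_eqTo _ _) (.refl _)))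
  refine .trans (.cap_append a b a' b' ha hb) ?_
  refine .symm (.trans (.comp_congr (.refl _) (.comp_congr e (.refl _))) ?_)
  refine .trans (.symm (.comp_assoc _ _ _)) (.comp_congr ?_ (.refl _))
  exact .trans (.symm (.comp_assoc _ _ _)) (.comp_congr (eqTo_comp_eqTo _ _) (.refl _))

theorem eqTo_cap_right {a b c : List S.Letter} (h : b = S.dual a) (hc : c = b) :
    SkeinEq rel (((eqTo hc).tensor (idd a)).comp (cap a b h)) (cap a c (hc.trans h)) := by
  subst hc; exact .trans (.comp_congr (.tensor_id _ _) (.refl _)) (.id_comp _)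

theorem eqTo_cap_left {a b c : List S.Letter} (h : b = S.dual a) (hc : c = a) :
    SkeinEq rel (((idd b).tensor (eqTo hc)).comp (cap a b h)) (cap c b (by rw [h, hc])) := by
  subst hc; exact .trans (.comp_congr (.tensor_id _ _) (.refl _)) (.id_comp _)

instance : PivotalCategory (Spider S R rel) where
  dual X := ⟨S.dual X.word⟩
  ev X := hom (cap X.word (S.dual X.word) rfl)
  coev X := hom (cup X.word (S.dual X.word) rfl)
  ev' X := hom (cap (S.dual X.word) X.word (eq_dual_symm rfl))
  coev' X := hom (cup (S.dual X.word) X.word (eq_dual_symm rfl))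
  zigzag₁ X := sound (zigzag_left_eq _ _ _)
  zigzag₂ X := sound (zigzag_right_eq _ _ _)
  zigzag₃ X := sound (zigzag_left_eq _ _ _)
  zigzag₄ X := sound (zigzag_right_eq _ _ _)
  exists_transpose x := by
    induction x using hom_ind with | _ f
    exact ⟨hom f.rot, sound (.rot_cap f), sound (.rot_cap' f)⟩
  exists_dual_tensor X Y :=
    ⟨hom (eqTo (S.dual_append X.word Y.word).symm),
      sound (.trans (eqTo_cap_right rfl _) (cap_append_eq _ _ _ _ rfl rfl)),
      sound (.trans (eqTo_cap_left _ _)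
        (cap_append_eq _ _ _ _ (eq_dual_symm rfl) (eq_dual_symm rfl)))⟩
  exists_dual_unit :=
    ⟨hom (idd []),
      sound (.trans (.comp_congr (.tensor_id _ _) .cap_nil) (.id_comp _)),
      sound (.trans (.comp_congr (.tensor_id _ _) .cap_nil) (.id_comp _))⟩

end Spider

/-! ### Quantum integers -/

section Quantum

variable {R : Type u} [CommRing R] (q : Rˣ)

/-- The quantum integer `[m] = q ^ (1 - m) + q ^ (3 - m) + ⋯ + q ^ (m - 1)`, with `[-m] = -[m]`. -/
def qInt (m : ℤ) : R :=
  (m.sign : R) * ∑ i ∈ Finset.range m.natAbs, ((q ^ (-(m.natAbs : ℤ) + 1 + 2 * i) : Rˣ) : R)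

/-- The quantum factorial. -/
def qFactorial (k : ℕ) : R := ∏ i ∈ Finset.range k, qInt q (i + 1)

/-- The quantum binomial coefficient `[m][m-1]⋯[m-t+1] / [t]!`, used only if `[t]!` is a unit. -/
def qBinom (m : ℤ) (t : ℕ) : R :=
  (∏ i ∈ Finset.range t, qInt q (m - i)) * Ring.inverse (qFactorial q t)

end Quantum

/-! ### The HOMFLYPT category -/

/-- One color, with the orientations up (`true`) and down (`false`), and no vertices. -/
def homflySignature : SpiderSignature where
  Letter := Bool
  bar := not
  bar_bar := by simp
  Vertex _ _ := Empty

/-- The HOMFLYPT relators. -/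
inductive HomflyRel {R : Type u} [CommRing R] (a s v : Rˣ) : homflySignature.Relators R
  /-- `a⁻¹ X₊ - a X₋ = (s - s⁻¹) id` for the positive and the negative crossing of two strands -/
  | skein : HomflyRel a s v [true, true] [true, true]
      (((braid (S := homflySignature) [true] [true]).smul ((a⁻¹ : Rˣ) : R)).add
        ((braidInv (S := homflySignature) [true] [true]).smul (-(a : R))))
      ((idd (S := homflySignature) [true, true]).smul ((s : R) - ((s⁻¹ : Rˣ) : R)))
  /-- a positive kink is `a v⁻¹` -/
  | kink_right : HomflyRel a s v [true] [true]
      (closeRight (S := homflySignature) [true] [true] (braid (S := homflySignature) [true] [true]))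
      ((idd (S := homflySignature) [true]).smul ((a * v⁻¹ : Rˣ) : R))
  | kink_left : HomflyRel a s v [true] [true]
      (closeLeft (S := homflySignature) [true] [true] (braid (S := homflySignature) [true] [true]))
      ((idd (S := homflySignature) [true]).smul ((a * v⁻¹ : Rˣ) : R))
  /-- an unknot is `(v⁻¹ - v) / (s - s⁻¹)` -/
  | unknot (x : Bool) : HomflyRel a s v [] []
      (closeRight (S := homflySignature) [] [x] (idd (S := homflySignature) [x]))
      ((idd (S := homflySignature) []).smul
        ((((v⁻¹ : Rˣ) : R) - (v : R)) * Ring.inverse ((s : R) - ((s⁻¹ : Rˣ) : R))))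

/-- The HOMFLYPT category with parameters `a`, `s`, `v`. -/
abbrev HOMFLYPT (R : Type u) [CommRing R] (a s v : Rˣ) : Type :=
  Spider homflySignature R (HomflyRel a s v)

/-- The HOMFLYPT category specialized at `a = q ^ (-1/n)`, `s = q`, `v = q ^ (-n)`, where `t` is the
chosen `n`-th root of `q`. -/
abbrev HMF (R : Type u) [CommRing R] (n : ℕ) (q t : Rˣ) : Type :=
  HOMFLYPT R t⁻¹ q (q ^ n)⁻¹

/-! ### The MOY category -/

/-- The oriented colors `k⁺` (`true`) and `k⁻` (`false`) for `1 ≤ k ≤ n`. -/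
abbrev MOYLetter (n : ℕ) : Type := {k : ℕ // 1 ≤ k ∧ k ≤ n} × Bool

/-- The word of an upward edge with label `k`. An edge labelled `0` is erased. (Labels above `n`
are not admissible; they do not occur in any diagram below.) -/
def up (n k : ℕ) : List (MOYLetter n) :=
  if h : 1 ≤ k ∧ k ≤ n then [(⟨k, h⟩, true)] else []

theorem up_zero (n : ℕ) : up n 0 = [] := by simp [up]

/-- The trivalent vertices `k ⊗ l ⟶ m` and `m ⟶ k ⊗ l`, where `m = k + l ≤ n`. -/
inductive MOYVertex (n : ℕ) : List (MOYLetter n) → List (MOYLetter n) → Type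
  | merge (k l m : ℕ) (h : k + l = m) (hm : m ≤ n) : MOYVertex n (up n k ++ up n l) (up n m)
  | split (k l m : ℕ) (h : k + l = m) (hm : m ≤ n) : MOYVertex n (up n m) (up n k ++ up n l)

/-- The generators of the MOY category. -/
def moySignature (n : ℕ) : SpiderSignature where
  Letter := MOYLetter n
  bar x := (x.1, !x.2)
  bar_bar := by simp
  Vertex := MOYVertex n

section MOY

variable {R : Type u} {n : ℕ}

/-- Diagrams between words of oriented colors. -/
abbrev MOYDiagram (R : Type u) (n : ℕ) (a b : List (MOYLetter n)) : Type u :=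
  (moySignature n).Diagram R a b

/-- The vertex `k ⊗ l ⟶ m`. -/
def merge (k l m : ℕ) (h : k + l = m) (hm : m ≤ n) : MOYDiagram R n (up n k ++ up n l) (up n m) :=
  vertex (S := moySignature n) (.merge k l m h hm)

/-- The vertex `m ⟶ k ⊗ l`. -/
def split (k l m : ℕ) (h : k + l = m) (hm : m ≤ n) : MOYDiagram R n (up n m) (up n k ++ up n l) :=
  vertex (S := moySignature n) (.split k l m h hm)

/-- The identity of a word. -/
abbrev str (a : List (MOYLetter n)) : MOYDiagram R n a a := eqTo rfl

/-- The ladder with one rung labelled `r` going from the right to the left upright; the uprights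
are labelled `k`, `l` at the bottom and `k'`, `l'` at the top. -/
def rungLeft (k l r k' l' : ℕ) (hk : k + r = k') (hl : r + l' = l) (hk' : k' ≤ n) (hl' : l ≤ n) :
    MOYDiagram R n (up n k ++ up n l) (up n k' ++ up n l') :=
  (((str (up n k)).tensor (split r l' l hl hl')).comp (eqTo (List.append_assoc _ _ _).symm)).comp
    ((merge k r k' hk hk').tensor (str (up n l')))

/-- The ladder with one rung labelled `s` going from the left to the right upright. -/
def rungRight (k l s k' l' : ℕ) (hk : k' + s = k) (hl : s + l = l') (hk' : k ≤ n) (hl' : l' ≤ n) :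
    MOYDiagram R n (up n k ++ up n l) (up n k' ++ up n l') :=
  (((split k' s k hk hk').tensor (str (up n l))).comp (eqTo (List.append_assoc _ _ _))).comp
    ((str (up n k')).tensor (merge s l l' hl hl'))

/-- The box with uprights `k`, `l` whose lower rung `s` goes to the right and whose upper rung `r`
goes to the left. The labels of the uprights are `k, l`, then `k - s, l + s`, then `k', l'`. -/
def boxRightLeft (k l s r k' l' : ℕ) (hs : s ≤ k) (hls : l + s ≤ n) (hk : k ≤ n)
    (hk' : k' + s = k + r) (hl' : l' + r = l + s) (hk'n : k' ≤ n) :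
    MOYDiagram R n (up n k ++ up n l) (up n k' ++ up n l') :=
  (rungRight k l s (k - s) (l + s) (by omega) (by omega) hk hls).comp
    (rungLeft (k - s) (l + s) r k' l' (by omega) (by omega) hk'n hls)

/-- The box with uprights `k`, `l` whose lower rung `r` goes to the left and whose upper rung `s`
goes to the right. The labels of the uprights are `k, l`, then `k + r, l - r`, then `k', l'`. -/
def boxLeftRight (k l r s k' l' : ℕ) (hr : r ≤ l) (hkr : k + r ≤ n) (hl : l ≤ n)
    (hk' : k' + s = k + r) (hl' : l' + r = l + s) (hl'n : l' ≤ n) :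
    MOYDiagram R n (up n k ++ up n l) (up n k' ++ up n l') :=
  (rungLeft k l r (k + r) (l - r) (by omega) (by omega) hkr hl).comp
    (rungRight (k + r) (l - r) s k' l' (by omega) (by omega) hkr hl'n)

end MOY

/-- The braid expansion of a crossing of upward strands labelled `k` and `l`, `k + l ≤ n`:
`(-1) ^ (k + k l) q ^ (k - k l / n) ∑_{b - a = k - l} (-q) ^ (-b)` times the box whose lower rung
`b` goes to the right and whose upper rung `a` goes to the left. Here `t ^ n = q`. -/
def braidExpansion {R : Type u} [CommRing R] (n : ℕ) (q t : Rˣ) (k l : ℕ) (h : k + l ≤ n) :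
    MOYDiagram R n (up n k ++ up n l) (up n l ++ up n k) :=
  (sum ((List.finRange (k + 1)).map fun (b : Fin (k + 1)) =>
    if hb : k ≤ l + b then
      (boxRightLeft k l b (l + b - k) l k (by have := b.2; omega) (by have := b.2; omega)
        (by omega) (by omega) (by omega) (by omega)).smul (((-q) ^ (-((b : ℕ) : ℤ)) : Rˣ) : R)
    else zero)).smul
    ((-1) ^ (k + k * l) * ((q ^ k * t⁻¹ ^ (k * l) : Rˣ) : R))

/-- The relators of the MOY category: erasing edges labelled `0`, the two bubble relations, the
`6j` relations, the box relations and the braid relations, with their mirror images. All labels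
are between `0` and `n`: a relation is imposed whenever all its diagrams are admissible. -/
inductive MOYRel {R : Type u} [CommRing R] (n : ℕ) (q t : Rˣ) : (moySignature n).Relators R
  | merge_zero_left (l : ℕ) (hl : l ≤ n) : MOYRel n q t _ _
      (merge 0 l l (by omega) hl) (eqTo (by rw [up_zero, List.nil_append]))
  | merge_zero_right (k : ℕ) (hk : k ≤ n) : MOYRel n q t _ _
      (merge k 0 k (by omega) hk) (eqTo (by rw [up_zero, List.append_nil]))
  | split_zero_left (l : ℕ) (hl : l ≤ n) : MOYRel n q t _ _
      (split 0 l l (by omega) hl) (eqTo (by rw [up_zero, List.nil_append]))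
  | split_zero_right (k : ℕ) (hk : k ≤ n) : MOYRel n q t _ _
      (split k 0 k (by omega) hk) (eqTo (by rw [up_zero, List.append_nil]))
  /-- first bubble relation: two parallel edges `k`, `l` -/
  | bubble (k l : ℕ) (h : k + l ≤ n) : MOYRel n q t _ _
      ((split k l (k + l) rfl h).comp (merge k l (k + l) rfl h))
      ((str (up n (k + l))).smul (qBinom q ((k + l : ℕ) : ℤ) k))
  /-- second bubble relation: a loop labelled `l` attached to a strand labelled `k` -/
  | bubble_right (k l : ℕ) (h : k + l ≤ n) : MOYRel n q t _ _
      (closeRight (up n k) (up n l)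
        ((merge k l (k + l) rfl h).comp (split k l (k + l) rfl h)))
      ((str (up n k)).smul (qBinom q ((n : ℤ) - k) l))
  | bubble_left (k l : ℕ) (h : l + k ≤ n) : MOYRel n q t _ _
      (closeLeft (up n l) (up n k)
        ((merge l k (l + k) rfl h).comp (split l k (l + k) rfl h)))
      ((str (up n k)).smul (qBinom q ((n : ℤ) - k) l))
  | sixj_merge (k l m : ℕ) (h : k + l + m ≤ n) : MOYRel n q t _ _
      (((merge k l (k + l) rfl (by omega)).tensor (str (up n m))).comp
        (merge (k + l) m (k + l + m) rfl h))
      ((eqTo (List.append_assoc _ _ _)).comp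
        (((str (up n k)).tensor (merge l m (l + m) rfl (by omega))).comp
          (merge k (l + m) (k + l + m) (by omega) h)))
  | sixj_split (k l m : ℕ) (h : k + l + m ≤ n) : MOYRel n q t _ _
      ((split (k + l) m (k + l + m) rfl h).comp
        ((split k l (k + l) rfl (by omega)).tensor (str (up n m))))
      (((split k (l + m) (k + l + m) (by omega) h).comp
        ((str (up n k)).tensor (split l m (l + m) rfl (by omega)))).comp
          (eqTo (List.append_assoc _ _ _).symm))
  /-- the box relation -/
  | box (k l r s k' l' : ℕ) (hs : s ≤ k) (hr : r ≤ l) (hk : k + r ≤ n) (hl : l + s ≤ n)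
      (hk' : k' + s = k + r) (hl' : l' + r = l + s) : MOYRel n q t _ _
      (boxRightLeft k l s r k' l' hs hl (by omega) hk' hl' (by omega))
      (sum ((List.finRange (min r s + 1)).map fun (i : Fin (min r s + 1)) =>
        (boxLeftRight k l (r - i) (s - i) k' l' (by omega) (by omega) (by omega)
          (by have := i.2; omega) (by have := i.2; omega) (by omega)).smul (qBinom q ((k : ℤ) - l + r - s) i)))
  /-- the mirror image of the box relation -/
  | box_mirror (k l r s k' l' : ℕ) (hs : s ≤ k) (hr : r ≤ l) (hk : k + r ≤ n) (hl : l + s ≤ n)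
      (hk' : k' + s = k + r) (hl' : l' + r = l + s) : MOYRel n q t _ _
      (boxLeftRight k l r s k' l' hr hk (by omega) hk' hl' (by omega))
      (sum ((List.finRange (min r s + 1)).map fun (i : Fin (min r s + 1)) =>
        (boxRightLeft k l (s - i) (r - i) k' l' (by omega) (by omega) (by omega)
          (by have := i.2; omega) (by have := i.2; omega) (by omega)).smul (qBinom q ((l : ℤ) - k + s - r) i)))
  /-- the positive crossing -/
  | braid_pos (k l : ℕ) (h : k + l ≤ n) : MOYRel n q t _ _
      (braid (up n k) (up n l)) (braidExpansion n q t k l h)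
  /-- the negative crossing: replace `q` by its inverse -/
  | braid_neg (k l : ℕ) (h : k + l ≤ n) : MOYRel n q t _ _
      (braidInv (up n l) (up n k)) (braidExpansion n q⁻¹ t⁻¹ k l h)

/-- The category `MOY(SL_n)`, with objects the words in `1^±, …, n^±`. -/
abbrev MOY (R : Type u) [CommRing R] (n : ℕ) (q t : Rˣ) : Type :=
  Spider (moySignature n) R (MOYRel n q t)

/-- The words in `1⁺` and `1⁻`. -/
def isStandardWord (R : Type u) [CommRing R] (n : ℕ) (q t : Rˣ) :
    ObjectProperty (MOY R n q t) :=
  fun X => ∀ x : MOYLetter n, x ∈ (X.word : List (MOYLetter n)) → x.1.1 = 1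

instance (R : Type u) [CommRing R] (n : ℕ) (q t : Rˣ) : (isStandardWord R n q t).IsMonoidal where
  prop_unit := fun x hx => absurd hx (List.not_mem_nil (a := x))
  prop_tensor _ _ hX hY := fun x hx => (List.mem_append.1 hx).elim (hX x) (hY x)

/-- The category `MOY^n(SL_n)`: the full subcategory of `MOY(SL_n)` on the words in `1⁺` and `1⁻`.
The edges inside a diagram may have any of the labels `1, …, n`. -/
abbrev MOYStandard (R : Type u) [CommRing R] (n : ℕ) (q t : Rˣ) : Type :=
  (isStandardWord R n q t).FullSubcategory

instance (R : Type u) [CommRing R] (n : ℕ) (q t : Rˣ) : PivotalCategory (MOYStandard R n q t) :=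
  fullSubcategoryPivotal (isStandardWord R n q t) (fun X hX x hx => by
    obtain ⟨y, hy, rfl⟩ := List.mem_map.1 (List.mem_reverse.1 hx)
    exact hX y hy)

end

/-! The functor from webs to tangles replaces an edge of colour `k` by `k` parallel strands that
carry the quantum antisymmetrizer `P_k`. On two strands the skein relation says that `e = q - t X₊`,
with `t` the chosen root of `q`, satisfies `e² = [2] e`; Reidemeister III gives the braid relation
for neighbouring copies of `e`. So every bundle of parallel strands carries an action of a Hecke
algebra (`HeckeData`), and the unknot and kink relations fix the partial traces: `[n]` for a loop,
`[n-1]` for closing one strand of `e`. This list of properties is `HeckeStrand`.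

From these properties alone all MOY relations follow. A merge becomes `P_m`, a split becomes `P_m`
times a binomial. The `6j` relations say that large antisymmetrizers absorb small ones. The bubbles
are idempotency and iterated partial traces (`closeRight_strandProj`). A ladder becomes a product of
idempotents `P_j ⊗ P_{M-j}`; the two recursions for antisymmetrizers, adding a strand on the right
or on the left, give the commutation of single rungs, and divided powers give the general box
relation (`LadderData.three_term`, `LadderData.ladderF_mul_ladderE`). The expansion of crossings is
`HeckeData.antisymPair_mul_block_eq`, an induction that pulls one strand at a time out of the first
cable.

In the other direction, the merge of two edges labelled one followed by the split is again a Hecke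
generator: the properties in `HeckeStrand` are MOY relations with labels at most two
(`Web.heckeStrand`). This gives a functor from tangles to webs. Going from tangles to webs and back
is the identity on generators. Going from webs to tangles and back is the identity up to a
retraction: merging `k` edges labelled one and splitting again is `[k]! P_k`
(`Web.smul_strandProj`), so an edge of colour `k` is the summand of `k` edges labelled one that is
cut out by `P_k`. A web can therefore be recovered from its image, which gives faithfulness; the
first composite gives fullness and essential surjectivity.

Both categories are given by presentations, so the functors are built as interpretations of
diagrams. Letters go to words with idempotents, as in an idempotent completion, and
`Interpretation.eval_congr` shows that the isotopy axioms are respected. Since `P_1 = 1`, the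
idempotents are identities on words in `1⁺` and `1⁻`, and there the interpretation is a braided
pivotal functor. Sphericity holds because the kinks on the two sides of a strand are the same unit
(`sphericalWord_of_kink`), and it passes to duals and to concatenations. -/

/-! ### Quantum integers and quantum binomials. -/

noncomputable section QuantumIntegers

variable {R : Type u} [CommRing R]

/-- The sum telescopes once it is multiplied by `q - q⁻¹`. Since that factor is assumed to be a
unit, identities between quantum integers can be checked on this closed form, as identities of
Laurent monomials in `q`. -/
theorem qInt_sub_mul (q : Rˣ) (m : ℤ) :
    ((q : R) - ((q⁻¹ : Rˣ) : R)) * qInt q m = ((q ^ m : Rˣ) : R) - ((q ^ (-m) : Rˣ) : R) := by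
  have key : ∀ k : ℕ, ((q : R) - ((q⁻¹ : Rˣ) : R)) *
      ∑ i ∈ Finset.range k, ((q ^ (-(k : ℤ) + 1 + 2 * i) : Rˣ) : R) =
        ((q ^ (k : ℤ) : Rˣ) : R) - ((q ^ (-(k : ℤ)) : Rˣ) : R) := by
    intro k
    have h : ∀ i : ℕ, ((q : R) - ((q⁻¹ : Rˣ) : R)) * ((q ^ (-(k : ℤ) + 1 + 2 * i) : Rˣ) : R) =
        ((q ^ (-(k : ℤ) + 2 * (i + 1 : ℕ)) : Rˣ) : R) - ((q ^ (-(k : ℤ) + 2 * i) : Rˣ) : R) := by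
      intro i
      rw [sub_mul, ← Units.val_mul, ← Units.val_mul, ← zpow_one_add, ← zpow_neg_one, ← zpow_add]
      rw [show 1 + (-(k : ℤ) + 1 + 2 * i) = -(k : ℤ) + 2 * (i + 1 : ℕ) by push_cast; ring,
        show -1 + (-(k : ℤ) + 1 + 2 * i) = -(k : ℤ) + 2 * i by ring]
    rw [Finset.mul_sum, Finset.sum_congr rfl fun i _ => h i,
      Finset.sum_range_sub fun i : ℕ => ((q ^ (-(k : ℤ) + 2 * i) : Rˣ) : R)]
    rw [show -(k : ℤ) + 2 * k = k by ring, Nat.cast_zero, mul_zero, add_zero]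
  unfold qInt
  obtain ⟨k, rfl | rfl⟩ := m.eq_nat_or_neg
  · rcases Nat.eq_zero_or_pos k with rfl | hk
    · simp
    · rw [Int.sign_eq_one_of_pos (by omega), Int.natAbs_natCast, Int.cast_one, one_mul, key]
  · rcases Nat.eq_zero_or_pos k with rfl | hk
    · simp
    · rw [Int.sign_eq_neg_one_of_neg (by omega), Int.natAbs_neg, Int.natAbs_natCast, Int.cast_neg,
        Int.cast_one, neg_one_mul, mul_neg, key, neg_neg, neg_sub]

theorem qInt_zero (q : Rˣ) : qInt q 0 = (0 : R) := by simp [qInt]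

theorem qInt_one (q : Rˣ) : qInt q 1 = (1 : R) := by simp [qInt]

theorem qInt_two (q : Rˣ) : qInt q 2 = (q : R) + ((q⁻¹ : Rˣ) : R) := by
  simp [qInt, Finset.sum_range_succ, add_comm, show Int.sign 2 = 1 from rfl]

theorem qInt_neg (q : Rˣ) (m : ℤ) : qInt q (-m) = -(qInt q m : R) := by
  simp [qInt, Int.sign_neg]

theorem qInt_inv {q : Rˣ} (hd : IsUnit ((q : R) - ((q⁻¹ : Rˣ) : R))) (m : ℤ) :
    qInt q⁻¹ m = (qInt q m : R) := by
  refine hd.mul_left_cancel ?_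
  rw [qInt_sub_mul]
  have h := qInt_sub_mul q⁻¹ m
  simp only [inv_inv, zpow_neg, inv_zpow] at h ⊢
  linear_combination -h

/-- The three-term identity of quantum integers. -/
theorem qInt_mul {q : Rˣ} (hd : IsUnit ((q : R) - ((q⁻¹ : Rˣ) : R))) (a b c : ℤ) :
    (qInt q a * qInt q (b + c) : R) = qInt q b * qInt q (a + c) + qInt q c * qInt q (a - b) := by
  refine (hd.mul hd).mul_left_cancel ?_
  have e : ∀ x y : R, ((q : R) - ((q⁻¹ : Rˣ) : R)) * ((q : R) - ((q⁻¹ : Rˣ) : R)) * (x * y) =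
    (((q : R) - ((q⁻¹ : Rˣ) : R)) * x) * (((q : R) - ((q⁻¹ : Rˣ) : R)) * y) := fun x y => by ring
  rw [mul_add, e, e, e]
  simp only [qInt_sub_mul]
  simp only [sub_mul, mul_sub, ← Units.val_mul, ← zpow_add]
  ring_nf

/-- Two consecutive quantum integers isolate a pure power of `q`. The coefficients in the expansion
of crossings and the value of a kink both come from this. -/
theorem qInt_add_one {q : Rˣ} (hd : IsUnit ((q : R) - ((q⁻¹ : Rˣ) : R))) (a : ℤ) :
    qInt q (a + 1) - ((q⁻¹ : Rˣ) : R) * qInt q a = ((q ^ a : Rˣ) : R) := by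
  refine hd.mul_left_cancel ?_
  have e : ((q : R) - ((q⁻¹ : Rˣ) : R)) * (qInt q (a + 1) - ((q⁻¹ : Rˣ) : R) * qInt q a) =
    ((q : R) - ((q⁻¹ : Rˣ) : R)) * qInt q (a + 1) -
      ((q⁻¹ : Rˣ) : R) * (((q : R) - ((q⁻¹ : Rˣ) : R)) * qInt q a) := by ring
  rw [e, qInt_sub_mul, qInt_sub_mul, mul_sub, sub_mul]
  simp only [← Units.val_mul, ← zpow_neg_one, ← zpow_one_add, ← zpow_add]
  ring_nf

theorem qInt_add_one' {q : Rˣ} (hd : IsUnit ((q : R) - ((q⁻¹ : Rˣ) : R))) (a : ℤ) :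
    qInt q (a + 1) - (q : R) * qInt q a = ((q ^ (-a) : Rˣ) : R) := by
  have h := qInt_add_one (q := q⁻¹) (by simpa using hd.neg) a
  rw [qInt_inv hd, qInt_inv hd, inv_inv, inv_zpow'] at h
  exact h

theorem qBinom_zero (q : Rˣ) (m : ℤ) : (qBinom q m 0 : R) = 1 := by
  simp [qBinom, qFactorial]

/-- The quantum integers `[1], …, [n]` and `q - q⁻¹` are units. -/
structure QuantumUnits (q : Rˣ) (n : ℕ) : Prop where
  sub_inv : IsUnit ((q : R) - ((q⁻¹ : Rˣ) : R))
  isUnit : ∀ k : ℕ, 1 ≤ k → k ≤ n → IsUnit (qInt q (k : ℤ) : R)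

namespace QuantumUnits

variable {q : Rˣ} {n : ℕ} (hq : QuantumUnits q n)
include hq

/-- The hypotheses are symmetric in `q` and `q⁻¹`; this is how the negative crossing is reduced to
the positive one. -/
theorem inv : QuantumUnits q⁻¹ n where
  sub_inv := by simpa using hq.sub_inv.neg
  isUnit k h1 hk := by rw [qInt_inv hq.sub_inv]; exact hq.isUnit k h1 hk

theorem isUnit_qFactorial {t : ℕ} (ht : t ≤ n) : IsUnit (qFactorial q t) := by
  unfold qFactorial
  rw [IsUnit.prod_iff]
  intro i hi
  have := hq.isUnit (i + 1) (by omega) (by rw [Finset.mem_range] at hi; omega)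
  exact_mod_cast this

/-- For `t ≤ n` the `Ring.inverse` in the binomial is a true inverse. The one-step, symmetry and
multinomial identities are proved by multiplying with factorials and cancelling them. -/
theorem qFactorial_mul_qBinom {t : ℕ} (ht : t ≤ n) (m : ℤ) :
    qFactorial q t * qBinom q m t = ∏ i ∈ Finset.range t, qInt q (m - i) := by
  rw [qBinom, mul_left_comm, Ring.mul_inverse_cancel _ (hq.isUnit_qFactorial ht), mul_one]

theorem qInt_mul_qBinom_succ {t : ℕ} (ht : t + 1 ≤ n) (m : ℤ) :
    (qInt q ((t : ℤ) + 1) * qBinom q m (t + 1) : R) =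
      qInt q (m - t) * qBinom q m t := by
  refine (hq.isUnit_qFactorial (t := t) (by omega)).mul_left_cancel ?_
  have h1 := hq.qFactorial_mul_qBinom ht m
  have h2 := hq.qFactorial_mul_qBinom (t := t) (by omega) m
  rw [Finset.prod_range_succ, ← h2, qFactorial, Finset.prod_range_succ] at h1
  change qFactorial q t * _ * _ = _ at h1
  linear_combination h1

theorem qInt_mul_qBinom_succ_succ {t : ℕ} (ht : t + 1 ≤ n) (m : ℤ) :
    (qInt q ((t : ℤ) + 1) * qBinom q (m + 1) (t + 1) : R) =
      qInt q (m + 1) * qBinom q m t := by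
  refine (hq.isUnit_qFactorial (t := t) (by omega)).mul_left_cancel ?_
  have h1 := hq.qFactorial_mul_qBinom ht (m + 1)
  have h2 := hq.qFactorial_mul_qBinom (t := t) (by omega) m
  have e : ∏ i ∈ Finset.range t, (qInt q (m + 1 - (i + 1 : ℕ)) : R) =
      ∏ i ∈ Finset.range t, qInt q (m - i) :=
    Finset.prod_congr rfl fun i _ => by congr 1; push_cast; ring
  rw [Finset.prod_range_succ', e, ← h2, qFactorial, Finset.prod_range_succ] at h1
  change qFactorial q t * _ * _ = _ at h1
  simp only [Nat.cast_zero, sub_zero] at h1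
  linear_combination h1

theorem qBinom_one (hn : 1 ≤ n) (m : ℤ) : (qBinom q m 1 : R) = qInt q m := by
  simpa [qInt_one, qBinom_zero] using hq.qInt_mul_qBinom_succ (t := 0) hn m

theorem qFactorial_mul_qFactorial_mul_qBinom {k l : ℕ} (hk : k ≤ n) :
    qFactorial q k * qFactorial q l * qBinom q ((k + l : ℕ) : ℤ) k = qFactorial q (k + l) := by
  rw [mul_right_comm, hq.qFactorial_mul_qBinom hk]
  unfold qFactorial
  rw [add_comm k l, Finset.prod_range_add, mul_comm, ← Finset.prod_range_reflect _ k]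
  congr 1
  refine Finset.prod_congr rfl fun i hi => ?_
  rw [Finset.mem_range] at hi
  congr 1
  omega

theorem qBinom_symm {k l : ℕ} (hk : k ≤ n) (hl : l ≤ n) :
    (qBinom q ((k + l : ℕ) : ℤ) k : R) = qBinom q ((k + l : ℕ) : ℤ) l := by
  refine ((hq.isUnit_qFactorial hk).mul (hq.isUnit_qFactorial hl)).mul_left_cancel ?_
  rw [hq.qFactorial_mul_qFactorial_mul_qBinom hk, mul_comm (qFactorial q k), add_comm k l,
    hq.qFactorial_mul_qFactorial_mul_qBinom hl]

theorem qBinom_self {k : ℕ} (hk : k ≤ n) : (qBinom q (k : ℤ) k : R) = 1 := by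
  simpa [qBinom_zero] using hq.qBinom_symm (l := 0) hk (by omega)

theorem qBinom_eq_zero {k l : ℕ} (hl : l ≤ n) (h : k < l) : (qBinom q (k : ℤ) l : R) = 0 := by
  refine (hq.isUnit_qFactorial hl).mul_left_cancel ?_
  rw [hq.qFactorial_mul_qBinom hl, mul_zero, Finset.prod_eq_zero (Finset.mem_range.2 h)]
  rw [sub_self, qInt_zero]

/-- Both sides are the quantum multinomial `[k+l+m]! / ([k]! [l]! [m]!)`. This is the scalar part of
coassociativity of splits. -/
theorem qBinom_split {k l m : ℕ} (h : k + l + m ≤ n) :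
    (qBinom q ((k + l + m : ℕ) : ℤ) (k + l) * qBinom q ((k + l : ℕ) : ℤ) k : R) =
      qBinom q ((k + l + m : ℕ) : ℤ) k * qBinom q ((l + m : ℕ) : ℤ) l := by
  refine (((hq.isUnit_qFactorial (t := k) (by omega)).mul
    (hq.isUnit_qFactorial (t := l) (by omega))).mul
    (hq.isUnit_qFactorial (t := m) (by omega))).mul_left_cancel ?_
  have h1 := hq.qFactorial_mul_qFactorial_mul_qBinom (k := k) (l := l) (by omega)
  have h2 := hq.qFactorial_mul_qFactorial_mul_qBinom (k := l) (l := m) (by omega)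
  have h3 := hq.qFactorial_mul_qFactorial_mul_qBinom (k := k) (l := l + m) (by omega)
  have h4 := hq.qFactorial_mul_qFactorial_mul_qBinom (k := k + l) (l := m) (by omega)
  rw [← add_assoc] at h3
  linear_combination (qFactorial q m * qBinom q ((k + l + m : ℕ) : ℤ) (k + l)) * h1 + h4 - h3 -
    (qFactorial q k * qBinom q ((k + l + m : ℕ) : ℤ) k) * h2

/-- The quantum Pascal identity. -/
theorem qBinom_pascal {b : ℕ} (hb : b + 1 ≤ n) (k : ℤ) :
    (qBinom q (k + 1) (b + 1) : R) = ((q ^ ((b : ℤ) + 1) : Rˣ) : R) * qBinom q k (b + 1) +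
      ((q ^ (b - k) : Rˣ) : R) * qBinom q k b := by
  have hu := hq.isUnit (b + 1) (by omega) hb
  push_cast at hu
  refine hu.mul_left_cancel ?_
  have h1 := hq.qInt_mul_qBinom_succ hb k
  have h2 := hq.qInt_mul_qBinom_succ_succ hb k
  -- Once `h1` and `h2` have expressed the other binomials by the one at `b`, Pascal's identity is
  -- this decomposition of `[k+1]`.
  have h3 : (qInt q (k + 1) : R) = ((q ^ ((b : ℤ) + 1) : Rˣ) : R) * qInt q (k - b) +
      ((q ^ (b - k) : Rˣ) : R) * qInt q ((b : ℤ) + 1) := by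
    refine hq.sub_inv.mul_left_cancel ?_
    rw [mul_add, mul_left_comm, qInt_sub_mul, qInt_sub_mul, mul_left_comm, qInt_sub_mul]
    simp only [mul_sub, ← Units.val_mul, ← zpow_add]
    ring_nf
  linear_combination h2 - ((q ^ ((b : ℤ) + 1) : Rˣ) : R) * h1 + qBinom q k b * h3

end QuantumUnits

end QuantumIntegers

/-! ### Antisymmetrizers in Hecke algebras. -/

noncomputable section HeckeAlgebra

variable {R : Type u} [CommRing R] {A : Type v} [Ring A] [Algebra R A]

/-- The relations of the Hecke algebra on `m` strands, for the generators `e i` that are `[2]` times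
the antisymmetrizers of two neighbouring strands. -/
structure HeckeRelations (q : Rˣ) (m : ℕ) (e : ℕ → A) : Prop where
  sq : ∀ i, i + 1 < m → e i * e i = (qInt q 2 : R) • e i
  comm : ∀ i j, i + 1 < j → j + 1 < m → e i * e j = e j * e i
  braid : ∀ i, i + 2 < m → e i * e (i + 1) * e i - e i = e (i + 1) * e i * e (i + 1) - e (i + 1)

/-- The antisymmetrizer of the `k` strands `i, …, i + k - 1`. -/
def antisym (q : Rˣ) (e : ℕ → A) (i : ℕ) : ℕ → A
  | 0 => 1
  | 1 => 1
  | k + 2 => Ring.inverse (qInt q ((k : ℤ) + 2) : R) •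
      ((qInt q ((k : ℤ) + 1) : R) • (antisym q e i (k + 1) * e (i + k) * antisym q e i (k + 1)) -
        (qInt q (k : ℤ) : R) • antisym q e i (k + 1))

theorem antisym_zero (q : Rˣ) (e : ℕ → A) (i : ℕ) : antisym q e i 0 = 1 := by rw [antisym]

theorem antisym_one (q : Rˣ) (e : ℕ → A) (i : ℕ) : antisym q e i 1 = 1 := by rw [antisym]

/-- The recursion uses only algebra operations, quantum integers and the generators `e (i + s)` with
`s + 1 < k`. So antisymmetrizers can be shifted along the strands, put into wider bundles and
carried through functors. -/
theorem map_antisym {B : Type w} [Ring B] [Algebra R B] (φ : A →ₐ[R] B) (q : Rˣ) (e : ℕ → A)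
    (f : ℕ → B) (i j : ℕ) (k : ℕ) (h : ∀ s, s + 1 < k → φ (e (i + s)) = f (j + s)) :
    φ (antisym q e i k) = antisym q f j k := by
  induction k with
  | zero => simp [antisym_zero]
  | succ k ih =>
    cases k with
    | zero => simp [antisym_one]
    | succ k =>
      rw [antisym, antisym, map_smul, map_sub, map_smul, map_smul, map_mul, map_mul,
        ih fun s hs => h s (by omega), h k (by omega)]

theorem antisym_congr (q : Rˣ) (e f : ℕ → A) (i j k : ℕ)
    (h : ∀ s, s + 1 < k → e (i + s) = f (j + s)) : antisym q e i k = antisym q f j k :=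
  map_antisym (AlgHom.id R A) q e f i j k h

/-- The recursion is a palindrome in the generators, so it is unchanged when products are reversed.
One-sided statements about antisymmetrizers thus yield their reflections. -/
theorem op_antisym (q : Rˣ) (e : ℕ → A) (i k : ℕ) :
    antisym q (fun j => MulOpposite.op (e j)) i k = MulOpposite.op (antisym q e i k) := by
  induction k with
  | zero => simp [antisym_zero]
  | succ k ih =>
    cases k with
    | zero => simp [antisym_one]
    | succ k => rw [antisym, ih, antisym]; simp [mul_assoc]

theorem antisym_inv {q : Rˣ} (hd : IsUnit ((q : R) - ((q⁻¹ : Rˣ) : R))) (e : ℕ → A) (i k : ℕ) :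
    antisym q⁻¹ e i k = antisym q e i k := by
  induction k with
  | zero => simp [antisym_zero]
  | succ k ih =>
    cases k with
    | zero => simp [antisym_one]
    | succ k => rw [antisym, ih, antisym]; simp only [qInt_inv hd]

/-- An element commuting with the generators commutes with the antisymmetrizer. -/
theorem commute_antisym (q : Rˣ) (e : ℕ → A) (i k : ℕ) (x : A)
    (h : ∀ j, i ≤ j → j + 1 < i + k → Commute x (e j)) : Commute x (antisym q e i k) := by
  induction k with
  | zero => rw [antisym_zero]; exact Commute.one_right x
  | succ k ih =>
    cases k with
    | zero => rw [antisym_one]; exact Commute.one_right x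
    | succ k =>
      have ih := ih fun j h1 h2 => h j h1 (by omega)
      rw [antisym]
      exact (((((ih.mul_right (h _ (by omega) (by omega))).mul_right ih).smul_right _).sub_right
        (ih.smul_right _))).smul_right _

theorem QuantumUnits.smul_antisym {q : Rˣ} {n : ℕ} (hq : QuantumUnits q n) (e : ℕ → A) (i : ℕ)
    {k : ℕ} (hk : k + 2 ≤ n) :
    (qInt q ((k : ℤ) + 2) : R) • antisym q e i (k + 2) =
      (qInt q ((k : ℤ) + 1) : R) • (antisym q e i (k + 1) * e (i + k) * antisym q e i (k + 1)) -
        (qInt q (k : ℤ) : R) • antisym q e i (k + 1) := by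
  have hu := hq.isUnit (k + 2) (by omega) hk
  push_cast at hu
  rw [antisym, smul_smul, Ring.mul_inverse_cancel _ hu, one_smul]

/-- An element that absorbs the generators absorbs the antisymmetrizer. -/
theorem QuantumUnits.mul_antisym {q : Rˣ} {n : ℕ} (hq : QuantumUnits q n) (e : ℕ → A) (i : ℕ)
    {k : ℕ} (hk : k ≤ n) (x : A)
    (h : ∀ j, i ≤ j → j + 1 < i + k → x * e j = (qInt q 2 : R) • x) :
    x * antisym q e i k = x := by
  induction k with
  | zero => rw [antisym_zero, mul_one]
  | succ k ih =>
    cases k with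
    | zero => rw [antisym_one, mul_one]
    | succ k =>
      have ih := ih (by omega) fun j h1 h2 => h j h1 (by omega)
      have hu := hq.isUnit (k + 2) (by omega) hk
      push_cast at hu
      refine hu.smul_left_cancel.1 ?_
      rw [← mul_smul_comm, hq.smul_antisym e i hk, mul_sub, mul_smul_comm, mul_smul_comm,
        ← mul_assoc, ← mul_assoc, ih, h _ (by omega) (by omega), smul_mul_assoc, ih, smul_smul,
        ← sub_smul]
      congr 1
      -- `[k+1] [2] - [k] = [k+2]`, so the recursion reproduces `x` exactly.
      have := qInt_mul hq.sub_inv ((k : ℤ) + 1) 1 1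
      rw [qInt_one] at this
      norm_num at this
      rw [this]
      ring_nf

theorem HeckeRelations.op {q : Rˣ} {m : ℕ} {e : ℕ → A} (he : HeckeRelations q m e) :
    HeckeRelations q m fun j => MulOpposite.op (e j) where
  sq i hi := by rw [← MulOpposite.op_mul, he.sq i hi, MulOpposite.op_smul]
  comm i j h1 h2 := by rw [← MulOpposite.op_mul, ← MulOpposite.op_mul, he.comm i j h1 h2]
  braid i hi := by
    have := he.braid i hi
    simp only [← MulOpposite.op_mul, ← MulOpposite.op_sub, ← mul_assoc, this]

/-- Numbering the strands from the right sends the generator of the strands `i` and `i + 1` to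
position `m - 2 - i`. -/
theorem HeckeRelations.mirror {q : Rˣ} {m : ℕ} {e : ℕ → A} (he : HeckeRelations q m e) :
    HeckeRelations q m fun j => e (m - 2 - j) where
  sq i hi := he.sq _ (by omega)
  comm i j h1 h2 := (he.comm _ _ (by omega) (by omega)).symm
  braid i hi := by
    have := he.braid (m - 2 - (i + 1)) (by omega)
    rw [show m - 2 - (i + 1) + 1 = m - 2 - i by omega] at this
    exact this.symm

theorem HeckeRelations.mono {q : Rˣ} {m m' : ℕ} {e : ℕ → A} (he : HeckeRelations q m e)
    (h : m' ≤ m) : HeckeRelations q m' e where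
  sq i hi := he.sq _ (by omega)
  comm i j h1 h2 := he.comm _ _ (by omega) (by omega)
  braid i hi := he.braid _ (by omega)

theorem HeckeRelations.inv {q : Rˣ} (hd : IsUnit ((q : R) - ((q⁻¹ : Rˣ) : R))) {m : ℕ} {e : ℕ → A}
    (he : HeckeRelations q m e) : HeckeRelations q⁻¹ m e where
  sq i hi := by rw [qInt_inv hd, he.sq i hi]
  comm := he.comm
  braid := he.braid

/-- A Hecke algebra on `m` strands in which the first `n` quantum integers are invertible. -/
structure HeckeData (q : Rˣ) (n m : ℕ) (e : ℕ → A) : Prop where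
  units : QuantumUnits q n
  rels : HeckeRelations q m e

namespace HeckeData

variable {q : Rˣ} {n m : ℕ} {e : ℕ → A} (H : HeckeData q n m e)
include H

theorem op : HeckeData q n m fun j => MulOpposite.op (e j) := ⟨H.units, H.rels.op⟩

theorem mirror : HeckeData q n m fun j => e (m - 2 - j) := ⟨H.units, H.rels.mirror⟩

theorem inv : HeckeData q⁻¹ n m e := ⟨H.units.inv, H.rels.inv H.units.sub_inv⟩

theorem mono {m' : ℕ} (h : m' ≤ m) : HeckeData q n m' e := ⟨H.units, H.rels.mono h⟩

theorem smul_cancel {k : ℕ} (h1 : 1 ≤ k) (hk : k ≤ n) {x y : A}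
    (h : (qInt q (k : ℤ) : R) • x = (qInt q (k : ℤ) : R) • y) : x = y :=
  (H.units.isUnit k h1 hk).smul_left_cancel.1 h

theorem commute_e {i j k : ℕ} (hj : j + 1 < m) (hik : i + k ≤ m) (h : j + 1 < i ∨ i + k ≤ j) :
    Commute (e j) (antisym q e i k) :=
  commute_antisym q e i k _ fun s h1 h2 => by
    rcases h with h | h
    · exact H.rels.comm _ _ (by omega) (by omega)
    · exact (H.rels.comm _ _ (by omega) (by omega)).symm

theorem commute {i k i' k' : ℕ} (h : i + k ≤ i') (h' : i' + k' ≤ m) :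
    Commute (antisym q e i k) (antisym q e i' k') :=
  commute_antisym q e i' k' _ fun s h1 h2 =>
    (H.commute_e (by omega) (by omega) (by omega)).symm

/-- For all generators but the last, the recursion ends in a smaller antisymmetrizer that absorbs
them by induction. The last generator is new to the recursion and needs the braid relation. -/
theorem antisym_mul_e {i k : ℕ} (hk : k ≤ n) (hik : i + k ≤ m) {j : ℕ} (h1 : i ≤ j)
    (h2 : j + 1 < i + k) : antisym q e i k * e j = (qInt q 2 : R) • antisym q e i k := by
  induction k generalizing j with
  | zero => omega
  | succ k ih =>
    rcases k with _ | k
    · omega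
    have ih := @ih (by omega) (by omega)
    have hu := H.units.isUnit (k + 2) (by omega) hk
    push_cast at hu
    refine hu.smul_left_cancel.1 ?_
    rw [smul_comm _ (qInt q 2 : R), ← smul_mul_assoc, H.units.smul_antisym e i hk]
    rcases Nat.lt_or_ge j (i + k) with hj | hj
    · rw [sub_mul, smul_mul_assoc, smul_mul_assoc, mul_assoc, ih h1 (by omega)]
      simp only [mul_smul_comm, smul_sub, smul_comm (qInt q 2 : R)]
    obtain rfl : j = i + k := by omega
    rcases k with _ | k
    · simp [antisym_one, qInt_zero, qInt_one, H.rels.sq i (by omega)]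
    -- It remains to show that `[k+2] x g x - [k+1] x`, a multiple of the next antisymmetrizer,
    -- absorbs `g`. Expanding the right factor `x` by its own recursion turns `x g x` into `x g f y`
    -- and `x g`.
    set x := antisym q e i (k + 1 + 1)
    set y := antisym q e i (k + 1)
    set g := e (i + (k + 1))
    set f := e (i + k)
    have hx : (qInt q ((k : ℤ) + 2) : R) • x = (qInt q ((k : ℤ) + 1) : R) • (y * f * y) -
        (qInt q (k : ℤ) : R) • y := H.units.smul_antisym e i (by omega)
    have hxf : x * f = (qInt q 2 : R) • x := ih (by omega) (by omega)
    have hxy : x * y = x := H.units.mul_antisym e i (by omega) x fun s h1 h2 => ih h1 (by omega)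
    have hyg : y * g = g * y := (H.commute_e (by omega) (by omega) (by omega)).symm
    have hgg : g * g = (qInt q 2 : R) • g := H.rels.sq _ (by omega)
    have hbr : f * g * f - f = g * f * g - g := H.rels.braid (i + k) (by omega)
    have hxgy : x * g * y = x * g := by rw [mul_assoc, ← hyg, ← mul_assoc, hxy]
    have e1 : (qInt q ((k : ℤ) + 2) : R) • (x * g * x) =
        (qInt q ((k : ℤ) + 1) : R) • (x * g * f * y) - (qInt q (k : ℤ) : R) • (x * g) := by
      rw [← mul_smul_comm, hx, mul_sub, mul_smul_comm, mul_smul_comm, hxgy, ← mul_assoc,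
        ← mul_assoc, hxgy]
    -- As `y` commutes with `g`, the braid relation replaces `g f g` by `f g f - f + g`; then `x`
    -- absorbs `f` and `y`.
    have e2 : x * g * f * y * g = (qInt q 2 : R) • (x * g * f * y) - (qInt q 2 : R) • x + x * g :=
        by
      have : x * (g * f * g) * y = x * (f * g * f - f + g) * y := by rw [hbr]; abel_nf
      rw [mul_assoc, hyg, ← mul_assoc, mul_assoc (x * g), mul_assoc x, ← mul_assoc g, this, mul_add,
        mul_sub, add_mul, sub_mul, ← mul_assoc, ← mul_assoc, hxf, hxgy]
      simp only [smul_mul_assoc, hxy]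
    have e3 := congrArg (· * g) e1
    simp only [sub_mul, smul_mul_assoc, e2] at e3
    rw [mul_assoc x g g, hgg, mul_smul_comm] at e3
    rw [sub_mul, smul_mul_assoc, smul_mul_assoc]
    push_cast
    rw [show (k : ℤ) + 1 + 1 = k + 2 by ring]
    linear_combination (norm := module) e3 - (qInt q 2 : R) • e1

theorem e_mul_antisym {i k : ℕ} (hk : k ≤ n) (hik : i + k ≤ m) {j : ℕ} (h1 : i ≤ j)
    (h2 : j + 1 < i + k) : e j * antisym q e i k = (qInt q 2 : R) • antisym q e i k := by
  have := H.op.antisym_mul_e hk hik h1 h2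
  rw [op_antisym] at this
  exact MulOpposite.op_injective this

theorem antisym_mul_antisym {i k i' k' : ℕ} (hk : k ≤ n) (hik : i + k ≤ m) (h : i ≤ i')
    (h' : i' + k' ≤ i + k) : antisym q e i k * antisym q e i' k' = antisym q e i k :=
  H.units.mul_antisym e i' (by omega) _ fun j h1 h2 => H.antisym_mul_e hk hik (by omega) (by omega)

theorem antisym_mul_antisym' {i k i' k' : ℕ} (hk : k ≤ n) (hik : i + k ≤ m) (h : i ≤ i')
    (h' : i' + k' ≤ i + k) : antisym q e i' k' * antisym q e i k = antisym q e i k := by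
  have := H.op.antisym_mul_antisym hk hik h h'
  rw [op_antisym, op_antisym] at this
  exact MulOpposite.op_injective this

/-- The antisymmetrizers of the mirrored Hecke algebra. -/
theorem antisym_mirror {i k : ℕ} (hk : k ≤ n) (hik : i + k ≤ m) :
    antisym q (fun j => e (m - 2 - j)) (m - i - k) k = antisym q e i k := by
  rcases Nat.eq_zero_or_pos k with rfl | hk0
  · simp [antisym_zero]
  -- The product of the two antisymmetrizers equals the left factor because that absorbs generators
  -- from the right, and equals the right factor because that absorbs them from the left.
  have h1 : antisym q (fun j => e (m - 2 - j)) (m - i - k) k * antisym q e i k =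
      antisym q (fun j => e (m - 2 - j)) (m - i - k) k :=
    H.units.mul_antisym e i hk _ fun j h1 h2 => by
      have := H.mirror.antisym_mul_e (i := m - i - k) (j := m - 2 - j) hk (by omega) (by omega)
        (by omega)
      rwa [show m - 2 - (m - 2 - j) = j by omega] at this
  have h2 := H.mirror.op.units.mul_antisym (fun j => MulOpposite.op (e (m - 2 - j))) (m - i - k) hk
    (MulOpposite.op (antisym q e i k)) fun j h1 h2 => by
      rw [← MulOpposite.op_mul, H.e_mul_antisym hk hik (by omega) (by omega), MulOpposite.op_smul]
  rw [op_antisym q fun j => e (m - 2 - j), ← MulOpposite.op_mul] at h2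
  rw [← h1, MulOpposite.op_injective h2]

/-- The recursion for the antisymmetrizer that adds a strand on the left. -/
theorem smul_antisym_left {i k : ℕ} (hk : k + 2 ≤ n) (hik : i + k + 2 ≤ m) :
    (qInt q ((k : ℤ) + 2) : R) • antisym q e i (k + 2) =
      (qInt q ((k : ℤ) + 1) : R) • (antisym q e (i + 1) (k + 1) * e i * antisym q e (i + 1) (k +
        1)) -
        (qInt q (k : ℤ) : R) • antisym q e (i + 1) (k + 1) := by
  have := H.units.smul_antisym (fun j => e (m - 2 - j)) (m - i - (k + 2)) hk
  rw [H.antisym_mirror hk (by omega)] at this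
  have h2 := H.antisym_mirror (i := i + 1) (k := k + 1) (by omega) (by omega)
  rw [show m - (i + 1) - (k + 1) = m - i - (k + 2) by omega] at h2
  rwa [h2, show m - 2 - (m - i - (k + 2) + k) = i by omega] at this

end HeckeData

end HeckeAlgebra

/-! ### The box relation for abstract ladders. -/

noncomputable section Ladders

variable {R : Type u} [CommRing R] {A : Type v} [Ring A] [Algebra R A]

/-- Idempotents `P j`, `lo ≤ j ≤ hi`, for ladders with uprights `j` and `M - j`. -/
structure LadderData (q : Rˣ) (n M lo hi : ℕ) (P : ℕ → A) : Prop where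
  units : QuantumUnits q n
  idem : ∀ a, lo ≤ a → a ≤ hi → P a * P a = P a
  up : ∀ a b c, lo ≤ a → a ≤ b → b ≤ c → c ≤ hi → P a * P b * P c = P a * P c
  down : ∀ a b c, lo ≤ c → c ≤ b → b ≤ a → a ≤ hi → P a * P b * P c = P a * P c
  box : ∀ j, lo ≤ j → j + 2 ≤ hi →
    (qInt q ((j : ℤ) + 1) * qInt q ((M : ℤ) - j) : R) • (P (j + 1) * P j * P (j + 1)) =
      (qInt q ((M : ℤ) - j - 1) * qInt q ((j : ℤ) + 2) : R) • (P (j + 1) * P (j + 2) * P (j + 1)) +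
        (qInt q (2 * (j + 1) - (M : ℤ)) : R) • P (j + 1)

namespace LadderData

variable {q : Rˣ} {n M lo hi : ℕ} {P : ℕ → A} (D : LadderData q n M lo hi P)
include D

/-- Turning ladders upside down exchanges `up` and `down`; the box relation is a palindrome. -/
theorem op : LadderData q n M lo hi fun j => MulOpposite.op (P j) where
  units := D.units
  idem a h1 h2 := by rw [← MulOpposite.op_mul, D.idem a h1 h2]
  up a b c h1 h2 h3 h4 := by
    simp only [← MulOpposite.op_mul, ← mul_assoc]
    rw [D.down c b a h1 h2 h3 h4]
  down a b c h1 h2 h3 h4 := by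
    simp only [← MulOpposite.op_mul, ← mul_assoc]
    rw [D.up c b a h1 h2 h3 h4]
  box j h1 h2 := by
    have := D.box j h1 h2
    simp only [← MulOpposite.op_mul, ← MulOpposite.op_smul, ← MulOpposite.op_add, ← mul_assoc, this]

/-- Exchanging the uprights swaps the two triple products in the box relation and changes the sign
of the quantum integer in its last term, so the relation keeps its form. The mirrored box relation
of webs comes from here. -/
theorem mirror (hhi : hi ≤ M) (hlo : lo ≤ M) : LadderData q n M (M - hi) (M - lo) fun j => P (M -
    j) where
  units := D.units
  idem a h1 h2 := D.idem _ (by omega) (by omega)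
  up a b c h1 h2 h3 h4 := D.down _ _ _ (by omega) (by omega) (by omega) (by omega)
  down a b c h1 h2 h3 h4 := D.up _ _ _ (by omega) (by omega) (by omega) (by omega)
  box j h1 h2 := by
    have := D.box (M - (j + 2)) (by omega) (by omega)
    rw [show M - (j + 2) + 1 = M - (j + 1) by omega, show M - (j + 2) + 2 = M - j by omega] at this
    rw [show ((M - (j + 2) : ℕ) : ℤ) = (M : ℤ) - j - 2 by omega] at this
    rw [show (M : ℤ) - j - 2 + 1 = M - j - 1 by ring, show (M : ℤ) - (M - j - 2) = j + 2 by ring,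
      show (M : ℤ) - j - 2 + 2 = M - j by ring, show (j : ℤ) + 2 - 1 = j + 1 by ring,
      show (2 * ((M : ℤ) - j - 1) - M) = -(2 * (j + 1) - M) by ring, qInt_neg] at this
    rw [this]
    module

/-- The relation between a ladder that goes down to `j` and back to `j + 1` and one that goes up
first. -/
theorem three_term {k j : ℕ} (h1 : lo ≤ j) (h2 : j < k) (h3 : k + 1 ≤ hi) :
    (qInt q ((j : ℤ) + 1) * qInt q ((M : ℤ) - j) : R) • (P k * P j * P (j + 1)) =
      (qInt q ((M : ℤ) - k) * qInt q ((k : ℤ) + 1) : R) • (P k * P (k + 1) * P (j + 1)) +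
        (qInt q ((k : ℤ) - j) * qInt q ((j : ℤ) + k + 1 - M) : R) • (P k * P (j + 1)) := by
  -- Induction on the distance between `k` and `j + 1`; at distance zero this is the box relation of
  -- single rungs.
  obtain ⟨d, rfl⟩ : ∃ d, k = j + d + 1 := ⟨k - j - 1, by omega⟩
  induction d generalizing j with
  | zero =>
    rw [add_zero, D.idem (j + 1) (by omega) (by omega), D.box j h1 (by omega)]
    push_cast
    rw [show (j : ℤ) + 1 - j = 1 by ring, qInt_one, one_mul,
      show (j : ℤ) + (j + 1) + 1 - M = 2 * (j + 1) - M by ring,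
      show (M : ℤ) - (j + 1) = M - j - 1 by ring, show (j : ℤ) + 1 + 1 = j + 2 by ring]
  | succ d ih =>
    set k := j + (d + 1) + 1 with hk
    have ih := @ih (j + 1) (by omega) (by omega) (by omega)
    rw [show j + 1 + d + 1 = k by omega] at ih
    have ih := congrArg (· * P (j + 1)) ih
    simp only [add_mul, smul_mul_assoc] at ih
    rw [D.down k (j + 1 + 1) (j + 1) (by omega) (by omega) (by omega) (by omega),
      mul_assoc (P k) (P (k + 1)), mul_assoc (P k) (P (k + 1) * _),
      D.down (k + 1) (j + 1 + 1) (j + 1) (by omega) (by omega) (by omega) (by omega),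
      ← mul_assoc] at ih
    have hb := congrArg (P k * ·) (D.box j h1 (by omega))
    simp only [mul_add, mul_smul_comm, ← mul_assoc] at hb
    rw [D.down k (j + 1) j (by omega) (by omega) (by omega) (by omega)] at hb
    push_cast at ih
    rw [show (M : ℤ) - (j + 1) = M - j - 1 by ring, show (j : ℤ) + 1 + 1 = j + 2 by ring,
      mul_comm (qInt q ((j : ℤ) + 2)), mul_assoc] at ih
    rw [← mul_assoc] at ih
    rw [hb, ih, add_assoc, ← add_smul]
    congr 2
    have e1 : (k : ℤ) = j + d + 2 := by omega
    have := qInt_mul D.units.sub_inv ((d : ℤ) + 2) 1 (2 * j + 2 + d + 1 - M)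
    rw [qInt_one, one_mul] at this
    rw [e1, show (j : ℤ) + d + 2 - j = d + 2 by ring,
      show (j : ℤ) + (j + d + 2) + 1 - M = 1 + (2 * j + 2 + d + 1 - M) - 1 by ring,
      show (j : ℤ) + d + 2 - (j + 1) = d + 1 by ring]
    -- The two multiples of `P k * P (j + 1)`, one from the induction hypothesis and one from the
    -- box relation, add up by the three-term identity.
    have t2 := qInt_mul D.units.sub_inv ((d : ℤ) + 2) ((d : ℤ) + 1) (2 * j + 2 - M)
    rw [show (d : ℤ) + 2 - (d + 1) = 1 by ring, qInt_one, mul_one] at t2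
    rw [show 1 + (2 * (j : ℤ) + 2 + d + 1 - M) - 1 = d + 1 + (2 * j + 2 - M) by ring, t2]
    rw [show (j : ℤ) + 1 + (j + d + 2) + 1 - M = d + 2 + (2 * j + 2 - M) by ring,
      show 2 * (j : ℤ) + 2 * 1 - M = 2 * j + 2 - M by ring]

end LadderData

/-- The rung `E ^ (r)` on a ladder with uprights `j` and `M - j`. -/
def ladderE (q : Rˣ) (M : ℕ) (P : ℕ → A) (j r : ℕ) : A :=
  (qBinom q ((M : ℤ) - j) r : R) • (P j * P (j + r))

/-- The rung `F ^ (s)` on a ladder with uprights `j + s` and `M - j - s`. -/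
def ladderF (q : Rˣ) (P : ℕ → A) (j s : ℕ) : A :=
  (qBinom q ((j : ℤ) + s) s : R) • (P (j + s) * P j)

namespace LadderData

variable {q : Rˣ} {n M lo hi : ℕ} {P : ℕ → A} (D : LadderData q n M lo hi P)
include D

/-- The law of divided powers: the middle idempotent disappears by monotonicity, and the two
binomials combine. -/
theorem ladderE_mul {j r : ℕ} (hj : lo ≤ j) (h : j + r + 1 ≤ hi) (hr : r + 1 ≤ n) :
    ladderE q M P j r * ladderE q M P (j + r) 1 =
      (qInt q ((r : ℤ) + 1) : R) • ladderE q M P j (r + 1) := by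
  unfold ladderE
  rw [smul_mul_smul_comm, smul_smul, D.units.qInt_mul_qBinom_succ hr, D.units.qBinom_one (by omega),
    mul_comm (qBinom _ _ _)]
  rw [← mul_assoc, mul_assoc (P j), D.idem (j + r) (by omega) (by omega),
    D.up _ _ _ hj (by omega) (by omega) (by omega)]
  push_cast
  rw [show (M : ℤ) - (j + r) = M - j - r by ring, add_assoc j]

theorem ladderF_zero {j : ℕ} (h1 : lo ≤ j) (h2 : j ≤ hi) : ladderF q P j 0 = P j := by
  rw [ladderF, qBinom_zero, one_smul, add_zero, D.idem j h1 h2]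

theorem ladderE_zero {j : ℕ} (h1 : lo ≤ j) (h2 : j ≤ hi) : ladderE q M P j 0 = P j := by
  rw [ladderE, qBinom_zero, one_smul, add_zero, D.idem j h1 h2]

/-- Moving one rung `E` through a rung `F ^ (s + 1)`. -/
theorem ladderF_mul_ladderE_one {j s : ℕ} (hj : lo ≤ j) (h : j + s + 2 ≤ hi) (hs : s + 1 ≤ n) :
    ladderF q P j (s + 1) * ladderE q M P j 1 =
      ladderE q M P (j + s + 1) 1 * ladderF q P (j + 1) (s + 1) +
        (qInt q (2 * (j : ℤ) + s + 2 - M) : R) • ladderF q P (j + 1) s := by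
  have hu := D.units.isUnit (s + 1) (by omega) hs
  push_cast at hu
  refine hu.smul_left_cancel.1 ?_
  -- After multiplication by `[s+1]`, all binomials in `F` are multiples of the one with upper entry
  -- `j + s + 1` and lower entry `s`. The claim is `three_term` scaled by it.
  have T := congrArg ((qBinom q ((j : ℤ) + s + 1) s : R) • ·)
    (D.three_term (k := j + s + 1) hj (by omega) (by omega))
  have b1 := D.units.qInt_mul_qBinom_succ hs ((j : ℤ) + s + 1)
  have b2 := D.units.qInt_mul_qBinom_succ_succ hs ((j : ℤ) + s + 1)
  rw [show (j : ℤ) + s + 1 - s = j + 1 by ring] at b1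
  unfold ladderF ladderE
  simp only [smul_add, smul_mul_smul_comm, smul_smul] at T ⊢
  rw [D.units.qBinom_one (by omega), D.units.qBinom_one (by omega)]
  rw [← mul_assoc (P _ * P _), mul_assoc (P _), D.idem j (by omega) (by omega),
    show j + s + 1 + 1 = j + 1 + (s + 1) by ring, ← mul_assoc (P _ * P _),
    mul_assoc (P _) (P (j + 1 + (s + 1))), D.idem (j + 1 + (s + 1)) (by omega) (by omega),
    show j + (s + 1) = j + s + 1 by ring, show j + 1 + s = j + s + 1 by ring]
  push_cast at T ⊢
  rw [show j + s + 1 + 1 = j + 1 + (s + 1) by ring] at T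
  rw [show (j : ℤ) + (s + 1) = j + s + 1 by ring, show (j : ℤ) + 1 + s = j + s + 1 by ring,
    ← mul_assoc, b1]
  rw [show (j : ℤ) + 1 + (s + 1) = j + s + 1 + 1 by ring, mul_left_comm, b2]
  rw [show (j : ℤ) + s + 1 - j = s + 1 by ring,
    show (j : ℤ) + (j + s + 1) + 1 - M = 2 * j + s + 2 - M by ring] at T
  linear_combination (norm := module) T

/-- The terms of the box relation. -/
def _root_.ladderTerm (q : Rˣ) (M : ℕ) (P : ℕ → A) (j r s t : ℕ) : A :=
  if t ≤ r ∧ t ≤ s then ladderE q M P (j + s) (r - t) * ladderF q P (j + r) (s - t) else 0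

/-- A further rung `E` moves through `F^(s-t)`: it either joins the other rungs `E`, which keeps
`t`, or cancels against one `F`, which raises `t`. Terms out of range are zero by convention and
`[r+1-t]` vanishes at `t = r + 1`, so the boundary cases obey the same formula. -/
theorem ladderTerm_mul {j r s t : ℕ} (hj : lo ≤ j) (h : j + r + s + 1 ≤ hi) (hr : r + 1 ≤ n)
    (hs : s ≤ n) (ht : t ≤ s) :
    ladderTerm q M P j r s t * ladderE q M P (j + r) 1 =
      (qInt q ((r : ℤ) + 1 - t) : R) • ladderTerm q M P j (r + 1) s t +
        (qInt q (2 * (j : ℤ) + 2 * r + s - t + 1 - M) : R) • ladderTerm q M P j (r + 1) s (t +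
          1) := by
  unfold ladderTerm
  rcases Nat.lt_or_ge r t with hrt | hrt
  · rw [if_neg (by omega), zero_mul, if_neg (by omega : ¬(t + 1 ≤ r + 1 ∧ _)), smul_zero, add_zero]
    rcases Nat.lt_or_ge (r + 1) t with h' | h'
    · rw [if_neg (by omega), smul_zero]
    · obtain rfl : t = r + 1 := by omega
      rw [show (r : ℤ) + 1 - (r + 1 : ℕ) = 0 by push_cast; ring, qInt_zero, zero_smul]
  have hE : ladderE q M P (j + s) (r - t) * ladderE q M P (j + s + (r - t)) 1 =
      (qInt q ((r : ℤ) + 1 - t) : R) • ladderE q M P (j + s) (r + 1 - t) := by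
    rw [D.ladderE_mul (by omega) (by omega) (by omega), show r - t + 1 = r + 1 - t by omega,
      show ((r - t : ℕ) : ℤ) + 1 = r + 1 - t by omega]
  rw [if_pos ⟨hrt, ht⟩, if_pos ⟨by omega, ht⟩]
  rcases Nat.lt_or_ge t s with hts | hts
  · rw [if_pos ⟨by omega, hts⟩]
    obtain ⟨u, rfl⟩ : ∃ u, s = t + u + 1 := ⟨s - t - 1, by omega⟩
    rw [show t + u + 1 - t = u + 1 by omega, mul_assoc,
      D.ladderF_mul_ladderE_one (by omega) (by omega) (by omega), mul_add, ← mul_assoc,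
      show j + r + u + 1 = j + (t + u + 1) + (r - t) by omega, hE, smul_mul_assoc, mul_smul_comm,
      show t + u + 1 - (t + 1) = u by omega, show r + 1 - (t + 1) = r - t by omega]
    rw [show j + (r + 1) = j + r + 1 by ring]
    congr 3
    push_cast
    ring
  · obtain rfl : t = s := by omega
    rw [if_neg (by omega : ¬(_ ∧ t + 1 ≤ t)), smul_zero, add_zero, Nat.sub_self,
      D.ladderF_zero (by omega) (by omega), D.ladderF_zero (by omega) (by omega), ← smul_mul_assoc,
      ← hE, show j + t + (r - t) = j + r by omega, mul_assoc, mul_assoc]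
    congr 1
    unfold ladderE
    rw [mul_smul_comm, smul_mul_assoc, ← mul_assoc, D.idem _ (by omega) (by omega), mul_assoc,
      show j + (r + 1) = j + r + 1 by ring, D.idem (j + r + 1) (by omega) (by omega)]

/-- The box relation. -/
theorem ladderF_mul_ladderE {j r s : ℕ} (hj : lo ≤ j) (h : j + r + s ≤ hi) (hr : r ≤ n)
    (hs : s ≤ n) :
    ladderF q P j s * ladderE q M P j r =
      ∑ t ∈ Finset.range (s + 1), (qBinom q (2 * (j : ℤ) + s + r - M) t : R) •
        ladderTerm q M P j r s t := by
  induction r with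
  | zero =>
    rw [Finset.sum_eq_single_of_mem 0 (by simp) fun t _ ht => by
      rw [ladderTerm, if_neg (by omega), smul_zero]]
    rw [qBinom_zero, one_smul, ladderTerm, if_pos (by simp), Nat.sub_zero, Nat.sub_zero, add_zero,
      D.ladderE_zero hj (by omega), D.ladderE_zero (by omega) (by omega)]
    unfold ladderF
    rw [smul_mul_assoc, mul_assoc, D.idem _ hj (by omega), mul_smul_comm, ← mul_assoc,
      D.idem _ (by omega) (by omega)]
  | succ r ih =>
    have ih := ih (by omega) (by omega)
    have hu := D.units.isUnit (r + 1) (by omega) hr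
    push_cast at hu
    refine hu.smul_left_cancel.1 ?_
    -- By the law of divided powers, one more rung `E` on the formula for `r` gives `[r+1]` times
    -- the formula for `r + 1`.
    rw [← mul_smul_comm, ← D.ladderE_mul hj (by omega) hr, ← mul_assoc, ih, Finset.sum_mul]
    have e : ∀ t ∈ Finset.range (s + 1), (qBinom q (2 * (j : ℤ) + s + r - M) t : R) •
        ladderTerm q M P j r s t * ladderE q M P (j + r) 1 =
        (qBinom q (2 * (j : ℤ) + s + r - M) t * qInt q ((r : ℤ) + 1 - t) : R) •
          ladderTerm q M P j (r + 1) s t +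
        (qBinom q (2 * (j : ℤ) + s + r - M) t * qInt q (2 * (j : ℤ) + 2 * r + s - t + 1 - M) : R) •
          ladderTerm q M P j (r + 1) s (t + 1) := by
      intro t ht
      rw [Finset.mem_range] at ht
      rw [smul_mul_assoc, D.ladderTerm_mul hj (by omega) hr hs (by omega), smul_add, smul_smul,
        smul_smul]
    -- The contributions with `t` and with `t + 1` are collected by a shift of the index; the top
    -- term of the shifted sum is out of range and hence zero.
    rw [Finset.sum_congr rfl e, Finset.sum_add_distrib, Finset.sum_range_succ',
      Finset.sum_range_succ
      (fun t => _ • ladderTerm q M P j (r + 1) s (t + 1)), Finset.smul_sum, Finset.sum_range_succ']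
    rw [show ladderTerm q M P j (r + 1) s (s + 1) = 0 from if_neg (by omega), smul_zero, add_zero,
      add_right_comm, ← Finset.sum_add_distrib, qBinom_zero, qBinom_zero, one_mul, one_smul]
    congr 1
    · refine Finset.sum_congr rfl fun t ht => ?_
      rw [Finset.mem_range] at ht
      rw [← add_smul, smul_smul]
      congr 1
      have hu := D.units.isUnit (t + 1) (by omega) (by omega)
      push_cast at hu ⊢
      refine hu.mul_left_cancel ?_
      set m : ℤ := 2 * (j : ℤ) + s + r - M with hm
      have b1 := D.units.qInt_mul_qBinom_succ (t := t) (by omega) m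
      have b2 := D.units.qInt_mul_qBinom_succ_succ (t := t) (by omega) m
      rw [show 2 * (j : ℤ) + s + (r + 1) - M = m + 1 by rw [hm]; ring,
        show 2 * (j : ℤ) + 2 * r + s - t + 1 - M = m + r - t + 1 by rw [hm]; ring,
        show (r : ℤ) + 1 - (t + 1) = r - t by ring]
      -- Comparing coefficients of the term `t + 1` amounts to `[t+1] [m+r-t+1] = [r+1] [m+1] -
      -- [m-t] [r-t]`.
      have i1 := qInt_mul D.units.sub_inv ((t : ℤ) + 1) ((r : ℤ) + 1) (m - t)
      rw [show (t : ℤ) + 1 - (r + 1) = -(r - t) by ring, qInt_neg,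
        show (r : ℤ) + 1 + (m - t) = m + r - t + 1 by ring,
        show (t : ℤ) + 1 + (m - t) = m + 1 by ring] at i1
      linear_combination qInt q ((r : ℤ) - t) * b1 + qBinom q m t * i1 - qInt q ((r : ℤ) + 1) * b2

end LadderData

end Ladders

/-! ### Pairs of antisymmetrizers form ladders. -/

noncomputable section Projections

variable {R : Type u} [CommRing R] {A : Type v} [Ring A] [Algebra R A]

/-- The product of the antisymmetrizers of the first `j` and of the last `m - j` strands. -/
def antisymPair (q : Rˣ) (e : ℕ → A) (m j : ℕ) : A := antisym q e 0 j * antisym q e j (m - j)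

theorem antisymPair_zero (q : Rˣ) (e : ℕ → A) (m : ℕ) : antisymPair q e m 0 = antisym q e 0 m := by
  rw [antisymPair, antisym_zero, one_mul, Nat.sub_zero]

theorem antisymPair_self (q : Rˣ) (e : ℕ → A) (m : ℕ) : antisymPair q e m m = antisym q e 0 m := by
  rw [antisymPair, Nat.sub_self, antisym_zero, mul_one]

namespace HeckeData

variable {q : Rˣ} {n m : ℕ} {e : ℕ → A} (H : HeckeData q n m e)
include H

theorem shift {x m' : ℕ} (h : x + m' ≤ m) : HeckeData q n m' fun j => e (x + j) where
  units := H.units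
  rels :=
    { sq := fun i hi => H.rels.sq _ (by omega)
      comm := fun i j h1 h2 => H.rels.comm _ _ (by omega) (by omega)
      braid := fun i hi => H.rels.braid (x + i) (by omega) }

theorem antisym_idem {i k : ℕ} (hk : k ≤ n) (hik : i + k ≤ m) :
    antisym q e i k * antisym q e i k = antisym q e i k :=
  H.antisym_mul_antisym hk hik le_rfl le_rfl

theorem antisymPair_comm {j : ℕ} (hj : j ≤ m) :
    antisymPair q e m j = antisym q e j (m - j) * antisym q e 0 j :=
  (H.commute (by omega) (by omega)).eq

theorem antisymPair_mul_left {j i k : ℕ} (hjn : j ≤ n) (hj : j ≤ m) (h : i + k ≤ j) :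
    antisymPair q e m j * antisym q e i k = antisymPair q e m j := by
  rw [H.antisymPair_comm hj, mul_assoc, H.antisym_mul_antisym hjn (by omega) (by omega) (by omega)]

theorem antisymPair_mul_right {j i k : ℕ} (hjn : m - j ≤ n) (hj : j ≤ m) (h : j ≤ i)
    (h' : i + k ≤ m) : antisymPair q e m j * antisym q e i k = antisymPair q e m j := by
  rw [antisymPair, mul_assoc, H.antisym_mul_antisym hjn (by omega) (by omega) (by omega)]

theorem left_mul_antisymPair {j i k : ℕ} (hjn : j ≤ n) (hj : j ≤ m) (h : i + k ≤ j) :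
    antisym q e i k * antisymPair q e m j = antisymPair q e m j := by
  rw [antisymPair, ← mul_assoc, H.antisym_mul_antisym' hjn (by omega) (by omega) (by omega)]

theorem right_mul_antisymPair {j i k : ℕ} (hjn : m - j ≤ n) (hj : j ≤ m) (h : j ≤ i)
    (h' : i + k ≤ m) : antisym q e i k * antisymPair q e m j = antisymPair q e m j := by
  rw [H.antisymPair_comm hj, ← mul_assoc,
    H.antisym_mul_antisym' hjn (by omega) (by omega) (by omega)]

theorem antisymPair_idem {j : ℕ} (hjn : j ≤ n) (hjn' : m - j ≤ n) (hj : j ≤ m) :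
    antisymPair q e m j * antisymPair q e m j = antisymPair q e m j := by
  nth_rewrite 2 [antisymPair]
  rw [← mul_assoc, H.antisymPair_mul_left hjn hj (by omega),
    H.antisymPair_mul_right hjn' hj (by omega) (by omega)]

/-- The right factor of the middle pair lies within the last `m - a` strands, and its left factor
within the first `c`. So the outer pairs absorb the two factors from their sides. -/
theorem antisymPair_up {a b c : ℕ} (han : m - a ≤ n) (hcn : c ≤ n) (hab : a ≤ b) (hbc : b ≤ c)
    (hc : c ≤ m) : antisymPair q e m a * antisymPair q e m b * antisymPair q e m c =
      antisymPair q e m a * antisymPair q e m c := by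
  rw [H.antisymPair_comm (j := b) (by omega), ← mul_assoc,
    H.antisymPair_mul_right han (by omega) hab (by omega), mul_assoc,
    H.left_mul_antisymPair hcn hc (by omega)]

theorem antisymPair_down {a b c : ℕ} (han : a ≤ n) (hcn : m - c ≤ n) (hcb : c ≤ b) (hba : b ≤ a)
    (ha : a ≤ m) : antisymPair q e m a * antisymPair q e m b * antisymPair q e m c =
      antisymPair q e m a * antisymPair q e m c := by
  rw [antisymPair.eq_1 q e m b, ← mul_assoc, H.antisymPair_mul_left han ha (by omega), mul_assoc,
    H.right_mul_antisymPair hcn (by omega) hcb (by omega)]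

/-- The recursion for the first `j + 2` strands, multiplied on both sides by the pair at `j + 1`.
That pair absorbs everything except the generator `e j`. -/
theorem antisymPair_box_up {j : ℕ} (hj : j + 2 ≤ n) (hjm : j + 2 ≤ m) (hn : m - (j + 1) ≤ n) :
    (qInt q ((j : ℤ) + 2) : R) •
      (antisymPair q e m (j + 1) * antisymPair q e m (j + 2) * antisymPair q e m (j + 1)) =
      (qInt q ((j : ℤ) + 1) : R) • (antisymPair q e m (j + 1) * e j * antisymPair q e m (j + 1)) -
        (qInt q (j : ℤ) : R) • antisymPair q e m (j + 1) := by
  have hr := congrArg (fun x => antisymPair q e m (j + 1) * x * antisymPair q e m (j + 1))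
    (H.units.smul_antisym e 0 hj)
  simp only [mul_sub, sub_mul, mul_smul_comm, smul_mul_assoc, zero_add] at hr
  rw [← mul_assoc, ← mul_assoc,
    H.antisymPair_mul_left (i := 0) (k := j + 1) (by omega) (by omega) (by omega),
    mul_assoc (_ * _) _ (antisymPair q e m (j + 1)),
    H.left_mul_antisymPair (by omega) (by omega) (by omega),
    H.antisymPair_idem (by omega) (by omega) (by omega)] at hr
  rw [← hr, antisymPair.eq_1 q e m (j + 2), ← mul_assoc, mul_assoc (_ * _),
    H.right_mul_antisymPair hn (by omega) (by omega) (by omega)]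

/-- The same argument for the last `m - j` strands, with the recursion that adds a strand on the
left. -/
theorem antisymPair_box_down {j : ℕ} (hjm : j + 2 ≤ m) (hj : j + 1 ≤ n) (hn : m - j ≤ n) :
    (qInt q ((m : ℤ) - j) : R) •
      (antisymPair q e m (j + 1) * antisymPair q e m j * antisymPair q e m (j + 1)) =
      (qInt q ((m : ℤ) - j - 1) : R) • (antisymPair q e m (j + 1) * e j * antisymPair q e m (j +
        1)) -
        (qInt q ((m : ℤ) - j - 2) : R) • antisymPair q e m (j + 1) := by
  obtain ⟨k, rfl⟩ : ∃ k, m = j + k + 2 := ⟨m - j - 2, by omega⟩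
  have hr := congrArg
    (fun x => antisymPair q e (j + k + 2) (j + 1) * x * antisymPair q e (j + k + 2) (j + 1))
    (H.smul_antisym_left (i := j) (k := k) (by omega) (by omega))
  simp only [mul_sub, sub_mul, mul_smul_comm, smul_mul_assoc] at hr
  rw [← mul_assoc, ← mul_assoc,
    H.antisymPair_mul_right (i := j + 1) (k := k + 1) (by omega) (by omega) (by omega) (by omega),
    mul_assoc (_ * _) _ (antisymPair q e _ (j + 1)),
    H.right_mul_antisymPair (by omega) (by omega) (by omega) (by omega),
    H.antisymPair_idem (by omega) (by omega) (by omega)] at hr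
  push_cast
  rw [show (j : ℤ) + k + 2 - j = k + 2 by ring, show (k : ℤ) + 2 - 1 = k + 1 by ring,
    show (k : ℤ) + 2 - 2 = k by ring, ← hr, antisymPair.eq_1 q e _ j, ← mul_assoc,
    H.antisymPair_mul_left hj (by omega) (by omega), show j + k + 2 - j = k + 2 by omega]

/-- The bounds keep both labels `j` and `m - j` at most `n`, where the antisymmetrizers behave well.
Both triple products in the box relation reduce to multiples of the pair with one generator in the
middle; after scaling, these terms cancel and a multiple of the pair remains. -/
theorem ladder : LadderData q n m (m - n) (min n m) (antisymPair q e m) where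
  units := H.units
  idem a h1 h2 := H.antisymPair_idem (by omega) (by omega) (by omega)
  up a b c h1 h2 h3 h4 := H.antisymPair_up (by omega) (by omega) h2 h3 (by omega)
  down a b c h1 h2 h3 h4 := H.antisymPair_down (by omega) (by omega) h2 h3 (by omega)
  box j h1 h2 := by
    have e1 := H.antisymPair_box_up (j := j) (by omega) (by omega) (by omega)
    have e2 := H.antisymPair_box_down (j := j) (by omega) (by omega) (by omega)
    have i1 := qInt_mul H.units.sub_inv ((m : ℤ) - j - 1) ((j : ℤ) + 1) (-1)
    rw [show (-1 : ℤ) = -(1) from rfl, qInt_neg, qInt_one,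
      show (j : ℤ) + 1 + -1 = j by ring, show (m : ℤ) - j - 1 + -1 = m - j - 2 by ring,
      show (m : ℤ) - j - 1 - (j + 1) = -(2 * (j + 1) - m) by ring, qInt_neg] at i1
    rw [mul_smul, e2, mul_smul, e1]
    simp only [smul_sub, smul_smul]
    have i2 := congrArg (· • antisymPair q e m (j + 1)) i1
    linear_combination (norm := module) i2

/-- In a Hecke algebra on `m` strands, the linear relation between the ladders from `(j, m - j)` to
`(i, m - i)` through `(m - 1, 1)`, `(1, m - 1)` and `(0, m)`. -/
theorem antisymPair_relation (hn : m ≤ n) {i j : ℕ} (hi : i + 1 ≤ m) (hj : j ≤ m) :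
    (qInt q ((m : ℤ) - j) * qInt q ((m : ℤ) - i) : R) •
      (antisymPair q e m j * antisymPair q e m (m - 1) * antisymPair q e m i) =
    (qInt q (j : ℤ) * qInt q (i : ℤ) : R) •
      (antisymPair q e m j * antisymPair q e m 1 * antisymPair q e m i) +
    (qInt q ((m : ℤ) - i - j) * qInt q (m : ℤ) : R) • antisym q e 0 m := by
  set w := antisym q e 0 m with hw
  -- The full antisymmetrizer absorbs every pair. This settles the cases in which `i` or `j` is
  -- extreme.
  have hl : ∀ a, a ≤ m → antisymPair q e m a * w = w := fun a ha => by
    rw [antisymPair, mul_assoc, H.antisym_mul_antisym' hn (by omega) (by omega) (by omega),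
      H.antisym_mul_antisym' hn (by omega) (by omega) (by omega)]
  have hr : ∀ a, a ≤ m → w * antisymPair q e m a = w := fun a ha => by
    rw [antisymPair, ← mul_assoc, H.antisym_mul_antisym hn (by omega) (by omega) (by omega),
      H.antisym_mul_antisym hn (by omega) (by omega) (by omega)]
  have h0 : antisymPair q e m 0 = w := antisymPair_zero q e m
  have hm : antisymPair q e m m = w := antisymPair_self q e m
  rcases Nat.eq_zero_or_pos i with rfl | hi0
  · rw [h0, mul_assoc, mul_assoc, hl _ (by omega), hl _ hj, hl _ (by omega), hl _ hj, Nat.cast_zero,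
      qInt_zero, mul_zero, zero_smul, zero_add]
    simp
  rcases Nat.eq_zero_or_pos j with rfl | hj0
  · rw [h0, hr _ (by omega), hr _ (by omega), hr _ (by omega), Nat.cast_zero, qInt_zero, zero_mul,
      zero_smul, zero_add]
    simp [mul_comm]
  rcases Nat.eq_or_lt_of_le hj with rfl | hjm
  · rw [hm, hr _ (by omega), hr _ (by omega), hr _ (by omega), sub_self, qInt_zero, zero_mul,
      zero_smul, hr _ (by omega), ← add_smul, show (j : ℤ) - i - j = -i by ring, qInt_neg]
    ring_nf
    rw [zero_smul]
  have D := H.ladder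
  -- The corner `i = j = 1`: the term `v * e 0 * v` is eliminated between two consecutive recursions
  -- that add a strand on the left.
  have base : (qInt q ((m : ℤ) - 1) * qInt q ((m : ℤ) - 1) : R) •
      (antisymPair q e m 1 * antisymPair q e m (m - 1) * antisymPair q e m 1) =
      antisymPair q e m 1 + (qInt q ((m : ℤ) - 2) * qInt q (m : ℤ) : R) • w := by
    rcases Nat.lt_or_ge m 3 with h3 | h3
    · obtain rfl : m = 2 := by omega
      norm_num
      rw [qInt_one, qInt_zero, one_mul, one_smul, zero_mul, zero_smul, add_zero,
        H.antisymPair_idem (by omega) (by omega) (by omega),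
        H.antisymPair_idem (by omega) (by omega) (by omega)]
    obtain ⟨k, rfl⟩ : ∃ k, m = k + 3 := ⟨m - 3, by omega⟩
    have e1 := H.smul_antisym_left (i := 0) (k := k + 1) (by omega) (by omega)
    have e2 := H.smul_antisym_left (i := 0) (k := k) (by omega) (by omega)
    have hv : antisymPair q e (k + 3) 1 = antisym q e 1 (k + 2) := by
      rw [antisymPair, antisym_one, one_mul]
      rfl
    have hu : antisymPair q e (k + 3) (k + 3 - 1) = antisym q e 0 (k + 2) := by
      rw [antisymPair, show k + 3 - (k + 3 - 1) = 1 by omega, antisym_one, mul_one]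
      rfl
    rw [hv, hu]
    set v := antisym q e 1 (k + 2)
    have hvz : v * antisym q e 1 (k + 1) = v :=
      H.antisym_mul_antisym (by omega) (by omega) (by omega) (by omega)
    have hzv : antisym q e 1 (k + 1) * v = v :=
      H.antisym_mul_antisym' (by omega) (by omega) (by omega) (by omega)
    have hvv : v * v = v := H.antisym_idem (by omega) (by omega)
    have e2 := congrArg (v * · * v) e2
    simp only [mul_sub, sub_mul, mul_smul_comm, smul_mul_assoc, zero_add] at e2
    rw [← mul_assoc, ← mul_assoc, hvz, mul_assoc (v * e 0), hzv, hvv] at e2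
    rw [show k + 1 + 2 = k + 3 by ring] at e1
    push_cast at e1 ⊢
    rw [show (k : ℤ) + 3 - 1 = k + 2 by ring, show (k : ℤ) + 3 - 2 = k + 1 by ring]
    rw [show (k : ℤ) + 1 + 2 = k + 3 by ring, show (k : ℤ) + 1 + 1 = k + 2 by ring] at e1
    have i1 := qInt_mul H.units.sub_inv ((k : ℤ) + 1) ((k : ℤ) + 2) (-1)
    rw [show (-1 : ℤ) = -(1) from rfl, qInt_neg, qInt_one, show (k : ℤ) + 2 + -1 = k + 1 by ring,
      show (k : ℤ) + 1 + -1 = k by ring, show (k : ℤ) + 1 - (k + 2) = -(1) by ring, qInt_neg,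
      qInt_one] at i1
    have i2 := congrArg (· • v) i1
    linear_combination (norm := module) (qInt q ((k : ℤ) + 2) : R) • e2 -
      (qInt q ((k : ℤ) + 1) : R) • e1 + i2
  -- The column `i = 1`, by induction on `j`; each step uses the three-term relation read upside
  -- down.
  have col : ∀ j, 1 ≤ j → j + 1 ≤ m → (qInt q ((m : ℤ) - j) * qInt q ((m : ℤ) - 1) : R) •
      (antisymPair q e m j * antisymPair q e m (m - 1) * antisymPair q e m 1) =
      (qInt q (j : ℤ) : R) • (antisymPair q e m j * antisymPair q e m 1) +
        (qInt q ((m : ℤ) - 1 - j) * qInt q (m : ℤ) : R) • w := by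
    intro j h1 h2
    induction j, h1 using Nat.le_induction with
    | base =>
      rw [H.antisymPair_idem (by omega) (by omega) (by omega)]
      push_cast
      rw [qInt_one, one_smul, base]
      congr 4
      ring
    | succ j h1 ih =>
      refine H.smul_cancel h1 (by omega) ?_
      have ih := congrArg (antisymPair q e m (j + 1) * ·) (ih (by omega))
      simp only [mul_add, mul_smul_comm, ← mul_assoc] at ih
      rw [D.down (j + 1) j 1 (by omega) (by omega) (by omega) (by omega), hl _ (by omega)] at ih
      have T := D.op.three_term (k := m - 1) (j := j) (by omega) (by omega) (by omega)
      simp only [← MulOpposite.op_mul, ← MulOpposite.op_smul, ← MulOpposite.op_add,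
        MulOpposite.op_inj] at T
      rw [show m - 1 + 1 = m by omega, hm, hr _ (by omega), hl _ (by omega), ← mul_assoc,
        show ((m - 1 : ℕ) : ℤ) = m - 1 by omega, show (m : ℤ) - (m - 1) = 1 by ring, qInt_one,
        one_mul, show (j : ℤ) + (m - 1) + 1 - m = j by ring,
        show (m : ℤ) - 1 + 1 = m by ring] at T
      have T := congrArg (· * antisymPair q e m 1) T
      simp only [add_mul, smul_mul_assoc] at T
      rw [hr _ (by omega)] at T
      have i1 := qInt_mul H.units.sub_inv ((j : ℤ) + 1) 1 ((m : ℤ) - 1 - j - 1)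
      rw [qInt_one, one_mul, show (j : ℤ) + 1 + (m - 1 - j - 1) = m - 1 by ring,
        show (1 : ℤ) + (m - 1 - j - 1) = m - 1 - j by ring,
        show (j : ℤ) + 1 - 1 = j by ring] at i1
      push_cast
      rw [show (m : ℤ) - (j + 1) = m - 1 - j by ring,
        show (m : ℤ) - 1 - (j + 1) = m - 1 - j - 1 by ring]
      have i2 := congrArg (· • w) i1
      linear_combination (norm := module) (qInt q ((j : ℤ) + 1) : R) • ih -
        (qInt q ((m : ℤ) - 1) : R) • T + (qInt q (m : ℤ) : R) • i2
  clear base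
  -- From the column to all `i`, by the three-term relation at the other end of the ladder.
  induction i, hi0 using Nat.le_induction with
  | base =>
    have := col j hj0 (by omega)
    push_cast
    rw [qInt_one, mul_one, this, mul_assoc (antisymPair q e m j),
      H.antisymPair_idem (by omega) (by omega) (by omega)]
  | succ i h1 ih =>
    refine H.smul_cancel h1 (by omega) ?_
    have ih := congrArg (· * antisymPair q e m (i + 1)) (ih (by omega))
    simp only [add_mul, smul_mul_assoc] at ih
    rw [hr _ (by omega), mul_assoc (antisymPair q e m j) (antisymPair q e m 1),
      mul_assoc (antisymPair q e m j) (_ * _),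
      D.up 1 i (i + 1) (by omega) (by omega) (by omega) (by omega), ← mul_assoc] at ih
    have T := D.three_term (k := m - 1) (j := i) (by omega) (by omega) (by omega)
    rw [show m - 1 + 1 = m by omega, hm, hl _ (by omega), hr _ (by omega),
      show ((m - 1 : ℕ) : ℤ) = m - 1 by omega, show (m : ℤ) - (m - 1) = 1 by ring, qInt_one,
      one_mul, show (i : ℤ) + (m - 1) + 1 - m = i by ring,
      show (m : ℤ) - 1 + 1 = m by ring] at T
    have T := congrArg (antisymPair q e m j * ·) T
    simp only [mul_add, mul_smul_comm, ← mul_assoc] at T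
    rw [hl _ (by omega)] at T
    have i1 := qInt_mul H.units.sub_inv ((i : ℤ) + 1) 1 ((m : ℤ) - i - j - 1)
    rw [qInt_one, one_mul, show (i : ℤ) + 1 + (m - i - j - 1) = m - j by ring,
      show (1 : ℤ) + (m - i - j - 1) = m - i - j by ring,
      show (i : ℤ) + 1 - 1 = i by ring] at i1
    push_cast
    rw [show (m : ℤ) - (i + 1) - j = m - i - j -
      1 by ring, show (m : ℤ) - (i + 1) = m - 1 - i by ring]
    have i2 := congrArg (· • w) i1
    linear_combination (norm := module) (qInt q ((i : ℤ) + 1) : R) • ih -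
      (qInt q ((m : ℤ) - j) : R) • T + (qInt q (m : ℤ) : R) • i2

end HeckeData

end Projections

/-! ### Crossings inside the Hecke algebra. -/

noncomputable section HeckeBraids

variable {R : Type u} [CommRing R] {A : Type v} [Ring A] [Algebra R A]

/-- The rescaled positive crossing of the strands `i` and `i + 1`. -/
def heckeCrossing (q : Rˣ) (e : ℕ → A) (i : ℕ) : A := (q : R) • (1 : A) - e i

/-- The strand `i` crosses the `l` strands to its right. -/
def heckeChain (q : Rˣ) (e : ℕ → A) (i : ℕ) : ℕ → A
  | 0 => 1
  | l + 1 => heckeChain q e i l * heckeCrossing q e (i + l)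

/-- The first `k` strands cross the next `l` strands. -/
def heckeBlock (q : Rˣ) (e : ℕ → A) (l : ℕ) : ℕ → A
  | 0 => 1
  | k + 1 => heckeChain q e k l * heckeBlock q e l k

/-- Meant for crossings of cables, which carry the generators at one end to those at the other.
Invertibility of `x` plays no role. -/
theorem semiconj_antisym (q : Rˣ) (e : ℕ → A) (i i' k : ℕ) (x : A)
    (h : ∀ s, s + 1 < k → e (i + s) * x = x * e (i' + s)) :
    antisym q e i k * x = x * antisym q e i' k := by
  induction k with
  | zero => simp [antisym_zero]
  | succ k ih =>
    cases k with
    | zero => simp [antisym_one]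
    | succ k =>
      have ih := ih fun s hs => h s (by omega)
      rw [antisym, antisym, smul_mul_assoc, mul_smul_comm, sub_mul, mul_sub, smul_mul_assoc,
        smul_mul_assoc, mul_smul_comm, mul_smul_comm, ih, mul_assoc, ih, ← mul_assoc,
          mul_assoc _ _ x,
        h k (by omega), ← mul_assoc, ih]
      simp only [mul_assoc]

namespace HeckeData

variable {q : Rˣ} {n m : ℕ} {e : ℕ → A} (H : HeckeData q n m e)
include H

theorem commute_crossing {i j : ℕ} (hi : i + 1 < m) (hj : j + 1 < m) (h : i + 1 < j ∨ j + 1 < i) :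
    Commute (e i) (heckeCrossing q e j) := by
  unfold heckeCrossing
  refine ((Commute.one_right _).smul_right _).sub_right ?_
  rcases h with h | h
  · exact H.rels.comm _ _ h hj
  · exact (H.rels.comm _ _ h hi).symm

theorem commute_chain {i j l : ℕ} (hj : j + 1 < m) (hi : i + l < m) (h : j + 1 < i ∨ i + l < j) :
    Commute (e j) (heckeChain q e i l) := by
  induction l with
  | zero => exact Commute.one_right _
  | succ l ih =>
    rw [heckeChain]
    exact (ih (by omega) (by omega)).mul_right (H.commute_crossing hj (by omega) (by omega))

theorem crossing_commute_chain {i j l : ℕ} (hj : j + 1 < m) (hi : i + l < m)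
    (h : j + 1 < i ∨ i + l < j) : Commute (heckeCrossing q e j) (heckeChain q e i l) := by
  nth_rewrite 1 [heckeCrossing]
  exact ((Commute.one_left _).smul_left _).sub_left (H.commute_chain hj hi h)

theorem commute_block {j l k : ℕ} (hj : j + 1 < m) (h : l + k ≤ j) :
    Commute (e j) (heckeBlock q e l k) := by
  induction k with
  | zero => exact Commute.one_right _
  | succ k ih =>
    rw [heckeBlock]
    exact (H.commute_chain hj (by omega) (by omega)).mul_right (ih (by omega))

/-- A form of Reidemeister III: a generator slides through a strand that crosses over its two
strands. Expanded in the generators it is the braid relation, because `q² - q [2] = -1`. -/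
theorem e_mul_crossing {i : ℕ} (hi : i + 2 < m) :
    e (i + 1) * (heckeCrossing q e i * heckeCrossing q e (i + 1)) =
      heckeCrossing q e i * heckeCrossing q e (i + 1) * e i := by
  have hb := H.rels.braid i hi
  have h1 := H.rels.sq i (by omega)
  have h2 := H.rels.sq (i + 1) (by omega)
  unfold heckeCrossing
  simp only [mul_sub, sub_mul, smul_mul_assoc, mul_smul_comm, one_mul, mul_one, ← mul_assoc]
  simp only [h1, h2, qInt_two]
  have hq : (q : R) * ((q⁻¹ : Rˣ) : R) = 1 := by simp
  have h3 := congrArg (· • (e i - e (i + 1))) hq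
  linear_combination (norm := module) h3 - hb

theorem e_mul_crossing' {i : ℕ} (hi : i + 2 < m) :
    e i * (heckeCrossing q e (i + 1) * heckeCrossing q e i) =
      heckeCrossing q e (i + 1) * heckeCrossing q e i * e (i + 1) := by
  have hb := H.rels.braid i hi
  have h1 := H.rels.sq i (by omega)
  have h2 := H.rels.sq (i + 1) (by omega)
  unfold heckeCrossing
  simp only [mul_sub, sub_mul, smul_mul_assoc, mul_smul_comm, one_mul, mul_one, ← mul_assoc]
  simp only [h1, h2, qInt_two]
  have hq : (q : R) * ((q⁻¹ : Rˣ) : R) = 1 := by simp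
  have h3 := congrArg (· • (e i - e (i + 1))) hq
  linear_combination (norm := module) hb - h3

theorem e_mul_chain {i j l : ℕ} (hi : i + l < m) (hj : j + 1 < l) :
    e (i + j + 1) * heckeChain q e i l = heckeChain q e i l * e (i + j) := by
  induction l with
  | zero => omega
  | succ l ih =>
    rcases Nat.lt_or_ge (j + 1) l with hl | hl
    · rw [heckeChain, ← mul_assoc, ih (by omega) hl, mul_assoc,
        (H.commute_crossing (by omega) (by omega) (by omega)).eq, mul_assoc]
    · obtain rfl : l = j + 1 := by omega
      rw [heckeChain, heckeChain, mul_assoc, ← mul_assoc (e _),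
        (H.commute_chain (by omega) (by omega) (by omega)).eq, mul_assoc, ← add_assoc,
        H.e_mul_crossing (by omega), ← mul_assoc]

theorem e_mul_chain_chain {j l : ℕ} (hj : j + 1 + l < m) :
    e j * (heckeChain q e (j + 1) l * heckeChain q e j l) =
      heckeChain q e (j + 1) l * heckeChain q e j l * e (j + l) := by
  induction l with
  | zero => simp [heckeChain]
  | succ l ih =>
    have : heckeChain q e (j + 1) (l + 1) * heckeChain q e j (l + 1) =
        heckeChain q e (j + 1) l * heckeChain q e j l *
          (heckeCrossing q e (j + l + 1) * heckeCrossing q e (j + l)) := by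
      rw [heckeChain, heckeChain, mul_assoc, ← mul_assoc (heckeCrossing q e _),
        (H.crossing_commute_chain (by omega) (by omega) (by omega)).eq, mul_assoc, mul_assoc,
        show j + 1 + l = j + l + 1 by ring]
    rw [this, ← mul_assoc, ih (by omega), mul_assoc, H.e_mul_crossing' (by omega), ← mul_assoc]
    rfl

theorem e_mul_block {j l k : ℕ} (hk : k + l ≤ m) (hj : j + 1 < k) :
    e j * heckeBlock q e l k = heckeBlock q e l k * e (l + j) := by
  induction k with
  | zero => omega
  | succ k ih =>
    rcases Nat.lt_or_ge (j + 1) k with hl | hl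
    · rw [heckeBlock, ← mul_assoc, (H.commute_chain (by omega) (by omega) (by omega)).eq, mul_assoc,
        ih (by omega) hl, mul_assoc]
    · obtain rfl : k = j + 1 := by omega
      rw [heckeBlock, heckeBlock, ← mul_assoc (heckeChain q e (j + 1) l), ← mul_assoc (e j),
        H.e_mul_chain_chain (by omega), add_comm l j, mul_assoc,
        (H.commute_block (by omega) (by omega)).eq, ← mul_assoc]

theorem e_mul_block' {j l k : ℕ} (hk : k + l ≤ m) (hj : j + 1 < l) :
    e (k + j) * heckeBlock q e l k = heckeBlock q e l k * e j := by
  induction k with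
  | zero => simp [heckeBlock]
  | succ k ih =>
    rw [heckeBlock, ← mul_assoc, show k + 1 + j = k + j + 1 by ring, H.e_mul_chain (by omega) hj,
      mul_assoc, ih (by omega), mul_assoc]

/-- Each generator inside one of the two cables slides through the block crossing to the other side,
hence so do the antisymmetrizers. -/
theorem antisymPair_mul_block {k l : ℕ} (h : k + l ≤ m) :
    antisymPair q e (k + l) k * heckeBlock q e l k =
      heckeBlock q e l k * antisymPair q e (k + l) l := by
  have h1 := semiconj_antisym q e 0 l k (heckeBlock q e l k) fun s hs => by
    rw [zero_add]; exact H.e_mul_block h hs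
  have h2 := semiconj_antisym q e k 0 l (heckeBlock q e l k) fun s hs => by
    rw [zero_add]; exact H.e_mul_block' h hs
  rw [(H.mono h).antisymPair_comm (j := l) (by omega), antisymPair, show k + l - k = l by omega,
    show k + l - l = k by omega, mul_assoc, h2, ← mul_assoc, h1, mul_assoc]

/-- The expansion of the crossing of one strand with an antisymmetrizer of `l` strands. -/
theorem antisym_mul_chain {i l : ℕ} (hl : l + 1 ≤ n) (hi : i + l + 1 ≤ m) :
    antisym q e (i + 1) l * heckeChain q e i l = ((-1) ^ (l + 1) * (q : R)) •
      ((qInt q (l : ℤ) : R) • (antisym q e (i + 1) l * antisym q e i l) -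
        (((q⁻¹ : Rˣ) : R) * qInt q ((l : ℤ) + 1)) • antisym q e i (l + 1)) := by
  have hqq : (q : R) * ((q⁻¹ : Rˣ) : R) = 1 := by simp
  induction l with
  | zero =>
    simp [antisym_zero, antisym_one, heckeChain, qInt_zero, qInt_one, smul_smul]
  | succ l ih =>
    have ih := ih (by omega) (by omega)
    -- Of the strands `i, …, i + l + 1`, `V` antisymmetrizes the last `l + 1`, `U` the first `l +
    -- 1`, and `w` all of them.
    set V := antisym q e (i + 1) (l + 1) with hV
    set U := antisym q e i (l + 1) with hU
    set w := antisym q e i (l + 1 + 1)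
    have hnat : V * heckeChain q e i (l + 1) = heckeChain q e i (l + 1) * U :=
      semiconj_antisym q e _ _ _ _ fun s hs => by
        rw [← H.e_mul_chain (by omega) hs]; congr 2; ring
    have hVV : V * V = V := H.antisym_idem (by omega) (by omega)
    have hUU : U * U = U := H.antisym_idem (by omega) (by omega)
    have hVv : V * antisym q e (i + 1) l = V :=
      H.antisym_mul_antisym (by omega) (by omega) (by omega) (by omega)
    have huU : antisym q e i l * U = U :=
      H.antisym_mul_antisym' (by omega) (by omega) (by omega) (by omega)
    have hwV : V * w = w :=
      H.antisym_mul_antisym' (by omega) (by omega) (by omega) (by omega)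
    -- Since `V` is idempotent and slides through the chain to become `U`, a factor `U` can be
    -- inserted at the end. At the front `V` yields the smaller antisymmetrizer that the induction
    -- hypothesis needs.
    have e1 : V * heckeChain q e i (l + 1) =
        V * (antisym q e (i + 1) l * heckeChain q e i l) * heckeCrossing q e (i + l) * U := by
      rw [← mul_assoc, hVv, mul_assoc V, ← heckeChain, mul_assoc, ← hnat, ← mul_assoc, hVV]
    -- In the first summand the last crossing commutes with the small antisymmetrizer and reaches
    -- `V`, which absorbs it as the scalar `q - [2] = -q⁻¹`. For `l = 0` this fails, but there `[l]
    -- = 0`.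
    have e2 : (qInt q (l : ℤ) : R) •
        (V * antisym q e (i + 1) l * antisym q e i l * heckeCrossing q e (i + l) * U) =
        -(((q⁻¹ : Rˣ) : R) * qInt q (l : ℤ)) • (V * U) := by
      rcases Nat.eq_zero_or_pos l with rfl | h0
      · simp [qInt_zero]
      have hVe : V * e (i + l) = (qInt q 2 : R) • V :=
        H.antisym_mul_e (by omega) (by omega) (by omega) (by omega)
      have hc : antisym q e i l * e (i + l) = e (i + l) * antisym q e i l :=
        (H.commute_e (by omega) (by omega) (by omega)).symm
      rw [hVv, heckeCrossing, mul_assoc V, mul_sub, hc, mul_sub, mul_smul_comm, mul_smul_comm,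
        mul_one, ← mul_assoc, hVe, sub_mul, smul_mul_assoc, smul_mul_assoc, smul_mul_assoc,
        mul_assoc, huU, qInt_two]
      module
    -- In the second summand the generator stands between two factors `U`, where the recursion for
    -- `w` evaluates it.
    have e3 : (qInt q ((l : ℤ) + 1) : R) • (V * U * heckeCrossing q e (i + l) * U) =
        ((q : R) * qInt q ((l : ℤ) + 1) - qInt q (l : ℤ)) • (V * U) -
          (qInt q ((l : ℤ) + 2) : R) • w := by
      have hr := congrArg (V * ·) (H.units.smul_antisym e i hl)
      simp only [mul_sub, mul_smul_comm] at hr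
      rw [hwV, ← mul_assoc, ← mul_assoc] at hr
      rw [heckeCrossing, mul_assoc V U, mul_sub, mul_smul_comm, mul_one, mul_assoc, sub_mul,
        smul_mul_assoc, hUU, mul_sub, mul_smul_comm, ← mul_assoc, ← mul_assoc]
      linear_combination (norm := module) hr
    rw [e1, ih]
    simp only [mul_smul_comm, smul_mul_assoc, mul_sub, sub_mul, ← mul_assoc]
    rw [e2]
    push_cast
    rw [show (l : ℤ) + 1 + 1 = l + 2 by ring, pow_succ (-1 : R) (l + 1)]
    have h3 := congrArg (fun x => ((-1 : R) ^ (l + 1) * (q : R) * qInt q ((l : ℤ) + 1) * x) •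
      (V * U)) hqq
    linear_combination (norm := module) -h3 -
      ((-1 : R) ^ (l + 1) * (q : R) * ((q⁻¹ : Rˣ) : R)) • e3

end HeckeData

end HeckeBraids

/-! ### Expansion of the crossing of two cables in ladders. -/

noncomputable section HeckeBraidExpansion

variable {R : Type u} [CommRing R] {A : Type v} [Ring A] [Algebra R A]

theorem antisym_shift (q : Rˣ) (e : ℕ → A) (x i k : ℕ) :
    antisym q (fun j => e (x + j)) i k = antisym q e (x + i) k :=
  antisym_congr q _ e i (x + i) k fun s _ => by rw [add_assoc]

theorem QuantumUnits.qInt_mul_qBinom {q : Rˣ} {n : ℕ} (hq : QuantumUnits q n) {k : ℕ}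
    (hk : k + 1 ≤ n) (m : ℤ) : (qInt q (m + 1) * qBinom q m k : R) =
      qInt q (m + 1 - k) * qBinom q (m + 1) k := by
  rw [← hq.qInt_mul_qBinom_succ_succ hk, ← hq.qInt_mul_qBinom_succ hk]

theorem neg_zpow_succ (q : Rˣ) (b : ℕ) :
    (((-q) ^ (-(b : ℤ)) : Rˣ) : R) = -(q : R) * (((-q) ^ (-((b + 1 : ℕ) : ℤ)) : Rˣ) : R) := by
  rw [← Units.val_neg, ← Units.val_mul, ← zpow_one_add]
  congr 2
  push_cast
  ring

namespace HeckeData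

variable {q : Rˣ} {n m : ℕ} {e : ℕ → A} (H : HeckeData q n m e)
include H

/-- The left factor of the middle pair lies inside the first `k` strands and is absorbed. -/
theorem antisymPair_mid {k l x y : ℕ} (hk : k + l ≤ n) (hm : k + l ≤ m) (hxy : x + y = k + l)
    (hx : x ≤ k) (hxl : x ≤ l) :
    antisymPair q e (k + l) k * antisymPair q e (k + l) x * antisymPair q e (k + l) l =
      antisymPair q e (k + l) k * antisym q e x y * antisymPair q e (k + l) l := by
  rw [antisymPair.eq_1 q e (k + l) x, show k + l - x = y by omega, ← mul_assoc,
    (H.mono hm).antisymPair_mul_left (by omega) (by omega) (by omega)]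

/-- The two relations that reduce a ladder on three uprights. -/
theorem block_reduction {k l b j x : ℕ} (hk : k + 1 + l ≤ n) (hm : k + 1 + l ≤ m) (hx : x + b = k)
    (hj : j ≤ b + 1) (hkl : k ≤ l + b) :
    (qInt q ((l : ℤ) + b + 1 - j) * qInt q ((k : ℤ) + 1) : R) •
      (antisymPair q e (k + 1 + l) (k + 1) * antisym q e (x + j) (l + b + 1 - j) *
        antisym q e x (l + b) * antisymPair q e (k + 1 + l) l) =
    (qInt q (j : ℤ) * qInt q ((l : ℤ) + b - k) : R) •
      (antisymPair q e (k + 1 + l) (k + 1) * antisym q e (x + 1) (l + b) *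
        antisymPair q e (k + 1 + l) l) +
    (qInt q ((k : ℤ) + 1 - j) * qInt q ((l : ℤ) + b + 1) : R) •
      (antisymPair q e (k + 1 + l) (k + 1) * antisym q e x (l + b + 1) *
        antisymPair q e (k + 1 + l) l) := by
  set K := antisymPair q e (k + 1 + l) (k + 1) with hK
  set L := antisymPair q e (k + 1 + l) l with hL
  have H' := H.mono hm
  -- The linear relation is applied to the `l + b + 1` strands that start at `x`. The outer pairs
  -- `K` and `L` absorb the antisymmetrizers that do not occur in the claim.
  have S := (H.shift (x := x) (m' := l + b + 1) (by omega)).antisymPair_relation (i := l + b - k)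
    (j := j) (by omega) (by omega) (by omega)
  have Kl : ∀ y z, y + z ≤ k + 1 → K * antisym q e y z = K := fun y z h =>
    H'.antisymPair_mul_left (by omega) (by omega) h
  have S := congrArg (fun y => K * y * L) S
  simp only [antisymPair.eq_1 _ _ (l + b + 1), antisym_shift, mul_add, add_mul, mul_smul_comm,
    smul_mul_assoc] at S
  rw [show l + b + 1 - 1 = l + b by omega, show l + b + 1 - (l + b) = 1 by omega, antisym_one,
    antisym_one, mul_one, one_mul, add_zero, show x + (l + b - k) = l by omega,
    show l + b + 1 - (l + b - k) = k + 1 by omega] at S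
  have hQL : antisym q e x (l + b - k) * (antisym q e l (k + 1) * L) = L := by
    rw [H'.right_mul_antisymPair (by omega) (by omega) (by omega) (by omega),
      H'.left_mul_antisymPair (by omega) (by omega) (by omega)]
  have hKQ : ∀ z, K * (antisym q e x j * z) = K * z := fun z => by
    rw [← mul_assoc, Kl _ _ (by omega)]
  -- For `j = 0` the first inner antisymmetrizer is too large to be absorbed, but then the
  -- coefficient `[j]` vanishes.
  have hv : (qInt q (j : ℤ) : R) • (K * (antisym q e (x + j) (l + b + 1 - j) *
      (antisym q e (x + 1) (l + b) * L))) =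
      (qInt q (j : ℤ) : R) • (K * (antisym q e (x + 1) (l + b) * L)) := by
    rcases Nat.eq_zero_or_pos j with h0 | h0
    · rw [h0, Nat.cast_zero, qInt_zero, zero_smul, zero_smul]
    · rw [← mul_assoc (antisym q e (x + j) _),
        H'.antisym_mul_antisym' (by omega) (by omega) (by omega) (by omega)]
  simp only [mul_assoc] at S
  rw [hQL, hKQ, hKQ, mul_comm (qInt q (j : ℤ)), mul_smul (qInt q ((l + b - k : ℕ) : ℤ)), hv,
    smul_smul] at S
  have c1 : ((l + b - k : ℕ) : ℤ) = l + b - k := by omega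
  push_cast at S
  rw [c1, show (l : ℤ) + b + 1 - (l + b - k) = k + 1 by ring] at S
  simp only [mul_assoc]
  rw [S, mul_comm (qInt q ((l : ℤ) + b - k))]

/-- The expansion of the crossing of two antisymmetrizers in ladders. -/
theorem antisymPair_mul_block_eq {k l : ℕ} (hk : k + l ≤ n) (hm : k + l ≤ m) :
    antisymPair q e (k + l) k * heckeBlock q e l k = ((-1) ^ (k + k * l) * (q : R) ^ k) •
      ∑ b ∈ Finset.range (k + 1), ((((-q) ^ (-(b : ℤ)) : Rˣ) : R) *
        (qBinom q (k : ℤ) b * qBinom q ((l : ℤ) + b) k)) •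
          (antisymPair q e (k + l) k * antisymPair q e (k + l) (k - b) *
            antisymPair q e (k + l) l) := by
  induction k with
  | zero =>
    simp only [zero_add, heckeBlock, mul_one, zero_mul, pow_zero, one_smul, Finset.range_one,
      Finset.sum_singleton, Nat.cast_zero, neg_zero, zpow_zero, Units.val_one, qBinom_zero,
      Nat.sub_zero]
    rw [(H.mono (m' := l) (by omega)).antisymPair_idem (by omega) (by omega) (by omega),
      antisymPair_self, antisymPair_zero, H.antisym_idem (by omega) (by omega)]
  | succ k ih =>
    have ih := ih (by omega) (by omega)
    set K := antisymPair q e (k + 1 + l) (k + 1) with hK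
    set L := antisymPair q e (k + 1 + l) l with hL
    have H' := H.mono hm
    have Kl : ∀ y z, y + z ≤ k + 1 → K * antisym q e y z = K := fun y z h =>
      H'.antisymPair_mul_left (by omega) (by omega) h
    have hKK : K * K = K := H'.antisymPair_idem (by omega) (by omega) (by omega)
    have hKr : K * antisym q e (k + 1) l = K :=
      H'.antisymPair_mul_right (by omega) (by omega) (by omega) (by omega)
    -- `V b` are the ladders of the expansion for `k + 1` strands. `A' b` and `B' b` come from the
    -- two summands in the expansion of the chain of the extra strand.
    set V : ℕ → A := fun b => K * antisymPair q e (k + 1 + l) (k + 1 - b) * L with hV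
    have hU : ∀ b, b ≤ k + 1 → k + 1 ≤ l + b →
        V b = K * antisym q e (k + 1 - b) (l + b) * L := fun b h1 h2 =>
      H.antisymPair_mid (by omega) (by omega) (by omega) (by omega) (by omega)
    set A' : ℕ → A := fun b => K * antisym q e (k - b) (l + b) * L with hA
    set B' : ℕ → A := fun b => K * antisym q e k (l + 1) * antisym q e (k - b) (l + b) * L with hB
    -- `block_reduction` with `j = b + 1` and with `j = b` expresses both families in `V b` and `V
    -- (b + 1)`.
    have hAB : ∀ b, b ≤ k → k ≤ l + b →
        (qInt q ((k : ℤ) + 1) : R) • ((qInt q (l : ℤ) : R) • A' b) =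
          (qInt q ((b : ℤ) + 1) * qInt q ((l : ℤ) + b - k) : R) • V b +
            (qInt q ((k : ℤ) - b) * qInt q ((l : ℤ) + b + 1) : R) • V (b + 1) ∧
        (qInt q ((k : ℤ) + 1) : R) • ((qInt q ((l : ℤ) + 1) : R) • B' b) =
          (qInt q (b : ℤ) * qInt q ((l : ℤ) + b - k) : R) • V b +
            (qInt q ((k : ℤ) + 1 - b) * qInt q ((l : ℤ) + b + 1) : R) • V (b + 1) := by
      intro b h1 h2
      have hVb : (qInt q ((l : ℤ) + b - k) : R) • (K * antisym q e (k - b + 1) (l + b) * L) =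
          (qInt q ((l : ℤ) + b - k) : R) • V b := by
        rcases Nat.eq_or_lt_of_le h2 with h3 | h3
        · rw [show (l : ℤ) + b - k = 0 by omega, qInt_zero, zero_smul, zero_smul]
        · rw [hU b (by omega) (by omega), show k - b + 1 = k + 1 - b by omega]
      have hVb' : V (b + 1) = K * antisym q e (k - b) (l + b + 1) * L := by
        rw [hU (b + 1) (by omega) (by omega), show k + 1 - (b + 1) = k - b by omega, add_assoc]
      have rA := H.block_reduction (k := k) (l := l) (b := b) (j := b + 1) (x := k - b) hk hm
        (by omega) (by omega) (by omega)
      have rB := H.block_reduction (k := k) (l := l) (b := b) (j := b) (x := k - b) hk hm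
        (by omega) (by omega) (by omega)
      rw [← hK, ← hL, mul_smul _ _ (K * antisym q e (k - b + 1) _ * L), hVb, ← mul_smul,
        ← hVb'] at rA rB
      rw [show k - b + (b + 1) = k + 1 by omega, show l + b + 1 - (b + 1) = l by omega, hKr] at rA
      rw [show k - b + b = k by omega, show l + b + 1 - b = l + 1 by omega] at rB
      push_cast at rA
      rw [show (l : ℤ) + b + 1 - (b + 1) =
        l by ring, show (k : ℤ) + 1 - (b + 1) = k - b by ring] at rA
      rw [show (l : ℤ) + b + 1 - b = l + 1 by ring] at rB
      refine ⟨?_, ?_⟩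
      · rw [← rA, smul_smul, mul_comm]
      · rw [← rB, smul_smul, mul_comm]
    -- The induction hypothesis with an additional factor `Y` in front of the block: `Y` lets the
    -- antisymmetrizers of the first strands pass to `K` and absorbs that of the next `l` strands.
    have hY : ∀ Y, (∀ i, i ≤ k → Commute Y (antisym q e 0 i)) → Y * antisym q e k l = Y →
        K * Y * heckeBlock q e l k * L = ((-1) ^ (k + k * l) * (q : R) ^ k) •
          ∑ b ∈ Finset.range (k + 1), ((((-q) ^ (-(b : ℤ)) : Rˣ) : R) *
            (qBinom q (k : ℤ) b * qBinom q ((l : ℤ) + b) k)) •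
              (K * Y * antisym q e (k - b) (l + b) * L) := by
      intro Y hc hYl
      have hKY : ∀ i z, i ≤ k → K * (Y * (antisym q e 0 i * z)) = K * (Y * z) := fun i z hi => by
        rw [← mul_assoc Y, (hc i hi).eq, ← mul_assoc K, ← mul_assoc K, Kl _ _ (by omega), mul_assoc]
      have hp : K * Y * antisymPair q e (k + l) k = K * Y := by
        rw [antisymPair, show k + l - k = l by omega, mul_assoc, hKY _ _ le_rfl, hYl]
      have hpL : antisymPair q e (k + l) l * L = L := by
        rw [antisymPair, show k + l - l = k by omega, mul_assoc,
          H'.right_mul_antisymPair (by omega) (by omega) (by omega) (by omega),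
          H'.left_mul_antisymPair (by omega) (by omega) (by omega)]
      rw [← hp, mul_assoc (K * Y), ih, mul_smul_comm, smul_mul_assoc, Finset.mul_sum,
        Finset.sum_mul]
      congr 1
      refine Finset.sum_congr rfl fun b hb => ?_
      rw [Finset.mem_range] at hb
      rw [mul_smul_comm, smul_mul_assoc, hp, ← mul_assoc (K * Y), ← mul_assoc (K * Y), hp,
        mul_assoc _ _ L, hpL,
        antisymPair, mul_assoc K, hKY _ _ (by omega), show k + l - (k - b) = l + b by omega,
        ← mul_assoc K]
    have hblk : K * heckeBlock q e l (k + 1) = K * heckeChain q e k l * heckeBlock q e l k * L := by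
      nth_rewrite 1 [← hKK]
      rw [mul_assoc, H.antisymPair_mul_block hm, heckeBlock, hL]
      simp only [mul_assoc]
    have hch : K * heckeChain q e k l = ((-1) ^ (l + 1) * (q : R)) •
        ((qInt q (l : ℤ) : R) • (K * antisym q e k l) -
          (((q⁻¹ : Rˣ) : R) * qInt q ((l : ℤ) + 1)) • (K * antisym q e k (l + 1))) := by
      nth_rewrite 1 [← hKr]
      rw [mul_assoc, H.antisym_mul_chain (by omega) (by omega), mul_smul_comm, mul_sub,
        mul_smul_comm, mul_smul_comm, ← mul_assoc, hKr]
    have hYA := hY (antisym q e k l) (fun i hi => (H.commute (by omega) (by omega)).symm)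
      (H.antisym_idem (by omega) (by omega))
    have hYB := hY (antisym q e k (l + 1)) (fun i hi => (H.commute (by omega) (by omega)).symm)
      (H.antisym_mul_antisym (by omega) (by omega) (by omega) (by omega))
    have hA' : ∀ b ∈ Finset.range (k + 1),
        K * antisym q e k l * antisym q e (k - b) (l + b) * L = A' b := fun b hb => by
      rw [Finset.mem_range] at hb
      rw [mul_assoc K, H.antisym_mul_antisym' (by omega) (by omega) (by omega) (by omega)]
    rw [Finset.sum_congr rfl fun b hb => by rw [hA' b hb]] at hYA
    rw [hblk, hch, smul_mul_assoc, smul_mul_assoc, sub_mul, sub_mul, smul_mul_assoc, smul_mul_assoc,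
      smul_mul_assoc, smul_mul_assoc, hYA, hYB, smul_comm _ ((-1) ^ (k + k * l) * (q : R) ^ k),
      smul_comm _ ((-1) ^ (k + k * l) * (q : R) ^ k), ← smul_sub, smul_smul, Finset.smul_sum,
      Finset.smul_sum, ← Finset.sum_sub_distrib]
    congr 1
    · rw [show k + 1 + (k + 1) * l = (l + 1) + (k + k * l) by ring, pow_add (-1 : R) (l + 1)]
      ring
    refine H.smul_cancel (k := k + 1) (by omega) (by omega) ?_
    rw [Finset.smul_sum, Finset.smul_sum]
    set c : ℕ → R := fun b => (((-q) ^ (-(b : ℤ)) : Rˣ) : R) *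
      (qBinom q (k : ℤ) b * qBinom q ((l : ℤ) + b) k) with hc
    have term : ∀ b ∈ Finset.range (k + 1), (qInt q ((k + 1 : ℕ) : ℤ) : R) •
        ((qInt q (l : ℤ) : R) • c b • A' b - (((q⁻¹ : Rˣ) : R) * qInt q ((l : ℤ) +
          1)) • c b • B' b) =
        (c b * (qInt q ((l : ℤ) + b + 1) * (qInt q ((k : ℤ) - b) - ((q⁻¹ : Rˣ) : R) *
          qInt q ((k : ℤ) - b + 1)))) • V (b + 1) +
        (c b * (qInt q ((l : ℤ) + b - k) * ((q ^ (b : ℤ) : Rˣ) : R))) • V b := by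
      intro b hb
      rw [Finset.mem_range] at hb
      -- For `l + b < k` the reduction is not available, but the binomial in `c b` is zero.
      rcases Nat.lt_or_ge (l + b) k with h1 | h1
      · have : c b = 0 := by
          have := H.units.qBinom_eq_zero (k := l + b) (l := k) (by omega) h1
          push_cast at this
          rw [hc]
          simp only [this, mul_zero]
        rw [this]
        simp
      obtain ⟨rA, rB⟩ := hAB b (by omega) h1
      rw [← qInt_add_one H.units.sub_inv]
      push_cast
      rw [show (k : ℤ) - b + 1 = k + 1 - b by ring]
      linear_combination (norm := module) c b • rA - (c b * ((q⁻¹ : Rˣ) : R)) • rB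
    rw [Finset.sum_congr rfl term, Finset.sum_add_distrib, Finset.sum_range_succ' _ (k + 1)]
    -- A zero term at `b = k + 1` gives the sum over `V b` the same range as the target, so that
    -- both can be split off at `b = 0` and compared.
    have last : c (k + 1) = 0 := by
      have := H.units.qBinom_eq_zero (k := k) (l := k + 1) (by omega) (by omega)
      rw [hc]
      simp only [this, mul_zero, zero_mul]
    have ext : ∑ b ∈ Finset.range (k + 1),
        (c b * (qInt q ((l : ℤ) + b - k) * ((q ^ (b : ℤ) : Rˣ) : R))) • V b =
        ∑ b ∈ Finset.range (k + 2),
        (c b * (qInt q ((l : ℤ) + b - k) * ((q ^ (b : ℤ) : Rˣ) : R))) • V b := by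
      rw [Finset.sum_range_succ _ (k + 1), last, zero_mul, zero_smul, add_zero]
    rw [ext, Finset.sum_range_succ' _ (k + 1), ← add_assoc, ← Finset.sum_add_distrib]
    congr 1
    · refine Finset.sum_congr rfl fun b hb => ?_
      rw [Finset.mem_range] at hb
      rw [← add_smul, smul_smul]
      congr 1
      -- The coefficient of `V (b + 1)`: Pascal's identity for the binomial in `k`, one-step
      -- identities for the binomial in `l + b`, and `p4` for the powers of `q`.
      have p1 := H.units.qBinom_pascal (b := b) (by omega) (k : ℤ)
      have p2 := H.units.qInt_mul_qBinom (k := k) (by omega) ((l : ℤ) + b)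
      have p3 := H.units.qInt_mul_qBinom_succ (t := k) (by omega) ((l : ℤ) + b + 1)
      have p4 := qInt_add_one' H.units.sub_inv ((k : ℤ) - b)
      have p5 := neg_zpow_succ q b
      rw [neg_sub] at p4
      rw [hc]
      simp only
      rw [p5]
      push_cast at p1 p3 ⊢
      rw [← add_assoc, p1]
      set z : R := (((-q) ^ (-((b : ℤ) + 1)) : Rˣ) : R)
      set B1 : R := qBinom q (k : ℤ) b
      set B2 : R := qBinom q (k : ℤ) (b + 1)
      have hqq : (q : R) * ((q⁻¹ : Rˣ) : R) = 1 := by simp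
      linear_combination (-(q : R) * z * B1 * (qInt q ((k : ℤ) - b) - ((q⁻¹ : Rˣ) : R) *
        qInt q ((k : ℤ) - b + 1))) * p2 - z * (((q ^ ((b : ℤ) + 1) : Rˣ) : R) * B2 +
        ((q ^ ((b : ℤ) - k) : Rˣ) : R) * B1) * p3 + z * B1 * (qInt q ((l : ℤ) + b + 1 - k) *
        qBinom q ((l : ℤ) + b + 1) k) * (p4 + qInt q ((k : ℤ) - b + 1) * hqq)
    · rw [smul_smul]
      congr 1
      have p3 := H.units.qInt_mul_qBinom_succ (t := k) (by omega) (l : ℤ)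
      rw [hc]
      simp only [qBinom_zero, Nat.cast_zero, add_zero, neg_zero, zpow_zero, Units.val_one, one_mul,
        mul_one]
      push_cast
      linear_combination -p3

end HeckeData

end HeckeBraidExpansion

/-! ### Strictification of spider categories. -/

noncomputable section SpiderMorphisms

open SpiderSignature SpiderSignature.Diagram Spider

variable {S : SpiderSignature} {R : Type u} [CommRing R] {rel : S.Relators R}

namespace Spider

/-- Transport of a morphism along equalities of its boundary words. -/
def hcast {a a' b b' : List S.Letter} (ha : a = a') (hb : b = b') (x : SHom rel a b) :
    SHom rel a' b' := ha ▸ hb ▸ x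

theorem hcast_rfl {a b : List S.Letter} (x : SHom rel a b) : hcast rfl rfl x = x := rfl

theorem hcast_add {a a' b b' : List S.Letter} (ha : a = a') (hb : b = b') (x y : SHom rel a b) :
    hcast ha hb (x + y) = hcast ha hb x + hcast ha hb y := by
  subst ha hb; rfl

theorem hcast_smul {a a' b b' : List S.Letter} (ha : a = a') (hb : b = b') (r : R)
    (x : SHom rel a b) : hcast ha hb (r • x) = r • hcast ha hb x := by
  subst ha hb; rfl

theorem hcast_zero {a a' b b' : List S.Letter} (ha : a = a') (hb : b = b') :
    hcast ha hb (0 : SHom rel a b) = 0 := by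
  subst ha hb; rfl

theorem hcomp_add {a b c : List S.Letter} (x : SHom rel a b) (y y' : SHom rel b c) :
    hcomp x (y + y') = hcomp x y + hcomp x y' :=
  Preadditive.comp_add (⟨a⟩ : Spider S R rel) ⟨b⟩ ⟨c⟩ x y y'

theorem add_hcomp {a b c : List S.Letter} (x x' : SHom rel a b) (y : SHom rel b c) :
    hcomp (x + x') y = hcomp x y + hcomp x' y :=
  Preadditive.add_comp (⟨a⟩ : Spider S R rel) ⟨b⟩ ⟨c⟩ x x' y

theorem smul_hcomp {a b c : List S.Letter} (r : R) (x : SHom rel a b) (y : SHom rel b c) :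
    hcomp (r • x) y = r • hcomp x y :=
  Linear.smul_comp (⟨a⟩ : Spider S R rel) ⟨b⟩ ⟨c⟩ r x y

theorem hcomp_smul {a b c : List S.Letter} (r : R) (x : SHom rel a b) (y : SHom rel b c) :
    hcomp x (r • y) = r • hcomp x y :=
  Linear.comp_smul (⟨a⟩ : Spider S R rel) ⟨b⟩ ⟨c⟩ x r y

theorem add_htensor {a b c d : List S.Letter} (x x' : SHom rel a b) (y : SHom rel c d) :
    htensor (x + x') y = htensor x y + htensor x' y := by
  induction x using ind; induction x' using ind; induction y using ind
  exact sound (.add_tensor _ _ _)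

theorem htensor_add {a b c d : List S.Letter} (x : SHom rel a b) (y y' : SHom rel c d) :
    htensor x (y + y') = htensor x y + htensor x y' := by
  induction x using ind; induction y using ind; induction y' using ind
  exact sound (.tensor_add _ _ _)

theorem smul_htensor {a b c d : List S.Letter} (r : R) (x : SHom rel a b) (y : SHom rel c d) :
    htensor (r • x) y = r • htensor x y := by
  induction x using ind; induction y using ind
  exact sound (.smul_tensor _ _ _)

theorem htensor_smul {a b c d : List S.Letter} (r : R) (x : SHom rel a b) (y : SHom rel c d) :
    htensor x (r • y) = r • htensor x y := by
  induction x using ind; induction y using ind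
  exact sound (.tensor_smul _ _ _)

/-- A morphism together with its boundary words. The tensor product of such morphisms is strictly
associative. -/
@[ext]
structure Mor (rel : S.Relators R) where
  dom : List S.Letter
  cod : List S.Letter
  hom : SHom rel dom cod

namespace Mor

/-- The identity of a word. -/
def id (rel : S.Relators R) (a : List S.Letter) : Mor rel := ⟨a, a, ofDiagram rel (idd a)⟩

instance : Mul (Mor rel) := ⟨fun x y => ⟨x.dom ++ y.dom, x.cod ++ y.cod, htensor x.hom y.hom⟩⟩

instance : One (Mor rel) := ⟨id rel []⟩

instance : SMul R (Mor rel) := ⟨fun r x => ⟨x.dom, x.cod, r • x.hom⟩⟩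

/-- Stacking of morphisms; if the boundary words do not match, the value is the first morphism. -/
def comp (x y : Mor rel) : Mor rel :=
  open scoped Classical in
  if h : x.cod = y.dom then ⟨x.dom, y.cod, hcomp x.hom (hcast h.symm rfl y.hom)⟩ else x

scoped infixl:65 " ⋆ " => Mor.comp

/-- Equations are proved between bundled morphisms, where no transport along equalities of words
occurs, and are brought back to hom sets by this. -/
theorem mk_inj {a b : List S.Letter} {x y : SHom rel a b}
    (h : (⟨a, b, x⟩ : Mor rel) = ⟨a, b, y⟩) : x = y := by
  simpa using h

theorem mk_hcast {a a' b b' : List S.Letter} (ha : a = a') (hb : b = b') (x : SHom rel a b) :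
    (⟨a', b', hcast ha hb x⟩ : Mor rel) = ⟨a, b, x⟩ := by
  subst ha hb; rfl

theorem mk_hcomp {a b c : List S.Letter} (x : SHom rel a b) (y : SHom rel b c) :
    (⟨a, c, hcomp x y⟩ : Mor rel) = ⟨a, b, x⟩ ⋆ ⟨b, c, y⟩ := by
  simp [comp, hcast_rfl]

theorem mk_htensor {a b c d : List S.Letter} (x : SHom rel a b) (y : SHom rel c d) :
    (⟨a ++ c, b ++ d, htensor x y⟩ : Mor rel) = ⟨a, b, x⟩ * ⟨c, d, y⟩ := rfl

theorem mk_smul {a b : List S.Letter} (r : R) (x : SHom rel a b) :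
    (⟨a, b, r • x⟩ : Mor rel) = r • (⟨a, b, x⟩ : Mor rel) := rfl

/-- Structural isomorphisms between equal words become identities when the boundary is bundled. This
is what makes the calculus strict. -/
theorem mk_eqTo {a b : List S.Letter} (h : a = b) :
    (⟨a, b, ofDiagram rel (eqTo h)⟩ : Mor rel) = id rel a := by
  subst h; rfl

theorem mk_comp {a b c : List S.Letter} (f : S.Diagram R a b) (g : S.Diagram R b c) :
    (⟨a, c, ofDiagram rel (f.comp g)⟩ : Mor rel) =
      ⟨a, b, ofDiagram rel f⟩ ⋆ ⟨b, c, ofDiagram rel g⟩ :=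
  mk_hcomp (ofDiagram rel f) (ofDiagram rel g)

theorem mk_tensor {a b c d : List S.Letter} (f : S.Diagram R a b) (g : S.Diagram R c d) :
    (⟨a ++ c, b ++ d, ofDiagram rel (f.tensor g)⟩ : Mor rel) =
      ⟨a, b, ofDiagram rel f⟩ * ⟨c, d, ofDiagram rel g⟩ := rfl

theorem mk_diag_smul {a b : List S.Letter} (r : R) (f : S.Diagram R a b) :
    (⟨a, b, ofDiagram rel (f.smul r)⟩ : Mor rel) = r • (⟨a, b, ofDiagram rel f⟩ : Mor rel) := rfl

theorem ext_of {x y : Mor rel} (hd : y.dom = x.dom) (hc : y.cod = x.cod)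
    (h : x.hom = hcast hd hc y.hom) : x = y := by
  obtain ⟨a, b, x⟩ := x
  obtain ⟨a', b', y⟩ := y
  dsimp only at hd hc
  subst hd hc
  simp only at h
  rw [h]
  rfl

@[simp] theorem id_dom (a : List S.Letter) : (id rel a).dom = a := (rfl)
@[simp] theorem id_cod (a : List S.Letter) : (id rel a).cod = a := (rfl)
@[simp] theorem mul_dom (x y : Mor rel) : (x * y).dom = x.dom ++ y.dom := (rfl)
@[simp] theorem mul_cod (x y : Mor rel) : (x * y).cod = x.cod ++ y.cod := (rfl)
@[simp] theorem smul_dom (r : R) (x : Mor rel) : (r • x).dom = x.dom := (rfl)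
@[simp] theorem smul_cod (r : R) (x : Mor rel) : (r • x).cod = x.cod := (rfl)

@[simp] theorem comp_dom (x y : Mor rel) : (x ⋆ y).dom = x.dom := by
  unfold comp; split <;> rfl

@[simp] theorem comp_cod (x y : Mor rel) (h : x.cod = y.dom) : (x ⋆ y).cod = y.cod := by
  unfold comp; rw [dif_pos h]

theorem id_nil : id rel [] = 1 := rfl

theorem id_append (a b : List S.Letter) : id rel (a ++ b) = id rel a * id rel b := by
  refine ext_of rfl rfl ?_
  exact sound (.symm (.tensor_id a b))

theorem id_comp (x : Mor rel) {a : List S.Letter} (h : a = x.dom) : id rel a ⋆ x = x := by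
  subst h
  obtain ⟨a, b, x⟩ := x
  rw [id, ← mk_hcomp]
  induction x using ind
  exact congrArg _ (sound (.id_comp _))

theorem comp_id (x : Mor rel) {a : List S.Letter} (h : a = x.cod) : x ⋆ id rel a = x := by
  subst h
  obtain ⟨a, b, x⟩ := x
  rw [id, ← mk_hcomp]
  induction x using ind
  exact congrArg _ (sound (.comp_id _))

/-- The axioms `tensor_assoc` and `tensor_nil` hold up to structural isomorphisms, which are
invisible in `Mor`; the tensor product thus becomes a monoid multiplication. -/
instance : Monoid (Mor rel) where
  mul_assoc x y z := by
    obtain ⟨a, a', x⟩ := x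
    obtain ⟨b, b', y⟩ := y
    obtain ⟨c, c', z⟩ := z
    induction x using ind with | _ f
    induction y using ind with | _ g
    induction z using ind with | _ k
    have h := congrArg (Mor.mk _ _) (sound (rel := rel) (.tensor_assoc f g k))
    rw [mk_comp, mk_comp, mk_eqTo, mk_eqTo, mk_tensor, mk_tensor, mk_tensor, mk_tensor] at h
    exact ((comp_id _ rfl).symm.trans h).trans (id_comp _ (List.append_assoc _ _ _))
  one_mul x := by
    obtain ⟨a, a', x⟩ := x
    induction x using ind with | _ f
    exact ext_of rfl rfl (sound (.nil_tensor f))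
  mul_one x := by
    obtain ⟨a, a', x⟩ := x
    induction x using ind with | _ f
    have h := congrArg (Mor.mk _ _) (sound (rel := rel) (.tensor_nil f))
    rw [mk_comp, mk_comp, mk_eqTo, mk_eqTo, mk_tensor] at h
    exact ((comp_id _ rfl).symm.trans h).trans (id_comp _ (List.append_nil _))

theorem id_comp_id (a : List S.Letter) : id rel a ⋆ id rel a = id rel a := comp_id _ rfl

theorem comp_assoc (x y z : Mor rel) (h : x.cod = y.dom) (h' : y.cod = z.dom) :
    x ⋆ y ⋆ z = x ⋆ (y ⋆ z) := by
  obtain ⟨a, b, x⟩ := x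
  obtain ⟨b, c, y⟩ := y
  obtain ⟨c, d, z⟩ := z
  dsimp only at h h'
  subst h h'
  rw [← mk_hcomp, ← mk_hcomp, ← mk_hcomp, ← mk_hcomp]
  induction x using ind; induction y using ind; induction z using ind
  exact congrArg _ (sound (.comp_assoc _ _ _))

theorem interchange (x y x' y' : Mor rel) (h : x.cod = y.dom) (h' : x'.cod = y'.dom) :
    (x * x') ⋆ (y * y') = (x ⋆ y) * (x' ⋆ y') := by
  obtain ⟨a, b, x⟩ := x
  obtain ⟨b, c, y⟩ := y
  obtain ⟨a', b', x'⟩ := x'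
  obtain ⟨b', c', y'⟩ := y'
  dsimp only at h h'
  subst h h'
  rw [← mk_htensor, ← mk_htensor, ← mk_hcomp, ← mk_hcomp, ← mk_hcomp, ← mk_htensor]
  induction x using ind; induction y using ind; induction x' using ind; induction y' using ind
  exact congrArg _ (sound (.interchange _ _ _ _))

theorem smul_mul (r : R) (x y : Mor rel) : (r • x) * y = r • (x * y) :=
  ext_of rfl rfl (smul_htensor r x.hom y.hom)

theorem mul_smul (r : R) (x y : Mor rel) : x * (r • y) = r • (x * y) :=
  ext_of rfl rfl (htensor_smul r x.hom y.hom)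

theorem smul_comp (r : R) (x y : Mor rel) (h : x.cod = y.dom) : (r • x) ⋆ y = r • (x ⋆ y) := by
  obtain ⟨a, b, x⟩ := x
  obtain ⟨b, c, y⟩ := y
  dsimp only at h
  subst h
  rw [← mk_smul, ← mk_hcomp, ← mk_hcomp, smul_hcomp, mk_smul]

theorem comp_smul (r : R) (x y : Mor rel) (h : x.cod = y.dom) : x ⋆ (r • y) = r • (x ⋆ y) := by
  obtain ⟨a, b, x⟩ := x
  obtain ⟨b, c, y⟩ := y
  dsimp only at h
  subst h
  rw [← mk_smul, ← mk_hcomp, ← mk_hcomp, hcomp_smul, mk_smul]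

theorem smul_smul' (r s : R) (x : Mor rel) : r • s • x = (r * s) • x :=
  ext_of rfl rfl (smul_smul r s x.hom)

theorem one_smul' (x : Mor rel) : (1 : R) • x = x := ext_of rfl rfl (one_smul R x.hom)

theorem smul_left_cancel {r : R} (hr : IsUnit r) {x y : Mor rel} (h : r • x = r • y) : x = y := by
  obtain ⟨u, rfl⟩ := hr
  have := congrArg (((u⁻¹ : Rˣ) : R) • ·) h
  simpa only [smul_smul', Units.inv_mul, one_smul'] using this

/-- Sliding two morphisms past each other. -/
theorem mul_eq_left (x y : Mor rel) : x * y = (x * id rel y.dom) ⋆ (id rel x.cod * y) := by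
  rw [interchange _ _ _ _ rfl rfl, comp_id _ rfl, id_comp _ rfl]

theorem mul_eq_right (x y : Mor rel) : x * y = (id rel x.dom * y) ⋆ (x * id rel y.cod) := by
  rw [interchange _ _ _ _ rfl rfl, comp_id _ rfl, id_comp _ rfl]

theorem mul_comp_id (x y : Mor rel) (h : x.cod = y.dom) (a : List S.Letter) :
    (x ⋆ y) * id rel a = (x * id rel a) ⋆ (y * id rel a) := by
  rw [interchange _ _ _ _ h rfl, id_comp_id]

theorem id_mul_comp (x y : Mor rel) (h : x.cod = y.dom) (a : List S.Letter) :
    id rel a * (x ⋆ y) = (id rel a * x) ⋆ (id rel a * y) := by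
  rw [interchange _ _ _ _ rfl h, id_comp_id]

end Mor

end Spider

end SpiderMorphisms

/-! ### Transposition of morphisms. -/

noncomputable section Rotation

open SpiderSignature SpiderSignature.Diagram Spider

variable {S : SpiderSignature} {R : Type u} [CommRing R] {rel : S.Relators R}

attribute [local simp] SpiderSignature.dual_dual SpiderSignature.dual_append

@[simp] theorem SpiderSignature.dual_nil : S.dual [] = [] := (rfl)

namespace Spider

namespace Mor

open scoped Spider.Mor

/-- The counit of the duality between a word and its dual. -/
def cap (rel : S.Relators R) (a : List S.Letter) : Mor rel :=
  ⟨S.dual a ++ a, [], ofDiagram rel (.cap a (S.dual a) rfl)⟩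

/-- The unit of the duality between a word and its dual. -/
def cup (rel : S.Relators R) (a : List S.Letter) : Mor rel :=
  ⟨[], a ++ S.dual a, ofDiagram rel (.cup a (S.dual a) rfl)⟩

/-- The positive crossing. -/
def braid (rel : S.Relators R) (a b : List S.Letter) : Mor rel :=
  ⟨a ++ b, b ++ a, ofDiagram rel (.braid a b)⟩

/-- The inverse of the positive crossing. -/
def braidInv (rel : S.Relators R) (a b : List S.Letter) : Mor rel :=
  ⟨b ++ a, a ++ b, ofDiagram rel (.braidInv a b)⟩

@[simp] theorem cap_dom (a : List S.Letter) : (cap rel a).dom = S.dual a ++ a := (rfl)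
@[simp] theorem cap_cod (a : List S.Letter) : (cap rel a).cod = [] := (rfl)
@[simp] theorem cup_dom (a : List S.Letter) : (cup rel a).dom = [] := (rfl)
@[simp] theorem cup_cod (a : List S.Letter) : (cup rel a).cod = a ++ S.dual a := (rfl)
@[simp] theorem braid_dom (a b : List S.Letter) : (braid rel a b).dom = a ++ b := (rfl)
@[simp] theorem braid_cod (a b : List S.Letter) : (braid rel a b).cod = b ++ a := (rfl)
@[simp] theorem braidInv_dom (a b : List S.Letter) : (braidInv rel a b).dom = b ++ a := (rfl)
@[simp] theorem braidInv_cod (a b : List S.Letter) : (braidInv rel a b).cod = a ++ b := (rfl)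

theorem mk_cap (a b : List S.Letter) (h : b = S.dual a) :
    (⟨b ++ a, [], ofDiagram rel (.cap a b h)⟩ : Mor rel) = cap rel a := by
  subst h; rfl

theorem mk_cup (a b : List S.Letter) (h : b = S.dual a) :
    (⟨[], a ++ b, ofDiagram rel (.cup a b h)⟩ : Mor rel) = cup rel a := by
  subst h; rfl

theorem cap_nil : cap rel [] = 1 := congrArg (Mor.mk _ _) (sound .cap_nil)

theorem cap_append (a b : List S.Letter) :
    cap rel (a ++ b) = (id rel (S.dual b) * cap rel a * id rel b) ⋆ cap rel b := by
  have h := congrArg (Mor.mk _ _) (sound (rel := rel) (.cap_append a b _ _ rfl rfl))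
  simp only [mk_comp, mk_tensor, mk_eqTo, mk_cap] at h
  refine (h.trans (congrArg (· ⋆ cap rel b) (id_comp _ ?_))).trans ?_
  · simp
  · rw [← mul_assoc]

theorem zigzag_left (a : List S.Letter) :
    (cup rel a * id rel a) ⋆ (id rel a * cap rel a) = id rel a := by
  have h := congrArg (Mor.mk _ _) (sound (rel := rel) (.zigzag_left a _ rfl))
  simp only [mk_comp, mk_tensor, mk_eqTo, mk_cap, mk_cup] at h
  rw [comp_id _ (by simp)] at h
  exact h

theorem zigzag_right (a : List S.Letter) :
    (id rel (S.dual a) * cup rel a) ⋆ (cap rel a * id rel (S.dual a)) = id rel (S.dual a) := by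
  have h := congrArg (Mor.mk _ _) (sound (rel := rel) (.zigzag_right a _ rfl))
  simp only [mk_comp, mk_tensor, mk_eqTo, mk_cap, mk_cup] at h
  rw [comp_id _ (by simp)] at h
  simpa [id_append] using h

theorem braid_braidInv (a b : List S.Letter) :
    braid rel a b ⋆ braidInv rel a b = id rel (a ++ b) := by
  have h := congrArg (Mor.mk _ _) (sound (rel := rel) (.braid_braidInv a b))
  rwa [mk_comp, mk_eqTo] at h

theorem braidInv_braid (a b : List S.Letter) :
    braidInv rel a b ⋆ braid rel a b = id rel (b ++ a) := by
  have h := congrArg (Mor.mk _ _) (sound (rel := rel) (.braidInv_braid a b))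
  rwa [mk_comp, mk_eqTo] at h

theorem braid_natural (x y : Mor rel) :
    (x * y) ⋆ braid rel x.cod y.cod = braid rel x.dom y.dom ⋆ (y * x) := by
  obtain ⟨a, a', x⟩ := x
  obtain ⟨b, b', y⟩ := y
  induction x using ind with | _ f
  induction y using ind with | _ g
  have h := congrArg (Mor.mk _ _) (sound (rel := rel) (.braid_natural f g))
  rwa [mk_comp, mk_comp, mk_tensor, mk_tensor] at h

theorem braid_append_right (a b c : List S.Letter) :
    braid rel a (b ++ c) = (braid rel a b * id rel c) ⋆ (id rel b * braid rel a c) := by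
  have h := congrArg (Mor.mk _ _) (sound (rel := rel) (.braid_append_right a b c))
  simp only [mk_comp, mk_tensor, mk_eqTo] at h
  rw [comp_id _ (by rw [comp_cod _ _ (by simp)]), comp_id _ (by simp)] at h
  exact (id_comp _ (by simp)).symm.trans h

theorem braid_append_left (a b c : List S.Letter) :
    braid rel (a ++ b) c = (id rel a * braid rel b c) ⋆ (braid rel a c * id rel b) := by
  have h := congrArg (Mor.mk _ _) (sound (rel := rel) (.braid_append_left a b c))
  simp only [mk_comp, mk_tensor, mk_eqTo] at h
  rw [comp_id _ (by rw [comp_cod _ _ (by simp)]), comp_id _ (by simp)] at h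
  exact (id_comp _ (by simp)).symm.trans h

/-- Bending a morphism down and up again. -/
theorem bend (x : Mor rel) (a : List S.Letter) (h : x.cod = S.dual a) :
    (id rel x.dom * cup rel a) ⋆ (((x * id rel a) ⋆ cap rel a) * id rel (S.dual a)) = x := by
  rw [mul_comp_id _ _ (by simp [h]), ← comp_assoc _ _ _ (by simp) (by simp [h]), mul_assoc x,
    ← id_append, interchange _ _ _ _ (by simp) (by simp), id_comp _ rfl, comp_id _ (by simp),
    mul_eq_left, cup_dom, id_nil, mul_one, h, comp_assoc _ _ _ (by simp [h]) (by simp),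
    zigzag_right, comp_id _ h.symm]

/-- Bending can be undone, so a morphism is determined by its bent form. Transposes are therefore
unique. -/
theorem cap_ext {x y : Mor rel} (a : List S.Letter) (hx : x.cod = S.dual a)
    (hy : y.cod = S.dual a) (hd : x.dom = y.dom)
    (h : (x * id rel a) ⋆ cap rel a = (y * id rel a) ⋆ cap rel a) : x = y := by
  rw [← bend x a hx, ← bend y a hy, h, hd]

end Mor

/-- `SkeinEq` contains no congruence rule for `rot`. The rule follows because the equation `rot_cap`
determines the class of the rotated diagram. -/
theorem rot_congr {a b : List S.Letter} {f g : S.Diagram R a b} (h : SkeinEq rel f g) :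
    SkeinEq rel f.rot g.rot := by
  have e : ∀ f : S.Diagram R a b,
      (⟨_, _, ofDiagram rel f.rot⟩ * Mor.id rel a).comp (Mor.cap rel a) =
        (Mor.id rel (S.dual b) * ⟨_, _, ofDiagram rel f⟩).comp (Mor.cap rel b) := fun f => by
    have h := congrArg (Mor.mk _ _) (sound (rel := rel) (.rot_cap f))
    rw [Mor.mk_comp, Mor.mk_comp, Mor.mk_tensor, Mor.mk_tensor] at h; exact h
  have h' := Mor.mk_inj (Mor.cap_ext (x := ⟨_, _, ofDiagram rel f.rot⟩)
    (y := ⟨_, _, ofDiagram rel g.rot⟩) a rfl rfl rfl (by rw [e, e, sound h]))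
  exact Quotient.exact (s := homSetoid rel _ _) h'

/-- Rotation of a morphism by half a turn. -/
def hrot {a b : List S.Letter} (x : SHom rel a b) : SHom rel (S.dual b) (S.dual a) :=
  Quotient.map (sa := homSetoid rel a b) (sb := homSetoid rel (S.dual b) (S.dual a))
    Diagram.rot (fun _ _ h => rot_congr h) x

namespace Mor

open scoped Spider.Mor

/-- Rotation of a morphism by half a turn. -/
def rot (x : Mor rel) : Mor rel := ⟨S.dual x.cod, S.dual x.dom, hrot x.hom⟩

@[simp] theorem rot_dom (x : Mor rel) : x.rot.dom = S.dual x.cod := (rfl)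
@[simp] theorem rot_cod (x : Mor rel) : x.rot.cod = S.dual x.dom := (rfl)

theorem mk_rot {a b : List S.Letter} (f : S.Diagram R a b) :
    (⟨_, _, ofDiagram rel f.rot⟩ : Mor rel) = rot ⟨_, _, ofDiagram rel f⟩ := rfl

theorem rot_cap (x : Mor rel) :
    (x.rot * id rel x.dom) ⋆ cap rel x.dom = (id rel (S.dual x.cod) * x) ⋆ cap rel x.cod := by
  obtain ⟨a, b, x⟩ := x
  induction x using ind with | _ f
  have h := congrArg (Mor.mk _ _) (sound (rel := rel) (.rot_cap f))
  rw [mk_comp, mk_comp, mk_tensor, mk_tensor, mk_rot] at h; exact h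

theorem rot_cap' (x : Mor rel) :
    (id rel x.dom * x.rot) ⋆ cap rel (S.dual x.dom) =
      (x * id rel (S.dual x.cod)) ⋆ cap rel (S.dual x.cod) := by
  obtain ⟨a, b, x⟩ := x
  induction x using ind with | _ f
  have h := congrArg (Mor.mk _ _) (sound (rel := rel) (.rot_cap' f))
  rw [mk_comp, mk_comp, mk_tensor, mk_tensor, mk_rot, mk_cap, mk_cap] at h; exact h

theorem eq_rot {x y : Mor rel} (hd : y.dom = S.dual x.cod) (hc : y.cod = S.dual x.dom)
    (h : (y * id rel x.dom) ⋆ cap rel x.dom = (id rel (S.dual x.cod) * x) ⋆ cap rel x.cod) :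
    y = x.rot :=
  cap_ext x.dom hc rfl hd (h.trans (rot_cap x).symm)

theorem rot_id (a : List S.Letter) : (id rel a).rot = id rel (S.dual a) :=
  (eq_rot rfl rfl rfl).symm

theorem rot_one : (1 : Mor rel).rot = 1 := rot_id []

/-- Here pivotality enters: the second transposition equation exhibits `x` as a transpose of
`x.rot`. -/
theorem rot_rot (x : Mor rel) : x.rot.rot = x := by
  refine (eq_rot (by simp) (by simp) ?_).symm
  have h := rot_cap' x
  simp only [rot_dom, rot_cod, dual_dual]
  exact h.symm

theorem rot_comp (x y : Mor rel) (h : x.cod = y.dom) : (x ⋆ y).rot = y.rot ⋆ x.rot := by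
  have h' : y.rot.cod = x.rot.dom := by simp [h]
  refine (eq_rot (by simp [h]) (by rw [comp_cod _ _ h']; simp) ?_).symm
  rw [comp_dom, comp_cod _ _ h, mul_comp_id _ _ h',
    comp_assoc _ _ _ (by simp [h]) (by simp), rot_cap x,
    ← comp_assoc _ _ _ (by simp [h]) (by simp), h,
    interchange _ _ _ _ (by simp) (by simp), comp_id _ (by simp), id_comp _ (by simp),
    mul_eq_right, rot_dom, comp_assoc _ _ _ (by simp [h]) (by simp [h]), h, rot_cap y,
    ← comp_assoc _ _ _ (by simp [h]) (by simp), ← id_mul_comp _ _ h]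

/-- By uniqueness of transposes. The cap of a concatenation consists of nested caps; the inner one
slides `x` around and the outer one `y`. -/
theorem rot_mul (x y : Mor rel) : (x * y).rot = y.rot * x.rot := by
  refine (eq_rot (by simp) (by simp) ?_).symm
  have e : ∀ k : Mor rel, k.cod = [] → ∀ z w : Mor rel,
      z * k * w = (id rel z.dom * k * id rel w.dom) ⋆ (z * w) := fun k hk z w => by
    rw [interchange _ _ _ _ (by simp [hk]) rfl, id_comp w rfl, mul_eq_right z k, hk, id_nil,
      mul_one]
  rw [mul_dom, mul_cod, cap_append, cap_append, id_append, dual_append, id_append,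
    ← comp_assoc _ _ _ (by simp) (by simp), ← comp_assoc _ _ _ (by simp) (by simp),
    show y.rot * x.rot * (id rel x.dom * id rel y.dom) =
      y.rot * (x.rot * id rel x.dom) * id rel y.dom by simp only [mul_assoc],
    show id rel (S.dual y.cod) * id rel (S.dual x.cod) * (x * y) =
      id rel (S.dual y.cod) * (id rel (S.dual x.cod) * x) * y by simp only [mul_assoc],
    interchange _ _ _ _ (by simp) (by simp), interchange _ _ _ _ (by simp) (by simp),
    interchange _ _ _ _ (by simp) (by simp), interchange _ _ _ _ (by simp) (by simp),
    rot_cap, comp_id _ rfl, id_comp (id rel y.dom) (a := y.dom) rfl,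
    id_comp (id rel (S.dual y.cod)) (a := S.dual y.cod) rfl, comp_id y.rot (a := S.dual y.dom) rfl,
    e _ (by simp) y.rot, e _ (by simp) _ y, comp_assoc _ _ _ (by simp) (by simp), rot_dom, id_dom,
    id_dom, rot_cap, comp_assoc _ _ _ (by simp) (by simp)]

theorem rot_eq (x : Mor rel) :
    x.rot = (id rel (S.dual x.cod) * cup rel x.dom) ⋆
      (((id rel (S.dual x.cod) * x) ⋆ cap rel x.cod) * id rel (S.dual x.dom)) := by
  rw [← rot_cap]
  exact (bend x.rot x.dom rfl).symm

/-- Bending a morphism up and down again. -/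
theorem unbend (x : Mor rel) :
    (cup rel x.cod * id rel x.dom) ⋆
      (id rel x.cod * ((id rel (S.dual x.cod) * x) ⋆ cap rel x.cod)) = x := by
  rw [id_mul_comp _ _ (by simp), ← comp_assoc _ _ _ (by simp) (by simp),
    ← mul_assoc (id rel x.cod), ← id_append, interchange _ _ _ _ (by simp) (by simp),
    comp_id _ (by simp), id_comp x rfl, mul_eq_right, cup_dom, id_nil, one_mul,
    comp_assoc _ _ _ (by simp) (by simp), zigzag_left, comp_id x rfl]

/-- The axioms for rotation mention only caps; bending gives the sliding rule for cups. -/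
theorem cup_rot (x : Mor rel) :
    cup rel x.cod ⋆ (id rel x.cod * x.rot) = cup rel x.dom ⋆ (x * id rel (S.dual x.dom)) := by
  have e : ∀ y z : Mor rel, y.dom = [] → z.dom = [] →
      y ⋆ (id rel y.cod * z) = z ⋆ (y * id rel z.cod) := fun y z hy hz => by
    have h := (mul_eq_left y z).symm.trans (mul_eq_right y z)
    rwa [hy, hz, id_nil, mul_one, one_mul] at h
  rw [rot_eq, id_mul_comp _ _ (by simp), ← comp_assoc _ _ _ (by simp) (by simp),
    ← mul_assoc, ← id_append]
  have h := e (cup rel x.cod) (cup rel x.dom) rfl rfl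
  rw [cup_cod, cup_cod] at h
  rw [h, comp_assoc _ _ _ (by simp) (by simp), id_append, ← mul_assoc (cup rel x.cod),
    ← mul_assoc (id rel x.cod), interchange _ _ _ _ (by simp) (by simp),
    unbend, id_comp_id]

end Mor

end Spider

end Rotation

/-! ### Interpretations with idempotents. -/

noncomputable section Interpretations

open SpiderSignature SpiderSignature.Diagram Spider

open scoped Spider.Mor

namespace Spider.Mor

variable {S : SpiderSignature} {R : Type u} [CommRing R] {rel : S.Relators R}

attribute [local simp] SpiderSignature.dual_dual SpiderSignature.dual_append

/-- The morphism underlying a bundled morphism with prescribed boundary. -/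
def toHom (x : Mor rel) {a b : List S.Letter} (hd : x.dom = a) (hc : x.cod = b) : SHom rel a b :=
  hcast hd hc x.hom

theorem mk_toHom (x : Mor rel) {a b : List S.Letter} (hd : x.dom = a) (hc : x.cod = b) :
    (⟨a, b, x.toHom hd hc⟩ : Mor rel) = x := mk_hcast hd hc x.hom

theorem _root_.Spider.hcomp_zero {a b c : List S.Letter} (x : SHom rel a b) :
    hcomp x (0 : SHom rel b c) = 0 := by
  simpa using hcomp_smul (0 : R) x (0 : SHom rel b c)

theorem _root_.Spider.zero_hcomp {a b c : List S.Letter} (x : SHom rel b c) :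
    hcomp (0 : SHom rel a b) x = 0 := by
  simpa using smul_hcomp (0 : R) (0 : SHom rel a b) x

theorem braidInv_natural (x y : Mor rel) :
    (y * x) ⋆ braidInv rel x.cod y.cod = braidInv rel x.dom y.dom ⋆ (x * y) := by
  rw [← id_comp ((y * x) ⋆ braidInv rel x.cod y.cod) (a := y.dom ++ x.dom) (by simp),
    ← braidInv_braid, comp_assoc _ _ _ (by simp) (by simp),
    ← comp_assoc (braid rel _ _) _ _ (by simp) (by simp), ← braid_natural,
    comp_assoc _ _ _ (by simp) (by simp), braid_braidInv, comp_id _ (by simp)]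

end Spider.Mor

variable {S T : SpiderSignature} {R : Type u} [CommRing R] {rel : T.Relators R}

/-- An assignment of objects of the idempotent completion of a spider category to the letters of a
signature: words and idempotent endomorphisms of them, compatible with duality. -/
structure StrandMap (S : SpiderSignature) (rel : T.Relators R) where
  word : S.Letter → List T.Letter
  word_bar : ∀ x, word (S.bar x) = T.dual (word x)
  idem : ∀ x, SHom rel (word x) (word x)
  idem_comp_idem : ∀ x, hcomp (idem x) (idem x) = idem x
  idem_bar : ∀ x, (⟨_, _, idem (S.bar x)⟩ : Mor rel) = Mor.rot ⟨_, _, idem x⟩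

namespace StrandMap

variable (φ : StrandMap S rel)

/-- The word assigned to a word. -/
def words (a : List S.Letter) : List T.Letter := a.flatMap φ.word

@[simp] theorem words_nil : φ.words [] = [] := (rfl)

@[simp] theorem words_append (a b : List S.Letter) : φ.words (a ++ b) = φ.words a ++ φ.words b :=
  List.flatMap_append

theorem words_cons (x : S.Letter) (a : List S.Letter) :
    φ.words (x :: a) = φ.word x ++ φ.words a := rfl

theorem words_singleton (x : S.Letter) : φ.words [x] = φ.word x := List.append_nil _

@[simp] theorem words_dual (a : List S.Letter) : φ.words (S.dual a) = T.dual (φ.words a) := by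
  induction a with
  | nil => rfl
  | cons x a ih =>
    rw [show x :: a = [x] ++ a from rfl, S.dual_append, words_append, words_append,
      T.dual_append, ih]
    congr 1
    rw [show S.dual [x] = [S.bar x] from rfl, words_singleton, words_singleton, φ.word_bar]

/-- The idempotent assigned to a word. -/
def proj (a : List S.Letter) : Mor rel :=
  (a.map fun x => (⟨_, _, φ.idem x⟩ : Mor rel)).prod

theorem proj_nil : φ.proj [] = 1 := rfl

theorem proj_append (a b : List S.Letter) : φ.proj (a ++ b) = φ.proj a * φ.proj b := by
  simp [proj]

theorem proj_singleton (x : S.Letter) : φ.proj [x] = ⟨_, _, φ.idem x⟩ := by simp [proj]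

theorem proj_cons (x : S.Letter) (a : List S.Letter) :
    φ.proj (x :: a) = ⟨_, _, φ.idem x⟩ * φ.proj a := by simp [proj]

@[simp] theorem proj_dom (a : List S.Letter) : (φ.proj a).dom = φ.words a := by
  induction a with
  | nil => rfl
  | cons x a ih => rw [proj_cons, Mor.mul_dom, ih]; rfl

@[simp] theorem proj_cod (a : List S.Letter) : (φ.proj a).cod = φ.words a := by
  induction a with
  | nil => rfl
  | cons x a ih => rw [proj_cons, Mor.mul_cod, ih]; rfl

theorem proj_comp_proj (a : List S.Letter) : φ.proj a ⋆ φ.proj a = φ.proj a := by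
  induction a with
  | nil => exact Mor.id_comp_id []
  | cons x a ih =>
    rw [proj_cons, Mor.interchange _ _ _ _ rfl (by simp), ih, ← Mor.mk_hcomp, φ.idem_comp_idem]

theorem rot_proj (a : List S.Letter) : (φ.proj a).rot = φ.proj (S.dual a) := by
  induction a with
  | nil => exact Mor.rot_one
  | cons x a ih =>
    rw [show S.dual (x :: a) = S.dual a ++ [S.bar x] by simp [SpiderSignature.dual], proj_append,
      ← ih, proj_cons, Mor.rot_mul, proj_singleton, φ.idem_bar]

end StrandMap

/-- A strand map together with images of the vertices. -/
structure Interpretation (S : SpiderSignature) (rel : T.Relators R) extends StrandMap S rel where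
  vertex : ∀ {a b : List S.Letter}, S.Vertex a b →
    SHom rel (toStrandMap.words a) (toStrandMap.words b)
  proj_comp_vertex : ∀ {a b : List S.Letter} (x : S.Vertex a b),
    toStrandMap.proj a ⋆ ⟨_, _, vertex x⟩ = ⟨_, _, vertex x⟩
  vertex_comp_proj : ∀ {a b : List S.Letter} (x : S.Vertex a b),
    (⟨_, _, vertex x⟩ : Mor rel) ⋆ toStrandMap.proj b = ⟨_, _, vertex x⟩

namespace Interpretation

open StrandMap

variable (φ : Interpretation S rel)

/-- The morphism assigned to a diagram. -/
def eval : ∀ {a b : List S.Letter}, S.Diagram R a b → SHom rel (φ.words a) (φ.words b)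
  -- Identities go to idempotents, as in an idempotent completion. Cups, caps and crossings are
  -- composed with the idempotents of their boundaries.
  | _, _, .eqTo (a := a) h => (φ.proj a).toHom (by simp) (by simp [h])
  | _, _, .comp f g => hcomp (eval f) (eval g)
  | _, _, .tensor f g =>
    hcast (φ.words_append _ _).symm (φ.words_append _ _).symm (htensor (eval f) (eval g))
  | _, _, .zero => 0
  | _, _, .add f g => eval f + eval g
  | _, _, .smul r f => r • eval f
  | _, _, .vertex x => φ.vertex x
  | _, _, .cup a b h =>
    (Mor.cup rel (φ.words a) ⋆ (φ.proj a * Mor.id rel (T.dual (φ.words a)))).toHom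
      (by simp) (by simp [h])
  | _, _, .cap a b h =>
    ((Mor.id rel (T.dual (φ.words a)) * φ.proj a) ⋆ Mor.cap rel (φ.words a)).toHom
      (by simp [h]) (by simp)
  | _, _, .braid a b =>
    ((φ.proj a * φ.proj b) ⋆ Mor.braid rel (φ.words a) (φ.words b)).toHom (by simp) (by simp)
  | _, _, .braidInv a b =>
    ((φ.proj b * φ.proj a) ⋆ Mor.braidInv rel (φ.words a) (φ.words b)).toHom (by simp) (by simp)
  | _, _, .rot f => hcast (φ.words_dual _).symm (φ.words_dual _).symm (hrot (eval f))

/-- The bundled morphism assigned to a diagram. -/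
def mor {a b : List S.Letter} (f : S.Diagram R a b) : Mor rel := ⟨_, _, φ.eval f⟩

variable {a b c d : List S.Letter}

@[simp] theorem mor_dom (f : S.Diagram R a b) : (φ.mor f).dom = φ.words a := (rfl)
@[simp] theorem mor_cod (f : S.Diagram R a b) : (φ.mor f).cod = φ.words b := (rfl)

theorem mor_eqTo (h : a = b) : φ.mor (eqTo h) = φ.proj a := by
  rw [mor, eval, Mor.mk_toHom]

theorem mor_comp (f : S.Diagram R a b) (g : S.Diagram R b c) :
    φ.mor (f.comp g) = φ.mor f ⋆ φ.mor g := by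
  rw [mor, eval, Mor.mk_hcomp]; rfl

theorem mor_tensor (f : S.Diagram R a b) (g : S.Diagram R c d) :
    φ.mor (f.tensor g) = φ.mor f * φ.mor g := by
  rw [mor, eval, Mor.mk_hcast]; rfl

theorem mor_smul (r : R) (f : S.Diagram R a b) : φ.mor (f.smul r) = r • φ.mor f := by
  rw [mor, eval]; rfl

theorem mor_vertex (x : S.Vertex a b) : φ.mor (.vertex x : S.Diagram R a b) =
    ⟨_, _, φ.vertex x⟩ := by
  rw [mor, eval]

theorem mor_cup (h : b = S.dual a) : φ.mor (.cup a b h) =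
    Mor.cup rel (φ.words a) ⋆ (φ.proj a * Mor.id rel (T.dual (φ.words a))) := by
  rw [mor, eval, Mor.mk_toHom]

theorem mor_cap (h : b = S.dual a) : φ.mor (.cap a b h) =
    (Mor.id rel (T.dual (φ.words a)) * φ.proj a) ⋆ Mor.cap rel (φ.words a) := by
  rw [mor, eval, Mor.mk_toHom]

theorem mor_braid : φ.mor (.braid a b) =
    (φ.proj a * φ.proj b) ⋆ Mor.braid rel (φ.words a) (φ.words b) := by
  rw [mor, eval, Mor.mk_toHom]

theorem mor_braidInv : φ.mor (.braidInv a b) =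
    (φ.proj b * φ.proj a) ⋆ Mor.braidInv rel (φ.words a) (φ.words b) := by
  rw [mor, eval, Mor.mk_toHom]

theorem mor_rot (f : S.Diagram R a b) : φ.mor f.rot = (φ.mor f).rot := by
  rw [mor, eval, Mor.mk_hcast]; rfl

/-- An idempotent on one leg of the cup slides around to its transpose on the other leg. -/
theorem mor_cup' (h : b = S.dual a) : φ.mor (.cup a b h) =
    Mor.cup rel (φ.words a) ⋆ (Mor.id rel (φ.words a) * φ.proj (S.dual a)) := by
  have := Mor.cup_rot (φ.proj a)
  rw [proj_cod, proj_dom, rot_proj] at this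
  rw [mor_cup, this]

theorem mor_cap' (h : b = S.dual a) : φ.mor (.cap a b h) =
    (φ.proj (S.dual a) * Mor.id rel (φ.words a)) ⋆ Mor.cap rel (φ.words a) := by
  have := Mor.rot_cap (φ.proj a)
  rw [proj_cod, proj_dom, rot_proj] at this
  rw [mor_cap, this]

theorem mor_cup_both (h : b = S.dual a) :
    Mor.cup rel (φ.words a) ⋆ (φ.proj a * φ.proj (S.dual a)) = φ.mor (.cup a b h) := by
  rw [Mor.mul_eq_left, ← Mor.comp_assoc _ _ _ (by simp) (by simp), proj_cod, proj_dom,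
    words_dual, ← mor_cup _ h, mor_cup', Mor.comp_assoc _ _ _ (by simp) (by simp),
    Mor.interchange _ _ _ _ (by simp) (by simp), proj_comp_proj, Mor.id_comp_id]

theorem mor_cap_both (h : b = S.dual a) :
    (φ.proj (S.dual a) * φ.proj a) ⋆ Mor.cap rel (φ.words a) = φ.mor (.cap a b h) := by
  rw [Mor.mul_eq_left, Mor.comp_assoc _ _ _ (by simp) (by simp), proj_cod, proj_dom,
    words_dual, ← mor_cap _ h, mor_cap', ← Mor.comp_assoc _ _ _ (by simp) (by simp),
    Mor.interchange _ _ _ _ (by simp) (by simp), proj_comp_proj, Mor.id_comp_id]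

theorem mor_zero : φ.mor (.zero : S.Diagram R a b) =
    ⟨φ.words a, φ.words b, 0⟩ := by
  rw [mor, eval]

/-- Induction on the diagram. For cups and caps the idempotent may sit on either leg, for crossings
it passes by naturality. Consequently the idempotents act as identities on all images, which the
unit laws in `eval_congr` require. -/
theorem mor_absorb (f : S.Diagram R a b) :
    φ.proj a ⋆ φ.mor f = φ.mor f ∧ φ.mor f ⋆ φ.proj b = φ.mor f := by
  have hl : ∀ {a b : List S.Letter} (x : SHom rel (φ.words a) (φ.words b)),
      φ.proj a ⋆ ⟨_, _, x⟩ =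
        ⟨_, _, hcomp ((φ.proj a).toHom (φ.proj_dom a) (φ.proj_cod a)) x⟩ := by
    intro a b x
    rw [Mor.mk_hcomp, Mor.mk_toHom]
  have hr : ∀ {a b : List S.Letter} (x : SHom rel (φ.words a) (φ.words b)),
      ⟨_, _, x⟩ ⋆ φ.proj b =
        ⟨_, _, hcomp x ((φ.proj b).toHom (φ.proj_dom b) (φ.proj_cod b))⟩ := by
    intro a b x
    rw [Mor.mk_hcomp, Mor.mk_toHom]
  induction f with
  | eqTo h => subst h; simp [mor_eqTo, proj_comp_proj]
  | comp f g hf hg =>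
    rw [mor_comp, ← Mor.comp_assoc _ _ _ (by simp) (by simp), hf.1,
      Mor.comp_assoc _ _ _ (by simp) (by simp), hg.2]
    exact ⟨rfl, rfl⟩
  | tensor f g hf hg =>
    rw [mor_tensor, proj_append, proj_append, Mor.interchange _ _ _ _ (by simp) (by simp),
      Mor.interchange _ _ _ _ (by simp) (by simp), hf.1, hg.1, hf.2, hg.2]
    exact ⟨rfl, rfl⟩
  | zero => rw [mor_zero, hl, hr, hcomp_zero, zero_hcomp]; exact ⟨rfl, rfl⟩
  | add f g hf hg =>
    rw [mor, hl] at hf hg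
    rw [hr] at hf hg
    rw [mor, eval, hl, hr, hcomp_add, add_hcomp, Mor.mk_inj hf.1, Mor.mk_inj hg.1,
      Mor.mk_inj hf.2, Mor.mk_inj hg.2]
    exact ⟨rfl, rfl⟩
  | smul r f hf =>
    rw [mor_smul, Mor.comp_smul _ _ _ (by simp), Mor.smul_comp _ _ _ (by simp), hf.1, hf.2]
    exact ⟨rfl, rfl⟩
  | vertex x =>
    rw [mor_vertex]
    exact ⟨φ.proj_comp_vertex x, φ.vertex_comp_proj x⟩
  | cup a b h =>
    subst h
    rw [proj_append, proj_nil, ← Mor.id_nil, Mor.id_comp _ (by simp)]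
    refine ⟨rfl, ?_⟩
    rw [← mor_cup_both, Mor.comp_assoc _ _ _ (by simp) (by simp),
      Mor.interchange _ _ _ _ (by simp) (by simp), proj_comp_proj, proj_comp_proj]
  | cap a b h =>
    subst h
    rw [proj_append, proj_nil, ← Mor.id_nil, Mor.comp_id _ (by simp)]
    refine ⟨?_, rfl⟩
    rw [← mor_cap_both, ← Mor.comp_assoc _ _ _ (by simp) (by simp),
      Mor.interchange _ _ _ _ (by simp) (by simp), proj_comp_proj, proj_comp_proj]
  | braid a b =>
    have h := Mor.braid_natural (φ.proj a) (φ.proj b)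
    simp only [proj_dom, proj_cod] at h
    have h1 : φ.mor (.braid a b) ⋆ (φ.proj b * φ.proj a) = φ.mor (.braid a b) := by
      rw [mor_braid, h, Mor.comp_assoc _ _ _ (by simp) (by simp),
        Mor.interchange _ _ _ _ (by simp) (by simp), proj_comp_proj, proj_comp_proj]
    rw [proj_append, proj_append, h1]
    rw [mor_braid, ← Mor.comp_assoc _ _ _ (by simp) (by simp),
        Mor.interchange _ _ _ _ (by simp) (by simp), proj_comp_proj, proj_comp_proj]
    exact ⟨rfl, rfl⟩
  | braidInv a b =>
    have h := Mor.braidInv_natural (φ.proj a) (φ.proj b)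
    simp only [proj_dom, proj_cod] at h
    have h1 : φ.mor (.braidInv a b) ⋆ (φ.proj a * φ.proj b) = φ.mor (.braidInv a b) := by
      rw [mor_braidInv, h, Mor.comp_assoc _ _ _ (by simp) (by simp),
        Mor.interchange _ _ _ _ (by simp) (by simp), proj_comp_proj, proj_comp_proj]
    rw [proj_append, proj_append, h1]
    rw [mor_braidInv, ← Mor.comp_assoc _ _ _ (by simp) (by simp),
        Mor.interchange _ _ _ _ (by simp) (by simp), proj_comp_proj, proj_comp_proj]
    exact ⟨rfl, rfl⟩
  | rot f hf =>
    rw [mor_rot, ← rot_proj, ← rot_proj, ← Mor.rot_comp _ _ (by simp),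
      ← Mor.rot_comp _ _ (by simp), hf.1, hf.2]
    exact ⟨rfl, rfl⟩

theorem proj_comp_mor (f : S.Diagram R a b) (h : c = a) : φ.proj c ⋆ φ.mor f = φ.mor f :=
  h ▸ (φ.mor_absorb f).1

theorem mor_comp_proj (f : S.Diagram R a b) (h : c = b) : φ.mor f ⋆ φ.proj c = φ.mor f :=
  h ▸ (φ.mor_absorb f).2

theorem mor_eqTo_comp (h : a = b) (f : S.Diagram R b c) : φ.mor ((eqTo h).comp f) = φ.mor f := by
  rw [mor_comp, mor_eqTo, proj_comp_mor _ _ h]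

theorem mor_comp_eqTo (f : S.Diagram R a b) (h : b = c) : φ.mor (f.comp (eqTo h)) = φ.mor f := by
  rw [mor_comp, mor_eqTo, mor_comp_proj _ _ rfl]

end Interpretation

end Interpretations

/-! ### Interpretations respect isotopy. -/

noncomputable section InterpretationSound

open SpiderSignature SpiderSignature.Diagram Spider

open scoped Spider.Mor

variable {S T : SpiderSignature} {R : Type u} [CommRing R] {rel : T.Relators R}

namespace Interpretation

open StrandMap

variable (φ : Interpretation S rel) {a b : List S.Letter}

theorem eval_eq_of_mor_eq {f g : S.Diagram R a b} (h : φ.mor f = φ.mor g) : φ.eval f = φ.eval g :=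
  Mor.mk_inj h

attribute [local simp] SpiderSignature.dual_dual SpiderSignature.dual_append

/-- The inserted idempotents are moved to the ends of the zigzag, the zigzag is straightened in the
target, and the idempotents collapse to one. -/
theorem mor_zigzag_left (h : b = S.dual a) :
    (φ.mor (.cup a b h) * φ.proj a) ⋆ (φ.proj a * φ.mor (.cap a b h)) = φ.proj a := by
  subst h
  have h1 := Mor.unbend (φ.proj a)
  simp only [proj_cod, proj_dom, ← mor_cap _ rfl] at h1
  have h2 : φ.mor (.cup a (S.dual a) rfl) * φ.proj a =
      φ.proj a ⋆ (Mor.cup rel (φ.words a) * Mor.id rel (φ.words a)) ⋆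
        (φ.proj a * Mor.id rel (T.dual (φ.words a) ++ φ.words a)) := by
    have := Mor.mul_eq_right (Mor.cup rel (φ.words a)) (φ.proj a)
    rw [Mor.cup_dom, Mor.id_nil, one_mul, proj_cod] at this
    rw [← this, Mor.id_append, ← mul_assoc, Mor.interchange _ _ _ _ (by simp) (by simp),
      Mor.comp_id (φ.proj a) (by simp), mor_cup]
  have h3 := Mor.mul_eq_right (φ.proj a) (φ.mor (.cap a (S.dual a) rfl))
  rw [mor_cod, words_nil, Mor.id_nil, mul_one, proj_dom] at h3
  rw [h2, Mor.comp_assoc _ _ _ (by simp) (by simp), Mor.interchange _ _ _ _ (by simp) (by simp),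
    proj_comp_proj, Mor.id_comp _ (by simp), h3, ← Mor.comp_assoc _ _ _ (by simp) (by simp),
    Mor.comp_assoc (φ.proj a) _ _ (by simp) (by simp), h1, proj_comp_proj, proj_comp_proj]

theorem mor_zigzag_right (h : b = S.dual a) :
    (φ.proj b * φ.mor (.cup a b h)) ⋆ (φ.mor (.cap a b h) * φ.proj b) = φ.proj b := by
  subst h
  have h1 := Mor.bend (φ.proj (S.dual a)) (φ.words a) (by simp)
  rw [proj_dom, words_dual, ← mor_cap' _ rfl] at h1
  have h2 : φ.proj (S.dual a) * φ.mor (.cup a (S.dual a) rfl) =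
      φ.proj (S.dual a) ⋆ (Mor.id rel (T.dual (φ.words a)) * Mor.cup rel (φ.words a)) ⋆
        (Mor.id rel (T.dual (φ.words a) ++ φ.words a) * φ.proj (S.dual a)) := by
    have := Mor.mul_eq_left (φ.proj (S.dual a)) (Mor.cup rel (φ.words a))
    rw [Mor.cup_dom, Mor.id_nil, mul_one, proj_cod, words_dual] at this
    rw [← this, Mor.id_append, mul_assoc, Mor.interchange _ _ _ _ (by simp) (by simp),
      Mor.comp_id _ (by simp), mor_cup']
  have h3 := Mor.mul_eq_left (φ.mor (.cap a (S.dual a) rfl)) (φ.proj (S.dual a))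
  rw [mor_cod, words_nil, Mor.id_nil, one_mul, proj_dom, words_dual] at h3
  rw [h2, Mor.comp_assoc _ _ _ (by simp) (by simp), Mor.interchange _ _ _ _ (by simp) (by simp),
    proj_comp_proj, Mor.id_comp _ (by simp), h3, ← Mor.comp_assoc _ _ _ (by simp) (by simp),
    Mor.comp_assoc (φ.proj _) _ _ (by simp) (by simp), h1, proj_comp_proj, proj_comp_proj]

theorem mor_cap_append (a b : List S.Letter) {c d : List S.Letter} (hc : c = S.dual a)
    (hd : d = S.dual b) :
    φ.mor (.cap (a ++ b) (d ++ c) (eq_dual_append hc hd)) =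
      (φ.proj d * φ.mor (.cap a c hc) * φ.proj b) ⋆ φ.mor (.cap b d hd) := by
  subst hc hd
  have h1 : φ.proj (S.dual b) * φ.mor (.cap a (S.dual a) rfl) * φ.proj b =
      (Mor.id rel (T.dual (φ.words b)) * φ.mor (.cap a (S.dual a) rfl) *
        Mor.id rel (φ.words b)) ⋆ (φ.proj (S.dual b) * φ.proj b) := by
    have := Mor.mul_eq_right (φ.proj (S.dual b)) (φ.mor (.cap a (S.dual a) rfl))
    rw [mor_cod, words_nil, Mor.id_nil, mul_one, proj_dom, words_dual] at this
    rw [Mor.interchange _ _ _ _ (by simp) (by simp), Mor.id_comp _ (by simp), ← this]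
  rw [h1, Mor.comp_assoc _ _ _ (by simp) (by simp), ← mor_cap_both φ (a := b) (b := S.dual b) rfl,
    ← Mor.comp_assoc (φ.proj _ * φ.proj _) _ _ (by simp) (by simp),
    Mor.interchange _ _ _ _ (by simp) (by simp), proj_comp_proj, proj_comp_proj,
    mor_cap_both φ (a := b) (b := S.dual b) rfl, mor_cap, mor_cap, mor_cap, words_append,
      Mor.cap_append,
    ← Mor.comp_assoc _ _ _ (by simp) (by simp), ← Mor.comp_assoc _ _ _ (by simp) (by simp)]
  congr 1
  rw [T.dual_append, Mor.id_append, proj_append, ← mul_assoc,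
    mul_assoc (Mor.id rel _) (Mor.id rel _),
    Mor.interchange _ _ _ _ (by simp) (by simp), Mor.interchange _ _ _ _ (by simp) (by simp),
    Mor.interchange _ _ _ _ (by simp) (by simp), Mor.id_comp_id, Mor.id_comp _ (by simp),
    Mor.comp_id _ (by simp), Mor.comp_id _ (by simp)]

theorem mor_rot_cap (f : S.Diagram R a b) :
    ((φ.mor f).rot * φ.proj a) ⋆ φ.mor (.cap a (S.dual a) rfl) =
      (φ.proj (S.dual b) * φ.mor f) ⋆ φ.mor (.cap b (S.dual b) rfl) := by
  have h1 := Mor.rot_cap (φ.mor f)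
  have h2 : (φ.mor f).rot ⋆ φ.proj (S.dual a) = (φ.mor f).rot := by
    rw [← mor_rot, mor_comp_proj _ _ rfl]
  rw [mor_dom, mor_cod] at h1
  rw [← mor_cap_both, ← Mor.comp_assoc _ _ _ (by simp) (by simp),
    Mor.interchange _ _ _ _ (by simp) (by simp), proj_comp_proj, h2,
    mor_cap', ← Mor.comp_assoc _ _ _ (by simp) (by simp),
    Mor.interchange _ _ _ _ (by simp) (by simp), proj_comp_proj, Mor.comp_id _ (by simp)]
  rw [Mor.mul_eq_right, Mor.comp_assoc _ _ _ (by simp) (by simp)]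
  simp only [proj_cod, Mor.rot_dom, mor_cod]
  rw [h1, ← Mor.comp_assoc _ _ _ (by simp) (by simp), Mor.interchange _ _ _ _ (by simp) (by simp),
    φ.proj_comp_mor _ rfl, Mor.id_comp_id, Mor.mul_eq_right (φ.proj _),
    Mor.comp_assoc _ _ _ (by simp) (by simp)]
  simp only [proj_dom, mor_cod, words_dual]
  rw [← mor_cap' _ rfl, mor_cap, ← Mor.comp_assoc _ _ _ (by simp) (by simp),
    Mor.interchange _ _ _ _ (by simp) (by simp), φ.mor_comp_proj _ rfl, Mor.id_comp_id]

/-- The first transposition equation for `f.rot`, because rotating twice is the identity. -/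
theorem mor_rot_cap' (f : S.Diagram R a b) :
    (φ.proj a * (φ.mor f).rot) ⋆ φ.mor (.cap (S.dual a) a (eq_dual_symm rfl)) =
      (φ.mor f * φ.proj (S.dual b)) ⋆ φ.mor (.cap (S.dual b) b (eq_dual_symm rfl)) := by
  have h := φ.mor_rot_cap f.rot
  have e : ∀ a : List S.Letter, φ.mor (.cap (S.dual a) (S.dual (S.dual a)) rfl) =
      φ.mor (R := R) (.cap (S.dual a) a (eq_dual_symm rfl)) := fun a => by rw [mor_cap, mor_cap]
  rw [mor_rot, Mor.rot_rot, e, e, S.dual_dual] at h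
  exact h.symm

theorem mor_braid' (a b : List S.Letter) :
    φ.mor (.braid a b) = Mor.braid rel (φ.words a) (φ.words b) ⋆ (φ.proj b * φ.proj a) := by
  have h := Mor.braid_natural (φ.proj a) (φ.proj b)
  simp only [proj_dom, proj_cod] at h
  rw [mor_braid, h]

theorem mor_braid_braidInv (a b : List S.Letter) :
    φ.mor (.braid a b) ⋆ φ.mor (.braidInv a b) = φ.proj (a ++ b) := by
  rw [mor_braid', mor_braidInv, ← Mor.comp_assoc _ _ _ (by simp) (by simp),
    Mor.comp_assoc (Mor.braid _ _ _) _ _ (by simp) (by simp),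
    Mor.interchange _ _ _ _ (by simp) (by simp), proj_comp_proj, proj_comp_proj, ← mor_braid',
    mor_braid, Mor.comp_assoc _ _ _ (by simp) (by simp), Mor.braid_braidInv,
    Mor.comp_id _ (by simp), proj_append]

theorem mor_braidInv_braid (a b : List S.Letter) :
    φ.mor (.braidInv a b) ⋆ φ.mor (.braid a b) = φ.proj (b ++ a) := by
  rw [mor_braid', mor_braidInv, Mor.comp_assoc _ _ _ (by simp) (by simp),
    ← Mor.comp_assoc (Mor.braidInv _ _ _) _ _ (by simp) (by simp), Mor.braidInv_braid,
    Mor.id_comp _ (by simp),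
    Mor.interchange _ _ _ _ (by simp) (by simp), proj_comp_proj, proj_comp_proj, proj_append]

theorem mor_braid_natural {a b c d : List S.Letter} (f : S.Diagram R a b) (g : S.Diagram R c d) :
    (φ.mor f * φ.mor g) ⋆ φ.mor (.braid b d) = φ.mor (.braid a c) ⋆ (φ.mor g * φ.mor f) := by
  have h := Mor.braid_natural (φ.mor f) (φ.mor g)
  simp only [mor_dom, mor_cod] at h
  rw [mor_braid, ← Mor.comp_assoc _ _ _ (by simp) (by simp),
    Mor.interchange _ _ _ _ (by simp) (by simp), φ.mor_comp_proj _ rfl, φ.mor_comp_proj _ rfl,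
    h, mor_braid', Mor.comp_assoc _ _ _ (by simp) (by simp),
    Mor.interchange _ _ _ _ (by simp) (by simp), φ.proj_comp_mor _ rfl, φ.proj_comp_mor _ rfl]

theorem mor_braid_append_right (a b c : List S.Letter) :
    φ.mor (.braid a (b ++ c)) =
      (φ.mor (.braid a b) * φ.proj c) ⋆ (φ.proj b * φ.mor (.braid a c)) := by
  have h : φ.mor (.braid a b) ⋆ (φ.proj b * φ.proj a) = φ.mor (.braid a b) := by
    rw [← proj_append, φ.mor_comp_proj _ rfl]
  rw [mor_braid φ (b := c), ← Mor.id_comp (φ.proj b) (φ.proj_dom b).symm,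
    ← Mor.comp_id (φ.proj b) (φ.proj_cod b).symm, Mor.id_comp _ (by simp),
    ← Mor.interchange _ _ _ _ (by simp) (by simp), ← Mor.comp_assoc _ _ _ (by simp) (by simp),
    ← mul_assoc, Mor.interchange _ _ _ _ (by simp) (by simp), h, proj_comp_proj, mor_braid φ (a := a) (b := b),
    ← Mor.comp_id (φ.proj c) (φ.proj_cod c).symm, ← Mor.interchange _ _ _ _ (by simp) (by simp),
    Mor.comp_assoc _ _ _ (by simp) (by simp), ← Mor.braid_append_right, mor_braid, proj_append,
    words_append, mul_assoc]

theorem mor_braid_append_left (a b c : List S.Letter) :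
    φ.mor (.braid (a ++ b) c) =
      (φ.proj a * φ.mor (.braid b c)) ⋆ (φ.mor (.braid a c) * φ.proj b) := by
  have h : φ.mor (.braid b c) ⋆ (φ.proj c * φ.proj b) = φ.mor (.braid b c) := by
    rw [← proj_append, φ.mor_comp_proj _ rfl]
  rw [mor_braid φ (a := a) (b := c), ← Mor.comp_id (φ.proj b) (φ.proj_cod b).symm,
    ← Mor.interchange _ _ _ _ (by simp) (by simp), ← Mor.comp_assoc _ _ _ (by simp) (by simp),
    mul_assoc, Mor.interchange _ _ _ _ (by simp) (by simp), h, proj_comp_proj, mor_braid φ (a := b) (b := c),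
    ← Mor.comp_id (φ.proj a) (φ.proj_cod a).symm, ← Mor.interchange _ _ _ _ (by simp) (by simp),
    Mor.comp_assoc _ _ _ (by simp) (by simp), ← Mor.braid_append_left, mor_braid, proj_append,
    words_append, mul_assoc]

/-- The universal property of the presentation: only the relators need to be checked in the target.
The module axioms hold in its hom modules; the remaining isotopy axioms are equations of bundled
morphisms. -/
theorem eval_congr {relS : S.Relators R}
    (hrel : ∀ {a b} (f g : S.Diagram R a b), relS a b f g → φ.eval f = φ.eval g)
    {f g : S.Diagram R a b} (h : SkeinEq relS f g) : φ.eval f = φ.eval g := by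
  induction h with
  | rel h => exact hrel _ _ h
  | refl f => rfl
  | symm _ ih => exact ih.symm
  | trans _ _ ih ih' => exact ih.trans ih'
  | comp_congr _ _ ih ih' => rw [eval, eval, ih, ih']
  | tensor_congr _ _ ih ih' => rw [eval, eval, ih, ih']
  | add_congr _ _ ih ih' => rw [eval, eval, ih, ih']
  | smul_congr r _ ih => rw [eval, eval, ih]
  | add_assoc f g h => simp only [eval, add_assoc]
  | add_comm f g => simp only [eval, add_comm]
  | zero_add f => simp only [eval, zero_add]
  | one_smul f => simp only [eval, one_smul]
  | mul_smul r s f => simp only [eval, mul_smul]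
  | smul_add r f g => simp only [eval, smul_add]
  | add_smul r s f => simp only [eval, add_smul]
  | zero_smul f => simp only [eval, zero_smul]
  | add_comp f f' g => simp only [eval, add_hcomp]
  | comp_add f g g' => simp only [eval, hcomp_add]
  | smul_comp r f g => simp only [eval, smul_hcomp]
  | comp_smul r f g => simp only [eval, hcomp_smul]
  | add_tensor f f' g => simp only [eval, add_htensor, hcast_add]
  | tensor_add f g g' => simp only [eval, htensor_add, hcast_add]
  | smul_tensor r f g => simp only [eval, smul_htensor, hcast_smul]
  | tensor_smul r f g => simp only [eval, htensor_smul, hcast_smul]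
  | id_comp f =>
    exact φ.eval_eq_of_mor_eq (by rw [mor_comp, mor_eqTo, proj_comp_mor _ _ rfl])
  | comp_id f =>
    exact φ.eval_eq_of_mor_eq (by rw [mor_comp, mor_eqTo, mor_comp_proj _ _ rfl])
  | comp_assoc f g h =>
    exact φ.eval_eq_of_mor_eq (by
      simp only [mor_comp]; rw [Mor.comp_assoc _ _ _ (by simp) (by simp)])
  | tensor_id a b =>
    exact φ.eval_eq_of_mor_eq (by simp only [mor_tensor, mor_eqTo, proj_append])
  | interchange f g f' g' =>
    exact φ.eval_eq_of_mor_eq (by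
      simp only [mor_tensor, mor_comp]; rw [Mor.interchange _ _ _ _ (by simp) (by simp)])
  | tensor_assoc f g h =>
    exact φ.eval_eq_of_mor_eq (by
      rw [mor_comp_eqTo, mor_eqTo_comp]
      simp only [mor_tensor, mul_assoc])
  | nil_tensor f =>
    exact φ.eval_eq_of_mor_eq (by rw [mor_tensor, mor_eqTo, proj_nil, one_mul])
  | tensor_nil f =>
    exact φ.eval_eq_of_mor_eq (by
      rw [mor_comp_eqTo, mor_eqTo_comp, mor_tensor, mor_eqTo, proj_nil, mul_one])
  | zigzag_left a b h =>
    exact φ.eval_eq_of_mor_eq (by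
      rw [mor_comp, mor_comp_eqTo, mor_tensor, mor_tensor, mor_eqTo, mor_eqTo, mor_zigzag_left]
      rfl)
  | zigzag_right a b h =>
    exact φ.eval_eq_of_mor_eq (by
      rw [mor_comp, mor_comp_eqTo, mor_tensor, mor_tensor, mor_eqTo, mor_eqTo, mor_zigzag_right,
        List.append_nil])
  | cap_nil =>
    exact φ.eval_eq_of_mor_eq ((φ.mor_cap (R := R) (a := []) rfl).trans (by
      rw [mor_eqTo, proj_nil, words_nil, Mor.cap_nil, mul_one]; exact Mor.id_comp_id (rel :=
        rel) []))
  | cap_append a b a' b' ha hb =>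
    exact φ.eval_eq_of_mor_eq (by
      rw [mor_cap_append _ _ _ ha hb, mor_comp, mor_eqTo_comp, mor_tensor, mor_tensor, mor_eqTo,
        mor_eqTo, mul_assoc])
  | rot_cap f =>
    exact φ.eval_eq_of_mor_eq (by
      rw [mor_comp, mor_comp, mor_tensor, mor_tensor, mor_rot, mor_eqTo, mor_eqTo, mor_rot_cap])
  | rot_cap' f =>
    exact φ.eval_eq_of_mor_eq (by
      rw [mor_comp, mor_comp, mor_tensor, mor_tensor, mor_rot, mor_eqTo, mor_eqTo, mor_rot_cap'])
  | braid_braidInv a b =>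
    exact φ.eval_eq_of_mor_eq (by rw [mor_comp, mor_eqTo, mor_braid_braidInv])
  | braidInv_braid a b =>
    exact φ.eval_eq_of_mor_eq (by rw [mor_comp, mor_eqTo, mor_braidInv_braid])
  | braid_natural f g =>
    exact φ.eval_eq_of_mor_eq (by
      rw [mor_comp, mor_comp, mor_tensor, mor_tensor, mor_braid_natural])
  | braid_append_right a b c =>
    exact φ.eval_eq_of_mor_eq (by
      rw [mor_comp_eqTo, mor_eqTo_comp, mor_comp, mor_comp_eqTo, mor_tensor, mor_tensor, mor_eqTo,
        mor_eqTo, mor_braid_append_right])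
  | braid_append_left a b c =>
    exact φ.eval_eq_of_mor_eq (by
      rw [mor_comp_eqTo, mor_eqTo_comp, mor_comp, mor_comp_eqTo, mor_tensor, mor_tensor, mor_eqTo,
        mor_eqTo, mor_braid_append_left])

end Interpretation

end InterpretationSound

/-! ### Partial traces and sphericity. -/

noncomputable section Traces

set_option linter.unusedSimpArgs false

open SpiderSignature SpiderSignature.Diagram Spider

namespace Spider

namespace Mor

open scoped Spider.Mor

variable {S : SpiderSignature} {R : Type u} [CommRing R] {rel : S.Relators R}

attribute [local simp] SpiderSignature.dual_dual SpiderSignature.dual_append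

/-- This turns identities for caps into identities for cups, such as `cup_append`. -/
theorem rot_cap_eq (a : List S.Letter) : (cap rel a).rot = cup rel (S.dual a) := by
  refine (eq_rot (by simp) (by simp) ?_).symm
  have h := zigzag_left (rel := rel) (S.dual a)
  rw [cap_dom, cap_cod, cap_append, ← comp_assoc _ _ _ (by simp) (by simp), id_append,
    ← mul_assoc, cap_nil, dual_nil, id_nil, one_mul, ← id_nil, comp_id _ (by simp),
    interchange _ _ _ _ (by simp) (by simp), id_comp_id, h, ← id_append, id_comp _ (by simp)]

theorem cup_append (a b : List S.Letter) :
    cup rel (a ++ b) = cup rel a ⋆ (id rel a * cup rel b * id rel (S.dual a)) := by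
  have h := cap_append (rel := rel) (S.dual b) (S.dual a)
  have h' := congrArg rot h
  rw [rot_cap_eq, rot_comp _ _ (by simp), rot_mul, rot_mul, rot_cap_eq, rot_cap_eq, rot_id,
    rot_id, S.dual_append, S.dual_dual, S.dual_dual, ← mul_assoc] at h'
  exact h'

/-- Closing up the strands `x` on the right. -/
def closeRight (a x : List S.Letter) (f : Mor rel) : Mor rel :=
  (id rel a * cup rel x) ⋆ (f * id rel (S.dual x)) ⋆ (id rel a * cap rel (S.dual x))

/-- Closing up the strands `x` on the left. -/
def closeLeft (x a : List S.Letter) (f : Mor rel) : Mor rel :=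
  (cup rel (S.dual x) * id rel a) ⋆ (id rel (S.dual x) * f) ⋆ (cap rel x * id rel a)

theorem mk_closeRight (a x : List S.Letter) (f : S.Diagram R (a ++ x) (a ++ x)) :
    (⟨_, _, ofDiagram rel (Diagram.closeRight a x f)⟩ : Mor rel) =
      closeRight a x ⟨_, _, ofDiagram rel f⟩ := by
  simp only [Diagram.closeRight, mk_comp, mk_tensor, mk_eqTo, mk_cup, mk_cap]
  rw [id_comp _ (by simp), comp_id _ (by simp), comp_id _ (by simp), comp_id _ (by simp)]
  rfl

theorem mk_closeLeft (x a : List S.Letter) (f : S.Diagram R (x ++ a) (x ++ a)) :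
    (⟨_, _, ofDiagram rel (Diagram.closeLeft x a f)⟩ : Mor rel) =
      closeLeft x a ⟨_, _, ofDiagram rel f⟩ := by
  have h : (⟨a, _, ofDiagram rel ((Diagram.cup (S.dual x) x (eq_dual_symm rfl)).tensor (idd a))⟩ :
      Mor rel) = cup rel (S.dual x) * id rel a := by
    rw [← mk_cup (S.dual x) x (eq_dual_symm rfl)]; rfl
  simp only [Diagram.closeLeft, mk_comp, mk_tensor, mk_eqTo, h]
  rw [comp_id _ (by simp), comp_id _ (by simp)]
  rfl

variable (a b x y : List S.Letter) (f : Mor rel)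

section

variable {a b x y f}

theorem closeRight_dom : (closeRight a x f).dom = a := by simp [closeRight]

theorem closeRight_cod (hd : f.dom = a ++ x) (hc : f.cod = a ++ x) :
    (closeRight a x f).cod = a := by
  simp [closeRight, hd, hc]

theorem closeLeft_dom : (closeLeft x a f).dom = a := by simp [closeLeft]

theorem closeLeft_cod (hd : f.dom = x ++ a) (hc : f.cod = x ++ a) :
    (closeLeft x a f).cod = a := by
  simp [closeLeft, hd, hc]

theorem closeRight_append (hd : f.dom = a ++ (x ++ y)) (hc : f.cod = a ++ (x ++ y)) :
    closeRight a (x ++ y) f = closeRight a x (closeRight (a ++ x) y f) := by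
  simp only [closeRight]
  rw [cup_append, S.dual_append, cap_append, S.dual_dual, id_mul_comp _ _ (by simp [hd, hc]),
    id_mul_comp _ _ (by simp [hd, hc]), mul_comp_id _ _ (by simp [hd, hc]), mul_comp_id _ _ (by simp [hd, hc])]
  simp only [id_append, ← mul_assoc]
  rw [← comp_assoc _ _ _ (by simp [hd, hc]) (by simp [hd, hc])]
  congr 1
  rw [comp_assoc _ _ _ (by simp [hd, hc]) (by simp [hd, hc]), comp_assoc _ _ _ (by simp [hd, hc]) (by simp [hd, hc]),
    comp_assoc _ _ _ (by simp [hd, hc]) (by simp [hd, hc])]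

theorem closeLeft_append (hd : f.dom = (x ++ y) ++ a) (hc : f.cod = (x ++ y) ++ a) :
    closeLeft (x ++ y) a f = closeLeft y a (closeLeft x (y ++ a) f) := by
  simp only [closeLeft]
  rw [cap_append, S.dual_append, cup_append, S.dual_dual, mul_comp_id _ _ (by simp [hd, hc]),
    mul_comp_id _ _ (by simp [hd, hc]), id_mul_comp _ _ (by simp [hd, hc]), id_mul_comp _ _ (by simp [hd, hc])]
  simp only [id_append, mul_assoc]
  rw [← comp_assoc _ _ _ (by simp [hd, hc]) (by simp [hd, hc])]
  congr 1
  rw [comp_assoc _ _ _ (by simp [hd, hc]) (by simp [hd, hc]), comp_assoc _ _ _ (by simp [hd, hc]) (by simp [hd, hc]),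
    comp_assoc _ _ _ (by simp [hd, hc]) (by simp [hd, hc])]

/-- The cups and caps of the two closures lie on different sides of the morphism and slide past each
other. -/
theorem closeLeft_closeRight (hd : f.dom = x ++ a ++ y) (hc : f.cod = x ++ a ++ y) :
    closeLeft x a (closeRight (x ++ a) y f) = closeRight a y (closeLeft x (a ++ y) f) := by
  have hl : (cup rel (S.dual x) * id rel a) ⋆ (id rel (S.dual x ++ (x ++ a)) * cup rel y) =
      (id rel a * cup rel y) ⋆ (cup rel (S.dual x) * id rel (a ++ y ++ S.dual y)) := by
    have h := ((mul_eq_left (cup rel (S.dual x) * id rel a) (cup rel y)).symm.trans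
      (mul_assoc _ _ _)).trans (mul_eq_right (cup rel (S.dual x)) (id rel a * cup rel y))
    simpa [id_nil, id_append, mul_assoc] using h
  have hr : (id rel (S.dual x ++ (x ++ a)) * cap rel (S.dual y)) ⋆ (cap rel x * id rel a) =
      (cap rel x * id rel (a ++ y ++ S.dual y)) ⋆ (id rel a * cap rel (S.dual y)) := by
    have h := ((mul_eq_right (cap rel x * id rel a) (cap rel (S.dual y))).symm.trans
      (mul_assoc _ _ _)).trans (mul_eq_left (cap rel x) (id rel a * cap rel (S.dual y)))
    simpa [id_nil, id_append, mul_assoc] using h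
  simp only [closeLeft, closeRight]
  rw [id_mul_comp _ _ (by simp [hd, hc]), id_mul_comp _ _ (by simp [hd, hc]),
    mul_comp_id _ _ (by simp [hd, hc]), mul_comp_id _ _ (by simp [hd, hc])]
  simp only [mul_assoc, ← id_append]
  simp only [id_append, mul_assoc] at hl hr ⊢
  rw [← comp_assoc _ _ _ (by simp [hd, hc]) (by simp [hd, hc]),
    ← comp_assoc _ _ _ (by simp [hd, hc]) (by simp [hd, hc]), hl,
    comp_assoc _ _ _ (by simp [hd, hc]) (by simp [hd, hc]), hr]
  rw [← comp_assoc _ _ _ (by simp [hd, hc]) (by simp [hd, hc])]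
  congr 1
  rw [comp_assoc _ _ _ (by simp [hd, hc]) (by simp [hd, hc]),
    comp_assoc _ _ _ (by simp [hd, hc]) (by simp [hd, hc]),
    comp_assoc _ _ _ (by simp [hd, hc]) (by simp [hd, hc])]

theorem closeRight_comp_left {g : Mor rel} (hd : f.dom = a ++ x) (hc : f.cod = a ++ x)
    (hg : g.dom = a) (hg' : g.cod = a) :
    closeRight a x ((g * id rel x) ⋆ f) = g ⋆ closeRight a x f := by
  have h : (id rel a * cup rel x) ⋆ (g * id rel x * id rel (S.dual x)) =
      g ⋆ (id rel a * cup rel x) := by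
    rw [mul_assoc, ← id_append,
      interchange _ _ _ _ (by simp [hd, hc, hg, hg']) (by simp [hd, hc, hg, hg']), id_comp _ (by simp [hd, hc, hg, hg']),
      comp_id _ (by simp [hd, hc, hg, hg']), mul_eq_left, hg', cup_dom, id_nil, mul_one]
  simp only [closeRight]
  rw [mul_comp_id _ _ (by simp [hd, hc, hg, hg']), ← comp_assoc _ _ _ (by simp [hd, hc, hg, hg']) (by simp [hd, hc, hg, hg']), h,
    comp_assoc _ _ _ (by simp [hd, hc, hg, hg']) (by simp [hd, hc, hg, hg']),
    comp_assoc _ _ _ (by simp [hd, hc, hg, hg']) (by simp [hd, hc, hg, hg']),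
    comp_assoc (_ * _) _ _ (by simp [hd, hc, hg, hg']) (by simp [hd, hc, hg, hg'])]

theorem closeLeft_comp_right {g : Mor rel} (hd : f.dom = x ++ a) (hc : f.cod = x ++ a)
    (hg : g.dom = a) (hg' : g.cod = a) :
    closeLeft x a (f ⋆ (id rel x * g)) = closeLeft x a f ⋆ g := by
  have h : (id rel (S.dual x) * (id rel x * g)) ⋆ (cap rel x * id rel a) =
      (cap rel x * id rel a) ⋆ g := by
    rw [← mul_assoc, ← id_append,
      interchange _ _ _ _ (by simp [hd, hc, hg, hg']) (by simp [hd, hc, hg, hg']), comp_id _ (by simp [hd, hc, hg, hg']),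
      id_comp _ (by simp [hd, hc, hg, hg']), mul_eq_left, hg, cap_cod, id_nil, one_mul]
  simp only [closeLeft]
  rw [id_mul_comp _ _ (by simp [hd, hc, hg, hg']), comp_assoc _ _ _ (by simp [hd, hc, hg, hg']) (by simp [hd, hc, hg, hg']),
    comp_assoc _ _ _ (by simp [hd, hc, hg, hg']) (by simp [hd, hc, hg, hg']), h,
    ← comp_assoc _ _ _ (by simp [hd, hc, hg, hg']) (by simp [hd, hc, hg, hg']),
    ← comp_assoc _ _ _ (by simp [hd, hc, hg, hg']) (by simp [hd, hc, hg, hg']), comp_assoc _ _ _ (by simp [hd, hc, hg, hg']) (by simp [hd, hc, hg, hg'])]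

end

/-- The left and the right trace of endomorphisms of a word agree. -/
def SphericalWord (rel : S.Relators R) (a : List S.Letter) : Prop :=
  ∀ f : Mor rel, f.dom = a → f.cod = a → closeLeft a [] f = closeRight [] a f

theorem sphericalWord_nil : SphericalWord rel [] := by
  rintro f hd hc
  simp only [closeLeft, closeRight]
  simp only [dual_nil, id_nil, mul_one, one_mul]

/-- Both traces are taken one word at a time. Switching the sides of `b` and of `a` separately
leaves a left closure of `a` and a right closure of `b` on each side, in different orders. -/
theorem SphericalWord.append {a b : List S.Letter} (ha : SphericalWord rel a)
    (hb : SphericalWord rel b) : SphericalWord rel (a ++ b) := by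
  intro f hd hc
  rw [closeLeft_append (by simpa using hd) (by simpa using hc), List.append_nil,
    closeRight_append (by simpa using hd) (by simpa using hc), List.nil_append,
    hb _ closeLeft_dom (closeLeft_cod hd hc), ← ha _ closeRight_dom (closeRight_cod hd hc)]
  have h := closeLeft_closeRight (x := a) (a := []) (y := b) (f := f) (by simpa using hd)
    (by simpa using hc)
  rw [List.append_nil] at h
  exact h.symm

/-- Sliding `f` around the cup shows that rotation exchanges the two traces; hence sphericity passes
to dual words. -/
theorem closeLeft_rot (f : Mor rel) (hf : f.cod = f.dom) :
    closeLeft (S.dual f.dom) [] f.rot = closeRight [] f.dom f := by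
  have h := cup_rot f
  simp only [closeLeft, closeRight, id_nil, mul_one, one_mul, dual_dual]
  rw [hf] at h
  rw [h]

theorem SphericalWord.dual {a : List S.Letter} (ha : SphericalWord rel a) :
    SphericalWord rel (S.dual a) := by
  intro f hd hc
  have h1 := closeLeft_rot f (hc.trans hd.symm)
  have h2 := closeLeft_rot f.rot (by simp [hc, hd])
  have h3 := ha f.rot (by simp [hc]) (by simp [hd])
  rw [rot_rot] at h2
  simp only [hd, hc, rot_dom, dual_dual] at h1 h2
  rw [h2, ← h3, h1]

/-- Sphericality follows from the two kinks on a word being the same invertible scalar. -/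
theorem sphericalWord_of_kink {a : List S.Letter} {c : R} (hc : IsUnit c)
    (hr : closeRight a a (braid rel a a) = c • id rel a)
    (hl : closeLeft a a (braid rel a a) = c • id rel a) : SphericalWord rel a := by
  intro f hd hf
  -- A copy of `f` followed by a crossing is closed on both sides in either order. Closing the right
  -- strand first leaves `f` with a kink; if `f` is pulled through the crossing and the left strand
  -- is closed first, the other kink appears.
  have h := closeLeft_closeRight (x := a) (a := []) (y := a) (f := (f * id rel a) ⋆ braid rel a a)
    (by simp [hd]) (by simp [hd, hf])
  have hn := braid_natural f (id rel a)
  rw [id_cod, id_dom, hd, hf] at hn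
  rw [List.append_nil, closeRight_comp_left (by simp) (by simp) hd hf, hr, hn,
    List.nil_append, closeLeft_comp_right (by simp) (by simp) hd hf, hl,
    comp_smul _ _ _ (by simp [hf]), comp_id _ hf.symm, smul_comp _ _ _ (by simp [hd]),
    id_comp _ hd.symm] at h
  have hL : closeLeft a [] (c • f) = c • closeLeft a [] f := by
    simp only [closeLeft]
    rw [mul_smul, comp_smul _ _ _ (by simp [hd]), smul_comp _ _ _ (by simp [hd, hf])]
  have hR : closeRight [] a (c • f) = c • closeRight [] a f := by
    simp only [closeRight]
    rw [smul_mul, comp_smul _ _ _ (by simp [hd]), smul_comp _ _ _ (by simp [hd, hf])]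
  rw [hL, hR] at h
  exact smul_left_cancel hc h

theorem sphericalWord_of_letters {a : List S.Letter} (h : ∀ x ∈ a, SphericalWord rel [x]) :
    SphericalWord rel a := by
  induction a with
  | nil => exact sphericalWord_nil
  | cons x a ih =>
    exact SphericalWord.append (h x (by simp)) (ih fun y hy => h y (by simp [hy]))

end Mor

theorem leftTrace_eq {S : SpiderSignature} {R : Type u} [CommRing R] {rel : S.Relators R}
    {X : Spider S R rel} (f : X ⟶ X) (h : Mor.SphericalWord rel X.word) :
    PivotalCategory.leftTrace f = PivotalCategory.rightTrace f := by
  have h1 := h ⟨X.word, X.word, f⟩ rfl rfl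
  have hl : PivotalCategory.leftTrace f =
      hcomp (ofDiagram rel (.cup (S.dual X.word) X.word (eq_dual_symm rfl)))
        (hcomp (htensor (ofDiagram rel (idd (S.dual X.word))) f)
          (ofDiagram rel (.cap X.word (S.dual X.word) rfl))) := rfl
  have hr : PivotalCategory.rightTrace f =
      hcomp (ofDiagram rel (.cup X.word (S.dual X.word) rfl))
        (hcomp (htensor f (ofDiagram rel (idd (S.dual X.word))))
          (ofDiagram rel (.cap (S.dual X.word) X.word (eq_dual_symm rfl)))) := rfl
  rw [hl, hr]
  refine Mor.mk_inj (rel := rel) ?_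
  simp only [Mor.mk_hcomp, Mor.mk_cup, Mor.mk_cap]
  simp only [Mor.closeLeft, Mor.closeRight, Mor.id_nil, mul_one, one_mul] at h1
  rw [Mor.comp_assoc _ _ _ (by simp [S.dual_dual]) (by simp),
    Mor.comp_assoc _ _ _ (by simp) (by simp [S.dual_dual])] at h1
  exact h1

end Spider

end Traces

/-! ### Endomorphism algebras of words. -/

noncomputable section Endomorphisms

open SpiderSignature SpiderSignature.Diagram Spider

namespace Spider

variable {S : SpiderSignature} {R : Type u} [CommRing R] {rel : S.Relators R}

open scoped Spider.Mor

/-- Endomorphisms form a ring under stacking. -/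
instance (a : List S.Letter) : Ring (SHom rel a a) where
  mul := hcomp
  one := ofDiagram rel (idd a)
  mul_assoc x y z := by
    refine Mor.mk_inj (rel := rel) ?_
    exact (Mor.mk_hcomp _ _).trans ((congrArg (· ⋆ (⟨a, a, z⟩ : Mor rel)) (Mor.mk_hcomp x y)).trans
      ((Mor.comp_assoc _ _ _ rfl rfl).trans
        ((congrArg ((⟨a, a, x⟩ : Mor rel) ⋆ ·) (Mor.mk_hcomp y z).symm).trans
          (Mor.mk_hcomp _ _).symm)))
  one_mul x := Mor.mk_inj (rel := rel) ((Mor.mk_hcomp _ _).trans (Mor.id_comp ⟨a, a, x⟩ rfl))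
  mul_one x := Mor.mk_inj (rel := rel) ((Mor.mk_hcomp _ _).trans (Mor.comp_id ⟨a, a, x⟩ rfl))
  left_distrib := hcomp_add
  right_distrib := add_hcomp
  zero_mul := zero_hcomp
  mul_zero := hcomp_zero
  neg_add_cancel := neg_add_cancel
  zsmul := zsmulRec

instance (a : List S.Letter) : Algebra R (SHom rel a a) :=
  Algebra.ofModule (fun r x y => smul_hcomp r x y) (fun r x y => hcomp_smul r x y)

theorem Mor.mk_one (a : List S.Letter) : (⟨a, a, 1⟩ : Mor rel) = Mor.id rel a := rfl

theorem Mor.mk_mul {a : List S.Letter} (x y : SHom rel a a) :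
    (⟨a, a, x * y⟩ : Mor rel) = ⟨a, a, x⟩ ⋆ ⟨a, a, y⟩ := Mor.mk_hcomp x y

/-- The endomorphisms of `a` as endomorphisms of a word of the form `b ++ a ++ c`. -/
def place (a b c d : List S.Letter) (h : b ++ a ++ c = d) : SHom rel a a →ₐ[R] SHom rel d d :=
  AlgHom.ofLinearMap
    { toFun := fun x => hcast h h (htensor (htensor (1 : SHom rel b b) x) (1 : SHom rel c c))
      map_add' := fun x y => by rw [htensor_add, add_htensor, hcast_add]
      map_smul' := fun r x => by rw [htensor_smul, smul_htensor, hcast_smul, RingHom.id_apply] }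
    (Mor.mk_inj (rel := rel) ((Mor.mk_hcast h h _).trans (by
      rw [Mor.mk_htensor, Mor.mk_htensor, Mor.mk_one, Mor.mk_one, Mor.mk_one,
        Mor.mk_one, ← Mor.id_append, ← Mor.id_append, h])))
    fun x y => Mor.mk_inj (rel := rel) ((Mor.mk_hcast h h _).trans (by
      rw [Mor.mk_mul]
      refine Eq.trans ?_ (congrArg₂ Mor.comp (Mor.mk_hcast h h _) (Mor.mk_hcast h h _)).symm
      simp only [Mor.mk_htensor, Mor.mk_mul, Mor.mk_one]
      rw [Mor.interchange _ _ _ _ rfl rfl, Mor.interchange _ _ _ _ rfl rfl, Mor.id_comp_id,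
        Mor.id_comp_id]))

theorem mk_place {a b c d : List S.Letter} (h : b ++ a ++ c = d) (x : SHom rel a a) :
    (⟨d, d, place a b c d h x⟩ : Mor rel) = Mor.id rel b * ⟨a, a, x⟩ * Mor.id rel c :=
  Mor.mk_hcast h h _

end Spider

end Endomorphisms

/-! ### Hecke algebras acting on parallel strands. -/

noncomputable section Strands

set_option linter.unusedSimpArgs false

open SpiderSignature SpiderSignature.Diagram Spider

namespace Spider

variable {S : SpiderSignature} {R : Type u} [CommRing R] {rel : S.Relators R}

open scoped Spider.Mor

/-- The word of `k` strands with the letter `x`. -/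
abbrev strands (x : S.Letter) (k : ℕ) : List S.Letter := List.replicate k x

theorem strands_add (x : S.Letter) (k l : ℕ) : strands x (k + l) = strands x k ++ strands x l :=
  (List.replicate_append_replicate ..).symm

theorem Mor.id_strands_add (x : S.Letter) (k l : ℕ) :
    Mor.id rel (strands x (k + l)) = Mor.id rel (strands x k) * Mor.id rel (strands x l) := by
  rw [strands_add, Mor.id_append]

variable {x : S.Letter}

/-- The endomorphisms of `k` strands as endomorphisms of `m` strands, starting at the strand `i`. -/
def placeStrands (x : S.Letter) (i k m : ℕ) (h : i + k ≤ m) :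
    SHom rel (strands x k) (strands x k) →ₐ[R] SHom rel (strands x m) (strands x m) :=
  place (strands x k) (strands x i) (strands x (m - (i + k))) (strands x m) (by
    rw [← strands_add, ← strands_add, Nat.add_sub_cancel' h])

theorem mk_placeStrands {i k m : ℕ} (h : i + k ≤ m) (c : ℕ) (hc : i + k + c = m)
    (y : SHom rel (strands x k) (strands x k)) :
    (⟨_, _, placeStrands x i k m h y⟩ : Mor rel) =
      Mor.id rel (strands x i) * ⟨_, _, y⟩ * Mor.id rel (strands x c) := by
  rw [placeStrands, mk_place, ← hc, Nat.add_sub_cancel_left]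

theorem placeStrands_placeStrands {i k m j l : ℕ} (h : i + k ≤ m) (h' : j + l ≤ k)
    (h'' : i + j + l ≤ m) (y : SHom rel (strands x l) (strands x l)) :
    placeStrands x i k m h (placeStrands x j l k h' y) = placeStrands x (i + j) l m h'' y := by
  refine Mor.mk_inj (rel := rel) ?_
  rw [mk_placeStrands _ (m - (i + k)) (by omega), mk_placeStrands _ (k - (j + l)) (by omega),
    mk_placeStrands _ (k - (j + l) + (m - (i + k))) (by omega), Mor.id_strands_add,
    Mor.id_strands_add]
  simp only [mul_assoc]

/-- The elements `id ⊗ e ⊗ id` for an endomorphism `e` of two strands. -/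
def strandGen (x : S.Letter) (e : SHom rel (strands x 2) (strands x 2)) (m i : ℕ) :
    SHom rel (strands x m) (strands x m) :=
  if h : i + 2 ≤ m then placeStrands x i 2 m h e else 0

theorem strandGen_eq (e : SHom rel (strands x 2) (strands x 2)) {m i : ℕ} (h : i + 2 ≤ m) :
    strandGen x e m i = placeStrands x i 2 m h e := dif_pos h

theorem placeStrands_strandGen (e : SHom rel (strands x 2) (strands x 2)) {i k m s : ℕ}
    (h : i + k ≤ m) (hs : s + 2 ≤ k) :
    placeStrands x i k m h (strandGen x e k s) = strandGen x e m (i + s) := by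
  rw [strandGen_eq e hs, strandGen_eq e (by omega), placeStrands_placeStrands]

theorem placeStrands_antisym (q : Rˣ) (e : SHom rel (strands x 2) (strands x 2)) {i k m j l : ℕ}
    (h : i + k ≤ m) (hl : j + l ≤ k) :
    placeStrands x i k m h (antisym q (strandGen x e k) j l) =
      antisym q (strandGen x e m) (i + j) l :=
  map_antisym _ _ _ _ _ _ _ fun s hs => by
    rw [placeStrands_strandGen e h (by omega), add_assoc]

theorem strandGen_comm (e : SHom rel (strands x 2) (strands x 2)) {m i j : ℕ} (hij : i + 1 < j)
    (hj : j + 1 < m) :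
    strandGen x e m i * strandGen x e m j = strandGen x e m j * strandGen x e m i := by
  obtain ⟨d, rfl⟩ : ∃ d, j = i + 2 + d := ⟨j - (i + 2), by omega⟩
  obtain ⟨c, rfl⟩ : ∃ c, m = i + 2 + d + 2 + c := ⟨m - (i + 2 + d + 2), by omega⟩
  refine Mor.mk_inj (rel := rel) ?_
  rw [Mor.mk_mul, Mor.mk_mul, strandGen_eq e (by omega), strandGen_eq e (by omega),
    mk_placeStrands _ (d + (2 + c)) (by omega), mk_placeStrands _ c (by omega),
    Mor.id_strands_add x (i + 2), Mor.id_strands_add x i, Mor.id_strands_add x d,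
    Mor.id_strands_add x 2]
  simp only [mul_assoc]
  have he1 := Mor.comp_id (⟨_, _, e⟩ : Mor rel) (a := strands x 2) rfl
  have he2 := Mor.id_comp (⟨_, _, e⟩ : Mor rel) (a := strands x 2) rfl
  repeat rw [Mor.interchange _ _ _ _ rfl rfl]
  simp only [Mor.id_comp_id, he1, he2]

/-- Uniqueness of inverses. It turns the compatibility of positive crossings with tensor products
into that of negative crossings. -/
theorem Mor.eq_of_comp_eq_id {f g : Mor rel} (b : Mor rel) (hf : f ⋆ b = Mor.id rel b.cod)
    (hf' : b ⋆ f = Mor.id rel b.dom) (hg : g.cod = b.dom)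
    (h : g ⋆ b = Mor.id rel b.cod) : f = g := by
  have hfd := congrArg Mor.dom hf
  have hfb := congrArg Mor.cod hf'
  have hgd := congrArg Mor.dom h
  rw [Mor.comp_dom, Mor.id_dom] at hfd hgd
  rw [← Mor.id_comp f hfd.symm, ← h, Mor.comp_assoc _ _ _ hg hfd.symm, hf', Mor.comp_id _ hg.symm]

/-- When both sides are expanded with `a² = [2] a`, `b² = [2] b` and `q [2] = q² + 1`, everything
symmetric in `a` and `b` cancels and the braid relation of the generators is left. -/
theorem braid_of_yang_baxter {A : Type v} [Ring A] [Algebra R A] (q : Rˣ) {a b : A}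
    (ha : a * a = (qInt q 2 : R) • a) (hb : b * b = (qInt q 2 : R) • b)
    (h : ((q : R) • (1 : A) - a) * ((q : R) • (1 : A) - b) * ((q : R) • (1 : A) - a) =
      ((q : R) • (1 : A) - b) * ((q : R) • (1 : A) - a) * ((q : R) • (1 : A) - b)) :
    a * b * a - a = b * a * b - b := by
  have h2 : (qInt q 2 : R) = q + (q⁻¹ : Rˣ) := qInt_two q
  rw [h2] at ha hb
  simp only [sub_mul, mul_sub, smul_mul_assoc, mul_smul_comm, one_mul, mul_one, ha, hb] at h
  have hi : (q : R) * ((q⁻¹ : Rˣ) : R) = 1 := q.mul_inv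
  have ka := congrArg (· • a) hi
  have kb := congrArg (· • b) hi
  linear_combination (norm := module) -h + ka - kb

/-- A family of crossings that is compatible with the tensor product. -/
structure CrossingFamily (rel : S.Relators R) where
  cross : List S.Letter → List S.Letter → Mor rel
  dom : ∀ a b, (cross a b).dom = a ++ b
  cod : ∀ a b, (cross a b).cod = b ++ a
  nil_left : ∀ a, cross [] a = Mor.id rel a
  nil_right : ∀ a, cross a [] = Mor.id rel a
  append_right : ∀ a b c, cross a (b ++ c) = (cross a b * Mor.id rel c) ⋆ (Mor.id rel b * cross a c)
  append_left : ∀ a b c, cross (a ++ b) c = (Mor.id rel a * cross b c) ⋆ (cross a c * Mor.id rel b)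

namespace CrossingFamily

variable (B : CrossingFamily rel)

attribute [simp] dom cod

/-- The dictionary between algebra and topology: up to a power of `t`, the formal chain is the
crossing of one strand with a cable. Stating it for a `CrossingFamily` covers both signs of
crossings. -/
theorem mk_chain (t q : Rˣ) (e : SHom rel (strands x 2) (strands x 2))
    (he : (⟨_, _, (q : R) • (1 : SHom rel (strands x 2) (strands x 2)) - e⟩ : Mor rel) =
      (t : R) • B.cross [x] [x]) {m i l c : ℕ} (h : i + 1 + l + c = m) :
    (⟨_, _, heckeChain q (strandGen x e m) i l⟩ : Mor rel) = ((t ^ l : Rˣ) : R) •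
      (Mor.id rel (strands x i) * B.cross (strands x 1) (strands x l) *
        Mor.id rel (strands x c)) := by
  induction l generalizing c with
  | zero =>
    rw [heckeChain, Mor.mk_one,
      show B.cross (strands x 1) (strands x 0) = _ from B.nil_right _, ← h, Mor.id_strands_add,
          Mor.id_strands_add,
      Mor.id_strands_add, pow_zero, Units.val_one, Mor.one_smul',
      show Mor.id rel (strands x 0) = 1 from rfl, mul_one]
  | succ l ih =>
    have hc : (⟨_, _, heckeCrossing q (strandGen x e m) (i + l)⟩ : Mor rel) =
        (t : R) • (Mor.id rel (strands x (i + l)) * B.cross (strands x 1) (strands x 1) *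
          Mor.id rel (strands x c)) := by
      have h1 : heckeCrossing q (strandGen x e m) (i + l) =
          placeStrands x (i + l) 2 m (by omega)
            ((q : R) • (1 : SHom rel (strands x 2) (strands x 2)) - e) := by
        rw [heckeCrossing, strandGen_eq e (by omega), map_sub, map_smul, map_one]
      rw [h1, mk_placeStrands _ c (by omega), he, Mor.mul_smul, Mor.smul_mul]
      rfl
    rw [heckeChain, Mor.mk_mul, hc, ih (c := c + 1) (by omega), strands_add x l 1, B.append_right]
    rw [Mor.comp_smul _ _ _ (by simp [-List.replicate_one, -List.reduceReplicate, ← List.replicate_one]; omega), Mor.smul_comp _ _ _ (by simp [-List.replicate_one, -List.reduceReplicate, ← List.replicate_one]; omega), Mor.smul_smul',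
      add_comm c 1, Mor.id_strands_add x 1 c, Mor.id_strands_add x i l]
    congr 1
    · rw [pow_succ', Units.val_mul]
    · simp only [mul_assoc]
      rw [Mor.interchange _ _ _ _ (by simp) (by simp), Mor.id_comp_id]
      congr 1
      simp only [← mul_assoc]
      rw [Mor.interchange _ _ _ _ (by simp) (by simp), Mor.id_comp_id]

theorem mk_block (t q : Rˣ) (e : SHom rel (strands x 2) (strands x 2))
    (he : (⟨_, _, (q : R) • (1 : SHom rel (strands x 2) (strands x 2)) - e⟩ : Mor rel) =
      (t : R) • B.cross [x] [x]) {m k l c : ℕ} (h : k + l + c = m) :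
    (⟨_, _, heckeBlock q (strandGen x e m) l k⟩ : Mor rel) = ((t ^ (k * l) : Rˣ) : R) •
      (B.cross (strands x k) (strands x l) * Mor.id rel (strands x c)) := by
  induction k generalizing c with
  | zero =>
    rw [heckeBlock, Mor.mk_one,
      show B.cross (strands x 0) (strands x l) = _ from B.nil_left _, ← h, Mor.id_strands_add,
          Mor.id_strands_add,
      zero_mul, pow_zero, Units.val_one, Mor.one_smul',
      show Mor.id rel (strands x 0) = 1 from rfl, one_mul]
  | succ k ih =>
    rw [heckeBlock, Mor.mk_mul, ih (c := c + 1) (by omega), B.mk_chain t q e he (c := c) (by omega),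
      strands_add x k 1, B.append_left,
        Mor.comp_smul _ _ _ (by simp [-List.replicate_one, -List.reduceReplicate, ← List.replicate_one]; omega),
      Mor.smul_comp _ _ _ (by simp [-List.replicate_one, -List.reduceReplicate, ← List.replicate_one]; omega), Mor.smul_smul', add_comm c 1, Mor.id_strands_add x 1 c]
    congr 1
    · rw [add_mul, pow_add, one_mul, Units.val_mul]
    · simp only [← mul_assoc]
      rw [Mor.interchange _ _ _ _ (by simp [-List.replicate_one, -List.reduceReplicate, ← List.replicate_one]; omega)
        (by simp), Mor.id_comp_id]

/-- The crossings of a spider category. -/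
def pos (rel : S.Relators R) : CrossingFamily rel where
  cross := Mor.braid rel
  dom _ _ := rfl
  cod _ _ := rfl
  nil_left a := by
    have h := Mor.braid_append_left (rel := rel) [] [] a
    have h' := congrArg (· ⋆ Mor.braidInv rel [] a) h
    simp only [Mor.id_nil, one_mul, mul_one, List.append_nil] at h'
    rw [Mor.comp_assoc _ _ _ (by simp) (by simp), Mor.braid_braidInv, Mor.comp_id _ (by simp)] at h'
    exact h'.symm
  nil_right a := by
    have h := Mor.braid_append_right (rel := rel) a [] []
    have h' := congrArg (· ⋆ Mor.braidInv rel a []) h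
    simp only [Mor.id_nil, one_mul, mul_one, List.append_nil] at h'
    rw [Mor.comp_assoc _ _ _ (by simp) (by simp), Mor.braid_braidInv, Mor.comp_id _ (by simp)] at h'
    rw [← h', List.append_nil]
  append_right := Mor.braid_append_right
  append_left := Mor.braid_append_left

/-- The inverse crossings of a spider category. -/
def neg (rel : S.Relators R) : CrossingFamily rel where
  cross a b := Mor.braidInv rel b a
  dom _ _ := rfl
  cod _ _ := rfl
  nil_left a := by
    have h := Mor.braid_braidInv (rel := rel) a []
    rw [show Mor.braid rel a [] = _ from (pos rel).nil_right a, Mor.id_comp _ (by simp)] at h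
    rw [h, List.append_nil]
  nil_right a := by
    have h := Mor.braid_braidInv (rel := rel) [] a
    rw [show Mor.braid rel [] a = _ from (pos rel).nil_left a, Mor.id_comp _ (by simp)] at h
    rw [h, List.nil_append]
  append_right a b c := by
    refine Mor.eq_of_comp_eq_id (Mor.braid rel (b ++ c) a) (Mor.braidInv_braid _ _)
      (Mor.braid_braidInv _ _) (by simp) ?_
    rw [Mor.braid_append_left, ← Mor.comp_assoc _ _ _ (by simp) (by simp),
      Mor.comp_assoc (_ * _) (_ * _) (_ * _) (by simp) (by simp), ← Mor.id_mul_comp _ _ (by simp),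
      Mor.braidInv_braid, ← Mor.id_append, Mor.comp_id _ (by simp), ← Mor.mul_comp_id _ _ (by simp),
      Mor.braidInv_braid, ← Mor.id_append, List.append_assoc, Mor.comp_cod _ _ (by simp)]
    simp
  append_left a b c := by
    refine Mor.eq_of_comp_eq_id (Mor.braid rel c (a ++ b)) (Mor.braidInv_braid _ _)
      (Mor.braid_braidInv _ _) (by simp) ?_
    rw [Mor.braid_append_right, ← Mor.comp_assoc _ _ _ (by simp) (by simp),
      Mor.comp_assoc (_ * _) (_ * _) (_ * _) (by simp) (by simp), ← Mor.mul_comp_id _ _ (by simp),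
      Mor.braidInv_braid, ← Mor.id_append, Mor.comp_id _ (by simp), ← Mor.id_mul_comp _ _ (by simp),
      Mor.braidInv_braid, ← Mor.id_append, Mor.comp_cod _ _ (by simp)]
    simp

end CrossingFamily

/-- Naturality of the crossing of one strand with two others, applied to the crossing of those two.
-/
theorem strandGen_yang_baxter (t q : Rˣ) (e : SHom rel (strands x 2) (strands x 2))
    (he : (⟨_, _, (q : R) • (1 : SHom rel (strands x 2) (strands x 2)) - e⟩ : Mor rel) =
      (t : R) • Mor.braid rel [x] [x]) :
    heckeCrossing q (strandGen x e 3) 0 * heckeCrossing q (strandGen x e 3) 1 *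
        heckeCrossing q (strandGen x e 3) 0 =
      heckeCrossing q (strandGen x e 3) 1 * heckeCrossing q (strandGen x e 3) 0 *
        heckeCrossing q (strandGen x e 3) 1 := by
  have h0 : (⟨_, _, heckeCrossing q (strandGen x e 3) 0⟩ : Mor rel) =
      (t : R) • (Mor.braid rel [x] [x] * Mor.id rel [x]) := by
    have h1 : heckeCrossing q (strandGen x e 3) 0 = placeStrands x 0 2 3 (by omega)
        ((q : R) • (1 : SHom rel (strands x 2) (strands x 2)) - e) := by
      rw [heckeCrossing, strandGen_eq e (by omega), map_sub, map_smul, map_one]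
    rw [h1, mk_placeStrands _ 1 (by omega), he, Mor.mul_smul, Mor.smul_mul]
    exact congrArg _ (congrArg (· * _) (one_mul _))
  have h1 : (⟨_, _, heckeCrossing q (strandGen x e 3) 1⟩ : Mor rel) =
      (t : R) • (Mor.id rel [x] * Mor.braid rel [x] [x]) := by
    have h1 : heckeCrossing q (strandGen x e 3) 1 = placeStrands x 1 2 3 (by omega)
        ((q : R) • (1 : SHom rel (strands x 2) (strands x 2)) - e) := by
      rw [heckeCrossing, strandGen_eq e (by omega), map_sub, map_smul, map_one]
    rw [h1, mk_placeStrands _ 0 (by omega), he, Mor.mul_smul, Mor.smul_mul]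
    exact congrArg _ (mul_one _)
  refine Mor.mk_inj (rel := rel) ?_
  have hn := Mor.braid_natural (Mor.id rel [x]) (Mor.braid rel [x] [x])
  simp only [Mor.id_cod, Mor.id_dom, Mor.braid_cod, Mor.braid_dom] at hn
  rw [Mor.braid_append_right] at hn
  have key : ∀ a b : Mor rel, a.cod = b.dom → b.cod = a.dom →
      ((t : R) • a) ⋆ ((t : R) • b) ⋆ ((t : R) • a) = ((t : R) * (t * t)) • (a ⋆ b ⋆ a) :=
    fun a b hab hba => by
      rw [Mor.smul_comp _ a _ (by simp [hab]), Mor.comp_smul _ a b hab, Mor.smul_smul',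
        Mor.smul_comp _ (a ⋆ b) _ (by simp [hab, hba]), Mor.comp_smul _ _ a (by simp [hab, hba]),
        Mor.smul_smul', mul_assoc]
  rw [Mor.mk_mul, Mor.mk_mul, Mor.mk_mul, Mor.mk_mul, h0, h1, key _ _ (by simp) (by simp),
    key _ _ (by simp) (by simp), ← hn, Mor.comp_assoc _ _ _ (by simp) (by simp)]

/-- The quadratic and the braid relation are proved on two and three strands and transported by the
algebra maps `placeStrands`. Far commutativity is the interchange law. -/
theorem heckeData_strandGen {n : ℕ} (t : Rˣ) {q : Rˣ} (hq : QuantumUnits q n)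
    (e : SHom rel (strands x 2) (strands x 2))
    (he : (⟨_, _, (q : R) • (1 : SHom rel (strands x 2) (strands x 2)) - e⟩ : Mor rel) =
      (t : R) • Mor.braid rel [x] [x])
    (hsq : e * e = (qInt q 2 : R) • e) (m : ℕ) : HeckeData q n m (strandGen x e m) where
  units := hq
  rels :=
    { sq := fun i hi => by
        rw [strandGen_eq e (by omega), ← map_mul, hsq, map_smul]
      comm := fun i j hij hj => strandGen_comm e hij hj
      braid := fun i hi => by
        have hyb := strandGen_yang_baxter t q e he
        have h3 : ∀ j, j < 2 → strandGen x e 3 j * strandGen x e 3 j =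
            (qInt q 2 : R) • strandGen x e 3 j := fun j hj => by
          rw [strandGen_eq e (by omega), ← map_mul, hsq, map_smul]
        have h : strandGen x e 3 0 * strandGen x e 3 1 * strandGen x e 3 0 - strandGen x e 3 0 =
            strandGen x e 3 1 * strandGen x e 3 0 * strandGen x e 3 1 - strandGen x e 3 1 :=
          braid_of_yang_baxter q (h3 0 (by omega)) (h3 1 (by omega)) hyb
        have h' := congrArg (placeStrands x i 3 m (by omega)) h
        simpa only [map_sub, map_mul, placeStrands_strandGen e (show i + 3 ≤ m by omega)
          (show 0 + 2 ≤ 3 by omega), placeStrands_strandGen e (show i + 3 ≤ m by omega)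
          (show 1 + 2 ≤ 3 by omega), add_zero] using h' }

end Spider

end Strands

/-! ### Partial traces of antisymmetrizers. -/

noncomputable section PartialTraces

set_option linter.unusedSimpArgs false

open SpiderSignature SpiderSignature.Diagram Spider

namespace Spider

variable {S : SpiderSignature} {R : Type u} [CommRing R] {rel : S.Relators R}

open scoped Spider.Mor

namespace Mor

variable {a b x : List S.Letter} {f g : Mor rel}

theorem closeRight_comp_right (hd : f.dom = a ++ x) (hc : f.cod = a ++ x)
    (hg : g.dom = a) (hg' : g.cod = a) :
    closeRight a x (f ⋆ (g * id rel x)) = closeRight a x f ⋆ g := by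
  have h : (g * id rel x * id rel (S.dual x)) ⋆ (id rel a * cap rel (S.dual x)) =
      (id rel a * cap rel (S.dual x)) ⋆ g := by
    rw [mul_assoc, ← id_append, interchange _ _ _ _ (by simp [hg']) (by simp [S.dual_dual]),
      comp_id _ hg'.symm, id_comp _ (by simp [S.dual_dual]), mul_eq_right, hg, cap_cod, id_nil,
      mul_one]
  simp only [closeRight]
  rw [mul_comp_id _ _ (by simp [hc, hg]), ← comp_assoc _ _ _ (by simp [hd]) (by simp [hc, hg]),
    comp_assoc _ _ _ (by simp [hd, hc, hg]) (by simp [hg', S.dual_dual]), h,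
    ← comp_assoc _ _ _ (by simp [hd, hc, S.dual_dual]) (by simp [hg])]

theorem closeLeft_comp_left (hd : f.dom = x ++ a) (hc : f.cod = x ++ a)
    (hg : g.dom = a) (hg' : g.cod = a) :
    closeLeft x a ((id rel x * g) ⋆ f) = g ⋆ closeLeft x a f := by
  have h : (cup rel (S.dual x) * id rel a) ⋆ (id rel (S.dual x) * (id rel x * g)) =
      g ⋆ (cup rel (S.dual x) * id rel a) := by
    rw [← mul_assoc, ← id_append, interchange _ _ _ _ (by simp [S.dual_dual]) (by simp [hg]),
      comp_id _ (by simp [S.dual_dual]), id_comp _ (by simp [hg]), mul_eq_right, hg', cup_dom,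
      id_nil, one_mul]
  simp only [closeLeft]
  rw [id_mul_comp _ _ (by simp [hd, hg']),
    ← comp_assoc _ _ _ (by simp [hg, S.dual_dual]) (by simp [hd, hg']), h,
    comp_assoc g _ _ (by simp [hg']) (by simp [hd, S.dual_dual]),
    comp_assoc g _ _ (by simp [hg']) (by simp [hd, hc, S.dual_dual])]

theorem cup_nil : cup rel [] = 1 := by
  have h := rot_cap_eq (rel := rel) []
  rw [cap_nil, rot_one] at h
  exact h.symm

theorem closeRight_nil (hd : f.dom = a) (hc : f.cod = a) : closeRight a [] f = f := by
  simp only [closeRight, S.dual_nil, cap_nil, cup_nil, mul_one, id_nil]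
  rw [id_comp _ (by simp [hd]), comp_id _ (by simp [hc])]

theorem closeLeft_nil (hd : f.dom = a) (hc : f.cod = a) : closeLeft [] a f = f := by
  simp only [closeLeft, S.dual_nil, cap_nil, cup_nil, one_mul, id_nil]
  rw [id_comp _ (by simp [hd]), comp_id _ (by simp [hc])]

theorem closeRight_id_mul (hd : f.dom = a ++ x) (hc : f.cod = a ++ x) (b : List S.Letter) :
    closeRight (b ++ a) x (id rel b * f) = id rel b * closeRight a x f := by
  simp only [closeRight, id_append, mul_assoc]
  rw [id_mul_comp _ _ (by simp [hd, hc, S.dual_dual]), id_mul_comp _ _ (by simp [hd])]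

theorem closeLeft_mul_id (hd : f.dom = x ++ a) (hc : f.cod = x ++ a) (b : List S.Letter) :
    closeLeft x (a ++ b) (f * id rel b) = closeLeft x a f * id rel b := by
  simp only [closeLeft, id_append, ← mul_assoc]
  rw [mul_comp_id _ _ (by simp [hd, hc, S.dual_dual]), mul_comp_id _ _ (by simp [hd, S.dual_dual])]

theorem closeRight_smul (r : R) (hd : f.dom = a ++ x) (hc : f.cod = a ++ x) :
    closeRight a x (r • f) = r • closeRight a x f := by
  simp only [closeRight]
  rw [smul_mul, comp_smul _ _ _ (by simp [hd]), smul_comp _ _ _ (by simp [hd, hc, S.dual_dual])]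

theorem closeLeft_smul (r : R) (hd : f.dom = x ++ a) (hc : f.cod = x ++ a) :
    closeLeft x a (r • f) = r • closeLeft x a f := by
  simp only [closeLeft]
  rw [mul_smul, comp_smul _ _ _ (by simp [hd, S.dual_dual]), smul_comp _ _ _ (by simp [hd, hc, S.dual_dual])]

end Mor

/-- Closing up on the right as a linear map. -/
def closeRightHom {a x d : List S.Letter} (h : d = a ++ x) : SHom rel d d →ₗ[R] SHom rel a a where
  toFun f := hcomp (hcomp
    ((Mor.id rel a * Mor.cup rel x).toHom (a := a) (b := d ++ S.dual x) (by simp) (by simp [h]))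
    (htensor f (1 : SHom rel (S.dual x) (S.dual x))))
    ((Mor.id rel a * Mor.cap rel (S.dual x)).toHom (a := d ++ S.dual x) (b := a)
      (by simp [h, S.dual_dual]) (by simp))
  map_add' f g := by rw [add_htensor, hcomp_add, add_hcomp]
  map_smul' r f := by rw [smul_htensor, hcomp_smul, smul_hcomp, RingHom.id_apply]

theorem mk_closeRightHom {a x d : List S.Letter} (h : d = a ++ x) (f : SHom rel d d) :
    (⟨a, a, closeRightHom h f⟩ : Mor rel) = Mor.closeRight a x ⟨d, d, f⟩ := by
  refine (Mor.mk_hcomp _ _).trans ?_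
  rw [Mor.mk_hcomp, Mor.mk_toHom, Mor.mk_toHom, Mor.mk_htensor, Mor.mk_one]
  rfl

/-- Closing up on the left as a linear map. -/
def closeLeftHom {a x d : List S.Letter} (h : d = x ++ a) : SHom rel d d →ₗ[R] SHom rel a a where
  toFun f := hcomp (hcomp
    ((Mor.cup rel (S.dual x) * Mor.id rel a).toHom (a := a) (b := S.dual x ++ d) (by simp)
      (by simp [h, S.dual_dual]))
    (htensor (1 : SHom rel (S.dual x) (S.dual x)) f))
    ((Mor.cap rel x * Mor.id rel a).toHom (a := S.dual x ++ d) (b := a)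
      (by simp [h]) (by simp))
  map_add' f g := by rw [htensor_add, hcomp_add, add_hcomp]
  map_smul' r f := by rw [htensor_smul, hcomp_smul, smul_hcomp, RingHom.id_apply]

theorem mk_closeLeftHom {a x d : List S.Letter} (h : d = x ++ a) (f : SHom rel d d) :
    (⟨a, a, closeLeftHom h f⟩ : Mor rel) = Mor.closeLeft x a ⟨d, d, f⟩ := by
  refine (Mor.mk_hcomp _ _).trans ?_
  rw [Mor.mk_hcomp, Mor.mk_toHom, Mor.mk_toHom, Mor.mk_htensor, Mor.mk_one]
  rfl

/-- A letter with a Hecke generator `e` of its double strand: the crossings are `t⁻¹ (q - e)` and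
`t (q⁻¹ - e)`, and the partial traces are those of the `n`-dimensional representation. -/
structure HeckeStrand (rel : S.Relators R) (x : S.Letter) (n : ℕ) (q t : Rˣ)
    (e : SHom rel (strands x 2) (strands x 2)) : Prop where
  units : QuantumUnits q n
  pos : (⟨_, _, (q : R) • (1 : SHom rel (strands x 2) (strands x 2)) - e⟩ : Mor rel) =
    (t : R) • Mor.braid rel [x] [x]
  neg : (⟨_, _, ((q⁻¹ : Rˣ) : R) • (1 : SHom rel (strands x 2) (strands x 2)) - e⟩ : Mor rel) =
    ((t⁻¹ : Rˣ) : R) • Mor.braidInv rel [x] [x]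
  sq : e * e = (qInt q 2 : R) • e
  loop_right : Mor.closeRight [] [x] (Mor.id rel [x]) = (qInt q (n : ℤ) : R) • 1
  loop_left : Mor.closeLeft [x] [] (Mor.id rel [x]) = (qInt q (n : ℤ) : R) • 1
  kink_right : Mor.closeRight [x] [x] ⟨_, _, e⟩ = (qInt q ((n : ℤ) - 1) : R) • Mor.id rel [x]
  kink_left : Mor.closeLeft [x] [x] ⟨_, _, e⟩ = (qInt q ((n : ℤ) - 1) : R) • Mor.id rel [x]

/-- The antisymmetrizer of `k` strands. -/
def strandProj (q : Rˣ) {x : S.Letter} (e : SHom rel (strands x 2) (strands x 2)) (k : ℕ) :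
    SHom rel (strands x k) (strands x k) := antisym q (strandGen x e k) 0 k

theorem strands_succ (x : S.Letter) (k : ℕ) :
    strands x (k + 1) = strands x 1 ++ strands x k := by rw [← strands_add, add_comm]

variable {x : S.Letter} {n : ℕ} {q t : Rˣ} {e : SHom rel (strands x 2) (strands x 2)}

theorem mk_antisym {m i k : ℕ} (c : ℕ) (h : i + k + c = m) :
    (⟨_, _, antisym q (strandGen x e m) i k⟩ : Mor rel) =
      Mor.id rel (strands x i) * ⟨_, _, strandProj q e k⟩ * Mor.id rel (strands x c) := by
  have := placeStrands_antisym (x := x) q e (i := i) (k := k) (m := m) (j := 0) (l := k)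
    (by omega) (by omega)
  rw [add_zero] at this
  rw [← this, mk_placeStrands _ c h]
  rfl

namespace HeckeStrand

variable (H : HeckeStrand rel x n q t e)
include H

theorem data (m : ℕ) : HeckeData q n m (strandGen x e m) :=
  heckeData_strandGen t H.units e H.pos H.sq m

theorem strandProj_idem {k : ℕ} (hk : k ≤ n) : strandProj q e k * strandProj q e k =
    strandProj q e k :=
  (H.data k).antisym_idem hk (by omega)

/-- The scalar of the partial trace: in the recursion a generator contributes `[n-1]` and a free
strand `[n]`. -/
theorem qInt_trace (k : ℕ) :
    (qInt q ((k : ℤ) + 1) * qInt q ((n : ℤ) - 1) - qInt q (k : ℤ) * qInt q (n : ℤ) : R) =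
      qInt q ((n : ℤ) - (k + 1)) := by
  have h := qInt_mul H.units.sub_inv ((k : ℤ) + 1) k (n - 1 - k)
  rw [show (k : ℤ) + (n - 1 - k) = n - 1 by ring, show (k : ℤ) + 1 + (n - 1 - k) = n by ring,
    show (k : ℤ) + 1 - k = 1 by ring, qInt_one, mul_one] at h
  rw [h, show (n : ℤ) - (k + 1) = n - 1 - k by ring]
  ring

/-- The last strand of the recursion is closed. The smaller antisymmetrizers do not meet it and move
out of the closure, so only closures of a free strand and of one generator have to be known. -/
theorem closeRight_strandProj_one {k : ℕ} (hk : k + 1 ≤ n) :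
    (qInt q ((k : ℤ) + 1) : R) • closeRightHom (strands_add x k 1) (strandProj q e (k + 1)) =
      (qInt q ((n : ℤ) - k) : R) • strandProj q e k := by
  rcases k with _ | k
  · refine Mor.mk_inj (rel := rel) ?_
    rw [Mor.mk_smul, Mor.mk_smul, mk_closeRightHom]
    simp only [strandProj, antisym_zero, antisym_one, Nat.cast_zero, zero_add, sub_zero, qInt_one,
      Mor.mk_one, Mor.one_smul']
    exact H.loop_right
  · have hr := (H.units.smul_antisym (strandGen x e (k + 2)) 0 (k := k) (by omega))
    rw [zero_add] at hr
    have hP : (⟨_, _, antisym q (strandGen x e (k + 2)) 0 (k + 1)⟩ : Mor rel) =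
        ⟨_, _, strandProj q e (k + 1)⟩ * Mor.id rel (strands x 1) := by
      rw [mk_antisym 1 (by omega)]; exact congrArg (· * _) (one_mul _)
    -- The last strand is free and closes to a loop.
    have h1 : closeRightHom (strands_add x (k + 1) 1)
        (antisym q (strandGen x e (k + 2)) 0 (k + 1)) =
        (qInt q (n : ℤ) : R) • strandProj q e (k + 1) := by
      refine Mor.mk_inj (rel := rel) ?_
      have h2 := Mor.closeRight_id_mul (f := Mor.id rel (strands x 1)) (a := []) (x :=
          strands x 1) rfl rfl
        (strands x (k + 1))
      rw [List.append_nil] at h2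
      rw [mk_closeRightHom, hP, ← Mor.comp_id (_ * _) (a := strands x (k + 1) ++ strands x 1) rfl,
        Mor.closeRight_comp_left (a := strands x (k + 1)) (g := ⟨_, _, strandProj q e (k + 1)⟩)
          rfl rfl rfl rfl, Mor.id_append, h2,
            show Mor.closeRight [] (strands x 1) (Mor.id rel (strands x 1)) = _ from H.loop_right,
                Mor.mul_smul,
        mul_one, Mor.comp_smul _ _ _ rfl, Mor.comp_id _ rfl, Mor.mk_smul]
    have he : (⟨_, _, strandGen x e (k + 2) k⟩ : Mor rel) =
        Mor.id rel (strands x k) * ⟨_, _, e⟩ := by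
      rw [strandGen_eq e le_rfl, mk_placeStrands _ 0 (by omega)]; exact mul_one _
    -- The closure of the generator is a scalar, after which the two antisymmetrizers multiply to
    -- one.
    have h3 : closeRightHom (strands_add x (k + 1) 1)
        (antisym q (strandGen x e (k + 2)) 0 (k + 1) * strandGen x e (k + 2) k *
          antisym q (strandGen x e (k + 2)) 0 (k + 1)) =
        (qInt q ((n : ℤ) - 1) : R) • strandProj q e (k + 1) := by
      refine Mor.mk_inj (rel := rel) ?_
      have hc : (Mor.closeRight (strands x (k + 1)) (strands x 1)
          (Mor.id rel (strands x k) * ⟨_, _, e⟩)) =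
            (qInt q ((n : ℤ) - 1) : R) • Mor.id rel (strands x (k + 1)) := by
        rw [strands_add x k 1]
        refine (Mor.closeRight_id_mul (f := ⟨_, _, e⟩) (a := strands x 1) (x :=
          strands x 1) rfl rfl _).trans ?_
        refine (congrArg _ H.kink_right).trans ?_
        rw [Mor.mul_smul, Mor.id_append]; rfl
      have hd : (Mor.id rel (strands x k) * (⟨_, _, e⟩ : Mor rel)).dom =
          strands x (k + 1) ++ strands x 1 := by
        rw [← strands_add]; exact (strands_add x k 2).symm
      have hd' : (Mor.id rel (strands x k) * (⟨_, _, e⟩ : Mor rel)).cod =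
          strands x (k + 1) ++ strands x 1 := hd
      rw [mk_closeRightHom, Mor.mk_mul, Mor.mk_mul, hP, he,
        Mor.closeRight_comp_right (a := strands x (k + 1)) (g := ⟨_, _, strandProj q e (k + 1)⟩)
          (by simp) (by rw [Mor.comp_cod _ _ hd.symm, hd']) rfl rfl,
        Mor.closeRight_comp_left (a := strands x (k + 1)) (g := ⟨_, _, strandProj q e (k + 1)⟩)
          hd hd' rfl rfl, hc, Mor.comp_smul _ _ _ rfl, Mor.comp_id _ rfl,
        Mor.smul_comp _ _ _ rfl, ← Mor.mk_mul, H.strandProj_idem (by omega), Mor.mk_smul]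
    have hr' := congrArg (closeRightHom (strands_add x (k + 1) 1)) hr
    rw [map_smul, map_sub, map_smul, map_smul, h1, h3] at hr'
    push_cast
    rw [show (k : ℤ) + 1 + 1 = k + 2 by ring]
    refine hr'.trans ?_
    rw [smul_smul, smul_smul, ← sub_smul, H.qInt_trace]

/-- The same computation on the first strand, with the recursion that adds a strand on the left. -/
theorem closeLeft_strandProj_one {k : ℕ} (hk : k + 1 ≤ n) :
    (qInt q ((k : ℤ) + 1) : R) • closeLeftHom (strands_succ x k) (strandProj q e (k + 1)) =
      (qInt q ((n : ℤ) - k) : R) • strandProj q e k := by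
  rcases k with _ | k
  · refine Mor.mk_inj (rel := rel) ?_
    rw [Mor.mk_smul, Mor.mk_smul, mk_closeLeftHom]
    simp only [strandProj, antisym_zero, antisym_one, Nat.cast_zero, zero_add, sub_zero, qInt_one,
      Mor.mk_one, Mor.one_smul']
    exact H.loop_left
  · have hr := (H.data (k + 2)).smul_antisym_left (i := 0) (k := k) (by omega) (by omega)
    rw [zero_add] at hr
    have hP : (⟨_, _, antisym q (strandGen x e (k + 2)) 1 (k + 1)⟩ : Mor rel) =
        Mor.id rel (strands x 1) * ⟨_, _, strandProj q e (k + 1)⟩ := by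
      rw [mk_antisym 0 (by omega)]; exact mul_one _
    have h1 : closeLeftHom (strands_succ x (k + 1))
        (antisym q (strandGen x e (k + 2)) 1 (k + 1)) =
        (qInt q (n : ℤ) : R) • strandProj q e (k + 1) := by
      refine Mor.mk_inj (rel := rel) ?_
      have h2 := Mor.closeLeft_mul_id (f := Mor.id rel (strands x 1)) (a := []) (x := strands x 1)
        rfl rfl (strands x (k + 1))
      rw [List.nil_append] at h2
      rw [mk_closeLeftHom, hP, ← Mor.id_comp (_ * _) (a := strands x 1 ++ strands x (k + 1)) rfl,
        Mor.closeLeft_comp_right (a := strands x (k + 1)) (g := ⟨_, _, strandProj q e (k + 1)⟩)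
          rfl rfl rfl rfl, Mor.id_append, h2,
            show Mor.closeLeft (strands x 1) [] (Mor.id rel (strands x 1)) = _ from H.loop_left,
                Mor.smul_mul,
        one_mul, Mor.smul_comp _ _ _ rfl, Mor.id_comp ⟨_, _, strandProj q e (k + 1)⟩ rfl,
        Mor.mk_smul]
    have he : (⟨_, _, strandGen x e (k + 2) 0⟩ : Mor rel) =
        ⟨_, _, e⟩ * Mor.id rel (strands x k) := by
      rw [strandGen_eq e (by omega), mk_placeStrands _ k (by omega)]
      exact congrArg (· * _) (one_mul _)
    have h3 : closeLeftHom (strands_succ x (k + 1))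
        (antisym q (strandGen x e (k + 2)) 1 (k + 1) * strandGen x e (k + 2) 0 *
          antisym q (strandGen x e (k + 2)) 1 (k + 1)) =
        (qInt q ((n : ℤ) - 1) : R) • strandProj q e (k + 1) := by
      refine Mor.mk_inj (rel := rel) ?_
      have hc : (Mor.closeLeft (strands x 1) (strands x (k + 1))
          (⟨_, _, e⟩ * Mor.id rel (strands x k))) =
            (qInt q ((n : ℤ) - 1) : R) • Mor.id rel (strands x (k + 1)) := by
        rw [strands_succ x k]
        refine (Mor.closeLeft_mul_id (f := ⟨_, _, e⟩) (a := strands x 1) (x := strands x 1)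
          rfl rfl _).trans ?_
        refine (congrArg (· * _) H.kink_left).trans ?_
        rw [Mor.smul_mul, Mor.id_append]; rfl
      have hd : ((⟨_, _, e⟩ : Mor rel) * Mor.id rel (strands x k)).dom =
          strands x 1 ++ strands x (k + 1) := by
        rw [← strands_succ, add_assoc, add_comm, strands_add, Mor.mul_dom, add_comm]; rfl
      have hd' : ((⟨_, _, e⟩ : Mor rel) * Mor.id rel (strands x k)).cod =
          strands x 1 ++ strands x (k + 1) := hd
      rw [mk_closeLeftHom, Mor.mk_mul, Mor.mk_mul, hP, he,
        Mor.closeLeft_comp_right (a := strands x (k + 1)) (g := ⟨_, _, strandProj q e (k + 1)⟩)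
          (by simp) (by rw [Mor.comp_cod _ _ hd.symm, hd']) rfl rfl,
        Mor.closeLeft_comp_left (a := strands x (k + 1)) (g := ⟨_, _, strandProj q e (k + 1)⟩)
          hd hd' rfl rfl, hc, Mor.comp_smul _ _ _ rfl, Mor.comp_id _ rfl,
        Mor.smul_comp _ _ _ rfl, ← Mor.mk_mul, H.strandProj_idem (by omega), Mor.mk_smul]
    have hr' := congrArg (closeLeftHom (strands_succ x (k + 1))) hr
    rw [map_smul, map_sub, map_smul, map_smul, h1, h3] at hr'
    push_cast
    rw [show (k : ℤ) + 1 + 1 = k + 2 by ring]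
    refine hr'.trans ?_
    rw [smul_smul, smul_smul, ← sub_smul, H.qInt_trace]

/-- Closing up `l` of the strands of an antisymmetrizer. -/
theorem closeRight_strandProj {k l : ℕ} (h : k + l ≤ n) :
    (qBinom q ((k + l : ℕ) : ℤ) l : R) •
        Mor.closeRight (strands x k) (strands x l) ⟨_, _, strandProj q e (k + l)⟩ =
      (qBinom q ((n : ℤ) - k) l : R) • (⟨_, _, strandProj q e k⟩ : Mor rel) := by
  induction l with
  | zero =>
    rw [qBinom_zero, qBinom_zero, Mor.one_smul', Mor.one_smul']
    exact Mor.closeRight_nil rfl rfl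
  | succ l ih =>
    refine Mor.smul_left_cancel (H.units.isUnit (l + 1) (by omega) (by omega)) ?_
    have h1 := congrArg (Mor.mk (rel := rel) _ _) (H.closeRight_strandProj_one (k := k +
        l) (by omega))
    rw [Mor.mk_smul, Mor.mk_smul, mk_closeRightHom] at h1
    have hw : strands x (k + (l + 1)) = strands x k ++ (strands x l ++ strands x 1) := by
      rw [← strands_add, ← strands_add]
    have h2 := congrArg (Mor.closeRight (strands x k) (strands x l)) h1
    rw [Mor.closeRight_smul _ (by rw [Mor.closeRight_dom, strands_add])
        (by rw [Mor.closeRight_cod (strands_add x (k + l) 1) (strands_add x (k + l) 1),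
          strands_add]),
      Mor.closeRight_smul _ (strands_add x k l) (strands_add x k l)] at h2
    push_cast at h2 ih ⊢
    have hb := H.units.qInt_mul_qBinom_succ_succ (t := l) (by omega) ((k : ℤ) + l)
    have hb' := H.units.qInt_mul_qBinom_succ (t := l) (by omega) ((n : ℤ) - k)
    rw [Mor.smul_smul', Mor.smul_smul', ← add_assoc (k : ℤ), hb, hb', strands_add x l 1,
      Mor.closeRight_append hw hw, ← strands_add, mul_comm, ← Mor.smul_smul']
    refine (congrArg _ h2).trans ?_
    rw [Mor.smul_smul', mul_comm, ← Mor.smul_smul', ih (by omega), Mor.smul_smul', sub_sub]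

theorem closeLeft_strandProj {k l : ℕ} (h : l + k ≤ n) :
    (qBinom q ((l + k : ℕ) : ℤ) l : R) •
        Mor.closeLeft (strands x l) (strands x k) ⟨_, _, strandProj q e (l + k)⟩ =
      (qBinom q ((n : ℤ) - k) l : R) • (⟨_, _, strandProj q e k⟩ : Mor rel) := by
  induction l with
  | zero =>
    rw [qBinom_zero, qBinom_zero, Mor.one_smul', Mor.one_smul', zero_add]
    exact Mor.closeLeft_nil rfl rfl
  | succ l ih =>
    refine Mor.smul_left_cancel (H.units.isUnit (l + 1) (by omega) (by omega)) ?_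
    have h1 := congrArg (Mor.mk (rel := rel) _ _) (H.closeLeft_strandProj_one (k := l +
        k) (by omega))
    rw [Mor.mk_smul, Mor.mk_smul, mk_closeLeftHom] at h1
    have hw : strands x (l + k + 1) = (strands x 1 ++ strands x l) ++ strands x k := by
      rw [← strands_succ, ← strands_add]; congr 1; omega
    have h2 := congrArg (Mor.closeLeft (strands x l) (strands x k)) h1
    rw [Mor.closeLeft_smul _ (by rw [Mor.closeLeft_dom, strands_add])
        (by rw [Mor.closeLeft_cod (strands_succ x (l + k)) (strands_succ x (l + k)), strands_add]),
      Mor.closeLeft_smul _ (strands_add x l k) (strands_add x l k)] at h2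
    have hb := H.units.qInt_mul_qBinom_succ_succ (t := l) (by omega) ((l : ℤ) + k)
    have hb' := H.units.qInt_mul_qBinom_succ (t := l) (by omega) ((n : ℤ) - k)
    rw [show l + 1 + k = l + k + 1 by omega]
    push_cast at h2 ih ⊢
    rw [Mor.smul_smul', Mor.smul_smul', hb, hb', strands_succ x l,
      Mor.closeLeft_append hw hw, ← strands_add, mul_comm, ← Mor.smul_smul']
    refine (congrArg _ h2).trans ?_
    rw [Mor.smul_smul', mul_comm, ← Mor.smul_smul', ih (by omega), Mor.smul_smul',
      show (n : ℤ) - (l + k) = n - k - l by ring]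

end HeckeStrand

end Spider

end PartialTraces

/-! ### Webs as antisymmetrizers on cables. -/

noncomputable section WebInterpretation

set_option linter.unusedSimpArgs false

open SpiderSignature SpiderSignature.Diagram Spider

open scoped Spider.Mor

variable {T : SpiderSignature} {R : Type u} [CommRing R] {rel : T.Relators R}

namespace Interpretation

open StrandMap

variable {S : SpiderSignature} (φ : Interpretation S rel)

/-- The idempotents on the images of the cup, the cap and the closing strands can all be moved to
the image of `f`, which absorbs them. A closed web is thus an ordinary partial trace. -/
theorem mor_closeRight (a x : List S.Letter) (f : S.Diagram R (a ++ x) (a ++ x)) :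
    φ.mor (Diagram.closeRight a x f) = Mor.closeRight (φ.words a) (φ.words x) (φ.mor f) := by
  have hf := φ.mor_absorb f
  rw [proj_append] at hf
  have hx : (Mor.id rel (φ.words a) * φ.proj x) ⋆ φ.mor f = φ.mor f := by
    have h := congrArg ((Mor.id rel (φ.words a) * φ.proj x) ⋆ ·) hf.1
    rwa [← Mor.comp_assoc _ _ _ (by simp) (by simp), Mor.interchange _ _ _ _ (by simp) (by simp),
      proj_comp_proj, Mor.id_comp _ (by simp), hf.1, eq_comm] at h
  have hcup : (φ.proj a * φ.mor (.cup x (S.dual x) rfl)) ⋆ (φ.mor f * φ.proj (S.dual x)) =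
      (Mor.id rel (φ.words a) * Mor.cup rel (φ.words x)) ⋆
        (φ.mor f * φ.proj (S.dual x)) := by
    rw [mor_cup, ← Mor.id_comp (φ.proj a) (φ.proj_dom a).symm,
      ← Mor.interchange _ _ _ _ (by simp) (by simp), Mor.comp_assoc _ _ _ (by simp) (by simp),
      ← mul_assoc, Mor.interchange _ _ _ _ (by simp) (by simp), hf.1, Mor.id_comp _ (by simp)]
  have hcup' : (Mor.id rel (φ.words a) * Mor.cup rel (φ.words x)) ⋆
      (φ.mor f * φ.proj (S.dual x)) = (Mor.id rel (φ.words a) * Mor.cup rel (φ.words x)) ⋆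
        (φ.mor f * Mor.id rel (T.dual (φ.words x))) := by
    have h1 : φ.mor f * φ.proj (S.dual x) =
        (Mor.id rel (φ.words a) * (Mor.id rel (φ.words x) * φ.proj (S.dual x))) ⋆
          (φ.mor f * Mor.id rel (T.dual (φ.words x))) := by
      rw [← mul_assoc, ← Mor.id_append, Mor.interchange _ _ _ _ (by simp) (by simp),
        Mor.id_comp (φ.mor f) (by simp), Mor.comp_id _ (by simp)]
    rw [h1, ← Mor.comp_assoc _ _ _ (by simp) (by simp), Mor.interchange _ _ _ _ (by simp) (by simp),
      Mor.id_comp_id, ← mor_cup' _ rfl, mor_cup, ← Mor.id_comp_id (φ.words a),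
      ← Mor.interchange _ _ _ _ (by simp) (by simp), Mor.comp_assoc _ _ _ (by simp) (by simp),
      ← mul_assoc, Mor.interchange _ _ _ _ (by simp) (by simp), Mor.id_comp_id]
    rw [hx, Mor.id_comp_id]
  have hcap : (φ.mor f * Mor.id rel (T.dual (φ.words x))) ⋆
      (φ.proj a * φ.mor (.cap (S.dual x) x (eq_dual_symm rfl))) =
        (φ.mor f * Mor.id rel (T.dual (φ.words x))) ⋆
          (Mor.id rel (φ.words a) * Mor.cap rel (T.dual (φ.words x))) := by
    have h1 : φ.proj a * φ.mor (.cap (S.dual x) x (eq_dual_symm rfl) : S.Diagram R _ _) =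
        (φ.proj a * φ.proj x * Mor.id rel (T.dual (φ.words x))) ⋆
          (Mor.id rel (φ.words a) * Mor.cap rel (T.dual (φ.words x))) := by
      rw [mor_cap', mul_assoc, Mor.interchange _ _ _ _ (by simp) (by simp [T.dual_dual]),
        Mor.comp_id _ (by simp), words_dual, S.dual_dual]
    rw [h1, ← Mor.comp_assoc _ _ _ (by simp) (by simp [T.dual_dual]),
      Mor.interchange _ _ _ _ (by simp) (by simp), hf.2, Mor.id_comp_id]
  simp only [Diagram.closeRight]
  rw [mor_comp, mor_comp_eqTo, mor_comp, mor_comp_eqTo, mor_eqTo_comp, mor_comp_eqTo, mor_tensor,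
    mor_tensor, mor_tensor, mor_eqTo, mor_eqTo, hcup, hcup',
    Mor.comp_assoc _ _ _ (by simp) (by simp), hcap, ← Mor.comp_assoc _ _ _ (by simp) (by simp [T.dual_dual])]
  rfl

theorem mor_closeLeft (a x : List S.Letter) (f : S.Diagram R (x ++ a) (x ++ a)) :
    φ.mor (Diagram.closeLeft x a f) = Mor.closeLeft (φ.words x) (φ.words a) (φ.mor f) := by
  have hf := φ.mor_absorb f
  rw [proj_append] at hf
  have hx : (φ.proj x * Mor.id rel (φ.words a)) ⋆ φ.mor f = φ.mor f := by
    have h := congrArg ((φ.proj x * Mor.id rel (φ.words a)) ⋆ ·) hf.1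
    rwa [← Mor.comp_assoc _ _ _ (by simp) (by simp), Mor.interchange _ _ _ _ (by simp) (by simp),
      proj_comp_proj, Mor.id_comp _ (by simp), hf.1, eq_comm] at h
  have hcup0 : φ.mor (.cup (S.dual x) x (eq_dual_symm rfl) : S.Diagram R _ _) =
      Mor.cup rel (T.dual (φ.words x)) ⋆ (Mor.id rel (T.dual (φ.words x)) * φ.proj x) := by
    rw [mor_cup', words_dual, S.dual_dual]
  have hcup0' : φ.mor (.cup (S.dual x) x (eq_dual_symm rfl) : S.Diagram R _ _) =
      Mor.cup rel (T.dual (φ.words x)) ⋆ (φ.proj (S.dual x) * Mor.id rel (φ.words x)) := by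
    rw [mor_cup, words_dual, T.dual_dual]
  have hcup : (φ.mor (.cup (S.dual x) x (eq_dual_symm rfl)) * φ.proj a) ⋆
      (φ.proj (S.dual x) * φ.mor f) = (Mor.cup rel (T.dual (φ.words x)) * Mor.id rel (φ.words a)) ⋆
        (φ.proj (S.dual x) * φ.mor f) := by
    rw [hcup0, ← Mor.id_comp (φ.proj a) (φ.proj_dom a).symm,
      ← Mor.interchange _ _ _ _ (by simp [T.dual_dual]) (by simp),
      Mor.comp_assoc _ _ _ (by simp [T.dual_dual]) (by simp),
      mul_assoc, Mor.interchange _ _ _ _ (by simp) (by simp), hf.1, Mor.id_comp _ (by simp)]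
  have hcup' : (Mor.cup rel (T.dual (φ.words x)) * Mor.id rel (φ.words a)) ⋆
        (φ.proj (S.dual x) * φ.mor f) =
      (Mor.cup rel (T.dual (φ.words x)) * Mor.id rel (φ.words a)) ⋆
        (Mor.id rel (T.dual (φ.words x)) * φ.mor f) := by
    have h1 : φ.proj (S.dual x) * φ.mor f =
        (φ.proj (S.dual x) * Mor.id rel (φ.words x) * Mor.id rel (φ.words a)) ⋆
          (Mor.id rel (T.dual (φ.words x)) * φ.mor f) := by
      rw [mul_assoc, ← Mor.id_append, Mor.interchange _ _ _ _ (by simp) (by simp),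
        Mor.id_comp (φ.mor f) (by simp), Mor.comp_id _ (by simp)]
    rw [h1, ← Mor.comp_assoc _ _ _ (by simp [T.dual_dual]) (by simp),
      Mor.interchange _ _ _ _ (by simp [T.dual_dual]) (by simp),
      Mor.id_comp_id, ← hcup0', hcup0, ← Mor.id_comp_id (φ.words a),
      ← Mor.interchange _ _ _ _ (by simp [T.dual_dual]) (by simp),
      Mor.comp_assoc _ _ _ (by simp [T.dual_dual]) (by simp),
      mul_assoc, Mor.interchange _ _ _ _ (by simp) (by simp), Mor.id_comp_id]
    rw [hx, Mor.id_comp_id]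
  have hcap : (Mor.id rel (T.dual (φ.words x)) * φ.mor f) ⋆
      (φ.mor (.cap x (S.dual x) rfl) * φ.proj a) =
        (Mor.id rel (T.dual (φ.words x)) * φ.mor f) ⋆
          (Mor.cap rel (φ.words x) * Mor.id rel (φ.words a)) := by
    have h1 : φ.mor (.cap x (S.dual x) rfl : S.Diagram R _ _) * φ.proj a =
        (Mor.id rel (T.dual (φ.words x)) * (φ.proj x * φ.proj a)) ⋆
          (Mor.cap rel (φ.words x) * Mor.id rel (φ.words a)) := by
      rw [mor_cap, ← mul_assoc, Mor.interchange _ _ _ _ (by simp) (by simp),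
        Mor.comp_id _ (by simp)]
    rw [h1, ← Mor.comp_assoc _ _ _ (by simp) (by simp),
      Mor.interchange _ _ _ _ (by simp) (by simp), hf.2, Mor.id_comp_id]
  simp only [Diagram.closeLeft]
  rw [mor_comp, mor_comp_eqTo, mor_comp, mor_comp_eqTo, mor_tensor,
    mor_tensor, mor_tensor, mor_eqTo, mor_eqTo, hcup, hcup',
    Mor.comp_assoc _ _ _ (by simp [T.dual_dual]) (by simp), hcap,
    ← Mor.comp_assoc _ _ _ (by simp [T.dual_dual]) (by simp)]
  rfl

theorem eval_sum {a b : List S.Letter} (l : List (S.Diagram R a b)) :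
    φ.eval (Diagram.sum l) = (l.map fun f => φ.eval f).sum := by
  induction l with
  | nil => rw [Diagram.sum, List.foldr_nil, eval]; rfl
  | cons f l ih =>
    rw [List.map_cons, List.sum_cons, ← ih, Diagram.sum, List.foldr_cons, eval]; rfl

end Interpretation

theorem qBinom_inv {q : Rˣ} (hd : IsUnit ((q : R) - ((q⁻¹ : Rˣ) : R))) (m : ℤ) (k : ℕ) :
    (qBinom q⁻¹ m k : R) = qBinom q m k := by
  simp only [qBinom, qFactorial, qInt_inv hd]

namespace Spider.HeckeStrand

variable {x : T.Letter} {n : ℕ} {q t : Rˣ} {e : SHom rel (strands x 2) (strands x 2)}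
variable (H : HeckeStrand rel x n q t e)

/-- The antisymmetrizer as a bundled morphism. -/
def _root_.Spider.Mor.strandProj (q : Rˣ) {x : T.Letter} (e : SHom rel (strands x 2) (strands x 2))
    (k : ℕ) : Mor rel := ⟨_, _, Spider.strandProj q e k⟩

omit H in
@[simp] theorem _root_.Spider.Mor.strandProj_cod (k : ℕ) :
    (Mor.strandProj q e k).cod = strands x k := (rfl)

theorem mk_antisymPair {k l m : ℕ} (h : k + l = m) :
    (⟨_, _, antisymPair q (strandGen x e m) m k⟩ : Mor rel) =
      Mor.strandProj q e k * Mor.strandProj q e l := by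
  subst h
  rw [antisymPair, Nat.add_sub_cancel_left, Mor.mk_mul, mk_antisym l (by omega),
    mk_antisym 0 (by omega), Mor.mul_eq_left (Mor.strandProj q e k)]
  exact congrArg₂ _ (congrArg (· * _) (one_mul _)) (mul_one _)

include H

theorem strandProj_comp (k : ℕ) (hk : k ≤ n) :
    Mor.strandProj q e k ⋆ Mor.strandProj q e k = Mor.strandProj q e k := by
  rw [Mor.strandProj, ← Mor.mk_mul, H.strandProj_idem hk]

theorem strandProj_mul_comp {k l m : ℕ} (h : k + l = m) (hm : m ≤ n) :
    (Mor.strandProj q e k * Mor.strandProj q e l) ⋆ Mor.strandProj q e m =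
      Mor.strandProj q e m := by
  have hd := H.data m
  rw [← mk_antisymPair h, Mor.strandProj, ← Mor.mk_mul, strandProj, antisymPair, mul_assoc,
    hd.antisym_mul_antisym' hm (by omega) (by omega) (by omega),
    hd.antisym_mul_antisym' hm (by omega) (by omega) (by omega)]

theorem strandProj_comp_mul {k l m : ℕ} (h : k + l = m) (hm : m ≤ n) :
    Mor.strandProj q e m ⋆ (Mor.strandProj q e k * Mor.strandProj q e l) =
      Mor.strandProj q e m := by
  have hd := H.data m
  rw [← mk_antisymPair h, Mor.strandProj, ← Mor.mk_mul, strandProj, antisymPair, ← mul_assoc,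
    hd.antisym_mul_antisym hm (by omega) (by omega) (by omega),
    hd.antisym_mul_antisym hm (by omega) (by omega) (by omega)]

/-- The colored edges are interpreted as antisymmetrizers. -/
def strandMap : StrandMap (moySignature n) rel where
  word
    | (k, true) => strands x k.1
    | (k, false) => T.dual (strands x k.1)
  word_bar
    | (_, true) => rfl
    | (_, false) => (T.dual_dual _).symm
  idem
    | (k, true) => strandProj q e k.1
    | (k, false) => hrot (strandProj q e k.1)
  idem_comp_idem
    | (k, true) => H.strandProj_idem k.2.2
    | (k, false) => by
      refine Mor.mk_inj (rel := rel) ((Mor.mk_hcomp _ _).trans ?_)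
      have h := congrArg Mor.rot (H.strandProj_comp k.1 k.2.2)
      rw [Mor.rot_comp _ _ rfl] at h
      exact h
  idem_bar
    | (_, true) => rfl
    | (k, false) => (Mor.rot_rot (Mor.strandProj q e k.1)).symm

theorem words_up {k : ℕ} (hk : k ≤ n) : H.strandMap.words (up n k) = strands x k := by
  rcases Nat.eq_zero_or_pos k with rfl | h
  · rw [up_zero]; rfl
  · rw [up, dif_pos ⟨h, hk⟩]
    exact H.strandMap.words_singleton _

theorem words_up_append {k l m : ℕ} (h : k + l = m) (hk : k ≤ n) (hl : l ≤ n) :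
    H.strandMap.words (up n k ++ up n l) = strands x m := by
  refine (StrandMap.words_append H.strandMap (up n k) (up n l)).trans ?_
  rw [H.words_up hk, H.words_up hl, ← strands_add, h]

theorem proj_up {k : ℕ} (hk : k ≤ n) : H.strandMap.proj (up n k) = Mor.strandProj q e k := by
  rcases Nat.eq_zero_or_pos k with rfl | h
  · rw [up_zero, Mor.strandProj, strandProj, antisym_zero]; rfl
  · rw [up, dif_pos ⟨h, hk⟩]
    exact H.strandMap.proj_singleton _

theorem proj_up_append {k l : ℕ} (h : k + l ≤ n) : H.strandMap.proj (up n k ++ up n l) =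
    Mor.strandProj q e k * Mor.strandProj q e l := by
  refine (StrandMap.proj_append H.strandMap (up n k) (up n l)).trans ?_
  rw [H.proj_up (by omega), H.proj_up (by omega)]

/-- A merge is interpreted as an antisymmetrizer, a split as a quantum binomial coefficient times an
antisymmetrizer. -/
def _root_.Spider.Mor.vertex (q : Rˣ) (e : SHom rel (strands x 2) (strands x 2)) :
    ∀ {a b : List (moySignature n).Letter}, (moySignature n).Vertex a b → Mor rel
  | _, _, .merge _ _ m _ _ => Mor.strandProj q e m
  | _, _, .split k _ m _ _ => (qBinom q (m : ℤ) k : R) • Mor.strandProj q e m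

theorem vertex_dom {a b : List (moySignature n).Letter} (v : (moySignature n).Vertex a b) :
    (Mor.vertex q e v).dom = H.strandMap.words a := by
  cases v with
  | merge k l m h hm => exact (H.words_up_append h (by omega) (by omega)).symm
  | split k l m h hm => exact (H.words_up hm).symm

theorem vertex_cod {a b : List (moySignature n).Letter} (v : (moySignature n).Vertex a b) :
    (Mor.vertex q e v).cod = H.strandMap.words b := by
  cases v with
  | merge k l m h hm => exact (H.words_up hm).symm
  | split k l m h hm => exact (H.words_up_append h (by omega) (by omega)).symm

/-- The interpretation of webs by antisymmetrizers. -/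
def web : Interpretation (moySignature n) rel where
  toStrandMap := H.strandMap
  vertex v := (Mor.vertex q e v).toHom (H.vertex_dom v) (H.vertex_cod v)
  proj_comp_vertex v := by
    rw [Mor.mk_toHom]
    cases v with
    | merge k l m h hm =>
      rw [H.proj_up_append (by omega)]
      exact H.strandProj_mul_comp h hm
    | split k l m h hm =>
      rw [H.proj_up hm]
      exact (Mor.comp_smul _ _ _ rfl).trans (congrArg _ (H.strandProj_comp m hm))
  vertex_comp_proj v := by
    rw [Mor.mk_toHom]
    cases v with
    | merge k l m h hm => rw [H.proj_up hm]; exact H.strandProj_comp m hm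
    | split k l m h hm =>
      rw [H.proj_up_append (by omega)]
      refine (Mor.smul_comp _ _ _ ?_).trans (congrArg _ (H.strandProj_comp_mul h hm))
      subst h; exact strands_add x k l

theorem mor_merge {k l m : ℕ} (h : k + l = m) (hm : m ≤ n) :
    H.web.mor (merge k l m h hm) = Mor.strandProj q e m :=
  (H.web.mor_vertex _).trans (Mor.mk_toHom _ _ _)

theorem mor_split {k l m : ℕ} (h : k + l = m) (hm : m ≤ n) :
    H.web.mor (split k l m h hm) = (qBinom q (m : ℤ) k : R) • Mor.strandProj q e m :=
  (H.web.mor_vertex _).trans (Mor.mk_toHom _ _ _)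

theorem mor_str {k : ℕ} (hk : k ≤ n) :
    H.web.mor (str (up n k)) = Mor.strandProj q e k :=
  (H.web.mor_eqTo _).trans (H.proj_up hk)

end Spider.HeckeStrand

end WebInterpretation

/-! ### The MOY relations hold for antisymmetrizers. -/

noncomputable section WebRelations

set_option linter.unusedSimpArgs false

open SpiderSignature SpiderSignature.Diagram Spider

open scoped Spider.Mor

variable {T : SpiderSignature} {R : Type u} [CommRing R] {rel : T.Relators R}

namespace Spider.HeckeStrand

variable {x : T.Letter} {n : ℕ} {q t : Rˣ} {e : SHom rel (strands x 2) (strands x 2)}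
variable (H : HeckeStrand rel x n q t e)

/-- The products of two antisymmetrizers in the endomorphisms of `m` strands. -/
abbrev _root_.Spider.strandPair (q : Rˣ) {x : T.Letter} (e : SHom rel (strands x 2) (strands x 2))
    (m : ℕ) (j : ℕ) : SHom rel (strands x m) (strands x m) := antisymPair q (strandGen x e m) m j

theorem mor_rungLeft {k l r k' l' m : ℕ} (hm : k + l = m) (hk : k + r = k') (hl : r + l' = l)
    (hk' : k' ≤ n) (hl' : l ≤ n) :
    H.web.mor (rungLeft k l r k' l' hk hl hk' hl') = ⟨_, _, ladderE q m (strandPair q e m) k r⟩ :=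
      by
  have h : H.web.mor (rungLeft k l r k' l' hk hl hk' hl') =
      (H.web.mor (str (up n k)) * H.web.mor (split r l' l hl hl')) ⋆
        (H.web.mor (merge k r k' hk hk') * H.web.mor (str (up n l'))) :=
    (H.web.mor_comp _ _).trans (congrArg₂ Mor.comp ((H.web.mor_comp_eqTo _ _).trans
      (H.web.mor_tensor _ _)) (H.web.mor_tensor _ _))
  rw [h, H.mor_str (by omega), H.mor_split, H.mor_merge, H.mor_str (by omega), ladderE, Mor.mk_smul,
    Mor.mk_mul, mk_antisymPair hm, hk, mk_antisymPair (l := l') (by omega), Mor.mul_smul,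
    Mor.smul_comp _ _ _ (by
      rw [Mor.mul_cod, Mor.mul_dom]
      exact (strands_add x k l).symm.trans ((congrArg _ (by omega)).trans (strands_add x k' l')))]
  congr 2
  omega

/-- The split carries the binomial with lower entry `k'`, whereas `ladderF` has lower entry `s`; the
two agree by symmetry of binomials. -/
theorem mor_rungRight {k l s k' l' m : ℕ} (hm : k + l = m) (hk : k' + s = k) (hl : s + l = l')
    (hk' : k ≤ n) (hl' : l' ≤ n) :
    H.web.mor (rungRight k l s k' l' hk hl hk' hl') = ⟨_, _, ladderF q (strandPair q e m) k' s⟩ :=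
      by
  have h : H.web.mor (rungRight k l s k' l' hk hl hk' hl') =
      (H.web.mor (split k' s k hk hk') * H.web.mor (str (up n l))) ⋆
        (H.web.mor (str (up n k')) * H.web.mor (merge s l l' hl hl')) :=
    (H.web.mor_comp _ _).trans (congrArg₂ Mor.comp ((H.web.mor_comp_eqTo _ _).trans
      (H.web.mor_tensor _ _)) (H.web.mor_tensor _ _))
  rw [h, H.mor_str (by omega), H.mor_split, H.mor_merge, H.mor_str (by omega), ladderF, Mor.mk_smul,
    Mor.mk_mul, hk, mk_antisymPair hm, mk_antisymPair (l := l') (by omega), Mor.smul_mul,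
    Mor.smul_comp _ _ _ (by
      rw [Mor.mul_cod, Mor.mul_dom]
      exact (strands_add x k l).symm.trans ((congrArg _ (by omega)).trans (strands_add x k' l')))]
  subst hk
  rw [H.units.qBinom_symm (by omega) (by omega)]
  push_cast
  rfl

theorem mor_boxRightLeft {k l s r k' l' m : ℕ} (hm : k + l = m) (hs : s ≤ k) (hls : l + s ≤ n)
    (hk : k ≤ n) (hk' : k' + s = k + r) (hl' : l' + r = l + s) (hk'n : k' ≤ n) :
    H.web.mor (boxRightLeft k l s r k' l' hs hls hk hk' hl' hk'n) =
      ⟨_, _, ladderF q (strandPair q e m) (k - s) s * ladderE q m (strandPair q e m) (k - s) r⟩ :=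
        by
  refine (H.web.mor_comp _ _).trans ?_
  rw [H.mor_rungRight hm, H.mor_rungLeft (m := m) (by omega), Mor.mk_mul]

theorem mor_boxLeftRight {k l r s k' l' m : ℕ} (hm : k + l = m) (hr : r ≤ l) (hkr : k + r ≤ n)
    (hl : l ≤ n) (hk' : k' + s = k + r) (hl' : l' + r = l + s) (hl'n : l' ≤ n) :
    H.web.mor (boxLeftRight k l r s k' l' hr hkr hl hk' hl' hl'n) =
      ⟨_, _, ladderE q m (strandPair q e m) k r * ladderF q (strandPair q e m) k' s⟩ := by
  refine (H.web.mor_comp _ _).trans ?_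
  rw [H.mor_rungLeft hm, H.mor_rungRight (m := m) (by omega), Mor.mk_mul]

/-- The diagrams between words with the same image as linear maps. -/
theorem eval_eq_hcast {a b : List (moySignature n).Letter} {f : MOYDiagram R n a b} {m : ℕ}
    {y : SHom rel (strands x m) (strands x m)} (ha : strands x m = H.web.words a)
    (hb : strands x m = H.web.words b) (h : H.web.mor f = ⟨_, _, y⟩) :
    H.web.eval f = hcast ha hb y :=
  Mor.mk_inj (rel := rel) (h.trans (Mor.mk_hcast ha hb y).symm)

theorem _root_.Spider.hcast_sum {ι : Type*} (s : Finset ι) {a a' b b' : List T.Letter} (ha : a = a')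
    (hb : b = b') (f : ι → SHom rel a b) : hcast ha hb (∑ i ∈ s, f i) = ∑ i ∈ s,
      hcast ha hb (f i) := by
  subst ha hb; rfl

theorem eval_finRange_sum {a b : List (moySignature n).Letter} {N m : ℕ}
    {f : Fin N → MOYDiagram R n a b} {y : ℕ → SHom rel (strands x m) (strands x m)}
    (ha : strands x m = H.web.words a) (hb : strands x m = H.web.words b)
    (h : ∀ i, H.web.mor (f i) = ⟨_, _, y i⟩) :
    H.web.mor (Diagram.sum (S := moySignature n) ((List.finRange N).map f)) =
      ⟨_, _, ∑ i ∈ Finset.range N, y i⟩ := by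
  refine Eq.trans ?_ (Mor.mk_hcast ha hb _)
  rw [hcast_sum, ← Fin.sum_univ_eq_sum_range (fun i => hcast ha hb (y i)), Fin.sum_univ_def]
  refine congrArg (Mor.mk _ _) ((H.web.eval_sum _).trans ?_)
  rw [List.map_map]
  congr 2
  funext i
  exact H.eval_eq_hcast ha hb (h i)

theorem _root_.Finset.sum_range_min_succ {M : Type*} [AddCommMonoid M] (r s : ℕ) (f : ℕ → M)
    (h : ∀ i, r < i → f i = 0) :
    ∑ i ∈ Finset.range (s + 1), f i = ∑ i ∈ Finset.range (min r s + 1), f i := by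
  refine (Finset.sum_subset (Finset.range_mono (by omega)) fun i hi hi' => h i ?_).symm
  rw [Finset.mem_range] at hi hi'
  omega

theorem mor_box {k l r s k' l' : ℕ} (hs : s ≤ k) (hr : r ≤ l) (hk : k + r ≤ n) (hl : l + s ≤ n)
    (hk' : k' + s = k + r) (hl' : l' + r = l + s) :
    H.web.mor (boxRightLeft k l s r k' l' hs hl (by omega) hk' hl' (by omega)) =
      H.web.mor (R := R) (sum (S := moySignature n)
        ((List.finRange (min r s + 1)).map fun (i : Fin (min r s + 1)) =>
        (boxLeftRight k l (r - i) (s - i) k' l' (by omega) (by omega) (by omega)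
          (by have := i.2; omega) (by have := i.2; omega) (by omega)).smul
            (qBinom q ((k : ℤ) - l + r - s) i))) := by
  have hd := (H.data (k + l)).ladder.ladderF_mul_ladderE (j := k - s) (r := r) (s := s)
    (by omega) (by omega) (by omega) (by omega)
  -- The algebraic sum runs up to `s` and the relator up to `min r s`; the additional ladder terms
  -- are zero by convention.
  rw [Finset.sum_range_min_succ r s _ fun i hi => by
    rw [ladderTerm, if_neg (by omega), smul_zero]] at hd
  refine ((H.mor_boxRightLeft rfl hs hl (by omega) hk' hl' (by omega)).trans
    (congrArg _ hd)).trans (H.eval_finRange_sum (H.words_up_append rfl (by omega) (by omega)).symm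
      (H.words_up_append (by omega) (by omega) (by omega)).symm fun i => ?_).symm
  have hi := i.2
  rw [ladderTerm, if_pos (by omega), Mor.mk_smul]
  refine (H.web.mor_smul _ _).trans (congrArg₂ _ ?_ ((H.mor_boxLeftRight rfl (by omega) (by omega)
    (by omega) (by omega) (by omega) (by omega)).trans ?_))
  · congr 1
    push_cast [Nat.cast_sub hs]
    ring
  · rw [show k - s + s = k by omega, show k - s + r = k' by omega]

/-- The box relation for the mirrored ladder `j ↦ k + l - j`, in which `E` and `F` change roles. -/
theorem mor_box_mirror {k l r s k' l' : ℕ} (hs : s ≤ k) (hr : r ≤ l) (hk : k + r ≤ n)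
    (hl : l + s ≤ n) (hk' : k' + s = k + r) (hl' : l' + r = l + s) :
    H.web.mor (boxLeftRight k l r s k' l' hr hk (by omega) hk' hl' (by omega)) =
      H.web.mor (R := R) (sum (S := moySignature n)
        ((List.finRange (min r s + 1)).map fun (i : Fin (min r s + 1)) =>
        (boxRightLeft k l (s - i) (r - i) k' l' (by omega) (by omega) (by omega)
          (by have := i.2; omega) (by have := i.2; omega) (by omega)).smul
            (qBinom q ((l : ℤ) - k + s - r) i))) := by
  have hE : ∀ j s : ℕ, s ≤ k + l → j + s ≤ k + l →
    ladderE q (k + l) (fun j => strandPair q e (k + l) (k + l - j)) j s =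
      ladderF q (strandPair q e (k + l)) (k + l - j - s) s := fun j s h h' => by
    rw [ladderE, ladderF, show k + l - j - s + s = k + l - j by omega,
      show k + l - (j + s) = k + l - j - s by omega]
    congr 2
    omega
  have hF : ∀ j r : ℕ, r ≤ k + l → j + r ≤ k + l →
    ladderF q (fun j => strandPair q e (k + l) (k + l - j)) j r =
      ladderE q (k + l) (strandPair q e (k + l)) (k + l - j - r) r := fun j s h h' => by
    rw [ladderE, ladderF, show k + l - j - s + s = k + l - j by omega,
      show k + l - (j + s) = k + l - j - s by omega]
    congr 2
    omega
  have hd := ((H.data (k + l)).ladder.mirror (by omega) (by omega)).ladderF_mul_ladderE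
    (j := l - r) (r := s) (s := r) (by omega) (by omega) (by omega) (by omega)
  rw [Finset.sum_range_min_succ s r _ fun i hi => by
    rw [ladderTerm, if_neg (by omega), smul_zero], min_comm, hE _ _ (by omega) (by omega),
    hF _ _ (by omega) (by omega), show k + l - (l - r) - r = k by omega,
    show k + l - (l - r) - s = k' by omega] at hd
  refine ((H.mor_boxLeftRight rfl hr hk (by omega) hk' hl' (by omega)).trans
    (congrArg _ hd)).trans (H.eval_finRange_sum (H.words_up_append rfl (by omega) (by omega)).symm
      (H.words_up_append (by omega) (by omega) (by omega)).symm fun i => ?_).symm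
  have hi := i.2
  rw [ladderTerm, if_pos (by omega), Mor.mk_smul, hE _ _ (by omega) (by omega),
    hF _ _ (by omega) (by omega)]
  refine (H.web.mor_smul _ _).trans (congrArg₂ _ ?_ ((H.mor_boxRightLeft rfl (by omega) (by omega)
    (by omega) (by omega) (by omega) (by omega)).trans ?_))
  · congr 1
    push_cast [Nat.cast_sub hr]
    ring
  · rw [show k + l - (l - r + r) - (s - i) = k - (s - i) by omega,
      show k + l - (l - r + s) - (r - i) = k - (s - i) by omega]

/-- The expansion of the crossings of antisymmetrizers. -/
theorem _root_.Spider.CrossingFamily.strandProj_mul_comp_cross (B : CrossingFamily rel)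
    {q' t' : Rˣ} (hq : QuantumUnits q' n) (e : SHom rel (strands x 2) (strands x 2))
    {k l : ℕ} (h : k + l ≤ n) (hd : HeckeData q' n (k + l) (strandGen x e (k + l)))
    (he : (⟨_, _, (q' : R) • (1 : SHom rel (strands x 2) (strands x 2)) - e⟩ : Mor rel) =
      (t' : R) • B.cross [x] [x]) :
    (Mor.strandProj q' e k * Mor.strandProj q' e l) ⋆ B.cross (strands x k) (strands x l) =
      (⟨_, _, ((-1) ^ (k + k * l) * ((q' ^ k * t'⁻¹ ^ (k * l) : Rˣ) : R)) •
        ∑ b ∈ Finset.range (k + 1), if k ≤ l + b then (((-q') ^ (-(b : ℤ)) : Rˣ) : R) •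
          (ladderF q' (strandPair q' e (k + l)) (k - b) b *
            ladderE q' (k + l) (strandPair q' e (k + l)) (k - b) (l + b - k)) else 0⟩ : Mor rel) :=
              by
  have h1 := congrArg (Mor.mk (rel := rel) _ _) (hd.antisymPair_mul_block_eq h le_rfl)
  rw [Mor.mk_mul, B.mk_block t' q' e he (c := 0) (by omega), mk_antisymPair rfl,
    show Mor.id rel (strands x 0) = 1 from rfl, mul_one, Mor.comp_smul _ _ _ (by simp)] at h1
  -- The block in the Hecke algebra is `t' ^ (k * l)` times the crossing of the cables; this factor
  -- is divided out.
  have h2 := congrArg (((t'⁻¹ ^ (k * l) : Rˣ) : R) • ·) h1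
  simp only [Mor.smul_smul'] at h2
  rw [← Units.val_mul, ← mul_pow, inv_mul_cancel, one_pow, Units.val_one, Mor.one_smul'] at h2
  refine h2.trans ?_
  rw [← Mor.mk_smul, smul_smul]
  congr 2
  · push_cast; ring
  · refine Finset.sum_congr rfl fun b hb => ?_
    rw [Finset.mem_range] at hb
    split_ifs with hkl
    · rw [ladderE, ladderF, smul_mul_smul_comm, smul_smul, show k - b + b = k by omega,
        show k - b + (l + b - k) =
            l by omega, mul_assoc (strandPair _ _ _ k) (strandPair _ _ _ (k - b)) (_ * _),
        ← mul_assoc (strandPair _ _ _ (k - b)),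
        hd.antisymPair_idem (by omega) (by omega) (by omega), ← mul_assoc (strandPair _ _ _ k)]
      have h3 : (qBinom q' (((k + l : ℕ) : ℤ) - (k - b : ℕ)) (l + b - k) : R) =
          qBinom q' ((l : ℤ) + b) k := by
        rw [show (((k + l : ℕ) : ℤ) - (k - b : ℕ)) = ((k + (l + b - k) : ℕ) : ℤ) by omega,
          ← hq.qBinom_symm (k := k) (by omega) (by omega)]
        congr 1
        omega
      rw [h3, show ((k - b : ℕ) : ℤ) + b = k by omega]
    -- The web expansion has no term with `l + b < k`; in the algebraic expansion such a term has
    -- binomial zero.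
    · have := hq.qBinom_eq_zero (k := l + b) (l := k) (by omega) (by omega)
      push_cast at this
      rw [this, mul_zero, mul_zero, zero_smul]

/-- The parameters of the expansion are independent of those of the antisymmetrizers, so that the
negative crossing, with inverted parameters, is included. -/
theorem mor_braidExpansion (q' t' : Rˣ) {k l : ℕ} (h : k + l ≤ n) :
    H.web.mor (braidExpansion n q' t' k l h) =
      (⟨_, _, ((-1) ^ (k + k * l) * ((q' ^ k * t'⁻¹ ^ (k * l) : Rˣ) : R)) •
        ∑ b ∈ Finset.range (k + 1), if k ≤ l + b then (((-q') ^ (-(b : ℤ)) : Rˣ) : R) •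
          (ladderF q (strandPair q e (k + l)) (k - b) b *
            ladderE q (k + l) (strandPair q e (k + l)) (k - b) (l + b - k)) else 0⟩ : Mor rel) := by
  refine (H.web.mor_smul _ _).trans ((congrArg _ (H.eval_finRange_sum
    (H.words_up_append rfl (by omega) (by omega)).symm
    (H.words_up_append (by omega) (by omega) (by omega)).symm fun b => ?_)).trans (Mor.mk_smul _ _).symm)
  have hb' := b.2
  split_ifs with hb
  · refine (H.web.mor_smul _ _).trans ((congrArg _ (H.mor_boxRightLeft rfl (by omega) (by omega)
      (by omega) (by omega) (by omega) (by omega))).trans (Mor.mk_smul _ _).symm)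
  · refine (H.web.mor_zero).trans ?_
    refine (congrArg (Mor.mk _ _) (hcast_zero (H.words_up_append rfl (by omega) (by omega)).symm
      (H.words_up_append (by omega) (by omega) (by omega)).symm).symm).trans (Mor.mk_hcast _ _ _)

theorem mor_merge_comp_split {k l m : ℕ} (h : k + l = m) (hm : m ≤ n) :
    H.web.mor ((merge k l m h hm).comp (split k l m h hm)) =
      (qBinom q (m : ℤ) k : R) • Mor.strandProj q e m := by
  refine (H.web.mor_comp _ _).trans ((congrArg₂ _ (H.mor_merge h hm) (H.mor_split h hm)).trans ?_)
  rw [Mor.comp_smul _ _ _ rfl, H.strandProj_comp _ hm]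

/-- Relator by relator: the bubbles are idempotency and partial traces, the `6j` relations are
absorption together with `qBinom_split`, and the boxes and crossings are the ladder identities. For
the negative crossing, antisymmetrizers and binomials do not change under `q ↦ q⁻¹`. -/
theorem eval_web {a b : List (moySignature n).Letter} {f g : MOYDiagram R n a b}
    (h : MOYRel n q t a b f g) : H.web.eval f = H.web.eval g := by
  refine H.web.eval_eq_of_mor_eq ?_
  have h0 : Mor.strandProj q e 0 = 1 := by rw [Mor.strandProj, strandProj, antisym_zero]; rfl
  cases h with
  | merge_zero_left l hl =>
    refine (H.mor_merge _ _).trans (Eq.trans ?_ (H.web.mor_eqTo _).symm)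
    rw [show H.web.proj _ = _ from H.proj_up_append (k := 0) (l := l) (by omega), h0, one_mul]
  | merge_zero_right k hk =>
    refine (H.mor_merge _ _).trans (Eq.trans ?_ (H.web.mor_eqTo _).symm)
    rw [show H.web.proj _ = _ from H.proj_up_append (k := k) (l := 0) (by omega), h0, mul_one]
  | split_zero_left l hl =>
    refine (H.mor_split _ _).trans (Eq.trans ?_ (H.web.mor_eqTo _).symm)
    rw [show H.web.proj _ = _ from H.proj_up hl, qBinom_zero, Mor.one_smul']
  | split_zero_right k hk =>
    refine (H.mor_split _ _).trans (Eq.trans ?_ (H.web.mor_eqTo _).symm)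
    rw [show H.web.proj _ = _ from H.proj_up hk, H.units.qBinom_self hk, Mor.one_smul']
  | bubble k l h =>
    refine (H.web.mor_comp _ _).trans (Eq.trans ?_ (H.web.mor_smul _ _).symm)
    rw [H.mor_str h]
    refine (congrArg₂ _ (H.mor_split _ _) (H.mor_merge _ _)).trans ?_
    rw [Mor.smul_comp _ _ _ rfl, H.strandProj_comp _ h]
  | bubble_right k l h =>
    refine (H.web.mor_closeRight _ _ _).trans (Eq.trans ?_ (H.web.mor_smul _ _).symm)
    rw [H.mor_str (by omega), Mor.strandProj, ← H.closeRight_strandProj h]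
    refine (congrArg (Mor.closeRight _ _) (H.mor_merge_comp_split rfl h)).trans ?_
    rw [H.units.qBinom_symm (by omega) (by omega),
      show H.web.words (up n k) = _ from H.words_up (k := k) (by omega),
      show H.web.words (up n l) = _ from H.words_up (k := l) (by omega)]
    exact Mor.closeRight_smul _ (strands_add x k l) (strands_add x k l)
  | bubble_left k l h =>
    refine (H.web.mor_closeLeft _ _ _).trans (Eq.trans ?_ (H.web.mor_smul _ _).symm)
    rw [H.mor_str (by omega), Mor.strandProj, ← H.closeLeft_strandProj h]
    refine (congrArg (Mor.closeLeft _ _) (H.mor_merge_comp_split rfl h)).trans ?_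
    rw [show H.web.words (up n k) = _ from H.words_up (k := k) (by omega),
      show H.web.words (up n l) = _ from H.words_up (k := l) (by omega)]
    exact Mor.closeLeft_smul _ (strands_add x l k) (strands_add x l k)
  | sixj_merge k l m h =>
    refine (H.web.mor_comp _ _).trans (Eq.trans ?_ (H.web.mor_eqTo_comp _ _).symm)
    refine Eq.trans ?_ (H.web.mor_comp _ _).symm
    refine (congrArg₂ Mor.comp ((H.web.mor_tensor _ _).trans (congrArg₂ _ (H.mor_merge _ _)
      (H.mor_str (by omega)))) (H.mor_merge _ _)).trans (Eq.trans ?_ (congrArg₂ Mor.comp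
        ((H.web.mor_tensor _ _).trans (congrArg₂ _ (H.mor_str (by omega)) (H.mor_merge _ _)))
          (H.mor_merge _ _)).symm)
    rw [H.strandProj_mul_comp rfl h, H.strandProj_mul_comp (by omega) h]
  | sixj_split k l m h =>
    refine (H.web.mor_comp _ _).trans (Eq.trans ?_ (H.web.mor_comp_eqTo _ _).symm)
    refine Eq.trans ?_ (H.web.mor_comp _ _).symm
    refine (congrArg₂ Mor.comp (H.mor_split _ _) ((H.web.mor_tensor _ _).trans (congrArg₂ _
      (H.mor_split _ _) (H.mor_str (by omega))))).trans (Eq.trans ?_ (congrArg₂ Mor.comp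
        (H.mor_split _ _) ((H.web.mor_tensor _ _).trans (congrArg₂ _ (H.mor_str (by omega))
          (H.mor_split _ _)))).symm)
    rw [Mor.smul_mul, Mor.mul_smul,
      Mor.smul_comp _ _ _ (strands_add x (k + l) m),
      Mor.comp_smul _ _ _ (strands_add x (k + l) m), H.strandProj_comp_mul rfl h,
      Mor.smul_comp _ _ _ ((congrArg _ (add_assoc k l m)).trans (strands_add x k (l + m))),
      Mor.comp_smul _ _ _ ((congrArg _ (add_assoc k l m)).trans (strands_add x k (l + m))),
      H.strandProj_comp_mul (by omega) h, Mor.smul_smul', Mor.smul_smul', H.units.qBinom_split h]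
  | box k l r s k' l' hs hr hk hl hk' hl' => exact H.mor_box hs hr hk hl hk' hl'
  | box_mirror k l r s k' l' hs hr hk hl hk' hl' => exact H.mor_box_mirror hs hr hk hl hk' hl'
  | braid_pos k l h =>
    refine (H.web.mor_braid).trans (Eq.trans ?_ (H.mor_braidExpansion q t h).symm)
    rw [show H.web.words (up n k) = _ from H.words_up (k := k) (by omega),
      show H.web.words (up n l) = _ from H.words_up (k := l) (by omega),
      show H.web.proj (up n k) = _ from H.proj_up (k := k) (by omega),
      show H.web.proj (up n l) = _ from H.proj_up (k := l) (by omega)]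
    exact (CrossingFamily.pos rel).strandProj_mul_comp_cross H.units e h (H.data _) H.pos
  | braid_neg k l h =>
    refine (H.web.mor_braidInv).trans (Eq.trans ?_ (H.mor_braidExpansion q⁻¹ t⁻¹ h).symm)
    rw [show H.web.words (up n k) = _ from H.words_up (k := k) (by omega),
      show H.web.words (up n l) = _ from H.words_up (k := l) (by omega),
      show H.web.proj (up n k) = _ from H.proj_up (k := k) (by omega),
      show H.web.proj (up n l) = _ from H.proj_up (k := l) (by omega)]
    have h1 := (CrossingFamily.neg rel).strandProj_mul_comp_cross H.units.inv e h (H.data _).inv H.neg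
    have hp : ∀ k, Mor.strandProj q⁻¹ e k = Mor.strandProj q e k := fun k => by
      rw [Mor.strandProj, Mor.strandProj, strandProj, strandProj, antisym_inv H.units.sub_inv]
    have hp' : ∀ m j, strandPair q⁻¹ e m j = strandPair q e m j := fun m j => by
      simp only [antisymPair, antisym_inv H.units.sub_inv]
    rw [hp, hp] at h1
    refine h1.trans ?_
    simp only [hp', ladderE, ladderF, qBinom_inv H.units.sub_inv]

end Spider.HeckeStrand

end WebRelations

/-! ### The Hecke generator of the HOMFLYPT category. -/

noncomputable section HomflyStrand

set_option linter.unusedSimpArgs false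

open SpiderSignature SpiderSignature.Diagram Spider

open scoped Spider.Mor

namespace Homfly

variable {R : Type u} [CommRing R]

/-- The relators of the specialized HOMFLYPT category. -/
abbrev Rel (n : ℕ) (q t : Rˣ) : homflySignature.Relators R := HomflyRel t⁻¹ q (q ^ n)⁻¹

/-- The upward orientation. -/
abbrev upward : homflySignature.Letter := true

variable (n : ℕ) (q t : Rˣ)

/-- The positive crossing of two upward strands. -/
def pos : SHom (Rel n q t) (strands upward 2) (strands upward 2) :=
  ofDiagram (Rel n q t) (.braid [upward] [upward])

/-- The negative crossing of two upward strands. -/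
def neg : SHom (Rel n q t) (strands upward 2) (strands upward 2) :=
  ofDiagram (Rel n q t) (.braidInv [upward] [upward])

/-- The Hecke generator. -/
def gen : SHom (Rel n q t) (strands upward 2) (strands upward 2) :=
  (q : R) • (1 : SHom (Rel n q t) (strands upward 2) (strands upward 2)) - (t : R) • pos n q t

theorem pos_mul_neg : pos n q t * neg n q t = 1 := sound (.braid_braidInv _ _)

theorem skein : (t : R) • pos n q t - ((t⁻¹ : Rˣ) : R) • neg n q t =
    ((q : R) - ((q⁻¹ : Rˣ) : R)) • (1 : SHom (Rel n q t) (strands upward 2) (strands upward 2)) :=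
      by
  have h : (((t⁻¹)⁻¹ : Rˣ) : R) • pos n q t + (-((t⁻¹ : Rˣ) : R)) • neg n q t = _ :=
    sound (rel := Rel n q t) (.rel .skein)
  rw [inv_inv, neg_smul, ← sub_eq_add_neg] at h
  exact h

variable {n q t}

theorem neg_eq : ((q⁻¹ : Rˣ) : R) • (1 : SHom (Rel n q t) (strands upward 2) (strands upward 2)) -
    gen n q t = ((t⁻¹ : Rˣ) : R) • neg n q t := by
  have h := skein n q t
  rw [gen]
  linear_combination (norm := module) h

/-- The skein relation multiplied by the rescaled positive crossing is a quadratic equation for that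
crossing, with roots `q` and `-q⁻¹`. In terms of `e` it says `e² = [2] e`. -/
theorem gen_mul_gen : gen n q t * gen n q t = (qInt q 2 : R) • gen n q t := by
  have h := congrArg (((t : R) • pos n q t) * ·) (skein n q t)
  have ht : (t : R) * ((t⁻¹ : Rˣ) : R) = 1 := t.mul_inv
  have hq : (q : R) * ((q⁻¹ : Rˣ) : R) = 1 := q.mul_inv
  simp only [mul_sub, smul_mul_assoc, pos_mul_neg, mul_smul_comm, mul_one] at h
  have h1 := congrArg (· • (1 : SHom (Rel n q t) (strands upward 2) (strands upward 2))) hq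
  have h2 := congrArg (· • (1 : SHom (Rel n q t) (strands upward 2) (strands upward 2))) ht
  rw [gen, qInt_two]
  simp only [sub_mul, mul_sub, smul_mul_assoc, mul_smul_comm, mul_one, one_mul]
  linear_combination (norm := module) h - h1 + h2

variable (hq : QuantumUnits q n)
include hq

theorem unknot_eq : ((((q ^ n)⁻¹⁻¹ : Rˣ) : R) - (((q ^ n)⁻¹ : Rˣ) : R)) *
    Ring.inverse ((q : R) - ((q⁻¹ : Rˣ) : R)) = qInt q (n : ℤ) := by
  have h := qInt_sub_mul q (n : ℤ)
  rw [zpow_natCast, zpow_neg, zpow_natCast] at h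
  rw [inv_inv, ← h, mul_comm, ← mul_assoc, Ring.inverse_mul_cancel _ hq.sub_inv, one_mul]

theorem loop_right : Mor.closeRight [] [upward] (Mor.id (Rel n q t) [upward]) =
    (qInt q (n : ℤ) : R) • 1 := by
  have h := congrArg (Mor.mk (rel := Rel n q t) _ _) (sound (rel :=
      Rel n q t) (.rel (.unknot true)))
  rw [Mor.mk_diag_smul, unknot_eq hq] at h
  exact (Mor.mk_closeRight _ _ _).symm.trans h

/-- Closing an upward strand to the left is closing a downward strand to the right, so this is the
unknot relation for the other orientation. -/
theorem loop_left : Mor.closeLeft [upward] [] (Mor.id (Rel n q t) [upward]) =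
    (qInt q (n : ℤ) : R) • 1 := by
  have h := congrArg (Mor.mk (rel := Rel n q t) _ _) (sound (rel :=
      Rel n q t) (.rel (.unknot false)))
  rw [Mor.mk_diag_smul, unknot_eq hq] at h
  have h1 := (Mor.mk_closeRight (rel := Rel n q t) [] [false] _).symm.trans h
  refine Eq.trans ?_ h1
  simp only [Mor.closeLeft, Mor.closeRight, Mor.id_nil, one_mul, mul_one]
  congr 2

omit hq in
theorem closeRight_pos : Mor.closeRight [upward] [upward] (Mor.braid (Rel n q t) [upward] [upward]) =
    ((t⁻¹ * q ^ n : Rˣ) : R) • Mor.id (Rel n q t) [upward] := by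
  have h := congrArg (Mor.mk (rel := Rel n q t) _ _) (sound (rel := Rel n q t) (.rel .kink_right))
  rw [Mor.mk_diag_smul, inv_inv] at h
  exact (Mor.mk_closeRight _ _ _).symm.trans h

omit hq in
theorem closeLeft_pos : Mor.closeLeft [upward] [upward] (Mor.braid (Rel n q t) [upward] [upward]) =
    ((t⁻¹ * q ^ n : Rˣ) : R) • Mor.id (Rel n q t) [upward] := by
  have h := congrArg (Mor.mk (rel := Rel n q t) _ _) (sound (rel := Rel n q t) (.rel .kink_left))
  rw [Mor.mk_diag_smul, inv_inv] at h
  exact (Mor.mk_closeLeft _ _ _).symm.trans h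

/-- Closing one strand of `e = q - t X₊` gives `q [n]` from the loop, minus `t` times the positive
kink `t⁻¹ q ^ n`. -/
theorem kink_scalar : ((q : R) * qInt q (n : ℤ) - (t : R) * ((t⁻¹ * q ^ n : Rˣ) : R)) =
    qInt q ((n : ℤ) - 1) := by
  have h := qInt_add_one hq.sub_inv ((n : ℤ) - 1)
  have h1 : (q : R) * ((q⁻¹ : Rˣ) : R) = 1 := q.mul_inv
  rw [sub_add_cancel] at h
  have h2 : (q : R) * ((q ^ ((n : ℤ) - 1) : Rˣ) : R) = (t : R) * ((t⁻¹ * q ^ n : Rˣ) : R) := by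
    rw [← Units.val_mul, ← Units.val_mul, mul_inv_cancel_left, ← zpow_one_add, ← zpow_natCast]
    congr 2
    ring
  rw [← h2, ← h]
  linear_combination (qInt q ((n : ℤ) - 1)) * h1

theorem heckeStrand : HeckeStrand (Rel n q t) upward n q t (gen n q t) where
  units := hq
  pos := by rw [gen, sub_sub_cancel]; rfl
  neg := by rw [neg_eq]; rfl
  sq := gen_mul_gen
  loop_right := loop_right hq
  loop_left := loop_left hq
  kink_right := by
    have h1 : closeRightHom (a := [upward]) (x := [upward]) rfl
        (1 : SHom (Rel n q t) (strands upward 2) (strands upward 2)) =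
          (qInt q (n : ℤ) : R) • (1 : SHom (Rel n q t) [upward] [upward]) := by
      refine Mor.mk_inj (rel := Rel n q t) ((mk_closeRightHom _ _).trans ?_)
      have h := Mor.closeRight_id_mul (rel := Rel n q t) (f := Mor.id (Rel n q t) [upward]) (a :=
          [])
        (x := [upward]) rfl rfl [upward]
      rw [loop_right hq, Mor.mul_smul, mul_one, ← Mor.id_append] at h
      exact h
    have h2 : closeRightHom (a := [upward]) (x := [upward]) rfl (Homfly.pos n q t) =
        ((t⁻¹ * q ^ n : Rˣ) : R) • (1 : SHom (Rel n q t) [upward] [upward]) :=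
      Mor.mk_inj (rel := Rel n q t) ((mk_closeRightHom _ _).trans (closeRight_pos))
    refine (mk_closeRightHom (a := [upward]) (x := [upward]) rfl _).symm.trans ?_
    rw [gen, map_sub, map_smul, map_smul, h1, h2, smul_smul, smul_smul, ← sub_smul, kink_scalar hq]
    rfl
  kink_left := by
    have h1 : closeLeftHom (a := [upward]) (x := [upward]) rfl
        (1 : SHom (Rel n q t) (strands upward 2) (strands upward 2)) =
          (qInt q (n : ℤ) : R) • (1 : SHom (Rel n q t) [upward] [upward]) := by
      refine Mor.mk_inj (rel := Rel n q t) ((mk_closeLeftHom _ _).trans ?_)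
      have h := Mor.closeLeft_mul_id (rel := Rel n q t) (f := Mor.id (Rel n q t) [upward]) (a := [])
        (x := [upward]) rfl rfl [upward]
      rw [loop_left hq, Mor.smul_mul, one_mul, ← Mor.id_append] at h
      exact h
    have h2 : closeLeftHom (a := [upward]) (x := [upward]) rfl (Homfly.pos n q t) =
        ((t⁻¹ * q ^ n : Rˣ) : R) • (1 : SHom (Rel n q t) [upward] [upward]) :=
      Mor.mk_inj (rel := Rel n q t) ((mk_closeLeftHom _ _).trans (closeLeft_pos))
    refine (mk_closeLeftHom (a := [upward]) (x := [upward]) rfl _).symm.trans ?_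
    rw [gen, map_sub, map_smul, map_smul, h1, h2, smul_smul, smul_smul, ← sub_smul, kink_scalar hq]
    rfl

omit hq in
theorem sphericalWord (a : List homflySignature.Letter) : Mor.SphericalWord (Rel n q t) a := by
  have h : Mor.SphericalWord (Rel n q t) [upward] :=
    Mor.sphericalWord_of_kink (Units.isUnit _) (closeRight_pos) (closeLeft_pos)
  refine Mor.sphericalWord_of_letters fun x _ => ?_
  match x with
  | true => exact h
  | false => exact h.dual

end Homfly

end HomflyStrand

/-! ### Functors from interpretations; tangles in any category with a Hecke strand. -/

noncomputable section Realizations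

set_option linter.unusedSimpArgs false

open SpiderSignature SpiderSignature.Diagram Spider

open scoped Spider.Mor

variable {S T : SpiderSignature} {R : Type u} [CommRing R] {relS : S.Relators R}
  {rel : T.Relators R}

/-- An interpretation that respects the relators. -/
structure Realization (relS : S.Relators R) (rel : T.Relators R) extends
    Interpretation S rel where
  eval_rel : ∀ {a b : List S.Letter} (f g : S.Diagram R a b), relS a b f g →
    toInterpretation.eval f = toInterpretation.eval g

namespace Realization

variable (φ : Realization relS rel)

/-- The action of a realization on morphisms. -/
def map {a b : List S.Letter} (f : SHom relS a b) : SHom rel (φ.words a) (φ.words b) :=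
  Quotient.lift (s := homSetoid relS a b) (fun f => φ.eval f)
    (fun _ _ h => φ.eval_congr φ.eval_rel h) f

theorem map_add {a b : List S.Letter} (f g : SHom relS a b) :
    φ.map (f + g) = φ.map f + φ.map g := by
  induction f using ind with | _ f
  induction g using ind with | _ g
  change φ.eval (f.add g) = φ.eval f + φ.eval g
  rw [Interpretation.eval]

theorem map_smul {a b : List S.Letter} (r : R) (f : SHom relS a b) :
    φ.map (r • f) = r • φ.map f := by
  induction f using ind with | _ f
  exact Mor.mk_inj (φ.mor_smul r f)

/-- The action of a realization on bundled morphisms. -/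
def mapMor (f : Mor relS) : Mor rel := ⟨_, _, φ.map f.hom⟩

@[simp] theorem mapMor_dom (f : Mor relS) : (φ.mapMor f).dom = φ.words f.dom := (rfl)
@[simp] theorem mapMor_cod (f : Mor relS) : (φ.mapMor f).cod = φ.words f.cod := (rfl)

theorem mapMor_comp (x y : Mor relS) (h : x.cod = y.dom) :
    φ.mapMor (x ⋆ y) = φ.mapMor x ⋆ φ.mapMor y := by
  obtain ⟨a, b, x⟩ := x
  obtain ⟨b, c, y⟩ := y
  dsimp only at h
  subst h
  rw [← Mor.mk_hcomp]
  induction x using ind with | _ f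
  induction y using ind with | _ g
  exact φ.mor_comp f g

theorem mapMor_mul (x y : Mor relS) : φ.mapMor (x * y) = φ.mapMor x * φ.mapMor y := by
  obtain ⟨a, b, x⟩ := x
  obtain ⟨c, d, y⟩ := y
  induction x using ind with | _ f
  induction y using ind with | _ g
  exact φ.mor_tensor f g

theorem mapMor_smul (r : R) (x : Mor relS) : φ.mapMor (r • x) = r • φ.mapMor x := by
  obtain ⟨a, b, x⟩ := x
  induction x using ind with | _ f
  exact φ.mor_smul r f

theorem mapMor_id (a : List S.Letter) : φ.mapMor (Mor.id relS a) = φ.proj a := φ.mor_eqTo _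

theorem mapMor_cup (a : List S.Letter) : φ.mapMor (Mor.cup relS a) =
    Mor.cup rel (φ.words a) ⋆ (φ.proj a * Mor.id rel (T.dual (φ.words a))) := φ.mor_cup _

theorem mapMor_cap (a : List S.Letter) : φ.mapMor (Mor.cap relS a) =
    (Mor.id rel (T.dual (φ.words a)) * φ.proj a) ⋆ Mor.cap rel (φ.words a) := φ.mor_cap _

theorem mapMor_braid (a b : List S.Letter) : φ.mapMor (Mor.braid relS a b) =
    (φ.proj a * φ.proj b) ⋆ Mor.braid rel (φ.words a) (φ.words b) := φ.mor_braid

theorem mapMor_braidInv (a b : List S.Letter) : φ.mapMor (Mor.braidInv relS a b) =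
    (φ.proj b * φ.proj a) ⋆ Mor.braidInv rel (φ.words a) (φ.words b) := φ.mor_braidInv

theorem mapMor_rot (x : Mor relS) : φ.mapMor x.rot = (φ.mapMor x).rot := by
  obtain ⟨a, b, x⟩ := x
  induction x using ind with | _ f
  exact φ.mor_rot f

end Realization

theorem Homfly.inv_mul_kink {n : ℕ} {q t : Rˣ} (hq : QuantumUnits q n) :
    ((t⁻¹ : Rˣ) : R) * ((q : R) * qInt q (n : ℤ) - qInt q ((n : ℤ) - 1)) =
      ((t⁻¹ * q ^ n : Rˣ) : R) := by
  rw [← Homfly.kink_scalar (t := t) hq, sub_sub_cancel, ← mul_assoc, t.inv_mul, one_mul]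

namespace Spider.HeckeStrand

variable {x : T.Letter} {n : ℕ} {q t : Rˣ} {e : SHom rel (strands x 2) (strands x 2)}
variable (H : HeckeStrand rel x n q t e)

/-- The realization of webs by antisymmetrizers. -/
def webRealization : Realization (MOYRel n q t) rel where
  toInterpretation := H.web
  eval_rel _ _ h := H.eval_web h

include H in
theorem braid_eq : Mor.braid rel [x] [x] =
    ⟨_, _, ((t⁻¹ : Rˣ) : R) • ((q : R) • (1 : SHom rel (strands x 2) (strands x 2)) - e)⟩ := by
  rw [Mor.mk_smul, H.pos, Mor.smul_smul', t.inv_mul, Mor.one_smul']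

include H in
theorem braidInv_eq : Mor.braidInv rel [x] [x] =
    ⟨_, _, (t : R) • (((q⁻¹ : Rˣ) : R) • (1 : SHom rel (strands x 2) (strands x 2)) - e)⟩ := by
  rw [Mor.mk_smul, H.neg, Mor.smul_smul', t.mul_inv, Mor.one_smul']

-- The computation of `kink_scalar` read backwards: the crossing is `t⁻¹ (q - e)`, so the loop and
-- the partial trace of `e` determine the kink.
include H in
theorem closeRight_braid : Mor.closeRight [x] [x] (Mor.braid rel [x] [x]) =
    ((t⁻¹ * q ^ n : Rˣ) : R) • Mor.id rel [x] := by
  have h1 : closeRightHom (a := [x]) (x := [x]) rfl (1 : SHom rel (strands x 2) (strands x 2)) =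
      (qInt q (n : ℤ) : R) • (1 : SHom rel [x] [x]) := by
    refine Mor.mk_inj (rel := rel) ((mk_closeRightHom _ _).trans ?_)
    have h := Mor.closeRight_id_mul (rel := rel) (f := Mor.id rel [x]) (a := []) (x :=
        [x]) rfl rfl [x]
    rw [H.loop_right, Mor.mul_smul, mul_one, ← Mor.id_append] at h
    exact h
  have h2 : closeRightHom (a := [x]) (x := [x]) rfl e =
      (qInt q ((n : ℤ) - 1) : R) • (1 : SHom rel [x] [x]) :=
    Mor.mk_inj (rel := rel) ((mk_closeRightHom _ _).trans H.kink_right)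
  rw [H.braid_eq]
  refine (mk_closeRightHom (a := [x]) (x := [x]) rfl _).symm.trans ?_
  rw [map_smul, map_sub, map_smul, h1, h2, smul_smul, ← sub_smul, smul_smul,
    Homfly.inv_mul_kink H.units]
  rfl

include H in
theorem closeLeft_braid : Mor.closeLeft [x] [x] (Mor.braid rel [x] [x]) =
    ((t⁻¹ * q ^ n : Rˣ) : R) • Mor.id rel [x] := by
  have h1 : closeLeftHom (a := [x]) (x := [x]) rfl (1 : SHom rel (strands x 2) (strands x 2)) =
      (qInt q (n : ℤ) : R) • (1 : SHom rel [x] [x]) := by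
    refine Mor.mk_inj (rel := rel) ((mk_closeLeftHom _ _).trans ?_)
    have h := Mor.closeLeft_mul_id (rel := rel) (f := Mor.id rel [x]) (a := []) (x :=
        [x]) rfl rfl [x]
    rw [H.loop_left, Mor.smul_mul, one_mul, ← Mor.id_append] at h
    exact h
  have h2 : closeLeftHom (a := [x]) (x := [x]) rfl e =
      (qInt q ((n : ℤ) - 1) : R) • (1 : SHom rel [x] [x]) :=
    Mor.mk_inj (rel := rel) ((mk_closeLeftHom _ _).trans H.kink_left)
  rw [H.braid_eq]
  refine (mk_closeLeftHom (a := [x]) (x := [x]) rfl _).symm.trans ?_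
  rw [map_smul, map_sub, map_smul, h1, h2, smul_smul, ← sub_smul, smul_smul,
    Homfly.inv_mul_kink H.units]
  rfl

include H in
theorem sphericalWord : Mor.SphericalWord rel [x] :=
  Mor.sphericalWord_of_kink (Units.isUnit _) H.closeRight_braid H.closeLeft_braid

variable (rel x) in
/-- One color is interpreted as the letter `x`. -/
def _root_.ribbon : Interpretation homflySignature rel where
  word := fun y : Bool => cond y [x] (T.dual [x])
  word_bar
    | true => rfl
    | false => (T.dual_dual [x]).symm
  idem _ := ofDiagram rel (idd _)
  idem_comp_idem _ := sound (.id_comp _)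
  idem_bar
    | true => (Mor.rot_id (rel := rel) [x]).symm
    | false => (congrArg (Mor.id rel) (T.dual_dual [x]).symm).trans (Mor.rot_id (T.dual [x])).symm
  vertex v := v.elim
  proj_comp_vertex v := v.elim
  vertex_comp_proj v := v.elim

variable (rel x) in
theorem _root_.ribbon_proj (a : List homflySignature.Letter) :
    (ribbon rel x).proj a = Mor.id rel ((ribbon rel x).words a) := by
  induction a with
  | nil => rfl
  | cons y a ih =>
    rw [StrandMap.proj_cons, ih, StrandMap.words_cons, Mor.id_append]
    rfl

variable (rel x) in
theorem _root_.ribbon_braid : (ribbon rel x).mor (R := R) (.braid [true] [true]) =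
    Mor.braid rel [x] [x] := by
  refine (Interpretation.mor_braid _).trans ?_
  rw [ribbon_proj, ← Mor.id_append]
  exact Mor.id_comp _ rfl

variable (rel x) in
theorem _root_.ribbon_braidInv : (ribbon rel x).mor (R := R) (.braidInv [true] [true]) =
    Mor.braidInv rel [x] [x] := by
  refine (Interpretation.mor_braidInv _).trans ?_
  rw [ribbon_proj, ← Mor.id_append]
  exact Mor.id_comp _ rfl

/-- The realization of the HOMFLYPT category given by a letter with a Hecke generator. -/
def ribbonRealization : Realization (Homfly.Rel n q t) rel where
  toInterpretation := ribbon rel x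
  eval_rel f g h := by
    cases h with
    | skein =>
      have h1 : (ribbon rel x).eval (R := R) (.braid [true] [true]) = ((t⁻¹ : Rˣ) : R) •
          ((q : R) • (1 : SHom rel (strands x 2) (strands x 2)) - e) :=
        Mor.mk_inj ((ribbon_braid rel x).trans H.braid_eq)
      have h2 : (ribbon rel x).eval (R := R) (.braidInv [true] [true]) = (t : R) •
          (((q⁻¹ : Rˣ) : R) • (1 : SHom rel (strands x 2) (strands x 2)) - e) :=
        Mor.mk_inj ((ribbon_braidInv rel x).trans H.braidInv_eq)
      have h3 : (ribbon rel x).eval (R := R) (idd [true, true]) =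
          (1 : SHom rel (strands x 2) (strands x 2)) :=
        Mor.mk_inj ((Interpretation.mor_eqTo _ _).trans (ribbon_proj rel x _))
      simp only [Interpretation.eval]
      change (((t⁻¹)⁻¹ : Rˣ) : R) • (ribbon rel x).eval (R := R) (.braid [true] [true]) +
        (-((t⁻¹ : Rˣ) : R)) • (ribbon rel x).eval (R := R) (.braidInv [true] [true]) =
        ((q : R) - ((q⁻¹ : Rˣ) : R)) • (ribbon rel x).eval (R := R) (idd [true, true])
      have h4 : (((t⁻¹)⁻¹ : Rˣ) : R) • ((t⁻¹ : Rˣ) : R) •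
          ((q : R) • (1 : SHom rel (strands x 2) (strands x 2)) - e) +
          (-((t⁻¹ : Rˣ) : R)) • (t : R) •
          (((q⁻¹ : Rˣ) : R) • (1 : SHom rel (strands x 2) (strands x 2)) - e) =
          ((q : R) - ((q⁻¹ : Rˣ) : R)) • (1 : SHom rel (strands x 2) (strands x 2)) := by
        rw [inv_inv, neg_smul, smul_smul, smul_smul, t.mul_inv, t.inv_mul]
        module
      exact (congrArg₂ (· + ·) (congrArg _ h1) (congrArg _ h2)).trans
        (h4.trans (congrArg _ h3).symm)
    | kink_right =>
      refine (ribbon rel x).eval_eq_of_mor_eq (((ribbon rel x).mor_closeRight _ _ _).trans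
        (Eq.trans ?_ ((ribbon rel x).mor_smul _ _).symm))
      rw [ribbon_braid, Interpretation.mor_eqTo, ribbon_proj, inv_inv]
      exact H.closeRight_braid
    | kink_left =>
      refine (ribbon rel x).eval_eq_of_mor_eq (((ribbon rel x).mor_closeLeft _ _ _).trans
        (Eq.trans ?_ ((ribbon rel x).mor_smul _ _).symm))
      rw [ribbon_braid, Interpretation.mor_eqTo, ribbon_proj, inv_inv]
      exact H.closeLeft_braid
    | unknot y =>
      refine (ribbon rel x).eval_eq_of_mor_eq (((ribbon rel x).mor_closeRight _ _ _).trans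
        (Eq.trans ?_ ((ribbon rel x).mor_smul _ _).symm))
      rw [Interpretation.mor_eqTo, ribbon_proj, Interpretation.mor_eqTo, ribbon_proj,
        Homfly.unknot_eq H.units]
      match y with
      | true => exact H.loop_right
      | false =>
        -- The right closure of the reversed strand is the left closure of the strand.
        refine Eq.trans ?_ H.loop_left
        have h1 : (ribbon rel x).words [false] = T.dual [x] := List.append_nil _
        simp only [StrandMap.words_nil, Mor.closeLeft, Mor.closeRight, Mor.id_nil, one_mul,
          mul_one, Mor.id_append, List.nil_append, h1, T.dual_dual]

end Spider.HeckeStrand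

end Realizations

/-! ### The Hecke generator of the MOY category. -/

noncomputable section WebStrand

set_option linter.unusedSimpArgs false

open SpiderSignature SpiderSignature.Diagram Spider

open scoped Spider.Mor

theorem Spider.ofDiagram_sum {S : SpiderSignature} {R : Type u} [CommRing R] (rel : S.Relators R)
    {a b : List S.Letter} (l : List (S.Diagram R a b)) :
    ofDiagram rel (Diagram.sum l) = (l.map (ofDiagram rel)).sum := by
  induction l with
  | nil => rfl
  | cons f l ih => rw [List.map_cons, List.sum_cons, ← ih]; rfl

/-- Multiplication of morphisms by a scalar. -/
abbrev Spider.smulHom {S : SpiderSignature} {R : Type u} [CommRing R] {rel : S.Relators R}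
    {a b : List S.Letter} (r : R) (x : SHom rel a b) : SHom rel a b := r • x

namespace Web

variable {R : Type u} [CommRing R] {n : ℕ} {q t : Rˣ}

/-- The word of an upward edge with label `k`. -/
def edge (n k : ℕ) : List (moySignature n).Letter := up n k

theorem edge_zero (n : ℕ) : edge n 0 = [] := up_zero n

/-- The upward edge with label `1`. -/
def one (hn : 2 ≤ n) : (moySignature n).Letter := ((⟨1, le_rfl, by omega⟩, true) : MOYLetter n)

theorem edge_one (hn : 2 ≤ n) : edge n 1 = [one hn] := dif_pos ⟨le_rfl, by omega⟩

variable (q t) in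
/-- The merge vertex. -/
def merge {k l m : ℕ} (h : k + l = m) (hm : m ≤ n) : Mor (MOYRel n q t) :=
  ⟨edge n k ++ edge n l, edge n m, ofDiagram _ (_root_.merge k l m h hm)⟩

variable (q t) in
/-- The split vertex. -/
def split {k l m : ℕ} (h : k + l = m) (hm : m ≤ n) : Mor (MOYRel n q t) :=
  ⟨edge n m, edge n k ++ edge n l, ofDiagram _ (_root_.split k l m h hm)⟩

section

variable {k l m : ℕ} (h : k + l = m) (hm : m ≤ n)

@[simp] theorem merge_dom : (merge q t h hm).dom = edge n k ++ edge n l := (rfl)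
@[simp] theorem merge_cod : (merge q t h hm).cod = edge n m := (rfl)
@[simp] theorem split_dom : (split q t h hm).dom = edge n m := (rfl)
@[simp] theorem split_cod : (split q t h hm).cod = edge n k ++ edge n l := (rfl)

theorem bubble : split q t h hm ⋆ merge q t h hm =
    (qBinom q (m : ℤ) k : R) • Mor.id (MOYRel n q t) (edge n m) := by
  subst h
  exact (Mor.mk_comp _ _).symm.trans
    (congrArg (Mor.mk _ _) (sound (.rel (.bubble k l hm))))

end

theorem merge_zero_left {k : ℕ} (hk : k ≤ n) :
    merge q t (zero_add k) hk = Mor.id (MOYRel n q t) (edge n k) :=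
  (congrArg (Mor.mk _ _) (sound (.rel (.merge_zero_left k hk)))).trans
    ((Mor.mk_eqTo (rel := MOYRel n q t) (S := moySignature n) (a :=
      edge n _ ++ edge n _) _).trans (by rw [edge_zero]; rfl))

theorem merge_zero_right {k : ℕ} (hk : k ≤ n) :
    merge q t (add_zero k) hk = Mor.id (MOYRel n q t) (edge n k) :=
  (congrArg (Mor.mk _ _) (sound (.rel (.merge_zero_right k hk)))).trans
    ((Mor.mk_eqTo (rel := MOYRel n q t) (S := moySignature n) (a :=
      edge n _ ++ edge n _) _).trans (by rw [edge_zero, List.append_nil]))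

theorem split_zero_left {k : ℕ} (hk : k ≤ n) :
    split q t (zero_add k) hk = Mor.id (MOYRel n q t) (edge n k) :=
  (congrArg (Mor.mk _ _) (sound (.rel (.split_zero_left k hk)))).trans
    ((Mor.mk_eqTo _).trans (by rfl))

theorem split_zero_right {k : ℕ} (hk : k ≤ n) :
    split q t (add_zero k) hk = Mor.id (MOYRel n q t) (edge n k) :=
  (congrArg (Mor.mk _ _) (sound (.rel (.split_zero_right k hk)))).trans
    ((Mor.mk_eqTo _).trans (by rfl))

theorem sixj_merge {k l m p : ℕ} (h : k + l + m = p) (hp : p ≤ n) :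
    (merge q t (rfl : k + l = k + l) (by omega) * Mor.id _ (edge n m)) ⋆ merge q t h hp =
      (Mor.id _ (edge n k) * merge q t (rfl : l + m = l + m) (by omega)) ⋆
        merge q t ((add_assoc k l m).symm.trans h) hp := by
  subst h
  have h := congrArg (Mor.mk (rel := MOYRel n q t) _ _) (sound (.rel (.sixj_merge k l m hp)))
  have h1 : ∀ x : Mor (MOYRel n q t), x.dom = edge n k ++ (edge n l ++ edge n m) →
      Mor.mk _ _ (ofDiagram (MOYRel n q t) (eqTo (S := moySignature n)
        (List.append_assoc (edge n k) (edge n l) (edge n m)))) ⋆ x = x := fun x hx => by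
    rw [Mor.mk_eqTo, List.append_assoc, Mor.id_comp _ hx.symm]
  exact (Mor.mk_comp _ _).symm.trans (h.trans ((Mor.mk_comp _ _).trans
    ((congrArg _ (Mor.mk_comp _ _)).trans (h1 _ (by rw [Mor.comp_dom]; rfl)))))

theorem sixj_split {k l m p : ℕ} (h : k + l + m = p) (hp : p ≤ n) :
    split q t h hp ⋆ (split q t (rfl : k + l = k + l) (by omega) * Mor.id _ (edge n m)) =
      split q t ((add_assoc k l m).symm.trans h) hp ⋆
        (Mor.id _ (edge n k) * split q t (rfl : l + m = l + m) (by omega)) := by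
  subst h
  have h := congrArg (Mor.mk (rel := MOYRel n q t) _ _) (sound (.rel (.sixj_split k l m hp)))
  have h1 : ∀ x : Mor (MOYRel n q t), x.cod = edge n k ++ (edge n l ++ edge n m) →
      x ⋆ Mor.mk _ _ (ofDiagram (MOYRel n q t) (eqTo (S := moySignature n)
        (List.append_assoc (edge n k) (edge n l) (edge n m)).symm)) = x := fun x hx => by
    rw [Mor.mk_eqTo, Mor.comp_id _ hx.symm]
  exact (Mor.mk_comp _ _).symm.trans (h.trans ((Mor.mk_comp _ _).trans
    ((congrArg (· ⋆ _) (Mor.mk_comp _ _)).trans (h1 _ (by rw [Mor.comp_cod _ _ rfl]; rfl)))))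

theorem mk_rungLeft {k l r k' l' : ℕ} (hk : k + r = k') (hl : r + l' = l) (hk' : k' ≤ n)
    (hl' : l ≤ n) : (⟨_, _,
      ofDiagram (MOYRel n q t) (rungLeft k l r k' l' hk hl hk' hl')⟩ : Mor _) =
      (Mor.id _ (edge n k) * split q t hl hl') ⋆ (merge q t hk hk' * Mor.id _ (edge n l')) := by
  have h1 : ∀ x : Mor (MOYRel n q t), x.cod = edge n k ++ (edge n r ++ edge n l') →
      x ⋆ Mor.mk _ _ (ofDiagram (MOYRel n q t) (eqTo (S := moySignature n)
        (List.append_assoc (edge n k) (edge n r) (edge n l')).symm)) = x := fun x hx => by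
    rw [Mor.mk_eqTo, Mor.comp_id _ hx.symm]
  exact (Mor.mk_comp _ _).trans
    (congrArg₂ _ ((Mor.mk_comp _ _).trans (h1 _ (by rfl))) (by rfl))

theorem mk_rungRight {k l s k' l' : ℕ} (hk : k' + s = k) (hl : s + l = l') (hk' : k ≤ n)
    (hl' : l' ≤ n) : (⟨_, _,
      ofDiagram (MOYRel n q t) (rungRight k l s k' l' hk hl hk' hl')⟩ : Mor _) =
      (split q t hk hk' * Mor.id _ (edge n l)) ⋆ (Mor.id _ (edge n k') * merge q t hl hl') := by
  have h1 : ∀ x : Mor (MOYRel n q t), x.cod = edge n k' ++ edge n s ++ edge n l →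
      x ⋆ Mor.mk _ _ (ofDiagram (MOYRel n q t) (eqTo (S := moySignature n)
        (List.append_assoc (edge n k') (edge n s) (edge n l)))) = x := fun x hx => by
    rw [Mor.mk_eqTo, Mor.comp_id _ hx.symm]
  exact (Mor.mk_comp _ _).trans
    (congrArg₂ _ ((Mor.mk_comp _ _).trans (h1 _ (by rfl))) (by rfl))

variable (q t) in
/-- A merge followed by a split. -/
def dumbbell {k l m : ℕ} (h : k + l = m) (hm : m ≤ n) :
    SHom (MOYRel n q t) (edge n k ++ edge n l) (edge n k ++ edge n l) :=
  ofDiagram _ ((_root_.merge k l m h hm).comp (_root_.split k l m h hm))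

theorem mk_dumbbell {k l m : ℕ} (h : k + l = m) (hm : m ≤ n) :
    (⟨_, _, dumbbell q t h hm⟩ : Mor (MOYRel n q t)) = merge q t h hm ⋆ split q t h hm :=
  Mor.mk_comp _ _

theorem mk_box_right_left {k : ℕ} (h) (h') (h'') (h₃) (h₄) (h₅) :
    (⟨_, _, ofDiagram (MOYRel n q t) (boxRightLeft (k + 1) 1 1 1 (k + 1) 1 h h' h'' h₃ h₄ h₅)⟩ :
      Mor (MOYRel n q t)) =
      (split q t (rfl : k + 1 = k + 1) (by omega) * Mor.id _ (edge n 1)) ⋆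
        (Mor.id _ (edge n k) * ⟨_, _, dumbbell q t (rfl : 1 + 1 = 2) (by omega)⟩) ⋆
        (merge q t (rfl : k + 1 = k + 1) (by omega) * Mor.id _ (edge n 1)) := by
  refine (Mor.mk_comp _ _).trans ((congrArg₂ _ (mk_rungRight _ _ _ _) (mk_rungLeft _ _ _ _)).trans
    ?_)
  rw [mk_dumbbell, Mor.id_mul_comp _ _ rfl, Mor.comp_assoc _ _ _ (by simp) (by simp),
    Mor.comp_assoc _ _ _ (by simp) (by simp), Mor.comp_assoc _ _ _ (by simp) (by simp)]
  rfl

theorem mk_box_left_right {k : ℕ} (hk : k + 2 ≤ n) (h) (h') (h'') (h₃) (h₄) (h₅) :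
    (⟨_, _, ofDiagram (MOYRel n q t) (boxLeftRight (k + 1) 1 1 1 (k + 1) 1 h h' h'' h₃ h₄ h₅)⟩ :
      Mor (MOYRel n q t)) = ⟨_, _, dumbbell q t (rfl : k + 1 + 1 = k + 2) hk⟩ := by
  refine (Mor.mk_comp _ _).trans ((congrArg₂ _ (mk_rungLeft _ _ _ _) (mk_rungRight _ _ _ _)).trans
    ?_)
  have h1 : split q t (add_zero 1) (by omega : 1 ≤ n) = _ := split_zero_right _
  have h2 : merge q t (add_zero 1) (by omega : 1 ≤ n) = _ := merge_zero_right _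
  have h0 : Mor.id (MOYRel n q t) (edge n 0) = 1 := by rw [edge_zero]; rfl
  simp only [Nat.sub_self, h0, mul_one, h1, h2, mk_dumbbell, ← Mor.id_append]
  rw [Mor.id_comp _ (by simp), Mor.comp_id _ (by simp)]

theorem mk_box_zero {k : ℕ} (hk : k + 1 ≤ n) (h) (h') (h'') (h₃) (h₄) (h₅) :
    (⟨_, _, ofDiagram (MOYRel n q t) (boxLeftRight (k + 1) 1 0 0 (k + 1) 1 h h' h'' h₃ h₄ h₅)⟩ :
      Mor (MOYRel n q t)) = Mor.id _ (edge n (k + 1) ++ edge n 1) := by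
  refine (Mor.mk_comp _ _).trans ((congrArg₂ _ (mk_rungLeft _ _ _ _) (mk_rungRight _ _ _ _)).trans
    ?_)
  have h1 : split q t (zero_add 1) (by omega : 1 ≤ n) = _ := split_zero_left _
  have h2 : merge q t (zero_add 1) (by omega : 1 ≤ n) = _ := merge_zero_left _
  have h3 : split q t (add_zero (k + 1)) hk = _ := split_zero_right _
  have h4 : merge q t (add_zero (k + 1)) hk = _ := merge_zero_right _
  simp only [Nat.sub_zero, Nat.add_zero, h1, h2, h3, h4, ← Mor.id_append, Mor.id_comp_id]

/-- The box relation on `(k+1) ⊗ 1` with both rungs labelled one; the terms `t = 0` and `t = 1` give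
the dumbbell and the identity. It is the web counterpart of the recursion for antisymmetrizers. -/
theorem box_one (hq : QuantumUnits q n) {k : ℕ} (hk : k + 2 ≤ n) :
    (split q t (rfl : k + 1 = k + 1) (by omega) * Mor.id _ (edge n 1)) ⋆
        (Mor.id _ (edge n k) * ⟨_, _, dumbbell q t (rfl : 1 + 1 = 2) (by omega)⟩) ⋆
        (merge q t (rfl : k + 1 = k + 1) (by omega) * Mor.id _ (edge n 1)) =
      ⟨_, _, dumbbell q t (rfl : k + 1 + 1 = k + 2) hk + (qInt q (k : ℤ) : R) •
        (1 : SHom (MOYRel n q t) (edge n (k + 1) ++ edge n 1) (edge n (k + 1) ++ edge n 1))⟩ := by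
  have h := sound (rel := MOYRel n q t) (.rel (.box (k + 1) 1 1 1 (k + 1) 1 (by omega) (by omega)
    (by omega) (by omega) (by omega) (by omega)))
  refine (mk_box_right_left _ _ _ _ _ _).symm.trans (congrArg (Mor.mk _ _) (h.trans ?_))
  have e0 : ∀ h h' h'' h₃ h₄ h₅, (ofDiagram (MOYRel n q t)
      (boxLeftRight (k + 1) 1 1 1 (k + 1) 1 h h' h'' h₃ h₄ h₅) :
        SHom _ (edge n (k + 1) ++ edge n 1) (edge n (k + 1) ++ edge n 1)) =
      dumbbell q t (rfl : k + 1 + 1 = k + 2) hk :=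
    fun h h' h'' h₃ h₄ h₅ => Mor.mk_inj (mk_box_left_right hk h h' h'' h₃ h₄ h₅)
  have e1 : ∀ h h' h'' h₃ h₄ h₅, (ofDiagram (MOYRel n q t)
      (boxLeftRight (k + 1) 1 0 0 (k + 1) 1 h h' h'' h₃ h₄ h₅) :
        SHom _ (edge n (k + 1) ++ edge n 1) (edge n (k + 1) ++ edge n 1)) = 1 :=
    fun h h' h'' h₃ h₄ h₅ =>
      Mor.mk_inj ((mk_box_zero (by omega) h h' h'' h₃ h₄ h₅).trans (Mor.mk_one _).symm)
  refine (ofDiagram_sum _ _).trans (Eq.trans (b :=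
    (qBinom q (((k + 1 : ℕ) : ℤ) - (1 : ℕ) + (1 : ℕ) - (1 : ℕ)) 0 : R) •
      dumbbell q t (rfl : k + 1 + 1 = k + 2) hk +
    ((qBinom q (((k + 1 : ℕ) : ℤ) - (1 : ℕ) + (1 : ℕ) - (1 : ℕ)) 1 : R) • 1 + 0)) ?_ ?_)
  · exact congrArg₂ (Add.add (α := SHom (MOYRel n q t) (edge n (k + 1) ++ edge n 1) (edge n (k +
      1) ++ edge n 1)))
      (congrArg (smulHom (R := R) _) (e0 _ _ _ _ _ _))
      (congrArg₂ (Add.add (α := SHom (MOYRel n q t) (edge n (k + 1) ++ edge n 1) (edge n (k +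
        1) ++ edge n 1)))
        (congrArg (smulHom (R := R) _) (e1 _ _ _ _ _ _)) rfl)
  · rw [qBinom_zero, hq.qBinom_one (by omega), one_smul, add_zero,
      show ((k + 1 : ℕ) : ℤ) - (1 : ℕ) + (1 : ℕ) - (1 : ℕ) = k by push_cast; ring]

/-- Only `b = 0` and `b = 1` occur: the first box is empty and the second is the dumbbell. The
parameters are free in order to serve both crossings. -/
theorem braidExpansion_one (hn : 2 ≤ n) (q' t' : Rˣ) :
    ofDiagram (MOYRel n q t) (braidExpansion n q' t' 1 1 hn) = ((t'⁻¹ : Rˣ) : R) •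
      ((q' : R) • (1 : SHom (MOYRel n q t) (edge n 1 ++ edge n 1) (edge n 1 ++ edge n 1)) -
        dumbbell q t (rfl : 1 + 1 = 2) hn) := by
  have e0 : ∀ h h' h'' h₃ h₄ h₅,
      ofDiagram (MOYRel n q t) (boxRightLeft 1 1 0 0 1 1 h h' h'' h₃ h₄ h₅) =
      (1 : SHom (MOYRel n q t) (edge n 1 ++ edge n 1) (edge n 1 ++ edge n 1)) := by
    intro h h' h'' h₃ h₄ h₅
    refine Mor.mk_inj (Eq.trans ?_ (Mor.mk_one _).symm)
    refine (Mor.mk_comp _ _).trans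
      ((congrArg₂ _ (mk_rungRight _ _ _ _) (mk_rungLeft _ _ _ _)).trans ?_)
    have h1 : split q t (zero_add 1) (by omega : 1 ≤ n) = _ := split_zero_left _
    have h2 : merge q t (zero_add 1) (by omega : 1 ≤ n) = _ := merge_zero_left _
    have h3 : split q t (add_zero 1) (by omega : 1 ≤ n) = _ := split_zero_right _
    have h4 : merge q t (add_zero 1) (by omega : 1 ≤ n) = _ := merge_zero_right _
    simp only [Nat.sub_zero, Nat.add_zero, h1, h2, h3, h4, ← Mor.id_append, Mor.id_comp_id]
    rfl
  have e1 : ∀ h h' h'' h₃ h₄ h₅,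
      (ofDiagram (MOYRel n q t) (boxRightLeft 1 1 1 1 1 1 h h' h'' h₃ h₄ h₅) :
        SHom _ (edge n 1 ++ edge n 1) (edge n 1 ++ edge n 1)) = dumbbell q t (rfl : 1 + 1 =
          2) hn := by
    intro h h' h'' h₃ h₄ h₅
    refine Mor.mk_inj (Eq.trans ?_ (mk_dumbbell _ _).symm)
    refine (Mor.mk_comp _ _).trans
      ((congrArg₂ _ (mk_rungRight _ _ _ _) (mk_rungLeft _ _ _ _)).trans ?_)
    have h1 : split q t (zero_add 1) (by omega : 1 ≤ n) = _ := split_zero_left _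
    have h2 : merge q t (zero_add 1) (by omega : 1 ≤ n) = _ := merge_zero_left _
    have h0 : Mor.id (MOYRel n q t) (edge n 0) = 1 := by rw [edge_zero]; rfl
    simp only [Nat.sub_self, h0, one_mul, h1, h2, ← Mor.id_append]
    rw [Mor.id_comp _ (by simp), Mor.comp_id _ (by simp)]
  have e : (ofDiagram (MOYRel n q t) (braidExpansion n q' t' 1 1 hn) :
        SHom _ (edge n 1 ++ edge n 1) (edge n 1 ++ edge n 1)) =
      ((-1) ^ (1 + 1 * 1) * ((q' ^ 1 * t'⁻¹ ^ (1 * 1) : Rˣ) : R)) •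
      ((((-q') ^ (-((0 : ℕ) : ℤ)) : Rˣ) : R) •
        (1 : SHom (MOYRel n q t) (edge n 1 ++ edge n 1) (edge n 1 ++ edge n 1)) +
        ((((-q') ^ (-((1 : ℕ) : ℤ)) : Rˣ) : R) • dumbbell q t (rfl : 1 + 1 = 2) hn + 0)) := by
    refine congrArg (smulHom (R := R) _) ((ofDiagram_sum _ _).trans ?_)
    exact congrArg₂ (Add.add (α :=
      SHom (MOYRel n q t) (edge n 1 ++ edge n 1) (edge n 1 ++ edge n 1)))
      ((congrArg (ofDiagram _) (dif_pos (Nat.le_add_right 1 _))).trans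
        (congrArg (smulHom (R := R) _) (e0 _ _ _ _ _ _)))
      (congrArg₂ (Add.add (α := SHom (MOYRel n q t) (edge n 1 ++ edge n 1) (edge n 1 ++ edge n 1)))
        ((congrArg (ofDiagram _) (dif_pos (Nat.le_add_right 1 _))).trans
          (congrArg (smulHom (R := R) _) (e1 _ _ _ _ _ _))) rfl)
  refine e.trans ?_
  have h1 : (-1 : R) ^ (1 + 1 * 1) = 1 := by norm_num
  have h2 : (q' : R) * ((q'⁻¹ : Rˣ) : R) = 1 := q'.mul_inv
  have h3 : (((-q') ^ (-((1 : ℕ) : ℤ)) : Rˣ) : R) = -((q'⁻¹ : Rˣ) : R) := by simp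
  have h4 : (((-q') ^ (-((0 : ℕ) : ℤ)) : Rˣ) : R) = 1 := by simp
  rw [h1, h3, h4, one_mul, mul_one, pow_one, pow_one, Units.val_mul]
  have h5 := congrArg (fun r => (((t'⁻¹ : Rˣ) : R) * r) • dumbbell q t (rfl : 1 + 1 = 2) hn) h2
  linear_combination (norm := module) -h5

/-- The Hecke generator. -/
def gen (q t : Rˣ) (hn : 2 ≤ n) :
    SHom (MOYRel n q t) (strands (one hn) 2) (strands (one hn) 2) :=
  hcast (by rw [edge_one hn]; rfl) (by rw [edge_one hn]; rfl)
    (dumbbell q t (rfl : 1 + 1 = 2) hn)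

theorem mk_gen (hn : 2 ≤ n) : (⟨_, _, gen q t hn⟩ : Mor (MOYRel n q t)) =
    ⟨_, _, dumbbell q t (rfl : 1 + 1 = 2) hn⟩ := Mor.mk_hcast _ _ _

theorem mk_gen_sub (hn : 2 ≤ n) (r : R) : (⟨_, _, r • (1 : SHom (MOYRel n q t)
      (strands (one hn) 2) (strands (one hn) 2)) - gen q t hn⟩ :
      Mor (MOYRel n q t)) =
    ⟨_, _, r • (1 : SHom (MOYRel n q t) (edge n 1 ++ edge n 1) (edge n 1 ++ edge n 1)) -
      dumbbell q t (rfl : 1 + 1 = 2) hn⟩ := by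
  have key : ∀ (a b : List (moySignature n).Letter) (h : a = b) (x : SHom (MOYRel n q t) a a),
      (⟨_, _, r • (1 : SHom (MOYRel n q t) b b) - hcast h h x⟩ : Mor (MOYRel n q t)) =
        ⟨_, _, r • (1 : SHom (MOYRel n q t) a a) - x⟩ := by
    rintro a _ rfl x
    rfl
  exact key _ _ _ _

theorem closeRight_merge_split {k l m : ℕ} (h : k + l = m) (hm : m ≤ n) :
    Mor.closeRight (edge n k) (edge n l) (merge q t h hm ⋆ split q t h hm) =
      (qBinom q ((n : ℤ) - k) l : R) • Mor.id _ (edge n k) := by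
  subst h
  have h := congrArg (Mor.mk (rel := MOYRel n q t) _ _) (sound (.rel (.bubble_right k l hm)))
  exact (congrArg _ (Mor.mk_comp _ _).symm).trans ((Mor.mk_closeRight _ _ _).symm.trans h)

theorem closeLeft_merge_split {k l m : ℕ} (h : l + k = m) (hm : m ≤ n) :
    Mor.closeLeft (edge n l) (edge n k) (merge q t h hm ⋆ split q t h hm) =
      (qBinom q ((n : ℤ) - k) l : R) • Mor.id _ (edge n k) := by
  subst h
  have h := congrArg (Mor.mk (rel := MOYRel n q t) _ _) (sound (.rel (.bubble_left k l hm)))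
  exact (congrArg _ (Mor.mk_comp _ _).symm).trans ((Mor.mk_closeLeft _ _ _).symm.trans h)

/-- Each property is a MOY relation with labels at most two: the crossings are the braid relations,
`e² = [2] e` is the digon, the loops are the second bubble relation on the empty strand, and the
kinks are the same relation on a strand labelled one. -/
theorem heckeStrand (hq : QuantumUnits q n) (hn : 2 ≤ n) :
    HeckeStrand (MOYRel n q t) (one hn) n q t (gen q t hn) where
  units := hq
  pos := by
    have h := (congrArg (Mor.mk (rel := MOYRel n q t) _ _)
      ((sound (.rel (.braid_pos 1 1 hn))).trans (braidExpansion_one hn q t))).trans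
      (Mor.mk_smul _ _)
    rw [mk_gen_sub, ← edge_one hn]
    exact (Mor.one_smul' _).symm.trans ((congrArg (· • _) t.mul_inv.symm).trans
      ((Mor.smul_smul' _ _ _).symm.trans (congrArg _ h.symm)))
  neg := by
    have h := (congrArg (Mor.mk (rel := MOYRel n q t) _ _)
      ((sound (.rel (.braid_neg 1 1 hn))).trans (braidExpansion_one hn q⁻¹ t⁻¹))).trans
      (Mor.mk_smul _ _)
    rw [inv_inv] at h
    rw [mk_gen_sub, ← edge_one hn]
    exact (Mor.one_smul' _).symm.trans ((congrArg (· • _) t.inv_mul.symm).trans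
      ((Mor.smul_smul' _ _ _).symm.trans (congrArg _ h.symm)))
  sq := by
    refine Mor.mk_inj (rel := MOYRel n q t) ?_
    rw [Mor.mk_mul, Mor.mk_smul, mk_gen, mk_dumbbell, Mor.comp_assoc _ _ _ rfl (by simp),
      ← Mor.comp_assoc _ (merge q t _ _) _ rfl rfl, bubble, Mor.smul_comp _ _ _ rfl,
      Mor.id_comp _ (by simp), Mor.comp_smul _ _ _ (by simp), hq.qBinom_one (by omega)]
    rfl
  loop_right := by
    have h := closeRight_merge_split (q := q) (t := t) (zero_add 1) (by omega : 1 ≤ n)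
    rw [merge_zero_left, split_zero_left, Mor.id_comp_id, hq.qBinom_one (by omega), edge_zero,
      edge_one hn, Nat.cast_zero, sub_zero] at h
    exact h
  loop_left := by
    have h := closeLeft_merge_split (q := q) (t := t) (add_zero 1) (by omega : 1 ≤ n)
    rw [merge_zero_right, split_zero_right, Mor.id_comp_id, hq.qBinom_one (by omega), edge_zero,
      edge_one hn, Nat.cast_zero, sub_zero] at h
    exact h
  kink_right := by
    have h := closeRight_merge_split (q := q) (t := t) (rfl : 1 + 1 = 2) hn
    rw [← mk_dumbbell, ← mk_gen, hq.qBinom_one (by omega), edge_one hn] at h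
    exact h
  kink_left := by
    have h := closeLeft_merge_split (q := q) (t := t) (rfl : 1 + 1 = 2) hn
    rw [← mk_dumbbell, ← mk_gen, hq.qBinom_one (by omega), edge_one hn] at h
    exact h

end Web

end WebStrand

/-! ### Exploding an edge into edges labelled one. -/

noncomputable section Explosion

set_option linter.unusedSimpArgs false

open SpiderSignature SpiderSignature.Diagram Spider

open scoped Spider.Mor

namespace Web

variable {R : Type u} [CommRing R] {n : ℕ} {q t : Rˣ}

variable (q t) in
/-- The merge of `k` edges labelled `1`. -/
def fuse : ∀ k : ℕ, k ≤ n → Mor (MOYRel n q t)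
  | 0, _ => 1
  | k + 1, h => (fuse k (by omega) * Mor.id _ (edge n 1)) ⋆ merge q t rfl h

variable (q t) in
/-- The split into `k` edges labelled `1`. -/
def fray : ∀ k : ℕ, k ≤ n → Mor (MOYRel n q t)
  | 0, _ => 1
  | k + 1, h => split q t rfl h ⋆ (fray k (by omega) * Mor.id _ (edge n 1))

theorem fuse_succ {k : ℕ} (h : k + 1 ≤ n) :
    fuse q t (k + 1) h = (fuse q t k (by omega) * Mor.id _ (edge n 1)) ⋆ merge q t rfl h := rfl

theorem fray_succ {k : ℕ} (h : k + 1 ≤ n) :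
    fray q t (k + 1) h = split q t rfl h ⋆ (fray q t k (by omega) * Mor.id _ (edge n 1)) := rfl

@[simp] theorem fuse_cod {k : ℕ} (h : k ≤ n) : (fuse q t k h).cod = edge n k := by
  induction k with
  | zero => rw [edge_zero]; rfl
  | succ k ih => rw [fuse_succ, Mor.comp_cod _ _ (by simp [ih]), merge_cod]

@[simp] theorem fray_dom {k : ℕ} (h : k ≤ n) : (fray q t k h).dom = edge n k := by
  cases k with
  | zero => rw [edge_zero]; rfl
  | succ k => rw [fray_succ, Mor.comp_dom, split_dom]

theorem fuse_dom (hn : 2 ≤ n) {k : ℕ} (h : k ≤ n) :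
    (fuse q t k h).dom = strands (one hn) k := by
  induction k with
  | zero => rfl
  | succ k ih =>
    rw [fuse_succ, Mor.comp_dom, Mor.mul_dom, ih, Mor.id_dom, edge_one hn, strands_add]
    rfl

theorem fray_cod (hn : 2 ≤ n) {k : ℕ} (h : k ≤ n) :
    (fray q t k h).cod = strands (one hn) k := by
  induction k with
  | zero => rfl
  | succ k ih =>
    rw [fray_succ, Mor.comp_cod _ _ (by simp), Mor.mul_cod, ih, Mor.id_cod, edge_one hn, strands_add]
    rfl

theorem fray_cod_eq (hn : 2 ≤ n) {k : ℕ} (h : k ≤ n) :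
    (fray q t k h).cod = (fuse q t k h).dom := by rw [fray_cod hn, fuse_dom hn]

theorem qFactorial_succ (q : Rˣ) (k : ℕ) :
    (qFactorial q (k + 1) : R) = qFactorial q k * qInt q ((k : ℤ) + 1) := by
  rw [qFactorial, Finset.prod_range_succ]; rfl

/-- Nested digons, which contribute `[1], [2], …, [k]` one after the other. -/
theorem fray_comp_fuse (hq : QuantumUnits q n) (hn : 2 ≤ n) {k : ℕ} (h : k ≤ n) :
    fray q t k h ⋆ fuse q t k h = (qFactorial q k : R) • Mor.id _ (edge n k) := by
  induction k with
  | zero =>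
    rw [edge_zero, Mor.id_nil, qFactorial, Finset.prod_range_zero, Mor.one_smul']
    exact Mor.id_comp_id []
  | succ k ih =>
    have hc := fray_cod_eq (q := q) (t := t) hn (k := k) (by omega)
    rw [fray_succ, fuse_succ, Mor.comp_assoc _ _ _ (by simp) (by simp [hc]),
      ← Mor.comp_assoc (_ * _) (_ * _) _ (by simp [hc]) (by simp),
      ← Mor.mul_comp_id _ _ hc, ih, Mor.smul_mul, ← Mor.id_append, Mor.smul_comp _ _ _ (by simp),
      Mor.id_comp _ (by simp), Mor.comp_smul _ _ _ (by simp), bubble, Mor.smul_smul',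
      qFactorial_succ, hq.qBinom_symm (by omega) (by omega), hq.qBinom_one (by omega)]
    push_cast
    rfl

/-- By associativity of merges, moving one edge at a time from the second group. -/
theorem fuse_add {k l m : ℕ} (h : k + l = m) (hm : m ≤ n) :
    fuse q t m hm = (fuse q t k (by omega) * fuse q t l (by omega)) ⋆ merge q t h hm := by
  induction l generalizing m with
  | zero =>
    obtain rfl : k = m := h
    have h2 := merge_zero_right (q := q) (t := t) hm
    rw [h2, Mor.comp_id _ (by simp [edge_zero, fuse])]
    exact (mul_one _).symm
  | succ l ih =>
    obtain rfl : m = k + l + 1 := by omega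
    have h1 := sixj_merge (q := q) (t := t) (k := k) (l := l) (m := 1) rfl hm
    rw [fuse_succ, ih rfl (by omega), fuse_succ, Mor.mul_comp_id _ _ (by simp),
      Mor.comp_assoc _ _ _ (by simp) (by simp), h1, ← Mor.comp_assoc _ _ _ (by simp) (by simp),
      mul_assoc, Mor.interchange _ _ _ _ (by simp) (by simp), Mor.comp_id _ (by simp)]

theorem fray_add {k l m : ℕ} (h : k + l = m) (hm : m ≤ n) :
    fray q t m hm = split q t h hm ⋆ (fray q t k (by omega) * fray q t l (by omega)) := by
  induction l generalizing m with
  | zero =>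
    obtain rfl : k = m := h
    have h2 := split_zero_right (q := q) (t := t) hm
    rw [h2, Mor.id_comp _ (by simp [edge_zero, fray])]
    exact (mul_one _).symm
  | succ l ih =>
    obtain rfl : m = k + l + 1 := by omega
    have h1 := sixj_split (q := q) (t := t) (k := k) (l := l) (m := 1) rfl hm
    rw [fray_succ, ih rfl (by omega), fray_succ, Mor.mul_comp_id _ _ (by simp),
      ← Mor.comp_assoc _ _ _ (by simp) (by simp), h1, Mor.comp_assoc _ _ _ (by simp) (by simp),
      mul_assoc, Mor.interchange _ _ _ _ (by simp) (by simp), Mor.id_comp _ (by simp)]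

theorem smul_strandProj_one (hn : 2 ≤ n) :
    (qFactorial q 1 : R) • Mor.strandProj q (gen q t hn) 1 =
      fuse q t 1 (by omega) ⋆ fray q t 1 (by omega) := by
  have h1 := merge_zero_left (q := q) (t := t) (by omega : 1 ≤ n)
  have h2 := split_zero_left (q := q) (t := t) (by omega : 1 ≤ n)
  have h3 : fuse q t 1 (by omega : 1 ≤ n) = Mor.id _ (edge n 1) := by
    rw [fuse_succ, h1, fuse, one_mul, Mor.id_comp_id]
  have h4 : fray q t 1 (by omega : 1 ≤ n) = Mor.id _ (edge n 1) := by
    rw [fray_succ, h2, fray, one_mul, Mor.id_comp_id]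
  rw [h3, h4, Mor.id_comp_id, qFactorial, Finset.prod_range_one, Nat.cast_zero, zero_add, qInt_one,
    Mor.one_smul', Mor.strandProj, strandProj, antisym_one, Mor.mk_one, edge_one hn]
  rfl

/-- The first `k` edges do not meet the generator; they fuse back with factor `[k]!`. What remains
is the box of `box_one`. -/
theorem fray_gen_fuse (hq : QuantumUnits q n) (hn : 2 ≤ n) {k : ℕ} (h : k + 2 ≤ n) :
    ((fray q t (k + 1) (by omega) * Mor.id _ (edge n 1)) ⋆
      (Mor.id _ (strands (one hn) k) * ⟨_, _, gen q t hn⟩)) ⋆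
      (fuse q t (k + 1) (by omega) * Mor.id _ (edge n 1)) =
    (qFactorial q k : R) • ⟨_, _, dumbbell q t (rfl : k + 1 + 1 = k + 2) h + (qInt q (k : ℤ) : R) •
        (1 : SHom (MOYRel n q t) (edge n (k + 1) ++ edge n 1) (edge n (k + 1) ++ edge n 1))⟩ := by
  have hd : (fuse q t k (by omega : k ≤ n)).dom = strands (one hn) k := fuse_dom hn _
  have hc : (fray q t k (by omega : k ≤ n)).cod = strands (one hn) k := fray_cod hn _
  have hg : ((⟨_, _, gen q t hn⟩ : Mor (MOYRel n q t))) =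
    ⟨_, _, dumbbell q t (rfl : 1 + 1 = 2) hn⟩ := mk_gen hn
  set D : Mor (MOYRel n q t) := ⟨_, _, dumbbell q t (rfl : 1 + 1 = 2) hn⟩ with hD
  have hDd : D.dom = edge n 1 ++ edge n 1 := rfl
  have hDc : D.cod = edge n 1 ++ edge n 1 := rfl
  have h1 : (fray q t k (by omega) * (Mor.id _ (edge n 1) * Mor.id _ (edge n 1))) ⋆
      (Mor.id _ (strands (one hn) k) * D) ⋆
        (fuse q t k (by omega) * (Mor.id _ (edge n 1) * Mor.id _ (edge n 1))) =
      (qFactorial q k : R) • (Mor.id _ (edge n k) * D) := by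
    rw [← Mor.id_append, Mor.interchange _ _ _ _ (by simp [hc]) (by simp [hDd]),
      Mor.comp_id _ hc.symm, Mor.id_comp _ hDd.symm, Mor.interchange _ _ _ _ (by simp [hc, hd])
      (by simp [hDc]), Mor.comp_id _ hDc.symm, fray_comp_fuse hq hn, Mor.smul_mul]
  rw [hg, ← box_one hq h, fray_succ, fuse_succ, Mor.mul_comp_id _ _ (by simp),
    Mor.mul_comp_id _ _ (by simp), mul_assoc (fray _ _ _ _), mul_assoc (fuse _ _ _ _),
    ← Mor.comp_assoc _ _ (merge _ _ _ _ * _) (by simp [hc, hDc, hd, hDd]) (by simp),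
    Mor.comp_assoc (split _ _ _ _ * _) _ (_ * D) (by simp) (by simp [hc, hDd]),
    Mor.comp_assoc (split _ _ _ _ * _) _ _ (by simp) (by simp [hc, hDc, hd, hDd]), h1,
    Mor.comp_smul _ _ _ (by simp [hDd]), Mor.smul_comp _ _ _ (by simp [hDd, hDc])]

theorem comp_middle {S : SpiderSignature} {rel : S.Relators R} (F G E : Mor rel)
    (h : F.cod = G.dom) (hd : E.dom = G.cod) (hc : E.cod = F.dom) :
    ((F ⋆ G) ⋆ E) ⋆ (F ⋆ G) = F ⋆ (((G ⋆ E) ⋆ F) ⋆ G) := by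
  rw [Mor.comp_assoc F G E h hd.symm, Mor.comp_assoc F (G ⋆ E) (F ⋆ G) (by simp [h])
    (by rw [Mor.comp_cod _ _ hd.symm, hc, Mor.comp_dom]),
    Mor.comp_assoc (G ⋆ E) F G (by rw [Mor.comp_cod _ _ hd.symm, hc]) h]

/-- Both sides satisfy the same recursion: surrounded by fusions and frayings, the box relation
`box_one` becomes the recursion that defines the antisymmetrizer. Therefore antisymmetrizers of
tangles and thick edges of webs are the same thing. -/
theorem smul_strandProj (hq : QuantumUnits q n) (hn : 2 ≤ n) {k : ℕ} (h : k ≤ n) :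
    (qFactorial q k : R) • Mor.strandProj q (gen q t hn) k = fuse q t k h ⋆ fray q t k h := by
  induction k with
  | zero =>
    rw [qFactorial, Finset.prod_range_zero, Mor.one_smul', Mor.strandProj, strandProj,
      antisym_zero]
    exact (Mor.id_comp_id []).symm
  | succ k ih =>
    cases k with
    | zero => exact smul_strandProj_one hn
    | succ k =>
      have ih := ih (by omega)
      set F := fuse q t (k + 1) (by omega : k + 1 ≤ n) with hF
      set G := fray q t (k + 1) (by omega : k + 1 ≤ n) with hG
      have hd : (F * Mor.id _ (edge n 1)).dom = strands (one hn) (k + 2) := by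
        rw [Mor.mul_dom, hF, fuse_dom hn, Mor.id_dom, edge_one hn, strands_add _ (k + 1) 1]
        rfl
      have hc : (G * Mor.id _ (edge n 1)).cod = strands (one hn) (k + 2) := by
        rw [Mor.mul_cod, hG, fray_cod hn, Mor.id_cod, edge_one hn, strands_add _ (k + 1) 1]
        rfl
      -- `Φ` surrounds an endomorphism of `(k+1) ⊗ 1` by fusing below and fraying above. The
      -- identity goes to `[k+1]! P'` and the dumbbell to the composite for `k + 2`.
      let Φ : SHom (MOYRel n q t) (edge n (k + 1) ++ edge n 1) (edge n (k + 1) ++ edge n 1) →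
          SHom (MOYRel n q t) (strands (one hn) (k + 2)) (strands (one hn) (k + 2)) := fun x =>
        hcomp ((F * Mor.id _ (edge n 1)).toHom hd (by simp [hF]))
          (hcomp x ((G * Mor.id _ (edge n 1)).toHom (by simp [hG]) hc))
      have hΦ : ∀ x, (⟨_, _, Φ x⟩ : Mor (MOYRel n q t)) =
          (F * Mor.id _ (edge n 1)) ⋆ (⟨_, _, x⟩ ⋆ (G * Mor.id _ (edge n 1))) := fun x => by
        rw [Mor.mk_hcomp, Mor.mk_hcomp, Mor.mk_toHom, Mor.mk_toHom]
      set P' := antisym q (strandGen (one hn) (gen q t hn) (k + 2)) 0 (k + 1) with hP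
      have hP' : (⟨_, _, P'⟩ : Mor (MOYRel n q t)) =
          Mor.strandProj q (gen q t hn) (k + 1) * Mor.id _ (edge n 1) := by
        rw [hP, mk_antisym 1 (by omega), edge_one hn]
        exact congrArg (· * _) (one_mul _)
      have f0 : (qFactorial q (k + 1) : R) • (⟨_, _, P'⟩ : Mor (MOYRel n q t)) =
          (F * Mor.id _ (edge n 1)) ⋆ (G * Mor.id _ (edge n 1)) := by
        rw [hP', ← Mor.smul_mul, ih, Mor.mul_comp_id _ _ (by simp [hF, hG])]
      have hF' : F.cod = edge n (k + 1) := fuse_cod _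
      have hG' : G.dom = edge n (k + 1) := fray_dom _
      have f1 : Φ 1 = (qFactorial q (k + 1) : R) • P' := Mor.mk_inj (by
        rw [hΦ, Mor.mk_one, Mor.id_comp _ (by rw [Mor.mul_dom, hG']; rfl), Mor.mk_smul, f0])
      have f2 : (⟨_, _, Φ (dumbbell q t (rfl : k + 1 + 1 = k + 2) h)⟩ : Mor (MOYRel n q t)) =
          fuse q t (k + 2) h ⋆ fray q t (k + 2) h := by
        rw [hΦ, mk_dumbbell, fuse_succ, fray_succ,
          Mor.comp_assoc _ _ _ (by simp) (by simp only [split_cod, Mor.mul_dom, hG', Mor.id_dom]),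
          Mor.comp_assoc _ _ _ (by simp) (by simp)]
      have f3 : ∀ (r : R) x y, Φ (x + r • y) = Φ x + r • Φ y := fun r x y => by
        simp only [Φ, add_hcomp, smul_hcomp, hcomp_add, hcomp_smul]
      have hE : (⟨_, _, strandGen (one hn) (gen q t hn) (k + 2) k⟩ : Mor (MOYRel n q t)) =
          Mor.id _ (strands (one hn) k) * ⟨_, _, gen q t hn⟩ := by
        rw [strandGen_eq _ le_rfl, mk_placeStrands _ 0 (by omega)]
        exact mul_one _
      -- Both copies of `[k+1]! P'` are written as fusing and fraying, and the middle is evaluated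
      -- by `fray_gen_fuse`.
      have f4 : ((qFactorial q (k + 1) : R) * qFactorial q (k + 1)) •
          (P' * strandGen (one hn) (gen q t hn) (k + 2) k * P') = (qFactorial q k : R) •
          Φ (dumbbell q t (rfl : k + 1 + 1 = k + 2) h + (qInt q (k : ℤ) : R) • 1) := by
        refine Mor.mk_inj (rel := MOYRel n q t) ?_
        have h0 : ((qFactorial q (k + 1) : R) * qFactorial q (k + 1)) •
            (P' * strandGen (one hn) (gen q t hn) (k + 2) k * P') =
            ((qFactorial q (k + 1) : R) • P') * strandGen (one hn) (gen q t hn) (k + 2) k *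
              ((qFactorial q (k + 1) : R) • P') := by
          simp only [smul_mul_assoc, mul_smul_comm, smul_smul]
        have hE1 : (Mor.id _ (strands (one hn) k) * ⟨_, _, gen q t hn⟩ :
            Mor (MOYRel n q t)).dom = strands (one hn) (k + 2) := (strands_add _ _ _).symm
        have hE2 : (Mor.id _ (strands (one hn) k) * ⟨_, _, gen q t hn⟩ :
            Mor (MOYRel n q t)).cod = strands (one hn) (k + 2) := (strands_add _ _ _).symm
        have h1 : (F * Mor.id _ (edge n 1)).cod = (G * Mor.id _ (edge n 1)).dom := by
          rw [Mor.mul_cod, Mor.mul_dom, hF', hG']; rfl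
        have h2 : (F * Mor.id _ (edge n 1)).cod = edge n (k + 1) ++ edge n 1 := by
          rw [Mor.mul_cod, hF']; rfl
        rw [h0, Mor.mk_mul, Mor.mk_mul, Mor.mk_smul, f0, hE, Mor.mk_smul, hΦ,
          ← Mor.comp_smul _ _ _ (by rw [Mor.comp_dom]; exact h2),
          ← Mor.smul_comp _ _ _ (h2.symm.trans h1), ← fray_gen_fuse hq hn h,
          comp_middle _ _ _ h1 (hE1.trans hc.symm) (hE2.trans hd.symm)]
      have f5 := congrArg (((qFactorial q (k + 1) : R) * qFactorial q k) • ·)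
        (hq.smul_antisym (strandGen (one hn) (gen q t hn) (k + 2)) 0 h)
      rw [f3, f1] at f4
      simp only [← hP, zero_add] at f5
      have f6 : (qFactorial q (k + 2) : R) •
          antisym q (strandGen (one hn) (gen q t hn) (k + 2)) 0 (k + 2) =
          Φ (dumbbell q t (rfl : k + 1 + 1 = k + 2) h) := by
        have hu := hq.isUnit_qFactorial (t := k) (by omega)
        have h7 := congrArg (fun r => ((qFactorial q (k + 1) : R) * r) •
          (P' * strandGen (one hn) (gen q t hn) (k + 2) k * P')) (qFactorial_succ q k)
        rw [← hu.smul_left_cancel, qFactorial_succ q (k + 1),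
          show ((k + 1 : ℕ) : ℤ) + 1 = k + 2 by push_cast; ring]
        linear_combination (norm := module) f5 + f4 - h7
      exact (congrArg (Mor.mk _ _) f6).trans f2

end Web

end Explosion

/-! ### Realizations that are inverse up to a retraction. -/

noncomputable section Retractions

set_option linter.unusedSimpArgs false

open SpiderSignature SpiderSignature.Diagram Spider

open scoped Spider.Mor

variable {S T : SpiderSignature} {R : Type u} [CommRing R] {relS : S.Relators R}
  {rel : T.Relators R}

namespace Spider.Mor

theorem mk_add_congr {a b a' b' : List S.Letter} {x y : SHom relS a b} {x' y' : SHom relS a' b'}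
    (hx : (⟨a, b, x⟩ : Mor relS) = ⟨a', b', x'⟩) (hy : (⟨a, b, y⟩ : Mor relS) = ⟨a', b', y'⟩) :
    (⟨a, b, x + y⟩ : Mor relS) = ⟨a', b', x' + y'⟩ := by
  obtain rfl : a = a' := congrArg Mor.dom hx
  obtain rfl : b = b' := congrArg Mor.cod hx
  rw [mk_inj hx, mk_inj hy]

theorem mk_zero_congr {a b a' b' : List S.Letter} (ha : a = a') (hb : b = b') :
    (⟨a, b, 0⟩ : Mor relS) = ⟨a', b', 0⟩ := by
  subst ha hb
  rfl

/-- Composition with fixed morphisms on both sides. -/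
def sandwich (x y : Mor relS) {a b : List S.Letter} (hx : x.cod = a) (hy : y.dom = b)
    (f : SHom relS a b) : SHom relS x.dom y.cod :=
  hcomp (x.toHom rfl hx) (hcomp f (y.toHom hy rfl))

theorem mk_sandwich (x y : Mor relS) {a b : List S.Letter} (hx : x.cod = a) (hy : y.dom = b)
    (f : SHom relS a b) : (⟨_, _, sandwich x y hx hy f⟩ : Mor relS) = x ⋆ (⟨_, _, f⟩ ⋆ y) := by
  rw [sandwich, mk_hcomp, mk_hcomp, mk_toHom, mk_toHom]

theorem sandwich_add (x y : Mor relS) {a b : List S.Letter} (hx : x.cod = a) (hy : y.dom = b)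
    (f g : SHom relS a b) : sandwich x y hx hy (f + g) = sandwich x y hx hy f +
      sandwich x y hx hy g := by
  simp only [sandwich, add_hcomp, hcomp_add]

theorem sandwich_zero (x y : Mor relS) {a b : List S.Letter} (hx : x.cod = a) (hy : y.dom = b) :
    sandwich x y hx hy (0 : SHom relS a b) = 0 := by
  simp only [sandwich, zero_hcomp, hcomp_zero]

end Spider.Mor

/-- Morphisms that exhibit each letter as the image of the idempotent assigned to it by the
composite of two realizations. -/
structure Retraction (E : Realization relS rel) (J : Realization rel relS) where
  join : S.Letter → Mor relS
  cut : S.Letter → Mor relS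
  join_dom : ∀ y, (join y).dom = J.words (E.word y)
  join_cod : ∀ y, (join y).cod = [y]
  cut_dom : ∀ y, (cut y).dom = [y]
  cut_cod : ∀ y, (cut y).cod = J.words (E.word y)
  cut_join : ∀ y, cut y ⋆ join y = Mor.id relS [y]
  join_cut : ∀ y, join y ⋆ cut y = J.mapMor ⟨_, _, E.idem y⟩
  rot_join : ∀ y, (join y).rot = cut (S.bar y)
  rot_cut : ∀ y, (cut y).rot = join (S.bar y)
  proj_eq : ∀ a, J.proj (E.words a) = Mor.id relS (J.words (E.words a))
  map_vertex : ∀ {a b : List S.Letter} (v : S.Vertex a b), J.mapMor (E.mor (vertex v)) =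
    (a.map join).prod ⋆ (⟨_, _, ofDiagram relS (.vertex v)⟩ ⋆ (b.map cut).prod)

namespace Retraction

variable {E : Realization relS rel} {J : Realization rel relS} (r : Retraction E J)

include r in
theorem proj_dual (a : List S.Letter) :
    J.proj (T.dual (E.words a)) = Mor.id relS (J.words (T.dual (E.words a))) := by
  rw [← E.words_dual, r.proj_eq]

/-- The projection onto a word. -/
def joinWord (a : List S.Letter) : Mor relS := (a.map r.join).prod

/-- The inclusion of a word. -/
def cutWord (a : List S.Letter) : Mor relS := (a.map r.cut).prod

theorem joinWord_nil : r.joinWord [] = 1 := rfl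
theorem cutWord_nil : r.cutWord [] = 1 := rfl

theorem joinWord_cons (y : S.Letter) (a : List S.Letter) :
    r.joinWord (y :: a) = r.join y * r.joinWord a := by simp [joinWord]

theorem cutWord_cons (y : S.Letter) (a : List S.Letter) :
    r.cutWord (y :: a) = r.cut y * r.cutWord a := by simp [cutWord]

theorem joinWord_append (a b : List S.Letter) :
    r.joinWord (a ++ b) = r.joinWord a * r.joinWord b := by simp [joinWord]

theorem cutWord_append (a b : List S.Letter) :
    r.cutWord (a ++ b) = r.cutWord a * r.cutWord b := by simp [cutWord]

@[simp] theorem joinWord_cod (a : List S.Letter) : (r.joinWord a).cod = a := by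
  induction a with
  | nil => rfl
  | cons y a ih => rw [joinWord_cons, Mor.mul_cod, ih, r.join_cod]; rfl

@[simp] theorem cutWord_dom (a : List S.Letter) : (r.cutWord a).dom = a := by
  induction a with
  | nil => rfl
  | cons y a ih => rw [cutWord_cons, Mor.mul_dom, ih, r.cut_dom]; rfl

@[simp] theorem joinWord_dom (a : List S.Letter) : (r.joinWord a).dom = J.words (E.words a) := by
  induction a with
  | nil => rfl
  | cons y a ih =>
    rw [joinWord_cons, Mor.mul_dom, ih, r.join_dom, StrandMap.words_cons, StrandMap.words_append]

@[simp] theorem cutWord_cod (a : List S.Letter) : (r.cutWord a).cod = J.words (E.words a) := by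
  induction a with
  | nil => rfl
  | cons y a ih =>
    rw [cutWord_cons, Mor.mul_cod, ih, r.cut_cod, StrandMap.words_cons, StrandMap.words_append]

theorem cutWord_comp_joinWord (a : List S.Letter) :
    r.cutWord a ⋆ r.joinWord a = Mor.id relS a := by
  induction a with
  | nil => exact Mor.id_comp_id []
  | cons y a ih =>
    rw [cutWord_cons, joinWord_cons, Mor.interchange _ _ _ _ (by rw [r.cut_cod, r.join_dom])
      (by simp), ih, r.cut_join, ← Mor.id_append]
    rfl

theorem joinWord_comp_cutWord (a : List S.Letter) :
    r.joinWord a ⋆ r.cutWord a = J.mapMor (E.proj a) := by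
  induction a with
  | nil =>
    refine (Mor.id_comp_id []).trans ?_
    exact (J.mapMor_id []).symm
  | cons y a ih =>
    rw [cutWord_cons, joinWord_cons, Mor.interchange _ _ _ _ (by rw [r.cut_dom, r.join_cod])
      (by simp), ih, r.join_cut, StrandMap.proj_cons, Realization.mapMor_mul]

theorem rot_joinWord (a : List S.Letter) : (r.joinWord a).rot = r.cutWord (S.dual a) := by
  induction a with
  | nil => exact Mor.rot_one
  | cons y a ih =>
    rw [joinWord_cons, Mor.rot_mul, ih, r.rot_join, show y :: a = [y] ++ a from rfl, S.dual_append,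
      cutWord_append]
    exact congrArg _ (mul_one _).symm

theorem rot_cutWord (a : List S.Letter) : (r.cutWord a).rot = r.joinWord (S.dual a) := by
  induction a with
  | nil => exact Mor.rot_one
  | cons y a ih =>
    rw [cutWord_cons, Mor.rot_mul, ih, r.rot_cut, show y :: a = [y] ++ a from rfl, S.dual_append,
      joinWord_append]
    exact congrArg _ (mul_one _).symm

/-- The composite of the two realizations is the identity up to the retraction. -/
theorem mapMor_mor {a b : List S.Letter} (f : S.Diagram R a b) :
    J.mapMor (E.mor f) = r.joinWord a ⋆ (⟨_, _, ofDiagram relS f⟩ ⋆ r.cutWord b) := by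
  induction f with
  | @eqTo a b h =>
    subst h
    refine (congrArg _ (E.mor_eqTo _)).trans ((r.joinWord_comp_cutWord a).symm.trans ?_)
    exact congrArg _ (Mor.id_comp _ (by simp)).symm
  | @comp a b c f g hf hg =>
    rw [Interpretation.mor_comp, Realization.mapMor_comp _ _ _ (by simp), hf, hg, Mor.mk_comp]
    set F : Mor relS := ⟨_, _, ofDiagram relS f⟩
    set G : Mor relS := ⟨_, _, ofDiagram relS g⟩
    have h1 : F.dom = a := rfl
    have h2 : F.cod = b := rfl
    have h3 : G.dom = b := rfl
    have h4 : G.cod = c := rfl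
    -- Between the two factors the inclusion of `b` meets the projection onto `b`, and they cancel.
    rw [Mor.comp_assoc _ (F ⋆ _) _ (by simp [h1]) (by simp [h2]),
      Mor.comp_assoc F _ _ (by simp [h2]) (by simp),
      ← Mor.comp_assoc (r.cutWord b) _ _ (by simp) (by simp [h3]), r.cutWord_comp_joinWord,
      Mor.id_comp _ (by simp [h3]), Mor.comp_assoc F G _ (by simp [h2, h3]) (by simp [h4])]
  | @tensor a b c d f g hf hg =>
    rw [Interpretation.mor_tensor, Realization.mapMor_mul, hf, hg, Mor.mk_tensor, joinWord_append,
      cutWord_append]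
    set F : Mor relS := ⟨_, _, ofDiagram relS f⟩
    set G : Mor relS := ⟨_, _, ofDiagram relS g⟩
    have h1 : F.dom = a := rfl
    have h2 : F.cod = b := rfl
    have h3 : G.dom = c := rfl
    have h4 : G.cod = d := rfl
    rw [Mor.interchange _ _ _ _ (by simp [h2]) (by simp [h4]),
      Mor.interchange _ _ _ _ (by simp [h1]) (by simp [h3])]
  | @zero a b =>
    refine (congrArg _ E.mor_zero).trans (J.mor_zero.trans ?_)
    refine Eq.trans ?_ (Mor.mk_sandwich (r.joinWord a) (r.cutWord b) (by simp) (by simp) _)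
    refine Eq.trans ?_ (congrArg (Mor.mk _ _) (Mor.sandwich_zero _ _ _ _).symm)
    exact Mor.mk_zero_congr (by simp) (by simp)
  | @add a b f g hf hg =>
    have h : ∀ f : SHom relS a b, _ :=
      Mor.mk_sandwich (r.joinWord a) (r.cutWord b) (by simp) (by simp)
    rw [← h] at hf hg
    refine Eq.trans ?_ (h _)
    refine Eq.trans ?_ (congrArg (Mor.mk _ _) (Mor.sandwich_add _ _ _ _
      (ofDiagram relS f) (ofDiagram relS g)).symm)
    refine Eq.trans ?_ (Mor.mk_add_congr hf hg)
    have h2 : E.eval (f.add g) = E.eval f + E.eval g := by rw [Interpretation.eval]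
    exact congrArg (Mor.mk _ _) ((congrArg J.map h2).trans (J.map_add (E.eval f) (E.eval g)))
  | smul c f hf =>
    rw [Interpretation.mor_smul, Realization.mapMor_smul, hf, Mor.mk_diag_smul,
      Mor.smul_comp _ _ _ (by simp), Mor.comp_smul _ _ _ (by simp)]
  | vertex v => exact r.map_vertex v
  -- The inclusion of the dual word is the rotated projection. It slides around the cup and meets
  -- the inclusion of `a`, so the two form the idempotent.
  | cup a b h =>
    subst h
    rw [Interpretation.mor_cup, Realization.mapMor_comp _ _ _ (by simp), Realization.mapMor_mul,
      Realization.mapMor_id, r.proj_dual, Realization.mapMor_cup, r.proj_eq, cutWord_append,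
      ← rot_joinWord, joinWord_nil, ← r.joinWord_comp_cutWord, ← Mor.id_nil,
        Mor.id_comp _ (by simp),
      ← Mor.id_append, Mor.comp_id _ (by simp), Mor.mk_cup]
    have h1 := Mor.cup_rot (r.joinWord a)
    simp only [joinWord_dom, joinWord_cod] at h1
    rw [Mor.mul_eq_right (r.cutWord a), cutWord_dom, ← Mor.comp_assoc _ _ _ (by simp) (by simp), h1,
      Mor.mul_comp_id _ _ (by simp), ← Mor.comp_assoc _ _ _ (by simp) (by simp), Mor.rot_cod,
      joinWord_dom, StrandMap.words_dual]
  | cap a b h =>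
    subst h
    rw [Interpretation.mor_cap, Realization.mapMor_comp _ _ _ (by simp), Realization.mapMor_mul,
      Realization.mapMor_id, r.proj_dual, Realization.mapMor_cap, r.proj_eq, joinWord_append,
      ← rot_cutWord, cutWord_nil, ← r.joinWord_comp_cutWord, ← Mor.id_nil, Mor.comp_id _ (by simp),
      ← Mor.id_append, Mor.id_comp _ (by simp), Mor.mk_cap]
    have h1 := Mor.rot_cap (r.cutWord a)
    simp only [cutWord_dom, cutWord_cod] at h1
    rw [Mor.mul_eq_right (r.cutWord a).rot, joinWord_cod, Mor.comp_assoc _ _ _ (by simp) (by simp),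
      h1, Mor.id_mul_comp _ _ (by simp), Mor.comp_assoc _ _ _ (by simp) (by simp), Mor.rot_dom,
      cutWord_cod, StrandMap.words_dual]
  | braid a b =>
    have h1 := Mor.braid_natural (r.cutWord a) (r.cutWord b)
    simp only [cutWord_dom, cutWord_cod] at h1
    rw [Interpretation.mor_braid, Realization.mapMor_comp _ _ _ (by simp), Realization.mapMor_mul,
      Realization.mapMor_braid, r.proj_eq, r.proj_eq, joinWord_append, cutWord_append,
      ← r.joinWord_comp_cutWord, ← r.joinWord_comp_cutWord, ← Mor.id_append,
      Mor.id_comp _ (by simp), ← Mor.interchange _ _ _ _ (by simp) (by simp),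
      Mor.comp_assoc _ _ _ (by simp) (by simp), h1]
    rfl
  | braidInv a b =>
    have h1 := Mor.braidInv_natural (r.cutWord a) (r.cutWord b)
    simp only [cutWord_dom, cutWord_cod] at h1
    rw [Interpretation.mor_braidInv, Realization.mapMor_comp _ _ _ (by simp),
      Realization.mapMor_mul,
      Realization.mapMor_braidInv, r.proj_eq, r.proj_eq, joinWord_append, cutWord_append,
      ← r.joinWord_comp_cutWord, ← r.joinWord_comp_cutWord, ← Mor.id_append,
      Mor.id_comp _ (by simp), ← Mor.interchange _ _ _ _ (by simp) (by simp),
      Mor.comp_assoc _ _ _ (by simp) (by simp), h1]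
    rfl
  | @rot a b f hf =>
    rw [Interpretation.mor_rot, Realization.mapMor_rot, hf, ← rot_joinWord, ← rot_cutWord,
      Mor.rot_comp _ _ (by simp), Mor.rot_comp _ _ (by simp), Mor.comp_assoc _ _ _ (by simp) (by simp)]
    rfl

end Retraction

namespace Realization

/-- Two realizations of signatures without vertices compose to the identity if they do so on words. -/
theorem mapMor_mor_of_proj {E : Realization relS rel} {J : Realization rel relS}
    [∀ a b, IsEmpty (S.Vertex a b)] (hE : ∀ a, E.proj a = Mor.id rel (E.words a))
    (hJ : ∀ a, J.proj (E.words a) = Mor.id relS (J.words (E.words a)))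
    (hw : ∀ a, J.words (E.words a) = a) {a b : List S.Letter} (f : S.Diagram R a b) :
    J.mapMor (E.mor f) = ⟨_, _, ofDiagram relS f⟩ := by
  let r : Retraction E J :=
    { join := fun y => Mor.id relS [y]
      cut := fun y => Mor.id relS [y]
      join_dom := fun y => ((congrArg J.words (E.words_singleton y)).symm.trans (hw [y])).symm
      join_cod := fun y => rfl
      cut_dom := fun y => rfl
      cut_cod := fun y => ((congrArg J.words (E.words_singleton y)).symm.trans (hw [y])).symm
      cut_join := fun y => Mor.id_comp_id _
      join_cut := fun y => by
        rw [Mor.id_comp_id, ← E.proj_singleton, hE, J.mapMor_id, hJ, hw]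
      rot_join := fun y => Mor.rot_id _
      rot_cut := fun y => Mor.rot_id _
      proj_eq := hJ
      map_vertex := fun v => isEmptyElim v }
  have hj : ∀ a, r.joinWord a = Mor.id relS a := fun a => by
    induction a with
    | nil => rfl
    | cons y a ih => rw [r.joinWord_cons, ih]; exact (Mor.id_append [y] a).symm
  have hc : ∀ a, r.cutWord a = Mor.id relS a := fun a => by
    induction a with
    | nil => rfl
    | cons y a ih => rw [r.cutWord_cons, ih]; exact (Mor.id_append [y] a).symm
  rw [r.mapMor_mor, hj, hc, Mor.comp_id _ rfl]
  exact Mor.id_comp _ rfl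

end Realization

end Retractions

/-! ### Webs and tangles as mutual realizations. -/

noncomputable section WebRetraction

set_option linter.unusedSimpArgs false

open SpiderSignature SpiderSignature.Diagram Spider

open scoped Spider.Mor

theorem Spider.mk_strandGen {S : SpiderSignature} {R : Type u} [CommRing R] {rel : S.Relators R}
    {x : S.Letter} (e : SHom rel (strands x 2) (strands x 2)) {m i c : ℕ} (h : i + 2 + c = m) :
    (⟨_, _, strandGen x e m i⟩ : Mor rel) =
      Mor.id rel (strands x i) * ⟨_, _, e⟩ * Mor.id rel (strands x c) := by
  rw [strandGen_eq e (by omega), mk_placeStrands _ c h]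

namespace Web

variable {R : Type u} [CommRing R] {n : ℕ} {q t : Rˣ} (hq : QuantumUnits q n) (hn : 2 ≤ n)

/-- Webs as formal combinations of tangles. -/
def toHomfly (t : Rˣ) (hq : QuantumUnits q n) :
    Realization (MOYRel n q t) (Homfly.Rel n q t) := (Homfly.heckeStrand (t := t) hq).webRealization

/-- Tangles as webs. -/
def ofHomfly (t : Rˣ) (hq : QuantumUnits q n) (hn : 2 ≤ n) :
    Realization (Homfly.Rel n q t) (MOYRel n q t) :=
  (heckeStrand (t := t) hq hn).ribbonRealization

theorem ofHomfly_proj (w : List homflySignature.Letter) :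
    (ofHomfly t hq hn).proj w = Mor.id _ ((ofHomfly t hq hn).words w) := ribbon_proj _ _ w

theorem ofHomfly_words_strands (k : ℕ) :
    (ofHomfly t hq hn).words (strands Homfly.upward k) = strands (one hn) k := by
  induction k with
  | zero => rfl
  | succ k ih => exact congrArg (one hn :: ·) ih

theorem ofHomfly_mapMor_id (w : List homflySignature.Letter) :
    (ofHomfly t hq hn).mapMor (Mor.id _ w) = Mor.id _ ((ofHomfly t hq hn).words w) :=
  ((ofHomfly t hq hn).mapMor_id w).trans (ofHomfly_proj hq hn w)

theorem ofHomfly_gen : (ofHomfly t hq hn).mapMor ⟨_, _, Homfly.gen n q t⟩ =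
    ⟨_, _, gen q t hn⟩ := by
  have h1 : (ofHomfly t hq hn).map (1 : SHom (Homfly.Rel n q t)
      (strands Homfly.upward 2) (strands Homfly.upward 2)) =
      (1 : SHom (MOYRel n q t) (strands (one hn) 2) (strands (one hn) 2)) :=
    Mor.mk_inj (ofHomfly_mapMor_id hq hn _)
  have h2 : (ofHomfly t hq hn).map (Homfly.pos n q t) = ((t⁻¹ : Rˣ) : R) • ((q : R) •
      (1 : SHom (MOYRel n q t) (strands (one hn) 2) (strands (one hn) 2)) - gen q t hn) :=
    Mor.mk_inj ((ribbon_braid _ _).trans (heckeStrand hq hn).braid_eq)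
  have h3 : Homfly.gen n q t = (q : R) • (1 : SHom (Homfly.Rel n q t) (strands Homfly.upward 2)
      (strands Homfly.upward 2)) + (-(t : R)) • Homfly.pos n q t := by
    rw [Homfly.gen, neg_smul, sub_eq_add_neg]
  have h4 : (q : R) • (1 : SHom (MOYRel n q t) (strands (one hn) 2) (strands (one hn) 2)) +
      (-(t : R)) • ((t⁻¹ : Rˣ) : R) • ((q : R) •
      (1 : SHom (MOYRel n q t) (strands (one hn) 2) (strands (one hn) 2)) - gen q t hn) =
      gen q t hn := by
    rw [smul_smul, neg_mul, t.mul_inv]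
    module
  rw [h3]
  refine congrArg (Mor.mk _ _) (((ofHomfly t hq hn).map_add _ _).trans
    ((congrArg₂ (Add.add (α := SHom (MOYRel n q t) (strands (one hn) 2) (strands (one hn) 2)))
      (((ofHomfly t hq hn).map_smul _ _).trans (congrArg (smulHom _) h1))
      (((ofHomfly t hq hn).map_smul _ _).trans (congrArg (smulHom _) h2))).trans h4))

/-- The action of tangles on strands. -/
def ofHomflyHom (t : Rˣ) (hq : QuantumUnits q n) (hn : 2 ≤ n) (m : ℕ) :
    SHom (Homfly.Rel n q t) (strands Homfly.upward m) (strands Homfly.upward m) →ₐ[R]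
      SHom (MOYRel n q t) (strands (one hn) m) (strands (one hn) m) :=
  AlgHom.ofLinearMap
    { toFun := fun x => hcast (ofHomfly_words_strands hq hn m) (ofHomfly_words_strands hq hn m)
        ((ofHomfly t hq hn).map x)
      map_add' := fun x y => by rw [Realization.map_add, hcast_add]
      map_smul' := fun r x => by rw [Realization.map_smul, hcast_smul]; rfl }
    (Mor.mk_inj (rel := MOYRel n q t) ((Mor.mk_hcast _ _ _).trans
      ((ofHomfly_mapMor_id hq hn _).trans (by rw [ofHomfly_words_strands]; rfl))))
    (fun x y => Mor.mk_inj (rel := MOYRel n q t) ((Mor.mk_hcast _ _ _).trans (by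
      rw [Mor.mk_mul]
      refine Eq.trans ?_ (congrArg₂ _ (Mor.mk_hcast _ _ _) (Mor.mk_hcast _ _ _)).symm
      refine Eq.trans ?_ ((ofHomfly t hq hn).mapMor_comp ⟨_, _, x⟩ ⟨_, _, y⟩ rfl)
      rw [← Mor.mk_mul]
      rfl)))

theorem mk_ofHomflyHom (m : ℕ) (x : SHom (Homfly.Rel n q t) (strands Homfly.upward m) _) :
    (⟨_, _, ofHomflyHom t hq hn m x⟩ : Mor (MOYRel n q t)) =
      (ofHomfly t hq hn).mapMor ⟨_, _, x⟩ := Mor.mk_hcast _ _ _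

/-- On endomorphisms of strands the functor is an algebra map that takes generators to generators,
and hence antisymmetrizers to antisymmetrizers. -/
theorem ofHomfly_strandProj (k : ℕ) :
    (ofHomfly t hq hn).mapMor (Mor.strandProj q (Homfly.gen n q t) k) =
      Mor.strandProj q (gen q t hn) k := by
  refine (mk_ofHomflyHom hq hn k _).symm.trans (congrArg (Mor.mk _ _) ?_)
  refine map_antisym _ _ _ _ _ _ _ fun s hs => ?_
  refine Mor.mk_inj (rel := MOYRel n q t) ((mk_ofHomflyHom hq hn k _).trans ?_)
  obtain ⟨c, rfl⟩ : ∃ c, k = 0 + s + 2 + c := ⟨k - (0 + s + 2), by omega⟩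
  rw [mk_strandGen _ rfl, mk_strandGen _ rfl, Realization.mapMor_mul, Realization.mapMor_mul,
    ofHomfly_mapMor_id, ofHomfly_mapMor_id, ofHomfly_gen, ofHomfly_words_strands,
    ofHomfly_words_strands]

/-- The normalized split into edges labelled `1`. -/
def cut (q t : Rˣ) (k : ℕ) (hk : k ≤ n) : Mor (MOYRel n q t) :=
  (Ring.inverse (qFactorial q k) : R) • fray q t k hk

@[simp] theorem cut_dom {k : ℕ} (hk : k ≤ n) : (cut q t k hk).dom = edge n k := fray_dom hk

include hn in
theorem cut_cod {k : ℕ} (hk : k ≤ n) : (cut q t k hk).cod = strands (one hn) k := fray_cod hn hk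

include hq hn in
theorem cut_comp_fuse {k : ℕ} (hk : k ≤ n) :
    cut q t k hk ⋆ fuse q t k hk = Mor.id _ (edge n k) := by
  rw [cut, Mor.smul_comp _ _ _ (fray_cod_eq hn hk), fray_comp_fuse hq hn, Mor.smul_smul',
    Ring.inverse_mul_cancel _ (hq.isUnit_qFactorial hk), Mor.one_smul']

-- With `cut_comp_fuse` this exhibits the edge `k` as the summand of `k` edges labelled one that is
-- cut out by the antisymmetrizer. It is `smul_strandProj` divided by the unit `[k]!`.
include hq in
theorem fuse_comp_cut {k : ℕ} (hk : k ≤ n) :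
    fuse q t k hk ⋆ cut q t k hk = Mor.strandProj q (gen q t hn) k := by
  rw [cut, Mor.comp_smul _ _ _ (by simp), ← smul_strandProj hq hn, Mor.smul_smul',
    Ring.inverse_mul_cancel _ (hq.isUnit_qFactorial hk), Mor.one_smul']

/-- The joining of edges labelled `1` to a letter. -/
def joinLetter (q t : Rˣ) : MOYLetter n → Mor (MOYRel n q t)
  | (k, true) => fuse q t k.1 k.2.2
  | (k, false) => (cut q t k.1 k.2.2).rot

/-- The cutting of a letter into edges labelled `1`. -/
def cutLetter (q t : Rˣ) : MOYLetter n → Mor (MOYRel n q t)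
  | (k, true) => cut q t k.1 k.2.2
  | (k, false) => (fuse q t k.1 k.2.2).rot

theorem edge_eq (k : {k : ℕ // 1 ≤ k ∧ k ≤ n}) : edge n k.1 = [((k, true) : MOYLetter n)] :=
  dif_pos k.2

theorem dual_edge_eq (k : {k : ℕ // 1 ≤ k ∧ k ≤ n}) :
    (moySignature n).dual (edge n k.1) = [((k, false) : MOYLetter n)] := by
  rw [edge_eq]; rfl

theorem prod_fuse {k : ℕ} (hk : k ≤ n) :
    ((edge n k).map (joinLetter q t)).prod = fuse q t k hk := by
  rcases Nat.eq_zero_or_pos k with rfl | h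
  · rw [edge_zero]; rfl
  · rw [edge_eq ⟨k, h, hk⟩]; exact List.prod_singleton

theorem prod_cut {k : ℕ} (hk : k ≤ n) :
    ((edge n k).map (cutLetter q t)).prod = cut q t k hk := by
  rcases Nat.eq_zero_or_pos k with rfl | h
  · rw [edge_zero, cut, qFactorial, Finset.prod_range_zero, Ring.inverse_one, Mor.one_smul']; rfl
  · rw [edge_eq ⟨k, h, hk⟩]; exact List.prod_singleton

theorem ofHomfly_dual_strands (k : ℕ) :
    (ofHomfly t hq hn).words (homflySignature.dual (strands Homfly.upward k)) =
      (moySignature n).dual (strands (one hn) k) := by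
  rw [StrandMap.words_dual, ofHomfly_words_strands]

theorem prod_fuse_append {k l : ℕ} (hk : k ≤ n) (hl : l ≤ n) :
    ((edge n k ++ edge n l).map (joinLetter q t)).prod = fuse q t k hk * fuse q t l hl := by
  exact (congrArg List.prod (List.map_append ..)).trans (List.prod_append.trans
    (congrArg₂ _ (prod_fuse hk) (prod_fuse hl)))

theorem prod_cut_append {k l : ℕ} (hk : k ≤ n) (hl : l ≤ n) :
    ((edge n k ++ edge n l).map (cutLetter q t)).prod = cut q t k hk * cut q t l hl := by
  exact (congrArg List.prod (List.map_append ..)).trans (List.prod_append.trans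
    (congrArg₂ _ (prod_cut hk) (prod_cut hl)))

theorem ofHomfly_merge {k l m : ℕ} (h : k + l = m) (hm : m ≤ n) :
    (ofHomfly t hq hn).mapMor ((toHomfly t hq).mor (_root_.merge k l m h hm)) =
      (fuse q t k (by omega) * fuse q t l (by omega)) ⋆ (merge q t h hm ⋆ cut q t m hm) := by
  refine (congrArg _ ((Homfly.heckeStrand hq).mor_merge h hm)).trans ?_
  rw [ofHomfly_strandProj, ← fuse_comp_cut hq hn hm, fuse_add h hm,
    Mor.comp_assoc _ _ _ (by simp) (by simp)]

-- The factor `1 / [k]!` in `cut` is not multiplicative in `k`. The defect is the binomial that the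
-- interpretation puts on splits.
include hq in
theorem split_comp_cut {k l m : ℕ} (h : k + l = m) (hm : m ≤ n) :
    split q t h hm ⋆ (cut q t k (by omega) * cut q t l (by omega)) =
      (qBinom q (m : ℤ) k : R) • cut q t m hm := by
  have h1 : (Ring.inverse (qFactorial q k) * Ring.inverse (qFactorial q l) : R) =
      qBinom q (m : ℤ) k * Ring.inverse (qFactorial q m) := by
    have hk := hq.isUnit_qFactorial (t := k) (by omega)
    have hl := hq.isUnit_qFactorial (t := l) (by omega)
    have hm' := hq.isUnit_qFactorial (t := m) (by omega)
    subst h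
    refine ((hk.mul hl).mul hm').mul_left_cancel ?_
    have e1 := Ring.mul_inverse_cancel _ hk
    have e2 := Ring.mul_inverse_cancel _ hl
    have e3 := Ring.mul_inverse_cancel _ hm'
    have e4 := hq.qFactorial_mul_qFactorial_mul_qBinom (k := k) (l := l) (by omega)
    linear_combination qFactorial q (k + l) * qFactorial q l * Ring.inverse (qFactorial q l) * e1 +
      qFactorial q (k + l) * e2 - e4 - qFactorial q k * qFactorial q l *
        qBinom q ((k + l : ℕ) : ℤ) k * e3
  rw [cut, cut, cut, Mor.smul_mul, Mor.mul_smul, Mor.smul_smul',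
    Mor.comp_smul _ _ _ (by simp), ← fray_add h hm, Mor.smul_smul', h1]

theorem ofHomfly_split {k l m : ℕ} (h : k + l = m) (hm : m ≤ n) :
    (ofHomfly t hq hn).mapMor ((toHomfly t hq).mor (_root_.split k l m h hm)) =
      fuse q t m hm ⋆ (split q t h hm ⋆ (cut q t k (by omega) * cut q t l (by omega))) := by
  refine (congrArg _ ((Homfly.heckeStrand hq).mor_split h hm)).trans ?_
  rw [Realization.mapMor_smul, ofHomfly_strandProj, ← fuse_comp_cut hq hn hm,
    split_comp_cut hq h hm, Mor.comp_smul _ _ _ (by simp)]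

/-- Every letter is a retract of strands labelled `1`. -/
def retraction (t : Rˣ) (hq : QuantumUnits q n) (hn : 2 ≤ n) :
    Retraction (toHomfly t hq) (ofHomfly t hq hn) where
  join := joinLetter q t
  cut := cutLetter q t
  join_dom
    | (k, true) => (fuse_dom hn k.2.2).trans (ofHomfly_words_strands hq hn k.1).symm
    | (k, false) => (congrArg _ (cut_cod hn k.2.2)).trans (ofHomfly_dual_strands hq hn k.1).symm
  join_cod
    | (k, true) => (fuse_cod k.2.2).trans (edge_eq k)
    | (k, false) => (congrArg _ (cut_dom k.2.2)).trans (dual_edge_eq k)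
  cut_dom
    | (k, true) => (cut_dom k.2.2).trans (edge_eq k)
    | (k, false) => (congrArg _ (fuse_cod k.2.2)).trans (dual_edge_eq k)
  cut_cod
    | (k, true) => (cut_cod hn k.2.2).trans (ofHomfly_words_strands hq hn k.1).symm
    | (k, false) => (congrArg _ (fuse_dom hn k.2.2)).trans (ofHomfly_dual_strands hq hn k.1).symm
  cut_join
    | (k, true) => (cut_comp_fuse hq hn k.2.2).trans (congrArg _ (edge_eq k))
    | (k, false) => by
      have h := congrArg Mor.rot (cut_comp_fuse (t := t) hq hn k.2.2)
      rw [Mor.rot_comp _ _ ((cut_cod hn k.2.2).trans (fuse_dom hn k.2.2).symm), Mor.rot_id,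
        dual_edge_eq] at h
      exact h
  join_cut
    | (k, true) => (fuse_comp_cut hq hn k.2.2).trans (ofHomfly_strandProj hq hn k.1).symm
    | (k, false) => by
      have h := congrArg Mor.rot ((fuse_comp_cut hq hn k.2.2).trans
        (ofHomfly_strandProj (t := t) hq hn k.1).symm)
      rw [Mor.rot_comp _ _ ((fuse_cod k.2.2).trans (cut_dom k.2.2).symm),
        ← Realization.mapMor_rot] at h
      exact h
  rot_join
    | (k, true) => rfl
    | (k, false) => Mor.rot_rot _
  rot_cut
    | (k, true) => rfl
    | (k, false) => Mor.rot_rot _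
  proj_eq a := ofHomfly_proj hq hn _
  map_vertex v := by
    cases v with
    | merge k l m h hm =>
      exact (ofHomfly_merge hq hn h hm).trans (congrArg₂ (· ⋆ ·)
        (prod_fuse_append (by omega) (by omega)).symm (congrArg _ (prod_cut hm).symm))
    | split k l m h hm =>
      exact (ofHomfly_split hq hn h hm).trans (congrArg₂ (· ⋆ ·)
        (prod_fuse hm).symm (congrArg _ (prod_cut_append (by omega) (by omega)).symm))

end Web

end WebRetraction

/-! ### The functor of a realization and criteria for an equivalence. -/

noncomputable section RealizationFunctor

set_option linter.unusedSimpArgs false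

open SpiderSignature SpiderSignature.Diagram Spider

open scoped Spider.Mor

variable {S T : SpiderSignature} {R : Type u} [CommRing R] {relS : S.Relators R}
  {rel : T.Relators R}

namespace Spider.Mor

/-- A morphism of the spider category with its bundled source and target. -/
def bundle {X Y : Spider S R relS} (f : X ⟶ Y) : Mor relS := ⟨X.word, Y.word, f⟩

variable {X Y Z : Spider S R relS}

@[simp] theorem bundle_dom (f : X ⟶ Y) : (bundle f).dom = X.word := rfl
@[simp] theorem bundle_cod (f : X ⟶ Y) : (bundle f).cod = Y.word := rfl

theorem bundle_inj {f g : X ⟶ Y} (h : bundle f = bundle g) : f = g := mk_inj h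

theorem bundle_comp (f : X ⟶ Y) (g : Y ⟶ Z) : bundle (f ≫ g) = bundle f ⋆ bundle g :=
  mk_hcomp _ _

theorem bundle_whiskerLeft (Z : Spider S R relS) (f : X ⟶ Y) :
    bundle (Z ◁ f) = Mor.id relS Z.word * bundle f := mk_htensor _ _

theorem bundle_whiskerRight (f : X ⟶ Y) (Z : Spider S R relS) :
    bundle (f ▷ Z) = bundle f * Mor.id relS Z.word := mk_htensor _ _

theorem bundle_eqIso (h : X.word = Y.word) : bundle (eqIso h).hom = Mor.id relS X.word :=
  mk_eqTo h

theorem bundle_associator (X Y Z : Spider S R relS) :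
    bundle (α_ X Y Z).hom = Mor.id relS (X.word ++ Y.word ++ Z.word) := mk_eqTo _

theorem bundle_leftUnitor (X : Spider S R relS) : bundle (λ_ X).hom = Mor.id relS X.word :=
  mk_eqTo _

theorem bundle_rightUnitor (X : Spider S R relS) :
    bundle (ρ_ X).hom = Mor.id relS (X.word ++ []) := mk_eqTo _

theorem bundle_comp_eqIso (f : X ⟶ Y) (h : Y.word = Z.word) :
    bundle (f ≫ (eqIso h).hom) = bundle f := by
  rw [bundle_comp, bundle_eqIso]
  exact Mor.comp_id _ rfl

theorem bundle_eqIso_comp (h : X.word = Y.word) (f : Y ⟶ Z) :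
    bundle ((eqIso h).hom ≫ f) = bundle f := by
  rw [bundle_comp, bundle_eqIso, Mor.id_comp _ h]

/-- After bundling, the coherence conditions of the monoidal functor are equations between
composites of identities. -/
theorem bundle_comp_of_id {f : X ⟶ Y} {g : Y ⟶ Z} (hf : bundle f = Mor.id relS X.word)
    (hg : bundle g = Mor.id relS Y.word) : bundle (f ≫ g) = Mor.id relS X.word := by
  rw [bundle_comp, hf, hg]
  have h : X.word = Y.word := (congrArg Mor.cod hf).symm
  rw [h, Mor.id_comp_id]

theorem bundle_whiskerRight_of_id {f : X ⟶ Y} (hf : bundle f = Mor.id relS X.word)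
    (Z : Spider S R relS) : bundle (f ▷ Z) = Mor.id relS (X.word ++ Z.word) := by
  rw [bundle_whiskerRight, hf, Mor.id_append]

theorem bundle_whiskerLeft_of_id {f : X ⟶ Y} (hf : bundle f = Mor.id relS X.word)
    (Z : Spider S R relS) : bundle (Z ◁ f) = Mor.id relS (Z.word ++ X.word) := by
  rw [bundle_whiskerLeft, hf, Mor.id_append]

end Spider.Mor

namespace Realization

open Spider.Mor

variable (φ : Realization relS rel) {P : ObjectProperty (Spider S R relS)}
  (hP : ∀ X, P X → φ.proj X.word = Mor.id rel (φ.words X.word))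

/-- The functor defined by a realization on objects whose assigned idempotents are identities. -/
def functor : P.FullSubcategory ⥤ Spider T R rel where
  obj X := ⟨φ.words X.obj.word⟩
  map f := φ.map f.hom
  map_id X := Mor.mk_inj ((φ.mapMor_id X.obj.word).trans (hP _ X.property))
  map_comp f g := bundle_inj (((congrArg φ.mapMor (bundle_comp f.hom g.hom)).trans
    (φ.mapMor_comp (bundle f.hom) (bundle g.hom) rfl)).trans (bundle_comp _ _).symm)

include hP in
theorem mapMor_id_of_prop {X : Spider S R relS} (hX : P X) :
    φ.mapMor (Mor.id relS X.word) = Mor.id rel (φ.words X.word) :=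
  (φ.mapMor_id _).trans (hP X hX)

theorem bundle_functor_map_of_id {X Y : P.FullSubcategory} (f : X ⟶ Y)
    (hf : bundle f.hom = Mor.id relS X.obj.word) :
    bundle ((φ.functor hP).map f) = Mor.id rel (φ.words X.obj.word) :=
  (congrArg φ.mapMor hf).trans (φ.mapMor_id_of_prop hP X.property)

instance functor_additive : (φ.functor hP).Additive where
  map_add := φ.map_add _ _

instance functor_linear : (φ.functor hP).Linear R where
  map_smul f r := φ.map_smul r f.hom

variable [P.IsMonoidal]

/-- The functor of a realization is monoidal. -/
def functorCore : (φ.functor hP).CoreMonoidal where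
  εIso := eqIso rfl
  μIso X Y := eqIso (φ.words_append X.obj.word Y.obj.word).symm
  μIso_hom_natural_left f Z := bundle_inj <|
    (bundle_comp_eqIso _ _).trans <| (bundle_whiskerRight _ _).trans <|
      (congrArg₂ (· * ·) rfl (φ.mapMor_id_of_prop hP Z.property).symm).trans <|
      (φ.mapMor_mul (bundle f.hom) (Mor.id relS Z.obj.word)).symm.trans
        (bundle_eqIso_comp _ ((φ.functor hP).map (f ▷ Z))).symm
  μIso_hom_natural_right Z f := bundle_inj <|
    (bundle_comp_eqIso _ _).trans <| (bundle_whiskerLeft _ _).trans <|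
      (congrArg₂ (· * ·) (φ.mapMor_id_of_prop hP Z.property).symm rfl).trans <|
      (φ.mapMor_mul (Mor.id relS Z.obj.word) (bundle f.hom)).symm.trans
        (bundle_eqIso_comp _ ((φ.functor hP).map (Z ◁ f))).symm
  associativity X Y Z := bundle_inj <|
    (bundle_comp_of_id (bundle_whiskerRight_of_id (bundle_eqIso _) _)
      (bundle_comp_of_id (bundle_eqIso _) (φ.bundle_functor_map_of_id hP (α_ X Y Z).hom
        (bundle_associator X.obj Y.obj Z.obj)))).trans
    (bundle_comp_of_id (bundle_associator _ _ _)
      (bundle_comp_of_id (bundle_whiskerLeft_of_id (bundle_eqIso _) _) (bundle_eqIso _))).symm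
  left_unitality X := bundle_inj <| (bundle_leftUnitor _).trans
    (bundle_comp_of_id (X := 𝟙_ _ ⊗ (φ.functor hP).obj X)
      (bundle_whiskerRight_of_id (bundle_eqIso rfl) ((φ.functor hP).obj X))
      (bundle_comp_of_id (bundle_eqIso _)
        (φ.bundle_functor_map_of_id hP (λ_ X).hom (bundle_leftUnitor X.obj)))).symm
  right_unitality X := bundle_inj <| (bundle_rightUnitor _).trans
    (bundle_comp_of_id (bundle_whiskerLeft_of_id (bundle_eqIso _) _)
      (bundle_comp_of_id (bundle_eqIso _) (φ.bundle_functor_map_of_id hP (ρ_ X).hom (bundle_rightUnitor X.obj)))).symm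

instance functorMonoidal : (φ.functor hP).Monoidal := (φ.functorCore hP).toMonoidal

theorem functor_μ (X Y : P.FullSubcategory) : Functor.LaxMonoidal.μ (φ.functor hP) X Y =
    (eqIso (φ.words_append X.obj.word Y.obj.word).symm).hom := rfl

theorem functor_ε : Functor.LaxMonoidal.ε (φ.functor hP) = (eqIso rfl).hom := rfl

instance functorBraided : (φ.functor hP).Braided where
  braided X Y := bundle_inj <| by
    rw [functor_μ, functor_μ]
    refine (bundle_eqIso_comp _ ((φ.functor hP).map (β_ X Y).hom)).trans
      (Eq.trans ?_ (bundle_comp_eqIso _ (φ.words_append Y.obj.word X.obj.word).symm).symm)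
    refine (φ.mapMor_braid X.obj.word Y.obj.word).trans ?_
    rw [hP _ X.property, hP _ Y.property, ← Mor.id_append]
    exact Mor.id_comp _ rfl

theorem isPivotalFunctor (hd : ∀ X, P X → P (PivotalCategory.dual X)) :
    @IsPivotalFunctor _ _ _ (fullSubcategoryPivotal P hd) _ _ _ _ (φ.functor hP) _ := fun X => by
  have h1 : φ.mapMor (Mor.cap relS X.obj.word) = Mor.cap rel (φ.words X.obj.word) := by
    rw [mapMor_cap, hP _ X.property, ← Mor.id_append, Mor.id_comp _ (by simp)]
  have h2 : φ.mapMor (Mor.cap relS (S.dual X.obj.word)) =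
      Mor.cap rel (φ.words (S.dual X.obj.word)) := by
    have h : φ.proj (S.dual X.obj.word) = Mor.id rel (φ.words (S.dual X.obj.word)) :=
      hP _ (hd _ X.property)
    rw [mapMor_cap, h, ← Mor.id_append, Mor.id_comp _ (by simp)]
  refine ⟨eqIso (φ.words_dual X.obj.word), bundle_inj ?_, bundle_inj ?_⟩
  · rw [functor_μ, functor_ε]
    refine (bundle_eqIso_comp _ _).trans (Eq.trans ?_ (bundle_comp _ _).symm)
    refine Eq.trans h1 (Eq.trans ?_ (congrArg₂ (· ⋆ ·)
      (bundle_whiskerRight_of_id (bundle_eqIso (φ.words_dual X.obj.word)) _) (bundle_comp_eqIso _ _)).symm)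
    exact (Mor.id_comp _ (congrArg (· ++ φ.words X.obj.word) (φ.words_dual X.obj.word))).symm
  · rw [functor_μ, functor_ε]
    refine (bundle_eqIso_comp _ _).trans (Eq.trans ?_ (bundle_comp _ _).symm)
    refine Eq.trans (b := Mor.cap rel (T.dual (φ.words X.obj.word))) ?_ (Eq.trans ?_
      (congrArg₂ (· ⋆ ·) (bundle_whiskerLeft_of_id (bundle_eqIso (φ.words_dual X.obj.word)) _)
        (bundle_comp_eqIso _ _)).symm)
    · exact (congrArg φ.mapMor (Mor.mk_cap _ _ _)).trans
        (h2.trans (congrArg (Mor.cap rel) (φ.words_dual _)))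
    · exact (Mor.mk_cap (T.dual (φ.words X.obj.word)) _ _).symm.trans
        (Mor.id_comp _ (congrArg (φ.words X.obj.word ++ ·) (φ.words_dual X.obj.word))).symm

end Realization

namespace Retraction

open Spider.Mor

variable {E : Realization relS rel} {J : Realization rel relS} (r : Retraction E J)

include r in
theorem mapMor_mapMor (x : Mor relS) :
    J.mapMor (E.mapMor x) = r.joinWord x.dom ⋆ (x ⋆ r.cutWord x.cod) := by
  obtain ⟨a, b, x⟩ := x
  induction x using ind with | _ f
  exact r.mapMor_mor f

/-- A morphism is recovered from its image: apply the second realization, then include and project.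
Faithfulness is immediate. -/
theorem eq_cutWord_comp (x : Mor relS) :
    x = r.cutWord x.dom ⋆ (J.mapMor (E.mapMor x) ⋆ r.joinWord x.cod) := by
  rw [r.mapMor_mapMor, Mor.comp_assoc _ _ _ (by simp) (by simp),
    ← Mor.comp_assoc (r.cutWord _) _ _ (by simp) (by simp), r.cutWord_comp_joinWord,
    Mor.comp_assoc _ _ _ (by simp) (by simp), r.cutWord_comp_joinWord, Mor.comp_id _ (by simp),
    Mor.id_comp _ (by simp)]

-- The preimage is built from the images of the projection and the inclusion around `h`, transported
-- back by `J` and cut down to the words. As `E` undoes `J`, applying `E` lets the added factors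
-- cancel and leaves the idempotents of `a` and `b`.
include r in
theorem exists_mapMor_eq (hJ : ∀ x : Mor rel, E.mapMor (J.mapMor x) = x)
    {a b : List S.Letter} (h : Mor rel) (hd : h.dom = E.words a) (hc : h.cod = E.words b) :
    ∃ x : Mor relS, x.dom = a ∧ x.cod = b ∧
      E.mapMor x = E.proj a ⋆ (h ⋆ E.proj b) := by
  have ha : E.words (J.words (E.words a)) = E.words a :=
    congrArg Mor.dom (hJ (Mor.id rel (E.words a)))
  have hb : E.words (J.words (E.words b)) = E.words b :=
    congrArg Mor.dom (hJ (Mor.id rel (E.words b)))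
  obtain ⟨z, hz⟩ : ∃ z, z = h ⋆ E.mapMor (r.cutWord b) := ⟨_, rfl⟩
  obtain ⟨y, hy⟩ : ∃ y, y = E.mapMor (r.joinWord a) ⋆ z := ⟨_, rfl⟩
  have hzd : z.dom = E.words a := by simp [hz, hd]
  have hzc : z.cod = E.words b := by rw [hz, Mor.comp_cod _ _ (by simp [hc])]; simp [hb]
  have hyd : y.dom = E.words a := by simp [hy, ha]
  have hyc : y.cod = E.words b := by rw [hy, Mor.comp_cod _ _ (by simp [hzd]), hzc]
  have hxc : (J.mapMor y).cod = (r.joinWord b).dom := by simp [hyc]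
  refine ⟨r.cutWord a ⋆ (J.mapMor y ⋆ r.joinWord b), by simp, ?_, ?_⟩
  · rw [Mor.comp_cod _ _ (by simp [hyd]), Mor.comp_cod _ _ hxc, r.joinWord_cod]
  · rw [E.mapMor_comp _ _ (by simp [hyd]), E.mapMor_comp _ _ hxc, hJ, hy,
      Mor.comp_assoc _ _ _ (by simp [hzd]) (by simp [hzc, hb]),
      ← Mor.comp_assoc (E.mapMor (r.cutWord a)) _ _ (by simp) (by simp [hzd]),
      ← E.mapMor_comp _ _ (by simp), r.cutWord_comp_joinWord, hz,
      Mor.comp_assoc h _ _ (by simp [hc]) (by simp), ← E.mapMor_comp _ _ (by simp),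
      r.cutWord_comp_joinWord, E.mapMor_id, E.mapMor_id]

variable {P : ObjectProperty (Spider S R relS)}
  (hP : ∀ X, P X → E.proj X.word = Mor.id rel (E.words X.word))

include r in
theorem functor_faithful : (E.functor hP).Faithful where
  map_injective {X Y f g} h := by
    refine ObjectProperty.hom_ext _ (bundle_inj ((r.eq_cutWord_comp _).trans
      (Eq.trans ?_ (r.eq_cutWord_comp _).symm)))
    have h' : E.mapMor (bundle f.hom) = E.mapMor (bundle g.hom) := congrArg bundle h
    rw [h']
    rfl

include r in
theorem functor_full (hJ : ∀ x : Mor rel, E.mapMor (J.mapMor x) = x) :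
    (E.functor hP).Full where
  map_surjective {X Y} h := by
    obtain ⟨x, hd, hc, hx⟩ := r.exists_mapMor_eq (a := X.obj.word) (b := Y.obj.word) hJ
      (bundle h) rfl rfl
    refine ⟨ObjectProperty.homMk (x.toHom hd hc), bundle_inj ?_⟩
    refine (congrArg E.mapMor (Mor.mk_toHom _ _ _)).trans (hx.trans ?_)
    rw [hP _ X.property, hP _ Y.property]
    exact (Mor.id_comp (Mor.comp (bundle h) (Mor.id rel (E.words Y.obj.word))) (by simp; rfl)).trans
      (Mor.comp_id (bundle h) rfl)

-- Essential surjectivity: a word `b` is the image of `J.words b`, because `E` undoes `J` on words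
-- as well.
include r in
theorem functor_isEquivalence (hJ : ∀ x : Mor rel, E.mapMor (J.mapMor x) = x)
    (hw : ∀ b : List T.Letter, P ⟨J.words b⟩) : (E.functor hP).IsEquivalence where
  faithful := r.functor_faithful hP
  full := r.functor_full hP hJ
  essSurj :=
    { mem_essImage := fun b => ⟨⟨⟨J.words b.word⟩, hw b.word⟩,
        ⟨eqIso (X := (E.functor hP).obj ⟨⟨J.words b.word⟩, hw b.word⟩)
          (congrArg Mor.dom (hJ (Mor.id rel b.word)))⟩⟩ }

end Retraction

end RealizationFunctor

/-! ### Words in the standard colour and the equivalence. -/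

noncomputable section MainTheorem

open SpiderSignature SpiderSignature.Diagram Spider

open scoped Spider.Mor

namespace Web

variable {R : Type u} [CommRing R] {n : ℕ} {q t : Rˣ} (hq : QuantumUnits q n) (hn : 2 ≤ n)

/-- The antisymmetrizer of one strand is the identity. For this reason the interpretation is a
functor on standard words, without passing to an idempotent completion. -/
theorem idem_standard (x : MOYLetter n) (hx : x.1.1 = 1) :
    (⟨_, _, (toHomfly t hq).idem x⟩ : Mor (Homfly.Rel n q t)) =
      Mor.id _ ((toHomfly t hq).word x) := by
  obtain ⟨⟨k, hk⟩, o⟩ := x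
  obtain rfl : k = 1 := hx
  have h : Mor.strandProj q (Homfly.gen n q t) 1 = Mor.id _ (strands Homfly.upward 1) := by
    rw [Mor.strandProj, strandProj, antisym_one]; rfl
  cases o with
  | true => exact h
  | false => exact (congrArg Mor.rot h).trans (Mor.rot_id _)

theorem proj_standard {X : MOY R n q t} (hX : isStandardWord R n q t X) :
    (toHomfly t hq).proj X.word = Mor.id _ ((toHomfly t hq).words X.word) := by
  obtain ⟨w⟩ := X
  induction w with
  | nil => rfl
  | cons x a ih =>
    rw [StrandMap.proj_cons, StrandMap.words_cons, Mor.id_append,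
      ih fun y hy => hX y (List.mem_cons_of_mem _ hy)]
    exact congrArg (· * _) (idem_standard hq x (hX x List.mem_cons_self))

theorem isStandardWord_dual {X : MOY R n q t} (hX : isStandardWord R n q t X) :
    isStandardWord R n q t (PivotalCategory.dual X) := fun x hx => by
  obtain ⟨y, hy, rfl⟩ := List.mem_map.1 (List.mem_reverse.1 hx)
  exact hX y hy

theorem ofHomfly_words_standard (a : List homflySignature.Letter) :
    isStandardWord R n q t ⟨(ofHomfly t hq hn).words a⟩ := fun x hx => by
  obtain ⟨y, -, hy⟩ := List.mem_flatMap.1 hx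
  match y with
  | true => exact List.mem_singleton.1 hy ▸ rfl
  | false => exact List.mem_singleton.1 hy ▸ rfl

theorem toHomfly_words_ofHomfly_words (a : List homflySignature.Letter) :
    (toHomfly t hq).words ((ofHomfly t hq hn).words a) = a := by
  induction a with
  | nil => rfl
  | cons y a ih =>
    rw [StrandMap.words_cons, StrandMap.words_append, ih]
    match y with
    | true => rfl
    | false => rfl

instance (a b : List homflySignature.Letter) : IsEmpty (homflySignature.Vertex a b) :=
  inferInstanceAs (IsEmpty Empty)

/-- Tangles have no vertices, so it suffices that the round trip fixes words and that all
idempotents on the way are identities. -/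
theorem toHomfly_mapMor_ofHomfly_mapMor (x : Mor (Homfly.Rel n q t)) :
    (toHomfly t hq).mapMor ((ofHomfly t hq hn).mapMor x) = x := by
  obtain ⟨a, b, x⟩ := x
  induction x using ind with | _ f
  exact Realization.mapMor_mor_of_proj (ofHomfly_proj hq hn)
    (fun a => proj_standard hq (ofHomfly_words_standard hq hn a))
    (toHomfly_words_ofHomfly_words hq hn) f

theorem isSpherical_homfly : IsSpherical (HMF R n q t) := fun X f =>
  leftTrace_eq f (Homfly.sphericalWord X.word)

-- The two kinks on the edge labelled one are the same unit; sphericity then passes to the dual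
-- letter and to words.
include hq hn in
theorem sphericalWord_standard {X : MOY R n q t} (hX : isStandardWord R n q t X) :
    Mor.SphericalWord (MOYRel n q t) X.word := by
  have h := (heckeStrand (t := t) hq hn).sphericalWord
  refine Mor.sphericalWord_of_letters fun x hx => ?_
  have h1 : x.1.1 = 1 := hX x hx
  obtain ⟨⟨k, hk⟩, o⟩ := x
  obtain rfl : k = 1 := h1
  cases o with
  | true => exact h
  | false => exact h.dual

include hq hn in
theorem isSpherical_standard : IsSpherical (MOYStandard R n q t) := fun X f =>
  ObjectProperty.hom_ext _ (leftTrace_eq f.hom (sphericalWord_standard hq hn X.property))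

end Web

end MainTheorem

theorem mainTheorem6 {R : Type u} [CommRing R] [IsDomain R] (n : ℕ) (hn : 2 ≤ n)
    (q t : Rˣ) (ht : t ^ n = q)
    (hs : IsUnit ((q : R) - ((q⁻¹ : Rˣ) : R)))
    (hq : ∀ k : ℕ, 1 ≤ k → k ≤ n → IsUnit (qInt q (k : ℤ) : R)) :
    SphericalBraidedEquivalent R (MOYStandard R n q t) (HMF R n q t) := by
  have hu : QuantumUnits q n := ⟨hs, hq⟩
  refine ⟨Web.isSpherical_standard hu hn, Web.isSpherical_homfly,
    (Web.toHomfly t hu).functor fun _ => Web.proj_standard hu, inferInstance, inferInstance,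
    inferInstance, (Web.retraction t hu hn).functor_isEquivalence _
      (Web.toHomfly_mapMor_ofHomfly_mapMor hu hn) (Web.ofHomfly_words_standard hu hn),
    Realization.isPivotalFunctor _ _ fun _ => Web.isStandardWord_dual⟩
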